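/- Let $\mathbb F$ be a field of characteristic different from $2$, and let $Vir_{\mathbb F}=\bigoplus_{n\in\mathbb Z}\mathbb F L_n\oplus\mathbb F C$ be the Virasoro algebra, with $C$ central and $[L_m,L_n]=(m-n)L_{m+n}+\delta_{m+n,0}\frac{m^3-m}{12}C$ (the integer $m^3-m$ is divisible by $6$, so the coefficient makes sense in $\mathbb F$). For $c,h\in\mathbb F$ let $V(c,h)_{\mathbb F}$ be the Verma module generated by $v_{c,h}$ with $Cv_{c,h}=cv_{c,h}$, $L_0v_{c,h}=hv_{c,h}$, $L_nv_{c,h}=0$ for $n>0$; it is graded, $L_{-n_1}\cdots L_{-n_k}v_{c,h}$ having degree $n_1+\cdots+n_k$. Let $L(c,h)_{\mathbb F}$ be the quotient of $V(c,h)_{\mathbb F}$ by its maximal proper graded submodule, with the induced grading. There is exactly one vertex operator algebra structure over $\mathbb F$ on the graded space $L(\frac12,0)_{\mathbb F}$ with central charge $\frac12$, vacuum $\mathbf 1$ the image of $v_{1/2,0}$, Virasoro vector $\omega=L_{-2}\mathbf 1$ and $Y(\omega,z)=\sum_{n\in\mathbb Z}L_nz^{-n-2}$. With this structure the following hold. (A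 weak module is a vector space $M$ with vertex operators $Y_M(u,z)=\sum_n u_nz^{-n-1}$ satisfying truncation, $Y_M(\mathbf 1,z)=\mathrm{Id}$ and the Jacobi identity; it is admissible if it has a grading $M=\bigoplus_{n\ge 0}M(n)$ with $u_mM(n)\subseteq M(n+s-m-1)$ for $u$ of degree $s$. An admissible module is irreducible if it is nonzero and its only graded submodules are $0$ and itself. Isomorphisms are the linear isomorphisms that commute with all $u_n$.) 1. Let $M$ be a highest weight $Vir_{\mathbb F}$-module (generated by a nonzero highest weight vector) of central charge $\frac12$ and highest weight $h\in\mathbb F$ which is also a weak $L(\frac12,0)_{\mathbb F}$-module with $Y_M(\omega,z)=\sum_nL_nz^{-n-2}$. Then $h\in\{0,\frac12,\frac1{16}\}$ if $\operatorname{char}\mathbb F\ne7$, and $h\in\{0,\frac12\}$ if $\operatorname{char}\mathbb F=7$. 2. If $\operatorname{char}\mathbb F\neq 7$, then each of $L(\frac12,0)_{\mathbb F}$, $L(\frac12,\frac12)_{\mathbb F}$, $L(\frac12,\frac1{16})_{\mathbb F}$, with its grading, is an admissible $L(\frac12,0)_{\mathbb F}$-module with $Y(\omega,z)=\sum_nL_nz^{-n-2}$;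 these three modules are irreducible (they have no nontrivial submodules, graded or not) and pairwise non-isomorphic, and every irreducible admissible $L(\frac12,0)_{\mathbb F}$-module is isomorphic to one of them. 3. If $\operatorname{char}\mathbb F=7$, then every irreducible admissible $L(\frac12,0)_{\mathbb F}$-module is isomorphic to $L(\frac12,h)_{\mathbb F}$ with $h=0$ or $h=\frac12$, the latter with its grading and with an admissible $L(\frac12,0)_{\mathbb F}$-module structure for which $Y(\omega,z)=\sum_nL_nz^{-n-2}$. -/

import Mathlib

noncomputable section

/-! ### The Virasoro algebra over a field -/

/-- The coefficient `(m³ - m) / 12` of the Virasoro cocycle, as an element of a field of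
characteristic different from two. The integer `m³ - m` is always divisible by six, so the integer
division is exact; this makes sense in characteristic three. -/
def virCoeff (F : Type*) [Field F] (m : ℤ) : F := (((m ^ 3 - m) / 6 : ℤ) : F) / 2

/-- The underlying space of the Virasoro algebra: `⨁ₙ F Lₙ ⊕ F C`. -/
def Vir (F : Type*) [Field F] : Type _ := (ℤ →₀ F) × F

namespace Vir

variable (F : Type*) [Field F]

instance : AddCommGroup (Vir F) := inferInstanceAs (AddCommGroup ((ℤ →₀ F) × F))

instance : Module F (Vir F) := inferInstanceAs (Module F ((ℤ →₀ F) × F))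

/-- The basis vector `Lₙ`. -/
def L (n : ℤ) : Vir F := ((Finsupp.single n 1, 0) : (ℤ →₀ F) × F)

/-- The central basis vector `C`. -/
def C : Vir F := ((0, 1) : (ℤ →₀ F) × F)

/-- The bracket `[Lₘ, Lₙ] = (m - n) Lₘ₊ₙ + δ_{m+n,0} (m³ - m)/12 C` of basis vectors. -/
def basisBracket (m n : ℤ) : Vir F :=
  ((m : F) - n) • L F (m + n) + if m + n = 0 then virCoeff F m • C F else 0

/-- The projection forgetting the coefficient of `C`. -/
def toWitt : Vir F →ₗ[F] (ℤ →₀ F) := LinearMap.fst F (ℤ →₀ F) F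

/-- The bilinear extension of the bracket of the `Lₙ`; it vanishes as soon as one of the
arguments is a multiple of `C`. -/
def bracketMap : Vir F →ₗ[F] Vir F →ₗ[F] Vir F :=
  (Finsupp.linearCombination F fun m : ℤ =>
    (Finsupp.linearCombination F fun n : ℤ => basisBracket F m n) ∘ₗ toWitt F) ∘ₗ toWitt F

variable {F}

theorem bracketMap_L_L (m n : ℤ) : bracketMap F (L F m) (L F n) = basisBracket F m n := by
  have h : ∀ k, toWitt F (L F k) = Finsupp.single k 1 := fun _ => rfl
  simp [bracketMap, h]

theorem bracketMap_C_left (x : Vir F) : bracketMap F (C F) x = 0 := by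
  have h : toWitt F (C F) = 0 := rfl
  simp [bracketMap, h]

theorem bracketMap_C_right (x : Vir F) : bracketMap F x (C F) = 0 := by
  have h : toWitt F (C F) = 0 := rfl
  simp only [bracketMap, LinearMap.comp_apply]
  induction toWitt F x using Finsupp.induction_linear with
  | zero => simp
  | add f g hf hg => rw [map_add, LinearMap.add_apply, hf, hg, add_zero]
  | single m a => simp [h]

theorem induction {p : Vir F → Prop} (hL : ∀ n, p (L F n)) (hC : p (C F)) (h0 : p 0)
    (hadd : ∀ x y, p x → p y → p (x + y)) (hsmul : ∀ (a : F) x, p x → p (a • x)) (x : Vir F) :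
    p x := by
  obtain ⟨f, c⟩ := x
  have h1 : p ((f, 0) : (ℤ →₀ F) × F) := by
    induction f using Finsupp.induction_linear with
    | zero => exact h0
    | add f g hf hg =>
      have := hadd _ _ hf hg
      have e : ((f + g, 0) : (ℤ →₀ F) × F) = (f, 0) + (g, 0) := by simp
      rw [e]; exact this
    | single m a =>
      have := hsmul a _ (hL m)
      have e : ((Finsupp.single m a, 0) : (ℤ →₀ F) × F) = a • (Finsupp.single m 1, 0) := by simp
      rw [e]; exact this
  have h2 := hadd _ _ h1 (hsmul c _ hC)
  have e : ((f, c) : (ℤ →₀ F) × F) = (f, 0) + c • (0, 1) := by simp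
  rw [e]; exact h2

theorem six_mul_div (m : ℤ) : 6 * ((m ^ 3 - m) / 6) = m ^ 3 - m := by
  apply Int.mul_ediv_cancel'
  have h2 : (2 : ℤ) ∣ m ^ 3 - m := by
    have : m ^ 3 - m = (m * (m + 1)) * (m - 1) := by ring
    rw [this]
    exact Dvd.dvd.mul_right (Int.even_mul_succ_self m).two_dvd _
  have h3 : (3 : ℤ) ∣ m ^ 3 - m := by
    have : m % 3 = 0 ∨ m % 3 = 1 ∨ m % 3 = 2 := by omega
    apply Int.dvd_of_emod_eq_zero
    rcases this with h | h | h <;> simp [pow_succ, Int.sub_emod, Int.mul_emod, h]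
  omega

theorem virCoeff_neg (m : ℤ) : virCoeff F (-m) = -virCoeff F m := by
  have : ((-m) ^ 3 - -m) / 6 = -((m ^ 3 - m) / 6) := by
    have h1 := six_mul_div m
    have h2 := six_mul_div (-m)
    have : (-m) ^ 3 - -m = -(m ^ 3 - m) := by ring
    omega
  rw [virCoeff, this, virCoeff]
  push_cast
  ring

theorem basisBracket_swap (m n : ℤ) : basisBracket F m n = -basisBracket F n m := by
  unfold basisBracket
  rw [add_comm n m]
  by_cases h : m + n = 0
  · obtain rfl : m = -n := by omega
    simp only [h, if_true, virCoeff_neg]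
    module
  · simp only [h, if_false]
    module

theorem bracketMap_swap (x y : Vir F) : bracketMap F x y = -bracketMap F y x := by
  induction x using induction with
  | hL m =>
    induction y using induction with
    | hL n => rw [bracketMap_L_L, bracketMap_L_L, basisBracket_swap]
    | hC => rw [bracketMap_C_left, bracketMap_C_right, neg_zero]
    | h0 => simp
    | hadd x y hx hy => simp only [map_add, LinearMap.add_apply, hx, hy]; abel
    | hsmul a x hx => simp only [map_smul, LinearMap.smul_apply, hx, smul_neg]
  | hC => rw [bracketMap_C_left, bracketMap_C_right, neg_zero]
  | h0 => simp
  | hadd x y hx hy => simp only [map_add, LinearMap.add_apply, hx, hy]; abel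
  | hsmul a x hx => simp only [map_smul, LinearMap.smul_apply, hx, smul_neg]

theorem bracketMap_self (x : Vir F) : bracketMap F x x = 0 := by
  induction x using induction with
  | hL m =>
    rw [bracketMap_L_L, basisBracket]
    by_cases h : m + m = 0
    · obtain rfl : m = 0 := by omega
      simp [virCoeff]
    · simp [h]
  | hC => exact bracketMap_C_left _
  | h0 => simp
  | hadd x y hx hy =>
    simp only [map_add, LinearMap.add_apply, hx, hy, bracketMap_swap y x]
    abel
  | hsmul a x hx => simp only [map_smul, LinearMap.smul_apply, hx, smul_zero]

theorem virCoeff_cocycle (k m n : ℤ) (h : k + m + n = 0) :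
    ((m : F) - n) * virCoeff F k + ((n : F) - k) * virCoeff F m + ((k : F) - m) * virCoeff F n
      = 0 := by
  have key : (m - n) * ((k ^ 3 - k) / 6) + (n - k) * ((m ^ 3 - m) / 6)
      + (k - m) * ((n ^ 3 - n) / 6) = 0 := by
    have h1 := six_mul_div k
    have h2 := six_mul_div m
    have h3 := six_mul_div n
    obtain rfl : n = -k - m := by omega
    have : 6 * ((m - (-k - m)) * ((k ^ 3 - k) / 6) + ((-k - m) - k) * ((m ^ 3 - m) / 6)
      + (k - m) * (((-k - m) ^ 3 - (-k - m)) / 6)) = 0 := by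
      linear_combination (m - (-k - m)) * h1 + ((-k - m) - k) * h2 + (k - m) * h3
    omega
  have key' := congrArg (fun z : ℤ => (z : F)) key
  simp only [virCoeff]
  push_cast at key' ⊢
  linear_combination key' / 2

theorem bracketMap_leibniz_basis (k m n : ℤ) :
    bracketMap F (L F k) (basisBracket F m n) =
      bracketMap F (basisBracket F k m) (L F n) + bracketMap F (L F m) (basisBracket F k n) := by
  have hl : ∀ a b d : ℤ, bracketMap F (L F a) (basisBracket F b d)
      = ((b : F) - d) • basisBracket F a (b + d) := by
    intro a b d
    rw [basisBracket]
    split_ifs <;> simp [bracketMap_L_L, bracketMap_C_right]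
  rw [bracketMap_swap (basisBracket F k m), hl, hl, hl]
  unfold basisBracket
  have e1 : k + (m + n) = k + m + n := by ring
  have e2 : n + (k + m) = k + m + n := by ring
  have e3 : m + (k + n) = k + m + n := by ring
  rw [e1, e2, e3]
  by_cases h : k + m + n = 0
  · have hc := virCoeff_cocycle (F := F) k m n h
    have hc' : ((k : F) - m) * virCoeff F n =
      -(((m : F) - n) * virCoeff F k + ((n : F) - k) * virCoeff F m) := by
      linear_combination hc
    simp only [h, if_true, smul_add, smul_smul, neg_add, hc']
    push_cast
    module
  · simp only [h, if_false, add_zero, smul_smul]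
    push_cast
    module

theorem bracketMap_leibniz (x y z : Vir F) :
    bracketMap F x (bracketMap F y z) =
      bracketMap F (bracketMap F x y) z + bracketMap F y (bracketMap F x z) := by
  induction x using induction with
  | hL k =>
    induction y using induction with
    | hL m =>
      induction z using induction with
      | hL n => simpa only [bracketMap_L_L] using bracketMap_leibniz_basis k m n
      | hC => simp [bracketMap_C_right]
      | h0 => simp
      | hadd x y hx hy => simp only [map_add, hx, hy]; abel
      | hsmul a x hx => simp only [map_smul, hx, smul_add]
    | hC => simp [bracketMap_C_left, bracketMap_C_right]
    | h0 => simp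
    | hadd x y hx hy => simp only [map_add, LinearMap.add_apply, hx, hy]; abel
    | hsmul a x hx => simp only [map_smul, LinearMap.smul_apply, hx, smul_add]
  | hC => simp [bracketMap_C_left]
  | h0 => simp
  | hadd x y hx hy => simp only [map_add, LinearMap.add_apply, hx, hy]; abel
  | hsmul a x hx => simp only [map_smul, LinearMap.smul_apply, hx, smul_add]

instance : LieRing (Vir F) where
  bracket x y := bracketMap F x y
  add_lie x y z := by simp
  lie_add x y z := by simp
  lie_self x := bracketMap_self x
  leibniz_lie x y z := bracketMap_leibniz x y z

instance : LieAlgebra F (Vir F) where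
  lie_smul a x y := (bracketMap F x).map_smul a y

theorem lie_L_L (m n : ℤ) : ⁅L F m, L F n⁆ =
    ((m : F) - n) • L F (m + n) + if m + n = 0 then virCoeff F m • C F else 0 :=
  bracketMap_L_L m n

theorem lie_C (x : Vir F) : ⁅x, C F⁆ = 0 := bracketMap_C_right x

end Vir

/-! ### Highest weight modules -/

/-- `v` is a highest weight vector of central charge `c` and highest weight `h`. -/
structure IsHighestWeightVector {F : Type*} [Field F] {M : Type*} [AddCommGroup M] [Module F M]
    [LieRingModule (Vir F) M] (c h : F) (v : M) : Prop where
  ne_zero : v ≠ 0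
  lie_C : ⁅Vir.C F, v⁆ = c • v
  lie_L_zero : ⁅Vir.L F 0, v⁆ = h • v
  lie_L_pos : ∀ n : ℤ, 0 < n → ⁅Vir.L F n, v⁆ = 0

/-- `M` is a highest weight module: it is generated by a highest weight vector. -/
def IsHighestWeightModule {F : Type*} [Field F] (M : Type*) [AddCommGroup M] [Module F M]
    [LieRingModule (Vir F) M] [LieModule F (Vir F) M] (c h : F) : Prop :=
  ∃ v : M, IsHighestWeightVector c h v ∧ LieSubmodule.lieSpan F (Vir F) {v} = ⊤

/-- The enveloping algebra of the Virasoro algebra. -/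
abbrev VirU (F : Type*) [Field F] := UniversalEnvelopingAlgebra F (Vir F)

/-- The left ideal generated by `C - c`, `L₀ - h` and the `Lₙ` with `n > 0`. -/
def vermaIdeal {F : Type*} [Field F] (c h : F) : Submodule (VirU F) (VirU F) :=
  Submodule.span (VirU F)
    ({UniversalEnvelopingAlgebra.ι F (Vir.C F) - algebraMap F (VirU F) c,
      UniversalEnvelopingAlgebra.ι F (Vir.L F 0) - algebraMap F (VirU F) h} ∪
      {x | ∃ n : ℤ, 0 < n ∧ x = UniversalEnvelopingAlgebra.ι F (Vir.L F n)})

/-- The Verma module `V(c,h)`, i.e. the module induced from the one-dimensional module of the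
subalgebra spanned by `C` and the `Lₙ` with `n ≥ 0`, on which `C`, `L₀` and `Lₙ`, `n > 0`, act
as `c`, `h` and `0`. -/
def Verma {F : Type*} [Field F] (c h : F) : Type _ := VirU F ⧸ vermaIdeal c h

namespace Verma

variable {F : Type*} [Field F] (c h : F)

instance : AddCommGroup (Verma c h) := inferInstanceAs (AddCommGroup (VirU F ⧸ vermaIdeal c h))

instance : Module (VirU F) (Verma c h) :=
  inferInstanceAs (Module (VirU F) (VirU F ⧸ vermaIdeal c h))

instance : Module F (Verma c h) := inferInstanceAs (Module F (VirU F ⧸ vermaIdeal c h))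

instance : IsScalarTower F (VirU F) (Verma c h) :=
  inferInstanceAs (IsScalarTower F (VirU F) (VirU F ⧸ vermaIdeal c h))

attribute [local instance] LieRing.ofAssociativeRing in
theorem ι_lie (x y : Vir F) : UniversalEnvelopingAlgebra.ι F ⁅x, y⁆ =
    UniversalEnvelopingAlgebra.ι F x * UniversalEnvelopingAlgebra.ι F y
      - UniversalEnvelopingAlgebra.ι F y * UniversalEnvelopingAlgebra.ι F x := by
  rw [LieHom.map_lie, LieRing.of_associative_ring_bracket]

instance : LieRingModule (Vir F) (Verma c h) where
  bracket x m := UniversalEnvelopingAlgebra.ι F x • m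
  add_lie x y m := by rw [map_add, add_smul]
  lie_add x m n := smul_add _ m n
  leibniz_lie x y m := by
    rw [ι_lie, sub_smul, mul_smul, mul_smul]
    abel

instance : LieModule F (Vir F) (Verma c h) where
  smul_lie a x m := by
    change UniversalEnvelopingAlgebra.ι F (a • x) • m = a • UniversalEnvelopingAlgebra.ι F x • m
    rw [map_smul, smul_assoc]
  lie_smul a x m := by
    change UniversalEnvelopingAlgebra.ι F x • a • m = a • UniversalEnvelopingAlgebra.ι F x • m
    rw [← algebraMap_smul (VirU F) a m, ← mul_smul, ← Algebra.commutes, mul_smul,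
      algebraMap_smul]

/-- The generator `v_{c,h}`. -/
def gen : Verma c h := (vermaIdeal c h).mkQ 1

/-- The component `V(c,h)(n)` of degree `n`: the span of the vectors `L₋ₖ₁ ⋯ L₋ₖᵣ v` with all
`kᵢ ≥ 1` and `∑ kᵢ = n`. (Those with `k₁ ≥ ⋯ ≥ kᵣ` span the same space.) It is zero for
negative `n`. -/
def deg (n : ℤ) : Submodule F (Verma c h) :=
  Submodule.span F {x | ∃ l : List ℕ, (∀ k ∈ l, 1 ≤ k) ∧ (l.sum : ℤ) = n ∧
    x = l.foldr (fun k y => ⁅Vir.L F (-(k : ℤ)), y⁆) (gen c h)}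

/-- A submodule is graded when it is the sum of its intersections with the components. -/
def IsGraded (N : LieSubmodule F (Vir F) (Verma c h)) : Prop :=
  N.toSubmodule = ⨆ n : ℤ, N.toSubmodule ⊓ deg c h n

/-- The maximal graded submodule `W(c,h)`: the sum of all proper graded submodules. -/
def maxGraded : LieSubmodule F (Vir F) (Verma c h) :=
  sSup {N | N ≠ ⊤ ∧ IsGraded c h N}

end Verma

/-- The irreducible highest weight module `L(c,h) = V(c,h) / W(c,h)`. -/
abbrev VirIrr {F : Type*} [Field F] (c h : F) : Type _ := Verma c h ⧸ Verma.maxGraded c h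

namespace VirIrr

variable {F : Type*} [Field F] (c h : F)

/-- The image of `v_{c,h}` in `L(c,h)`. -/
def gen : VirIrr c h := LieSubmodule.Quotient.mk' (Verma.maxGraded c h) (Verma.gen c h)

/-- The component of degree `n` of `L(c,h)`. -/
def deg (n : ℤ) : Submodule F (VirIrr c h) :=
  (Verma.deg c h n).map (LieSubmodule.Quotient.mk' (Verma.maxGraded c h) : _ →ₗ[F] VirIrr c h)

end VirIrr

/-! ### Vertex operator algebras and their modules

A linear map `Y : V → (End M)[[z, z⁻¹]]`, `Y(u,z) = ∑ₙ uₙ z^{-n-1}`, is given by its modes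
`Y u n = uₙ`. -/

/-- The Jacobi identity
`z₀⁻¹ δ((z₁-z₂)/z₀) Y(u,z₁) Y(v,z₂) - z₀⁻¹ δ((z₂-z₁)/(-z₀)) Y(v,z₂) Y(u,z₁)
  = z₂⁻¹ δ((z₁-z₀)/z₂) Y(Y(u,z₀)v,z₂)`
applied to `w`, written out as the equality of the coefficients of
`z₀^{-l-1} z₁^{-m-1} z₂^{-n-1}` for all `l`, `m`, `n`. The sums are finite when the modes of any
`u` on any `w` vanish for large indices. -/
def JacobiIdentity {F V M : Type*} [Field F] [AddCommGroup V] [Module F V] [AddCommGroup M]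
    [Module F M] (YV : V →ₗ[F] (ℤ → Module.End F V)) (YM : V →ₗ[F] (ℤ → Module.End F M)) : Prop :=
  ∀ (u v : V) (w : M) (l m n : ℤ),
    (∑ᶠ i : ℕ, ((-1) ^ i * Ring.choose l i : ℤ) • YM u (l + m - i) (YM v (n + i) w))
      - (∑ᶠ i : ℕ, ((l.negOnePow : ℤ) * (-1) ^ i * Ring.choose l i : ℤ) •
          YM v (l + n - i) (YM u (m + i) w))
      = ∑ᶠ i : ℕ, (Ring.choose m i : ℤ) • YM (YV u (l + i) v) (m + n - i) w

/-- A vertex operator algebra structure over the field `F` (of characteristic different from two)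
on the vector space `V`. -/
@[ext]
structure VertexOperatorAlgebra (F V : Type*) [Field F] [AddCommGroup V] [Module F V] where
  /-- `Y u n` is the mode `uₙ`. -/
  Y : V →ₗ[F] (ℤ → Module.End F V)
  /-- The homogeneous components. -/
  deg : ℤ → Submodule F V
  /-- The vacuum vector. -/
  vac : V
  /-- The Virasoro vector. -/
  ω : V
  /-- The central charge. -/
  c : F
  isInternal : DirectSum.IsInternal deg
  finite_deg : ∀ n, Module.Finite F (deg n)
  bounded_below : ∃ N : ℤ, ∀ n < N, deg n = ⊥
  vac_mem : vac ∈ deg 0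
  ω_mem : ω ∈ deg 2
  mode_mem : ∀ (s t n : ℤ) (u v : V), u ∈ deg s → v ∈ deg t → Y u n v ∈ deg (s + t - n - 1)
  truncation : ∀ u v : V, ∃ N : ℤ, ∀ n ≥ N, Y u n v = 0
  vacuum : ∀ (n : ℤ) (v : V), Y vac n v = if n = -1 then v else 0
  creation : ∀ v : V, (∀ n : ℤ, 0 ≤ n → Y v n vac = 0) ∧ Y v (-1) vac = v
  /-- The Virasoro relations for `L(n) = ω_{n+1}`. -/
  virasoro : ∀ (m n : ℤ) (v : V),
    Y ω (m + 1) (Y ω (n + 1) v) - Y ω (n + 1) (Y ω (m + 1) v) =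
      ((m : F) - n) • Y ω (m + n + 1) v + if m + n = 0 then (virCoeff F m * c) • v else 0
  /-- `Y(L(-1)v, z) = d/dz Y(v,z)`. -/
  derivative : ∀ (v w : V) (n : ℤ), Y (Y ω 0 v) n w = (-n : ℤ) • Y v (n - 1) w
  /-- `L(0)` acts on the component of degree `n` as `n`. -/
  degree : ∀ (n : ℤ), ∀ v ∈ deg n, Y ω 1 v = n • v
  jacobi : JacobiIdentity Y Y

/-- A vertex operator algebra structure on `L(c,0)` is the Virasoro one when the vacuum is the
image of `v_{c,0}`, the Virasoro vector is `L₋₂` applied to it, `Y(ω,z) = ∑ Lₙ z^{-n-2}`, the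
central charge is `c` and the grading is the given one. -/
structure VertexOperatorAlgebra.IsVirasoro {F : Type*} [Field F] {c : F}
    (V : VertexOperatorAlgebra F (VirIrr c 0)) : Prop where
  vac_eq : V.vac = VirIrr.gen c 0
  ω_eq : V.ω = ⁅Vir.L F (-2), VirIrr.gen c 0⁆
  mode_ω : ∀ (n : ℤ) (x : VirIrr c 0), V.Y V.ω (n + 1) x = ⁅Vir.L F n, x⁆
  c_eq : V.c = c
  deg_eq : ∀ n, V.deg n = VirIrr.deg c 0 n

section Modules

variable {F V : Type*} [Field F] [AddCommGroup V] [Module F V]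

/-- A weak (untwisted) module structure on `M`. -/
structure WeakModule (A : VertexOperatorAlgebra F V) (M : Type*) [AddCommGroup M] [Module F M] where
  /-- `Y u n` is the mode `uₙ` on `M`. -/
  Y : V →ₗ[F] (ℤ → Module.End F M)
  truncation : ∀ (u : V) (w : M), ∃ N : ℤ, ∀ n ≥ N, Y u n w = 0
  vacuum : ∀ (n : ℤ) (w : M), Y A.vac n w = if n = -1 then w else 0
  jacobi : JacobiIdentity A.Y Y

/-- An admissible module: a weak module with a compatible grading by the nonnegative integers. -/
structure AdmissibleModule (A : VertexOperatorAlgebra F V) (M : Type*) [AddCommGroup M]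
    [Module F M] extends WeakModule A M where
  /-- The homogeneous components. -/
  gr : ℤ → Submodule F M
  gr_neg : ∀ n < 0, gr n = ⊥
  isInternal : DirectSum.IsInternal gr
  mode_mem : ∀ (s m n : ℤ) (u : V) (w : M), u ∈ A.deg s → w ∈ gr n →
    Y u m w ∈ gr (n + s - m - 1)

variable {A : VertexOperatorAlgebra F V} {M : Type*} [AddCommGroup M] [Module F M]

/-- The subspace `N` is a submodule of the weak module `M`. -/
def WeakModule.IsSubmodule (W : WeakModule A M) (N : Submodule F M) : Prop :=
  ∀ (u : V) (n : ℤ), ∀ w ∈ N, W.Y u n w ∈ N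

/-- `M` is irreducible as a weak module: it has no submodules, graded or not, except `0` and
itself. -/
def WeakModule.IsIrreducible (W : WeakModule A M) : Prop :=
  Nontrivial M ∧ ∀ N : Submodule F M, W.IsSubmodule N → N = ⊥ ∨ N = ⊤

/-- `M` has no graded submodules except `0` and itself. -/
def AdmissibleModule.IsGradedIrreducible (W : AdmissibleModule A M) : Prop :=
  Nontrivial M ∧ ∀ N : Submodule F M, W.IsSubmodule N → (N = ⨆ n : ℤ, N ⊓ W.gr n) →
    N = ⊥ ∨ N = ⊤

/-- Isomorphism of weak modules. -/
def WeakModule.IsIsomorphic {M' : Type*} [AddCommGroup M'] [Module F M']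
    (W : WeakModule A M) (W' : WeakModule A M') : Prop :=
  ∃ e : M ≃ₗ[F] M', ∀ (u : V) (n : ℤ) (w : M), e (W.Y u n w) = W'.Y u n (e w)

/-- The action of `L(n) = ω_{n+1}` on the weak module is the given action of `Lₙ`. -/
def WeakModule.ExtendsVir [LieRingModule (Vir F) M] (W : WeakModule A M) : Prop :=
  ∀ (n : ℤ) (w : M), W.Y A.ω (n + 1) w = ⁅Vir.L F n, w⁆

/-- The admissible module structure on `L(c,h)` has the standard Virasoro action and the standard
grading. -/
def AdmissibleModule.IsStandard {c h : F} (W : AdmissibleModule A (VirIrr c h)) : Prop :=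
  W.ExtendsVir ∧ ∀ n, W.gr n = VirIrr.deg c h n

end Modules

end

noncomputable section

/-! ### Operators satisfying the Virasoro relations -/

/-! Construction. If the modes of a field ω on a space M satisfy the Virasoro relations, then so do
the products with ω on the space of all fields on M, and the identity field is a highest weight
vector of weight 0 for them (`IsVirField.isVirRep_nprod`). The universal property of V(c,0)
therefore attaches a field on M to each vector of V(c,0). Dong's lemma makes these fields mutually
local, and locality gives the Jacobi identity (`IsLocal.jacobi`), with products of fields in place
of products of vectors. All this descends to L(c,0) exactly when the maximal graded submodule W of
V(c,0) is sent to zero; this condition is `IsGood`. It holds on L(c,0) itself (`isGood_field_zero`),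
which produces the vertex operator algebra. Conversely, in any weak module the fields are determined
by ω (`WeakModule.fld_mk`); hence the structure is unique, and a linear isomorphism need only
respect ω.

Restriction. At c = 1/2 a combination of words of degree six vanishes in L(1/2,0) (`mk_sing`). Its
weight preserving mode acts on a vector killed by all Lₙ, n > 0, as 2L₀(2L₀ - 1)(16L₀ - 1)
(`IsGood.cubic`). So h is 0, 1/2 or 1/16, and 1/16 = 1/2 in characteristic 7. The same cubic yields
an eigenvector of L₀ in the lowest component of an irreducible admissible module, which is then
L(1/2,h) (`AdmissibleModule.exists_equiv`).

Existence. Because L(1/2,h) is simple, it is enough that the weight preserving modes of the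
homogeneous elements of W kill the generator (`isGood_field`). V(1/2,0) maps to the Fock space of a
Neveu–Schwarz fermion (`toFock`), and the image of W is orthogonal to the image of V(1/2,0) for an
invariant form. Outside characteristic 7 the image contains every monomial of even length
(`wordSpan_le_range`), so W maps to zero (`toFock_eq_zero`). The scalars by which weight preserving
modes act on a singular vector depend only on its weight. For h = 1/2 they are read off from the
singular vector e₀ of the Fock space. For h = 1/16 they are the values of a functional `tw` on the
Fock space, built from the series (1+X)^(±1/2) and characterised by `tw_nsL_neg`. Explicit
Neveu–Schwarz and Ramond fermions also show that the three Verma modules are nonzero, so no PBW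
theorem is needed.

In positive characteristic L₀ does not separate degrees, so gradings are carried by splitting maps;
divided powers replace the exponential of L₋₁, and the combinatorial identities are proved with
integral binomial coefficients. -/

/-- The operators `ℓ n` satisfy the relations of the `Lₙ` in a module of central charge `c`. -/
structure IsVirRep {F N : Type*} [Field F] [AddCommGroup N] [Module F N]
    (ℓ : ℤ → Module.End F N) (c : F) : Prop where
  comm : ∀ m n v, ℓ m (ℓ n v) - ℓ n (ℓ m v) =
    ((m : F) - n) • ℓ (m + n) v + if m + n = 0 then (virCoeff F m * c) • v else 0

namespace IsVirRep

variable {F N : Type*} [Field F] [AddCommGroup N] [Module F N] {ℓ : ℤ → Module.End F N} {c : F}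

/-- The linear map on the Virasoro algebra given by operators `ℓ n` and a scalar. -/
def toLin (ℓ : ℤ → Module.End F N) (c : F) : Vir F →ₗ[F] Module.End F N :=
  LinearMap.coprod (M := ℤ →₀ F) (M₂ := F) (Finsupp.linearCombination F ℓ)
    ((LinearMap.id : F →ₗ[F] F).smulRight (c • (1 : Module.End F N)))

theorem toLin_L (ℓ : ℤ → Module.End F N) (c : F) (n : ℤ) : toLin ℓ c (Vir.L F n) = ℓ n := by
  refine (LinearMap.coprod_apply (M := ℤ →₀ F) (M₂ := F) _ _ (Finsupp.single n 1, 0)).trans ?_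
  simp

theorem toLin_C (ℓ : ℤ → Module.End F N) (c : F) : toLin ℓ c (Vir.C F) = c • 1 := by
  refine (LinearMap.coprod_apply (M := ℤ →₀ F) (M₂ := F) _ _ (0, 1)).trans ?_
  simp

theorem toLin_bracket (H : IsVirRep ℓ c) (x y : Vir F) :
    toLin ℓ c ⁅x, y⁆ = toLin ℓ c x * toLin ℓ c y - toLin ℓ c y * toLin ℓ c x := by
  induction x using Vir.induction with
  | hL m =>
    induction y using Vir.induction with
    | hL n =>
      ext v
      simp only [toLin_L, LinearMap.sub_apply, Module.End.mul_apply, H.comm, Vir.lie_L_L, map_add,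
        map_smul, LinearMap.add_apply, LinearMap.smul_apply]
      split_ifs <;> simp [toLin_C, smul_smul]
    | hC => rw [Vir.lie_C, map_zero, toLin_C]; simp
    | h0 => simp
    | hadd x y hx hy => simp only [lie_add, map_add, hx, hy, mul_add, add_mul]; abel
    | hsmul a x hx => simp only [lie_smul, map_smul, hx, smul_sub, mul_smul_comm, smul_mul_assoc]
  | hC =>
    rw [← lie_skew, Vir.lie_C, neg_zero, map_zero, toLin_C]
    simp
  | h0 => simp
  | hadd x y hx hy => simp only [add_lie, map_add, hx, hy, mul_add, add_mul]; abel
  | hsmul a x hx => simp only [smul_lie, map_smul, hx, smul_sub, mul_smul_comm, smul_mul_assoc]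

attribute [local instance] LieRing.ofAssociativeRing LieAlgebra.ofAssociativeAlgebra in
/-- The action of the enveloping algebra. -/
def toAlgHom (H : IsVirRep ℓ c) : VirU F →ₐ[F] Module.End F N :=
  UniversalEnvelopingAlgebra.lift F
    { toLin ℓ c with
      map_lie' := by
        intro x y
        have := H.toLin_bracket x y
        rw [LieRing.of_associative_ring_bracket]
        exact this }

attribute [local instance] LieRing.ofAssociativeRing LieAlgebra.ofAssociativeAlgebra in
theorem toAlgHom_ι (H : IsVirRep ℓ c) (x : Vir F) :
    H.toAlgHom (UniversalEnvelopingAlgebra.ι F x) = toLin ℓ c x := by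
  rw [toAlgHom, UniversalEnvelopingAlgebra.lift_ι_apply]
  rfl

end IsVirRep

/-- The enveloping algebra is a quotient of the tensor algebra, whose induction principle passes
down. -/
theorem VirU.induction {F : Type*} [Field F] {p : VirU F → Prop}
    (hs : ∀ a : F, p (algebraMap F _ a)) (hι : ∀ x, p (UniversalEnvelopingAlgebra.ι F x))
    (hmul : ∀ x y, p x → p y → p (x * y)) (hadd : ∀ x y, p x → p y → p (x + y)) (u : VirU F) :
    p u := by
  obtain ⟨t, rfl⟩ : ∃ t, UniversalEnvelopingAlgebra.mkAlgHom F (Vir F) t = u := by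
    induction u using Quotient.inductionOn with
    | h t => exact ⟨t, rfl⟩
  induction t using TensorAlgebra.induction with
  | algebraMap r => simpa using hs r
  | ι x => exact hι x
  | mul a b ha hb => rw [map_mul]; exact hmul _ _ ha hb
  | add a b ha hb => rw [map_add]; exact hadd _ _ ha hb

/-! ### The universal property of Verma modules. -/

namespace Verma

variable {F : Type*} [Field F] {c h : F}

theorem lie_eq_smul (x : Vir F) (m : Verma c h) : ⁅x, m⁆ = UniversalEnvelopingAlgebra.ι F x • m :=
  rfl

variable (c h) in
/-- The quotient map onto the Verma module. -/
def mk : VirU F →ₗ[VirU F] Verma c h := (vermaIdeal c h).mkQ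

theorem smul_gen (u : VirU F) : u • gen c h = mk c h u := by
  refine (map_smul (mk c h) u 1).symm.trans ?_
  rw [smul_eq_mul, mul_one]

theorem exists_smul_gen (x : Verma c h) : ∃ u : VirU F, x = u • gen c h := by
  obtain ⟨u, rfl⟩ := Submodule.mkQ_surjective (vermaIdeal c h) x
  exact ⟨u, (smul_gen u).symm⟩

theorem smul_gen_eq_zero {u : VirU F} (hu : u ∈ vermaIdeal c h) : u • gen c h = 0 := by
  rw [smul_gen]
  exact (Submodule.Quotient.mk_eq_zero _).2 hu

theorem lie_C_gen : ⁅Vir.C F, gen c h⁆ = c • gen c h := by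
  have := smul_gen_eq_zero (c := c) (h := h) (Submodule.subset_span (Or.inl (Or.inl rfl)))
  rw [sub_smul, sub_eq_zero, algebraMap_smul] at this
  exact this

theorem lie_L_zero_gen : ⁅Vir.L F 0, gen c h⁆ = h • gen c h := by
  have := smul_gen_eq_zero (c := c) (h := h) (Submodule.subset_span (Or.inl (Or.inr rfl)))
  rw [sub_smul, sub_eq_zero, algebraMap_smul] at this
  exact this

theorem lie_L_pos_gen {n : ℤ} (hn : 0 < n) : ⁅Vir.L F n, gen c h⁆ = 0 :=
  smul_gen_eq_zero (Submodule.subset_span (Or.inr ⟨n, hn, rfl⟩))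

theorem induction_lie {p : Verma c h → Prop} (hgen : p (gen c h))
    (hlie : ∀ (y : Vir F) x, p x → p ⁅y, x⁆) (hadd : ∀ x y, p x → p y → p (x + y))
    (hsmul : ∀ (a : F) x, p x → p (a • x)) (x : Verma c h) : p x := by
  obtain ⟨u, rfl⟩ := exists_smul_gen x
  -- The vector is generalised because a product in the enveloping algebra acts by one factor after
  -- the other.
  suffices H : ∀ x, p x → p (u • x) from H _ hgen
  induction u using VirU.induction with
  | hs a => intro x hx; rw [algebraMap_smul]; exact hsmul a x hx
  | hι y => exact hlie y
  | hmul a b ha hb => intro x hx; rw [mul_smul]; exact ha _ (hb _ hx)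
  | hadd a b ha hb => intro x hx; rw [add_smul]; exact hadd _ _ (ha _ hx) (hb _ hx)

theorem lie_C (x : Verma c h) : ⁅Vir.C F, x⁆ = c • x := by
  induction x using induction_lie with
  | hgen => exact lie_C_gen
  | hlie y x hx =>
    have := leibniz_lie (Vir.C F) y x
    rw [this, hx, ← lie_skew, Vir.lie_C, lie_smul]
    simp
  | hadd x y hx hy => rw [lie_add, hx, hy, smul_add]
  | hsmul a x hx => rw [lie_smul, hx, smul_comm]

theorem induction {p : Verma c h → Prop} (hgen : p (gen c h))
    (hL : ∀ n x, p x → p ⁅Vir.L F n, x⁆) (hadd : ∀ x y, p x → p y → p (x + y))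
    (hsmul : ∀ (a : F) x, p x → p (a • x)) (x : Verma c h) : p x := by
  induction x using induction_lie with
  | hgen => exact hgen
  | hlie y x hx =>
    induction y using Vir.induction with
    | hL n => exact hL n x hx
    | hC => rw [lie_C]; exact hsmul c x hx
    | h0 => rw [zero_lie, ← zero_smul F x]; exact hsmul _ _ hx
    | hadd y z hy hz => rw [add_lie]; exact hadd _ _ hy hz
    | hsmul a y hy => rw [smul_lie]; exact hsmul _ _ hy
  | hadd x y hx hy => exact hadd x y hx hy
  | hsmul a x hx => exact hsmul a x hx

theorem lie_L_L (m n : ℤ) (x : Verma c h) : ⁅Vir.L F m, ⁅Vir.L F n, x⁆⁆ =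
    ⁅Vir.L F n, ⁅Vir.L F m, x⁆⁆ + (((m : F) - n) • ⁅Vir.L F (m + n), x⁆ +
      if m + n = 0 then (virCoeff F m * c) • x else 0) := by
  rw [leibniz_lie, Vir.lie_L_L, add_lie, smul_lie]
  split_ifs
  · rw [smul_lie, lie_C, smul_smul, add_comm]
  · rw [zero_lie, add_comm]

/-- The universal property of the Verma module. -/
theorem exists_lift {N : Type*} [AddCommGroup N] [Module F N] {ℓ : ℤ → Module.End F N}
    (H : IsVirRep ℓ c) (v : N) (h0 : ℓ 0 v = h • v) (hpos : ∀ n : ℤ, 0 < n → ℓ n v = 0) :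
    ∃ φ : Verma c h →ₗ[F] N, φ (gen c h) = v ∧ ∀ n x, φ ⁅Vir.L F n, x⁆ = ℓ n (φ x) := by
  let f : VirU F →ₗ[F] N := (LinearMap.applyₗ v) ∘ₗ H.toAlgHom.toLinearMap
  have hf : ∀ u, f u = H.toAlgHom u v := fun _ => rfl
  -- The elements that kill `v` form a left ideal, so only the generators of `vermaIdeal` need
  -- checking.
  have hker : (vermaIdeal c h).restrictScalars F ≤ LinearMap.ker f := by
    intro u hu
    rw [Submodule.restrictScalars_mem] at hu
    rw [LinearMap.mem_ker]
    induction hu using Submodule.span_induction with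
    | mem x hx =>
      rcases hx with (rfl | rfl) | ⟨n, hn, rfl⟩
      · rw [map_sub, hf, hf, IsVirRep.toAlgHom_ι, IsVirRep.toLin_C, AlgHom.commutes]
        simp [Module.algebraMap_end_apply]
      · rw [map_sub, hf, hf, IsVirRep.toAlgHom_ι, IsVirRep.toLin_L, AlgHom.commutes, h0]
        simp [Module.algebraMap_end_apply]
      · rw [hf, IsVirRep.toAlgHom_ι, IsVirRep.toLin_L, hpos n hn]
    | zero => exact map_zero f
    | add x y _ _ hx hy => rw [map_add, hx, hy, add_zero]
    | smul a x _ hx =>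
      rw [hf] at hx ⊢
      rw [smul_eq_mul, map_mul, Module.End.mul_apply, hx, map_zero]
  let φ : Verma c h →ₗ[F] N := (Submodule.liftQ _ f hker) ∘ₗ
    (Submodule.Quotient.restrictScalarsEquiv F (vermaIdeal c h)).symm.toLinearMap
  have hφ : ∀ u : VirU F, φ (u • gen c h) = H.toAlgHom u v := by
    intro u
    rw [smul_gen]
    rfl
  refine ⟨φ, ?_, fun n x => ?_⟩
  · have := hφ 1
    rwa [one_smul, map_one] at this
  · obtain ⟨u, rfl⟩ := exists_smul_gen x
    rw [lie_eq_smul, ← mul_smul, hφ, hφ, map_mul, IsVirRep.toAlgHom_ι, IsVirRep.toLin_L]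
    rfl


/-! ### The grading of the Verma module -/

variable (c h) in
/-- The vector `L₋ₖ₁ ⋯ L₋ₖᵣ v`. -/
def word (l : List ℕ) : Verma c h := l.foldr (fun (k : ℕ) y => ⁅Vir.L F (-(k : ℤ)), y⁆) (gen c h)

theorem word_nil : word c h [] = gen c h := rfl

theorem word_cons (k : ℕ) (l : List ℕ) :
    word c h (k :: l) = ⁅Vir.L F (-(k : ℤ)), word c h l⁆ := rfl

/-- In `deg` the list of naturals is coerced as a whole to a list of integers, through the monad
structure on lists; here the coercion is moved inside the fold. -/
theorem deg_eq_span (n : ℤ) : deg c h n = Submodule.span F {x | ∃ l : List ℕ, (∀ k ∈ l, 1 ≤ k) ∧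
    (l.sum : ℤ) = n ∧ x = word c h l} := by
  simp only [deg, word, bind_pure_comp, List.map_eq_map, List.foldr_map]

theorem word_mem_deg {l : List ℕ} (hl : ∀ k ∈ l, 1 ≤ k) {n : ℤ} (hn : (l.sum : ℤ) = n) :
    word c h l ∈ deg c h n := by
  rw [deg_eq_span]
  exact Submodule.subset_span ⟨l, hl, hn, rfl⟩

theorem gen_mem_deg : gen c h ∈ deg c h 0 := word_mem_deg (l := []) (by simp) (by simp)

theorem lie_L_neg_mem_deg {k : ℕ} (hk : 1 ≤ k) {n : ℤ} {x : Verma c h} (hx : x ∈ deg c h n) :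
    ⁅Vir.L F (-(k : ℤ)), x⁆ ∈ deg c h (n + k) := by
  rw [deg_eq_span] at hx
  induction hx using Submodule.span_induction with
  | mem x hx =>
    obtain ⟨l, hl, hs, rfl⟩ := hx
    rw [← word_cons]
    refine word_mem_deg ?_ ?_
    · simpa using ⟨hk, hl⟩
    · rw [List.sum_cons, ← hs]; push_cast; ring
  | zero => simp
  | add x y _ _ hx hy => rw [lie_add]; exact add_mem hx hy
  | smul a x _ hx => rw [lie_smul]; exact Submodule.smul_mem _ _ hx

/-- Moving Lₘ to the right through a word creates commutator terms on the shorter word, so the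
induction on the word must be uniform in m. On the generator the operator creates, scales or
annihilates. -/
theorem lie_L_word_mem_deg (l : List ℕ) (hl : ∀ k ∈ l, 1 ≤ k) (m : ℤ) :
    ⁅Vir.L F m, word c h l⁆ ∈
      deg c h ((l.sum : ℤ) - m) := by
  induction l generalizing m with
  | nil =>
    rcases lt_trichotomy m 0 with hm | rfl | hm
    · obtain ⟨k, rfl⟩ : ∃ k : ℕ, m = -(k : ℤ) := ⟨m.natAbs, by omega⟩
      have := lie_L_neg_mem_deg (c := c) (h := h) (k := k) (by omega) gen_mem_deg
      simpa [word_nil] using this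
    · simp only [word_nil, lie_L_zero_gen]
      exact Submodule.smul_mem _ _ gen_mem_deg
    · simp [word_nil, lie_L_pos_gen hm]
  | cons k l ih =>
    have hk : 1 ≤ k := hl k (by simp)
    have hl' : ∀ k ∈ l, 1 ≤ k := fun j hj => hl j (by simp [hj])
    rw [word_cons, lie_L_L]
    refine add_mem ?_ (add_mem (Submodule.smul_mem _ _ ?_) ?_)
    · have := lie_L_neg_mem_deg hk (ih hl' m)
      convert this using 2
      rw [List.sum_cons]; push_cast; ring
    · have := ih hl' (m + -(k : ℤ))
      convert this using 2
      rw [List.sum_cons]; push_cast; ring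
    · split_ifs with hmk
      · refine Submodule.smul_mem _ _ (word_mem_deg hl' ?_)
        rw [List.sum_cons]; push_cast; omega
      · exact zero_mem _

theorem lie_L_mem_deg (m : ℤ) {n : ℤ} {x : Verma c h} (hx : x ∈ deg c h n) :
    ⁅Vir.L F m, x⁆ ∈ deg c h (n - m) := by
  rw [deg_eq_span] at hx
  induction hx using Submodule.span_induction with
  | mem x hx =>
    obtain ⟨l, hl, hs, rfl⟩ := hx
    rw [← hs]
    exact lie_L_word_mem_deg l hl m
  | zero => simp
  | add x y _ _ hx hy => rw [lie_add]; exact add_mem hx hy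
  | smul a x _ hx => rw [lie_smul]; exact Submodule.smul_mem _ _ hx

/-- Induction over the words in the `L₋ₖ`, `k ≥ 1`. -/
theorem induction_neg {p : Verma c h → Prop} (hgen : p (gen c h)) (h0 : p 0)
    (hL : ∀ (k : ℕ) (n : ℤ) x, 1 ≤ k → x ∈ deg c h n → p x → p ⁅Vir.L F (-(k : ℤ)), x⁆)
    (hadd : ∀ x y, p x → p y → p (x + y))
    (hsmul : ∀ (a : F) x, p x → p (a • x)) (x : Verma c h) : p x := by
  have hword : ∀ l : List ℕ, (∀ k ∈ l, 1 ≤ k) →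
      p (word c h l) := by
    intro l hl
    induction l with
    | nil => exact hgen
    | cons k l ih =>
      have hl' : ∀ k ∈ l, 1 ≤ k := fun j hj => hl j (by simp [hj])
      exact hL k l.sum _ (hl k (by simp)) (word_mem_deg hl' rfl) (ih hl')
  have hdeg : ∀ n, ∀ x ∈ deg c h n, p x := by
    intro n x hx
    rw [deg_eq_span] at hx
    induction hx using Submodule.span_induction with
    | mem x hx => obtain ⟨l, hl, -, rfl⟩ := hx; exact hword l hl
    | zero => exact h0
    | add x y _ _ hx hy => exact hadd x y hx hy
    | smul a x _ hx => exact hsmul a x hx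
  -- The sum of the components contains the generator and is stable under every Lₙ, positive ones
  -- included, so it is everything.
  have htop : x ∈ ⨆ n, deg c h n := by
    induction x using induction with
    | hgen => exact Submodule.mem_iSup_of_mem 0 gen_mem_deg
    | hL n x hx =>
      induction hx using Submodule.iSup_induction' with
      | mem k x hx => exact Submodule.mem_iSup_of_mem _ (lie_L_mem_deg n hx)
      | zero => simp
      | add x y _ _ hx hy => rw [lie_add]; exact add_mem hx hy
    | hadd x y hx hy => exact add_mem hx hy
    | hsmul a x hx => exact Submodule.smul_mem _ _ hx
  induction htop using Submodule.iSup_induction' with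
  | mem k x hx => exact hdeg k x hx
  | zero => exact h0
  | add x y _ _ hx hy => exact hadd x y hx hy

theorem deg_neg {n : ℤ} (hn : n < 0) : deg c h n = ⊥ := by
  rw [deg_eq_span, Submodule.span_eq_bot]
  rintro x ⟨l, -, hs, -⟩
  omega

theorem mem_deg_zero {x : Verma c h} (hx : x ∈ deg c h 0) : ∃ a : F, x = a • gen c h := by
  rw [deg_eq_span] at hx
  induction hx using Submodule.span_induction with
  | mem x hx =>
    obtain ⟨l, hl, hs, rfl⟩ := hx
    cases l with
    | nil => exact ⟨1, by simp [word_nil]⟩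
    | cons k l =>
      have := hl k (by simp)
      rw [List.sum_cons, Nat.cast_add] at hs
      omega
  | zero => exact ⟨0, by simp⟩
  | add x y _ _ hx hy =>
    obtain ⟨a, rfl⟩ := hx
    obtain ⟨b, rfl⟩ := hy
    exact ⟨a + b, by rw [add_smul]⟩
  | smul a x _ hx =>
    obtain ⟨b, rfl⟩ := hx
    exact ⟨a * b, by rw [mul_smul]⟩

theorem lie_L_zero {n : ℤ} {x : Verma c h} (hx : x ∈ deg c h n) :
    ⁅Vir.L F 0, x⁆ = (h + n) • x := by
  rw [deg_eq_span] at hx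
  induction hx using Submodule.span_induction with
  | mem x hx =>
    obtain ⟨l, hl, rfl, rfl⟩ := hx
    clear hl
    induction l with
    | nil => simp [word_nil, lie_L_zero_gen]
    | cons k l ih =>
      rw [word_cons, lie_L_L, ih, lie_smul, List.sum_cons]
      have : virCoeff F 0 = 0 := by simp [virCoeff]
      simp only [this, zero_mul, zero_smul, ite_self, zero_add, add_zero]
      push_cast
      module
  | zero => simp
  | add x y _ _ hx hy => rw [lie_add, hx, hy, smul_add]
  | smul a x _ hx => rw [lie_smul, hx, smul_comm]

/-- The words of degree n are indexed by the compositions of n. -/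
instance finite_deg (n : ℤ) : Module.Finite F (deg c h n) := by
  rw [deg_eq_span]
  apply Module.Finite.span_of_finite
  rcases lt_or_ge n 0 with hn | hn
  · refine Set.Finite.subset Set.finite_empty ?_
    rintro x ⟨l, -, hs, -⟩
    omega
  · obtain ⟨n, rfl⟩ := Int.eq_ofNat_of_zero_le hn
    refine Set.Finite.subset (Set.finite_range fun p : Composition n =>
      word c h p.blocks) ?_
    rintro x ⟨l, hl, hs, rfl⟩
    exact ⟨⟨l, fun {i} hi => hl i hi, by exact_mod_cast hs⟩, rfl⟩

end Verma

/-! ### Gradings given by splitting maps. -/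

/-- The linear map `δ` splits each vector into its components for the grading `D`. -/
structure IsGrading {F V : Type*} [Field F] [AddCommGroup V] [Module F V]
    (D : ℤ → Submodule F V) (δ : V →ₗ[F] ℤ →₀ V) : Prop where
  mem : ∀ x k, δ x k ∈ D k
  eq_single : ∀ x k, x ∈ D k → δ x = Finsupp.single k x
  sum_eq : ∀ x, ((δ x).sum fun _ y => y) = x

namespace IsGrading

variable {F V : Type*} [Field F] [AddCommGroup V] [Module F V] {D : ℤ → Submodule F V}
  {δ : V →ₗ[F] ℤ →₀ V}

/-- The map δ recovers the k-th summand from a sum of homogeneous vectors, which makes the sum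
direct; `sum_eq` makes it exhaustive. -/
theorem isInternal (H : IsGrading D δ) : DirectSum.IsInternal D := by
  classical
  constructor
  · have key : ∀ f : DirectSum ℤ fun i => D i, ∀ k,
        δ (DirectSum.coeAddMonoidHom D f) k = f k := by
      intro f k
      induction f using DirectSum.induction_on with
      | zero => simp
      | of i x =>
        rw [DirectSum.coeAddMonoidHom_of, H.eq_single _ i x.2]
        by_cases hik : i = k
        · subst hik; simp
        · rw [Finsupp.single_eq_of_ne (Ne.symm hik), DirectSum.of_eq_of_ne _ _ _ (Ne.symm hik)]
          rfl
      | add f g hf hg => simp [map_add, hf, hg]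
    intro f g hfg
    ext k
    rw [← key, ← key, hfg]
  · intro x
    refine ⟨∑ k ∈ (δ x).support, DirectSum.of (fun i => D i) k ⟨δ x k, H.mem x k⟩, ?_⟩
    rw [map_sum]
    simp only [DirectSum.coeAddMonoidHom_of]
    exact H.sum_eq x

end IsGrading

namespace Verma

variable {F : Type*} [Field F] {c h : F}

variable (c h) in
/-- The operators `Lₙ` on the Verma module. -/
def op (n : ℤ) : Module.End F (Verma c h) where
  toFun x := ⁅Vir.L F n, x⁆
  map_add' := lie_add _
  map_smul' a x := lie_smul a _ x

theorem op_apply (n : ℤ) (x : Verma c h) : op c h n x = ⁅Vir.L F n, x⁆ := rfl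

/-- The operators `Lₙ` on Laurent polynomials with coefficients in the Verma module, changing the
exponent by `-n`. -/
def twistedOp (n : ℤ) : Module.End F (ℤ →₀ Verma c h) :=
  Finsupp.lsum F fun k => Finsupp.lsingle (k - n) ∘ₗ op c h n

theorem twistedOp_single (n k : ℤ) (x : Verma c h) :
    twistedOp n (Finsupp.single k x) = Finsupp.single (k - n) ⁅Vir.L F n, x⁆ := by
  simp [twistedOp, op_apply]

theorem twistedOp_apply (n k : ℤ) (f : ℤ →₀ Verma c h) :
    twistedOp n f k = ⁅Vir.L F n, f (k + n)⁆ := by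
  induction f using Finsupp.induction_linear with
  | zero => simp
  | add f g hf hg => simp [hf, hg]
  | single j x =>
    rw [twistedOp_single, Finsupp.single_apply, Finsupp.single_apply]
    by_cases hj : j = k + n
    · rw [if_pos hj, if_pos (by omega)]
    · rw [if_neg hj, if_neg (by omega), lie_zero]

theorem isVirRep_twistedOp : IsVirRep (twistedOp (c := c) (h := h)) c where
  comm m n v := by
    ext k
    simp only [Finsupp.sub_apply, Finsupp.add_apply, Finsupp.smul_apply, twistedOp_apply]
    rw [add_right_comm k m n, lie_L_L, add_assoc k n m, add_comm n m]
    split_ifs with hmn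
    · simp only [hmn, add_zero, Finsupp.smul_apply]
      abel
    · rw [Finsupp.zero_apply]
      abel

/-- In positive characteristic the eigenvalues of L₀ do not separate degrees, so they cannot show
that the components are independent. Instead, Laurent polynomials over the Verma module carry a
Virasoro action in which Lₙ also lowers the exponent by n. The universal property sends the
generator to v·z⁰, and the exponents then record the degrees. -/
theorem exists_isGrading : ∃ δ : Verma c h →ₗ[F] ℤ →₀ Verma c h, IsGrading (deg c h) δ ∧
    ∀ n x k, δ ⁅Vir.L F n, x⁆ k = ⁅Vir.L F n, δ x (k + n)⁆ := by
  obtain ⟨δ, h1, h2⟩ := exists_lift (h := h) (isVirRep_twistedOp (c := c) (h := h))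
    (Finsupp.single 0 (gen c h))
    (by rw [twistedOp_single, lie_L_zero_gen]; simp)
    (fun n hn => by rw [twistedOp_single, lie_L_pos_gen hn]; simp)
  refine ⟨δ, ⟨?_, ?_, ?_⟩, fun n x k => by rw [h2, twistedOp_apply]⟩
  · intro x
    induction x using induction with
    | hgen =>
      intro k
      rw [h1, Finsupp.single_apply]
      split_ifs with hk
      · rw [← hk]; exact gen_mem_deg
      · exact zero_mem _
    | hL n x hx =>
      intro k
      rw [h2, twistedOp_apply]
      have := lie_L_mem_deg n (hx (k + n))
      rwa [add_sub_cancel_right] at this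
    | hadd x y hx hy => intro k; rw [map_add]; exact add_mem (hx k) (hy k)
    | hsmul a x hx => intro k; rw [map_smul]; exact Submodule.smul_mem _ _ (hx k)
  · intro x k hx
    rw [deg_eq_span] at hx
    induction hx using Submodule.span_induction with
    | mem x hx =>
      obtain ⟨l, -, rfl, rfl⟩ := hx
      induction l with
      | nil => simpa [word_nil] using h1
      | cons k l ih =>
        rw [word_cons, h2, ih, twistedOp_single, List.sum_cons, Nat.cast_add, sub_neg_eq_add,
          add_comm (k : ℤ)]
    | zero => simp
    | add x y _ _ hx hy => rw [map_add, hx, hy, Finsupp.single_add]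
    | smul a x _ hx => rw [map_smul, hx, Finsupp.smul_single]
  · intro x
    have hadd : ∀ f g : ℤ →₀ Verma c h, ((f + g).sum fun _ y => y) =
        (f.sum fun _ y => y) + g.sum fun _ y => y :=
      fun f g => Finsupp.sum_add_index' (fun _ => rfl) (fun _ _ _ => rfl)
    -- Setting z = 1 intertwines the twisted action with the original one, so splitting followed by
    -- summation fixes every vector as soon as it fixes the generator.
    have hop : ∀ n (f : ℤ →₀ Verma c h), ((twistedOp n f).sum fun _ y => y) =
        ⁅Vir.L F n, f.sum fun _ y => y⁆ := by
      intro n f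
      induction f using Finsupp.induction_linear with
      | zero => simp
      | add f g hf hg => rw [map_add, hadd, hadd, hf, hg, lie_add]
      | single j x =>
        rw [twistedOp_single, Finsupp.sum_single_index rfl, Finsupp.sum_single_index rfl]
    induction x using induction with
    | hgen => rw [h1, Finsupp.sum_single_index rfl]
    | hL n x hx => rw [h2, hop, hx]
    | hadd x y hx hy => rw [map_add, hadd, hx, hy]
    | hsmul a x hx =>
      rw [map_smul, Finsupp.sum_smul_index' fun _ => rfl, ← Finsupp.smul_sum, hx]

variable (c h) in
/-- The splitting of vectors of the Verma module into homogeneous components. -/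
def split : Verma c h →ₗ[F] ℤ →₀ Verma c h := exists_isGrading.choose

theorem isGrading : IsGrading (deg c h) (split c h) := exists_isGrading.choose_spec.1

theorem split_lie (n : ℤ) (x : Verma c h) (k : ℤ) :
    split c h ⁅Vir.L F n, x⁆ k = ⁅Vir.L F n, split c h x (k + n)⁆ :=
  exists_isGrading.choose_spec.2 n x k

theorem split_gen : split c h (gen c h) = Finsupp.single 0 (gen c h) :=
  isGrading.eq_single _ _ gen_mem_deg

/-! ### The maximal graded submodule -/

/-- The action of a product of operators `Lₘ`. -/
def act {M : Type*} [AddCommGroup M] [LieRingModule (Vir F) M] (l : List ℤ) (x : M) : M :=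
  l.foldr (fun m y => ⁅Vir.L F m, y⁆) x

theorem act_cons {M : Type*} [AddCommGroup M] [LieRingModule (Vir F) M] (m : ℤ) (l : List ℤ)
    (x : M) : act (F := F) (m :: l) x = ⁅Vir.L F m, act (F := F) l x⁆ := rfl

theorem act_append {M : Type*} [AddCommGroup M] [LieRingModule (Vir F) M] (l l' : List ℤ)
    (x : M) : act (F := F) (l ++ l') x = act (F := F) l (act (F := F) l' x) := by
  simp [act, List.foldr_append]

theorem act_add {M : Type*} [AddCommGroup M] [LieRingModule (Vir F) M] (l : List ℤ)
    (x y : M) : act (F := F) l (x + y) = act (F := F) l x + act (F := F) l y := by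
  induction l with
  | nil => rfl
  | cons m l ih => rw [act_cons, act_cons, act_cons, ih, lie_add]

theorem act_smul {M : Type*} [AddCommGroup M] [Module F M] [LieRingModule (Vir F) M]
    [LieModule F (Vir F) M] (l : List ℤ) (a : F) (x : M) :
    act (F := F) l (a • x) = a • act (F := F) l x := by
  induction l with
  | nil => rfl
  | cons m l ih => rw [act_cons, act_cons, ih, lie_smul]

theorem split_act (l : List ℤ) (x : Verma c h) (k : ℤ) :
    split c h (act (F := F) l x) k = act (F := F) l (split c h x (k + l.sum)) := by
  induction l generalizing k with
  | nil => simp [act]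
  | cons m l ih => rw [act_cons, act_cons, split_lie, ih, List.sum_cons, add_assoc]

/-- A subspace closed under the `Lₙ` is a submodule. -/
def lieSubmoduleOfClosed (N : Submodule F (Verma c h))
    (hN : ∀ n, ∀ x ∈ N, ⁅Vir.L F n, x⁆ ∈ N) : LieSubmodule F (Vir F) (Verma c h) where
  __ := N
  lie_mem := by
    intro y x hx
    induction y using Vir.induction with
    | hL n => exact hN n x hx
    | hC => rw [lie_C]; exact N.smul_mem c hx
    | h0 => rw [zero_lie]; exact N.zero_mem
    | hadd y z hy hz => rw [add_lie]; exact N.add_mem hy hz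
    | hsmul a y hy => rw [smul_lie]; exact N.smul_mem _ hy

theorem mem_of_gen_mem {N : LieSubmodule F (Vir F) (Verma c h)} (hN : gen c h ∈ N)
    (x : Verma c h) : x ∈ N := by
  induction x using induction with
  | hgen => exact hN
  | hL n x hx => exact N.lie_mem hx
  | hadd x y hx hy => exact N.add_mem hx hy
  | hsmul a x hx => exact N.smul_mem a hx

theorem isGraded_iff {N : LieSubmodule F (Vir F) (Verma c h)} :
    IsGraded c h N ↔ ∀ x ∈ N, ∀ k, split c h x k ∈ N := by
  constructor
  · intro hN x hx k
    rw [← LieSubmodule.mem_toSubmodule, hN] at hx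
    induction hx using Submodule.iSup_induction' with
    | mem n x hx =>
      rw [isGrading.eq_single x n hx.2, Finsupp.single_apply]
      split_ifs
      · exact hx.1
      · exact N.zero_mem
    | zero => simp
    | add x y _ _ hx hy => rw [map_add]; exact N.add_mem hx hy
  · intro hN
    refine le_antisymm (fun x hx => ?_) (iSup_le fun n => inf_le_left)
    rw [← isGrading.sum_eq x]
    exact Submodule.sum_mem _ fun k _ => Submodule.mem_iSup_of_mem k
      ⟨hN x hx k, isGrading.mem x k⟩

/-- The component of degree zero is the line of the generator, so a graded submodule that meets it
contains the generator and is everything. -/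
theorem split_zero_of_mem_of_ne_top {N : LieSubmodule F (Vir F) (Verma c h)} (hN : N ≠ ⊤)
    (hg : IsGraded c h N) {x : Verma c h} (hx : x ∈ N) : split c h x 0 = 0 := by
  by_contra hne
  obtain ⟨a, ha⟩ := mem_deg_zero (isGrading.mem x 0)
  have ha0 : a ≠ 0 := by
    rintro rfl
    exact hne (by rw [ha, zero_smul])
  apply hN
  rw [eq_top_iff]
  intro y _
  refine mem_of_gen_mem ?_ y
  have := isGraded_iff.1 hg x hx 0
  rw [ha] at this
  have := N.smul_mem a⁻¹ this
  rwa [smul_smul, inv_mul_cancel₀ ha0, one_smul] at this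

variable (c h) in
/-- The vectors from which no product of operators `Lₘ` leads to a vector with a nonzero component
of degree zero. -/
def radical : LieSubmodule F (Vir F) (Verma c h) :=
  lieSubmoduleOfClosed
    { carrier := {x | ∀ l : List ℤ, split c h (act (F := F) l x) 0 = 0}
      add_mem' := fun {x y} hx hy l => by
        rw [act_add, map_add, Finsupp.add_apply, hx l, hy l, add_zero]
      zero_mem' := fun l => by
        have := act_smul (F := F) l (0 : F) (0 : Verma c h)
        rw [zero_smul, zero_smul] at this
        rw [this]; simp
      smul_mem' := fun a x hx l => by
        rw [act_smul, map_smul, Finsupp.smul_apply, hx l, smul_zero] }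
    (fun n x hx l => by
      have := hx (l ++ [n])
      rwa [act_append] at this)

theorem mem_radical {x : Verma c h} :
    x ∈ radical c h ↔ ∀ l : List ℤ, split c h (act (F := F) l x) 0 = 0 := Iff.rfl

theorem act_zero {M : Type*} [AddCommGroup M] [LieRingModule (Vir F) M] (l : List ℤ) :
    act (F := F) l (0 : M) = 0 := by
  induction l with
  | nil => rfl
  | cons m l ih => rw [act_cons, ih, lie_zero]

theorem isGraded_radical : IsGraded c h (radical c h) := by
  rw [isGraded_iff]
  intro x hx k
  rw [mem_radical] at hx ⊢
  intro l
  rw [split_act, isGrading.eq_single _ _ (isGrading.mem x k), Finsupp.single_apply]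
  split_ifs with hk
  · have := hx l
    rw [split_act] at this
    rw [hk]
    exact this
  · exact act_zero l

theorem act_mem {N : LieSubmodule F (Vir F) (Verma c h)} {x : Verma c h} (hx : x ∈ N)
    (l : List ℤ) : act (F := F) l x ∈ N := by
  induction l with
  | nil => exact hx
  | cons m l ih => exact N.lie_mem ih

/-- Proper graded submodules have no component of degree zero and are stable under products of the
Lₘ, hence lie in the radical. The radical is itself graded, and proper because it misses the
generator. This turns membership in the maximal submodule into a condition that can be tested. -/
theorem maxGraded_eq_radical (hgen : gen c h ≠ 0) : maxGraded c h = radical c h := by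
  apply le_antisymm
  · refine sSup_le fun N hN x hx => ?_
    rw [mem_radical]
    exact fun l => split_zero_of_mem_of_ne_top hN.1 hN.2 (act_mem hx l)
  · refine le_sSup ⟨fun htop => hgen ?_, isGraded_radical⟩
    have : gen c h ∈ radical c h := by rw [htop]; trivial
    have := mem_radical.1 this []
    rwa [act, List.foldr_nil, split_gen, Finsupp.single_eq_same] at this

theorem split_zero_of_mem_maxGraded (hgen : gen c h ≠ 0) {x : Verma c h} (hx : x ∈ maxGraded c h) :
    split c h x 0 = 0 := by
  rw [maxGraded_eq_radical hgen] at hx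
  exact mem_radical.1 hx []

theorem split_mem_maxGraded (hgen : gen c h ≠ 0) {x : Verma c h} (hx : x ∈ maxGraded c h) (k : ℤ) :
    split c h x k ∈ maxGraded c h := by
  rw [maxGraded_eq_radical hgen] at hx ⊢
  exact isGraded_iff.1 isGraded_radical x hx k

end Verma
end

noncomputable section

/-! ### The irreducible quotient L(c,h). -/

namespace VirIrr

variable {F : Type*} [Field F] {c h : F}

variable (c h) in
/-- The quotient map `V(c,h) → L(c,h)`. -/
def mk : Verma c h →ₗ[F] VirIrr c h := (LieSubmodule.Quotient.mk' (Verma.maxGraded c h) : _ →ₗ[F] _)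

theorem mk_lie (y : Vir F) (x : Verma c h) : mk c h ⁅y, x⁆ = ⁅y, mk c h x⁆ :=
  (LieSubmodule.Quotient.mk' (Verma.maxGraded c h)).map_lie y x

theorem mk_gen : mk c h (Verma.gen c h) = gen c h := rfl

theorem mk_surjective : Function.Surjective (mk c h) :=
  LieSubmodule.Quotient.surjective_mk' (Verma.maxGraded c h)

theorem mk_eq_zero {x : Verma c h} : mk c h x = 0 ↔ x ∈ Verma.maxGraded c h :=
  LieSubmodule.Quotient.mk_eq_zero (Verma.maxGraded c h)

theorem deg_eq_map (n : ℤ) : deg c h n = (Verma.deg c h n).map (mk c h) := rfl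

theorem mk_mem_deg {n : ℤ} {x : Verma c h} (hx : x ∈ Verma.deg c h n) : mk c h x ∈ deg c h n :=
  Submodule.mem_map_of_mem hx

theorem gen_mem_deg : gen c h ∈ deg c h 0 := mk_mem_deg Verma.gen_mem_deg

theorem lie_L_L (m n : ℤ) (x : VirIrr c h) : ⁅Vir.L F m, ⁅Vir.L F n, x⁆⁆ =
    ⁅Vir.L F n, ⁅Vir.L F m, x⁆⁆ + (((m : F) - n) • ⁅Vir.L F (m + n), x⁆ +
      if m + n = 0 then (virCoeff F m * c) • x else 0) := by
  obtain ⟨x, rfl⟩ := mk_surjective x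
  simp only [← mk_lie, Verma.lie_L_L m n x, map_add, map_smul]
  split_ifs <;> simp

variable (c h) in
/-- The operators `Lₙ` on `L(c,h)`. -/
def op (n : ℤ) : Module.End F (VirIrr c h) where
  toFun x := ⁅Vir.L F n, x⁆
  map_add' := lie_add _
  map_smul' a x := lie_smul a _ x

theorem op_apply (n : ℤ) (x : VirIrr c h) : op c h n x = ⁅Vir.L F n, x⁆ := rfl

theorem isVirRep_op : IsVirRep (op c h) c where
  comm m n v := by simp only [op_apply]; rw [lie_L_L]; abel

theorem lie_L_zero_gen : ⁅Vir.L F 0, gen c h⁆ = h • gen c h := by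
  rw [← mk_gen, ← mk_lie, Verma.lie_L_zero_gen, map_smul]

theorem lie_L_pos_gen {n : ℤ} (hn : 0 < n) : ⁅Vir.L F n, gen c h⁆ = 0 := by
  rw [← mk_gen, ← mk_lie, Verma.lie_L_pos_gen hn, map_zero]

theorem induction {p : VirIrr c h → Prop} (hgen : p (gen c h))
    (hL : ∀ n x, p x → p ⁅Vir.L F n, x⁆) (hadd : ∀ x y, p x → p y → p (x + y))
    (hsmul : ∀ (a : F) x, p x → p (a • x)) (x : VirIrr c h) : p x := by
  obtain ⟨x, rfl⟩ := mk_surjective x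
  induction x using Verma.induction with
  | hgen => exact hgen
  | hL n x hx => rw [mk_lie]; exact hL _ _ hx
  | hadd x y hx hy => rw [map_add]; exact hadd _ _ hx hy
  | hsmul a x hx => rw [map_smul]; exact hsmul _ _ hx

/-- Induction over the words in the `L₋ₖ`, `k ≥ 1`. -/
theorem induction_neg {p : VirIrr c h → Prop} (hgen : p (gen c h)) (h0 : p 0)
    (hL : ∀ (k : ℕ) (n : ℤ) x, 1 ≤ k → x ∈ deg c h n → p x → p ⁅Vir.L F (-(k : ℤ)), x⁆)
    (hadd : ∀ x y, p x → p y → p (x + y))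
    (hsmul : ∀ (a : F) x, p x → p (a • x)) (x : VirIrr c h) : p x := by
  obtain ⟨x, rfl⟩ := mk_surjective x
  induction x using Verma.induction_neg with
  | hgen => exact hgen
  | h0 => rw [map_zero]; exact h0
  | hL k n x hk hn hx => rw [mk_lie]; exact hL k n _ hk (mk_mem_deg hn) hx
  | hadd x y hx hy => rw [map_add]; exact hadd _ _ hx hy
  | hsmul a x hx => rw [map_smul]; exact hsmul _ _ hx

theorem lie_L_mem_deg (m : ℤ) {n : ℤ} {x : VirIrr c h} (hx : x ∈ deg c h n) :
    ⁅Vir.L F m, x⁆ ∈ deg c h (n - m) := by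
  obtain ⟨x, hx, rfl⟩ := hx
  change ⁅Vir.L F m, mk c h x⁆ ∈ _
  rw [← mk_lie]
  exact mk_mem_deg (Verma.lie_L_mem_deg m hx)

theorem lie_L_zero {n : ℤ} {x : VirIrr c h} (hx : x ∈ deg c h n) :
    ⁅Vir.L F 0, x⁆ = (h + n) • x := by
  obtain ⟨x, hx, rfl⟩ := hx
  change ⁅Vir.L F 0, mk c h x⁆ = _ • mk c h x
  rw [← mk_lie, Verma.lie_L_zero hx, map_smul]

theorem deg_neg {n : ℤ} (hn : n < 0) : deg c h n = ⊥ := by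
  rw [deg_eq_map, Verma.deg_neg hn, Submodule.map_bot]

instance finite_deg (n : ℤ) : Module.Finite F (deg c h n) :=
  inferInstanceAs (Module.Finite F ((Verma.deg c h n).map (mk c h)))

theorem exists_isGrading (hgen : Verma.gen c h ≠ 0) :
    ∃ δ : VirIrr c h →ₗ[F] ℤ →₀ VirIrr c h, IsGrading (deg c h) δ ∧
      ∀ x k, δ (mk c h x) k = mk c h (Verma.split c h x k) := by
  let f : Verma c h →ₗ[F] ℤ →₀ VirIrr c h :=
    Finsupp.mapRange.linearMap (mk c h) ∘ₗ Verma.split c h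
  have hf : ∀ x k, f x k = mk c h (Verma.split c h x k) := fun x k => by
    simp [f]
  let δ : VirIrr c h →ₗ[F] ℤ →₀ VirIrr c h :=
    Submodule.liftQ (Verma.maxGraded c h).toSubmodule f (fun x hx => by
      rw [LinearMap.mem_ker]
      ext k
      rw [hf, Finsupp.zero_apply, mk_eq_zero]
      exact Verma.split_mem_maxGraded hgen hx k)
  have hδ : ∀ x, δ (mk c h x) = f x := fun x => Submodule.liftQ_apply _ _ _
  refine ⟨δ, ⟨?_, ?_, ?_⟩, fun x k => by rw [hδ, hf]⟩
  · intro x k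
    obtain ⟨x, rfl⟩ := mk_surjective x
    rw [hδ, hf]
    exact mk_mem_deg (Verma.isGrading.mem x k)
  · rintro x k ⟨x, hx, rfl⟩
    change δ (mk c h x) = Finsupp.single k (mk c h x)
    rw [hδ]
    ext j
    rw [hf, Verma.isGrading.eq_single x k hx, Finsupp.single_apply, Finsupp.single_apply]
    split_ifs <;> simp
  · intro x
    obtain ⟨x, rfl⟩ := mk_surjective x
    rw [hδ]
    conv_rhs => rw [← Verma.isGrading.sum_eq x]
    change (Finsupp.mapRange _ (map_zero (mk c h)) _).sum _ = _
    rw [Finsupp.sum_mapRange_index (fun _ => rfl), Finsupp.sum, Finsupp.sum, map_sum]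

/-- The splitting of vectors of `L(c,h)` into homogeneous components. -/
def split (hgen : Verma.gen c h ≠ 0) : VirIrr c h →ₗ[F] ℤ →₀ VirIrr c h :=
  (exists_isGrading hgen).choose

theorem isGrading (hgen : Verma.gen c h ≠ 0) : IsGrading (deg c h) (split hgen) :=
  (exists_isGrading hgen).choose_spec.1

theorem split_mk (hgen : Verma.gen c h ≠ 0) (x : Verma c h) (k : ℤ) :
    split hgen (mk c h x) k = mk c h (Verma.split c h x k) :=
  (exists_isGrading hgen).choose_spec.2 x k

theorem split_lie (hgen : Verma.gen c h ≠ 0) (n : ℤ) (x : VirIrr c h) (k : ℤ) :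
    split hgen ⁅Vir.L F n, x⁆ k = ⁅Vir.L F n, split hgen x (k + n)⁆ := by
  obtain ⟨x, rfl⟩ := mk_surjective x
  rw [← mk_lie, split_mk, split_mk, Verma.split_lie, mk_lie]

theorem gen_ne_zero (hgen : Verma.gen c h ≠ 0) : gen c h ≠ 0 := by
  intro h0
  rw [← mk_gen, mk_eq_zero] at h0
  have := Verma.split_zero_of_mem_maxGraded hgen h0
  rw [Verma.split_gen, Finsupp.single_eq_same] at this
  exact hgen this

theorem mk_act (l : List ℤ) (x : Verma c h) :
    mk c h (Verma.act (F := F) l x) = Verma.act (F := F) l (mk c h x) := by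
  induction l with
  | nil => rfl
  | cons m l ih => rw [Verma.act_cons, Verma.act_cons, mk_lie, ih]

theorem act_mem_deg (l : List ℤ) {n : ℤ} {x : VirIrr c h} (hx : x ∈ deg c h n) :
    Verma.act (F := F) l x ∈ deg c h (n - l.sum) := by
  induction l with
  | nil => simpa [Verma.act] using hx
  | cons m l ih =>
    rw [Verma.act_cons, List.sum_cons]
    have := lie_L_mem_deg m ih
    convert this using 2
    ring

/-- From a nonzero homogeneous vector some product of operators `Lₘ` leads to the generator. -/
theorem exists_act_eq_gen (hgen : Verma.gen c h ≠ 0) {n : ℤ} {x : VirIrr c h}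
    (hx : x ∈ deg c h n) (hx0 : x ≠ 0) :
    ∃ (l : List ℤ) (a : F), l.sum = n ∧ a ≠ 0 ∧ Verma.act (F := F) l x = a • gen c h := by
  obtain ⟨y, hy, rfl⟩ := hx
  change mk c h y ≠ 0 at hx0
  rw [Ne, mk_eq_zero, Verma.maxGraded_eq_radical hgen, Verma.mem_radical] at hx0
  push Not at hx0
  obtain ⟨l, hl⟩ := hx0
  have hsum : l.sum = n := by
    by_contra hne
    rw [Verma.split_act, Verma.isGrading.eq_single y n hy, Finsupp.single_apply,
      if_neg (by omega), Verma.act_zero] at hl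
    exact hl rfl
  obtain ⟨a, ha⟩ := Verma.mem_deg_zero (Verma.isGrading.mem (Verma.act (F := F) l y) 0)
  refine ⟨l, a, hsum, ?_, ?_⟩
  · rintro rfl
    exact hl (by rw [ha, zero_smul])
  · change Verma.act l (mk c h y) = _
    rw [← mk_act, ← mk_gen, ← map_smul, ← ha, Verma.split_act, Verma.isGrading.eq_single y n hy,
      hsum, zero_add, Finsupp.single_eq_same]

/-- `L(c,h)` has no submodules, graded or not, except zero and itself. -/
theorem eq_bot_or_eq_top (hgen : Verma.gen c h ≠ 0) (N : Submodule F (VirIrr c h))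
    (hN : ∀ n, ∀ x ∈ N, ⁅Vir.L F n, x⁆ ∈ N) : N = ⊥ ∨ N = ⊤ := by
  rw [or_iff_not_imp_left]
  intro hbot
  obtain ⟨w, hw, hw0⟩ := Submodule.exists_mem_ne_zero_of_ne_bot hbot
  have hne : (split hgen w).support.Nonempty := by
    rw [Finset.nonempty_iff_ne_empty, Ne, Finsupp.support_eq_empty]
    intro h0
    apply hw0
    rw [← (isGrading hgen).sum_eq w, h0, Finsupp.sum_zero_index]
  -- The top component is chosen: a product of total degree n that leads from it to the generator
  -- sends all lower components to negative degrees, that is, to zero. This is why ungraded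
  -- submodules are covered too.
  set n := (split hgen w).support.max' hne with hn
  have hn0 : split hgen w n ≠ 0 := Finsupp.mem_support_iff.1 (Finset.max'_mem _ hne)
  obtain ⟨l, a, hl, ha, hact⟩ := exists_act_eq_gen hgen ((isGrading hgen).mem w n) hn0
  have hactw : Verma.act (F := F) l w = a • gen c h := by
    have hsum : ∀ s : Finset ℤ, ∀ f : ℤ → VirIrr c h,
        Verma.act (F := F) l (∑ k ∈ s, f k) = ∑ k ∈ s, Verma.act (F := F) l (f k) := by
      classical
      intro s f
      induction s using Finset.induction_on with
      | empty => simp [Verma.act_zero]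
      | insert k s hk ih => rw [Finset.sum_insert hk, Finset.sum_insert hk, Verma.act_add, ih]
    conv_lhs => rw [← (isGrading hgen).sum_eq w]
    rw [Finsupp.sum, hsum, Finset.sum_eq_single n, hact]
    · intro k hk hkn
      have hlt : k < n := lt_of_le_of_ne (Finset.le_max' _ k hk) hkn
      have := act_mem_deg l ((isGrading hgen).mem w k)
      rwa [deg_neg (by omega), Submodule.mem_bot] at this
    · intro hnn
      rw [Finsupp.notMem_support_iff.1 hnn, Verma.act_zero]
  have hmem : Verma.act (F := F) l w ∈ N := by
    clear hactw hact hl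
    induction l with
    | nil => exact hw
    | cons m l ih => exact hN m _ ih
  have hg : gen c h ∈ N := by
    rw [hactw] at hmem
    have := N.smul_mem a⁻¹ hmem
    rwa [smul_smul, inv_mul_cancel₀ ha, one_smul] at this
  rw [eq_top_iff]
  intro x hx
  clear hx
  induction x using induction with
  | hgen => exact hg
  | hL n x hx => exact hN n x hx
  | hadd x y hx hy => exact N.add_mem hx hy
  | hsmul a x hx => exact N.smul_mem a hx

/-- A vector annihilated by all `Lₙ`, `n > 0`, is a multiple of the generator. -/
theorem mem_deg_zero_of_lie_eq_zero (hgen : Verma.gen c h ≠ 0) {w : VirIrr c h}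
    (hw : ∀ n : ℤ, 0 < n → ⁅Vir.L F n, w⁆ = 0) : w ∈ deg c h 0 := by
  have key : ∀ k, k ≠ 0 → split hgen w k = 0 := by
    intro k hk
    by_contra hne
    have hkpos : 0 < k := by
      by_contra hneg
      have := (isGrading hgen).mem w k
      rw [deg_neg (by omega), Submodule.mem_bot] at this
      exact hne this
    have hy : ∀ n : ℤ, 0 < n → op c h n (split hgen w k) = 0 := by
      intro n hn
      have := split_lie hgen n w (k - n)
      rw [hw n hn, sub_add_cancel, map_zero] at this
      exact this.symm
    have h0 := lie_L_zero ((isGrading hgen).mem w k)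
    -- A homogeneous singular vector of degree k > 0 is the image of the generator of V(c,h+k), so
    -- everything reached from it has degree at least k. But a nonzero homogeneous vector leads back
    -- to the generator, in degree zero.
    obtain ⟨φ, hφ1, hφ2⟩ := Verma.exists_lift isVirRep_op _ h0 hy
    have hφact : ∀ l x, φ (Verma.act (F := F) l x) = Verma.act (F := F) l (φ x) := by
      intro l x
      induction l with
      | nil => rfl
      | cons m l ih => rw [Verma.act_cons, Verma.act_cons, hφ2, ih]; rfl
    have hφdeg : ∀ x, split hgen (φ x) 0 = 0 := by
      intro x
      suffices H : ∀ j < k, split hgen (φ x) j = 0 from H 0 hkpos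
      induction x using Verma.induction_neg with
      | hgen =>
        intro j hj
        rw [hφ1, (isGrading hgen).eq_single _ _ ((isGrading hgen).mem w k), Finsupp.single_apply,
          if_neg (by omega)]
      | h0 => simp
      | hL m n x hm _ hx =>
        intro j hj
        rw [hφ2, op_apply, split_lie, hx _ (by omega), lie_zero]
      | hadd x y hx hy => intro j hj; rw [map_add, map_add, Finsupp.add_apply, hx j hj, hy j hj,
          add_zero]
      | hsmul a x hx => intro j hj; rw [map_smul, map_smul, Finsupp.smul_apply, hx j hj, smul_zero]
    obtain ⟨l, a, -, ha, hact⟩ := exists_act_eq_gen hgen ((isGrading hgen).mem w k) hne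
    have := hφdeg (Verma.act (F := F) l (Verma.gen _ _))
    rw [hφact, hφ1, hact, map_smul, (isGrading hgen).eq_single _ _ gen_mem_deg, Finsupp.smul_apply,
      Finsupp.single_eq_same] at this
    rcases smul_eq_zero.1 this with h | h
    · exact ha h
    · exact gen_ne_zero hgen h
  have := (isGrading hgen).sum_eq w
  rw [← this]
  exact Submodule.sum_mem _ fun k _ => by
    by_cases hk : k = 0
    · subst hk; exact (isGrading hgen).mem w 0
    · simp only [key k hk]; exact zero_mem _

end VirIrr
end

noncomputable section

/-! ### Formal fields -/

open Filter Finset in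
/-- A sum over the natural numbers with finitely many nonzero terms. -/
theorem finsum_eq_sum_range {M : Type*} [AddCommMonoid M] {f : ℕ → M} {B : ℕ}
    (h : ∀ i, B ≤ i → f i = 0) : ∑ᶠ i, f i = ∑ i ∈ range B, f i := by
  apply finsum_eq_sum_of_support_subset
  intro i hi
  rw [Function.mem_support] at hi
  simp only [coe_range, Set.mem_Iio]
  by_contra hB
  exact hi (h i (by omega))

section Fields

variable (F M : Type*) [Field F] [AddCommGroup M] [Module F M]

/-- The fields on `M`: sequences of operators `aₙ` such that `aₙ w = 0` for large `n`. -/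
def Fld : Submodule F (ℤ → Module.End F M) where
  carrier := {a | ∀ w, ∃ N : ℤ, ∀ n ≥ N, a n w = 0}
  add_mem' := by
    intro a b ha hb w
    obtain ⟨N, hN⟩ := ha w
    obtain ⟨K, hK⟩ := hb w
    exact ⟨max N K, fun n hn => by
      simp [hN n (le_trans (le_max_left _ _) hn), hK n (le_trans (le_max_right _ _) hn)]⟩
  zero_mem' := fun w => ⟨0, fun n _ => rfl⟩
  smul_mem' := by
    intro r a ha w
    obtain ⟨N, hN⟩ := ha w
    exact ⟨N, fun n hn => by simp [hN n hn]⟩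

variable {F M}

namespace Fld

theorem exists_bound (a : Fld F M) (w : M) : ∃ N : ℤ, ∀ n ≥ N, a.1 n w = 0 := a.2 w

theorem eventually_bound (a : Fld F M) (m : ℤ) (w : M) :
    ∀ᶠ B : ℕ in Filter.atTop, ∀ i : ℕ, B ≤ i → a.1 (m + i) w = 0 := by
  obtain ⟨N, hN⟩ := a.2 w
  filter_upwards [Filter.eventually_ge_atTop (N - m).toNat] with B hB i hi
  exact hN _ (by omega)

/-- The coefficients of `(z₁ - z₂)^l a(z₁) b(z₂) w`, expanded in the domain `|z₁| > |z₂|`. -/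
def P (a b : Fld F M) (l m n : ℤ) (w : M) : M :=
  ∑ᶠ i : ℕ, ((-1) ^ i * Ring.choose l i : ℤ) • a.1 (l + m - i) (b.1 (n + i) w)

theorem P_eq_sum (a b : Fld F M) (l m : ℤ) {n : ℤ} {w : M} {B : ℕ}
    (h : ∀ i : ℕ, B ≤ i → b.1 (n + i) w = 0) : P a b l m n w =
      ∑ i ∈ Finset.range B, ((-1) ^ i * Ring.choose l i : ℤ) • a.1 (l + m - i) (b.1 (n + i) w) :=
  finsum_eq_sum_range fun i hi => by rw [h i hi, map_zero, smul_zero]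

theorem P_eventually (a b : Fld F M) (l m n : ℤ) (w : M) :
    ∀ᶠ B : ℕ in Filter.atTop, P a b l m n w =
      ∑ i ∈ Finset.range B, ((-1) ^ i * Ring.choose l i : ℤ) • a.1 (l + m - i) (b.1 (n + i) w) := by
  filter_upwards [eventually_bound b n w] with B hB
  exact P_eq_sum a b l m hB

theorem P_add (a b : Fld F M) (l m n : ℤ) (v w : M) :
    P a b l m n (v + w) = P a b l m n v + P a b l m n w := by
  obtain ⟨B, h1, h2, h3⟩ := ((P_eventually a b l m n v).and ((P_eventually a b l m n w).and
    (P_eventually a b l m n (v + w)))).exists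
  rw [h1, h2, h3, ← Finset.sum_add_distrib]
  exact Finset.sum_congr rfl fun i _ => by rw [map_add, map_add, smul_add]

theorem P_smul (a b : Fld F M) (l m n : ℤ) (r : F) (w : M) :
    P a b l m n (r • w) = r • P a b l m n w := by
  obtain ⟨B, h2, h3⟩ := ((P_eventually a b l m n w).and (P_eventually a b l m n (r • w))).exists
  rw [h2, h3, Finset.smul_sum]
  exact Finset.sum_congr rfl fun i _ => by rw [map_smul, map_smul, smul_comm]

theorem P_add_left (a a' b : Fld F M) (l m n : ℤ) (w : M) :
    P (a + a') b l m n w = P a b l m n w + P a' b l m n w := by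
  obtain ⟨B, h1, h2, h3⟩ := ((P_eventually a b l m n w).and ((P_eventually a' b l m n w).and
    (P_eventually (a + a') b l m n w))).exists
  rw [h1, h2, h3, ← Finset.sum_add_distrib]
  exact Finset.sum_congr rfl fun i _ => by rw [← smul_add]; rfl

theorem P_smul_left (r : F) (a b : Fld F M) (l m n : ℤ) (w : M) :
    P (r • a) b l m n w = r • P a b l m n w := by
  obtain ⟨B, h2, h3⟩ := ((P_eventually a b l m n w).and (P_eventually (r • a) b l m n w)).exists
  rw [h2, h3, Finset.smul_sum]
  exact Finset.sum_congr rfl fun i _ => by rw [smul_comm]; rfl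

theorem P_add_right (a b b' : Fld F M) (l m n : ℤ) (w : M) :
    P a (b + b') l m n w = P a b l m n w + P a b' l m n w := by
  obtain ⟨B, h1, h2, h3⟩ := ((P_eventually a b l m n w).and ((P_eventually a b' l m n w).and
    (P_eventually a (b + b') l m n w))).exists
  rw [h1, h2, h3, ← Finset.sum_add_distrib]
  exact Finset.sum_congr rfl fun i _ => by rw [← smul_add, ← map_add]; rfl

theorem P_smul_right (r : F) (a b : Fld F M) (l m n : ℤ) (w : M) :
    P a (r • b) l m n w = r • P a b l m n w := by
  obtain ⟨B, h2, h3⟩ := ((P_eventually a b l m n w).and (P_eventually a (r • b) l m n w)).exists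
  rw [h2, h3, Finset.smul_sum]
  refine Finset.sum_congr rfl fun i _ => ?_
  rw [smul_comm r]
  congr 1
  exact map_smul (a.1 _) r _

/-- Pascal's rule, that is, one factor z₁ - z₂ split off from the power. -/
theorem P_succ (a b : Fld F M) (l m n : ℤ) (w : M) :
    P a b (l + 1) m n w = P a b l (m + 1) n w - P a b l m (n + 1) w := by
  obtain ⟨B, h1, h2, h3⟩ := ((eventually_bound b n w).and ((eventually_bound b (n + 1) w).and
    (Filter.eventually_ge_atTop 1))).exists
  have h1' : ∀ i : ℕ, B + 1 ≤ i → b.1 (n + i) w = 0 := fun i hi => h1 i (by omega)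
  rw [P_eq_sum a b _ _ h1', P_eq_sum a b _ _ h1', P_eq_sum a b _ _ h2, Finset.sum_range_succ',
    Finset.sum_range_succ']
  simp only [pow_zero, Ring.choose_zero_right, Nat.cast_zero, sub_zero, mul_one]
  have key : ∀ i : ℕ, Ring.choose (l + 1) (i + 1) = Ring.choose l i + Ring.choose l (i + 1) :=
    fun i => Ring.choose_succ_succ l i
  have e0 : l + 1 + m = l + (m + 1) := by ring
  rw [e0, add_sub_right_comm, ← Finset.sum_sub_distrib]
  congr 1
  refine Finset.sum_congr rfl fun i _ => ?_
  have e1 : l + (m + 1) - ((i + 1 : ℕ) : ℤ) = l + m - i := by push_cast; ring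
  have e2 : n + ((i + 1 : ℕ) : ℤ) = n + 1 + i := by push_cast; ring
  rw [key, e1, e2, ← sub_smul]
  congr 1
  ring

theorem P_zero (a b : Fld F M) (m n : ℤ) (w : M) : P a b 0 m n w = a.1 m (b.1 n w) := by
  rw [P, finsum_eq_sum_range (B := 1)]
  · simp
  · intro i hi
    rw [Ring.choose_zero_pos ℤ (by omega)]
    simp

theorem P_eq_zero (a b : Fld F M) (l m : ℤ) {n : ℤ} {w : M} (h : ∀ k ≥ n, b.1 k w = 0) :
    P a b l m n w = 0 := by
  rw [P_eq_sum (B := 0) a b l m (fun i _ => h _ (by omega))]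
  simp

/-- The coefficients of
`(z₁ - z₂)^l a(z₁) b(z₂) w - (-z₂ + z₁)^l b(z₂) a(z₁) w`. -/
def J (a b : Fld F M) (l m n : ℤ) (w : M) : M :=
  P a b l m n w - (l.negOnePow : ℤ) • P b a l n m w

theorem J_succ (a b : Fld F M) (l m n : ℤ) (w : M) :
    J a b (l + 1) m n w = J a b l (m + 1) n w - J a b l m (n + 1) w := by
  simp only [J, P_succ, Int.negOnePow_succ, Units.val_neg]
  simp only [smul_sub, neg_smul]
  abel

theorem J_zero (a b : Fld F M) (m n : ℤ) (w : M) :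
    J a b 0 m n w = a.1 m (b.1 n w) - b.1 n (a.1 m w) := by
  simp [J, P_zero]

theorem J_swap (a b : Fld F M) (l m n : ℤ) (w : M) :
    J b a l n m w = -((l.negOnePow : ℤ) • J a b l m n w) := by
  have : (l.negOnePow : ℤ) * (l.negOnePow : ℤ) = 1 := by
    rw [← Units.val_mul, Int.units_mul_self, Units.val_one]
  simp only [J, smul_sub, smul_smul, this, one_smul]
  abel

theorem J_add (a b : Fld F M) (l m n : ℤ) (v w : M) :
    J a b l m n (v + w) = J a b l m n v + J a b l m n w := by
  simp only [J, P_add, smul_add]; abel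

theorem J_smul (a b : Fld F M) (l m n : ℤ) (r : F) (w : M) :
    J a b l m n (r • w) = r • J a b l m n w := by
  simp only [J, P_smul, smul_sub]
  rw [smul_comm r]

/-- The `k`-th product of two fields. -/
def nprod (k : ℤ) (a b : Fld F M) : Fld F M :=
  ⟨fun n =>
    { toFun := fun w => J a b k 0 n w
      map_add' := fun v w => J_add a b k 0 n v w
      map_smul' := fun r w => J_smul a b k 0 n r w }, by
    intro w
    obtain ⟨N, hN⟩ := exists_bound b w
    obtain ⟨B, hB⟩ := (eventually_bound a 0 w).exists
    -- In the second half of `J` only finitely many vectors aᵢ w are nonzero, so one index beyond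
    -- which b kills all of them suffices for truncation.
    have : ∃ K : ℤ, ∀ i : ℕ, i < B → ∀ n ≥ K, b.1 (k + n - i) (a.1 (0 + i) w) = 0 := by
      clear hB
      induction B with
      | zero => exact ⟨0, by simp⟩
      | succ B ih =>
        obtain ⟨K, hK⟩ := ih
        obtain ⟨K', hK'⟩ := exists_bound b (a.1 (0 + B) w)
        refine ⟨max K (K' - k + B), fun i hi n hn => ?_⟩
        rcases Nat.lt_succ_iff_lt_or_eq.1 hi with h | rfl
        · exact hK i h n (by omega)
        · exact hK' _ (by omega)
    obtain ⟨K, hK⟩ := this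
    refine ⟨max N K, fun n hn => ?_⟩
    change J a b k 0 n w = 0
    rw [J, P_eq_zero a b _ _ (fun j hj => hN j (by omega)), P_eq_sum b a _ _ hB,
      Finset.sum_eq_zero, smul_zero, sub_zero]
    intro i hi
    rw [hK i (Finset.mem_range.1 hi) n (by omega), smul_zero]⟩

theorem nprod_apply (k : ℤ) (a b : Fld F M) (n : ℤ) (w : M) :
    (nprod k a b).1 n w = J a b k 0 n w := rfl

theorem ext' {a b : Fld F M} (h : ∀ n w, a.1 n w = b.1 n w) : a = b :=
  Subtype.ext (funext fun n => LinearMap.ext (h n))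

theorem nprod_add (k : ℤ) (a b b' : Fld F M) : nprod k a (b + b') = nprod k a b + nprod k a b' := by
  refine ext' fun n w => ?_
  change J a (b + b') k 0 n w = J a b k 0 n w + J a b' k 0 n w
  simp only [J, P_add_left, P_add_right, smul_add]
  abel

theorem nprod_smul (k : ℤ) (r : F) (a b : Fld F M) : nprod k a (r • b) = r • nprod k a b := by
  refine ext' fun n w => ?_
  change J a (r • b) k 0 n w = r • J a b k 0 n w
  simp only [J, P_smul_left, P_smul_right, smul_sub]
  rw [smul_comm r]

theorem add_nprod (k : ℤ) (a a' b : Fld F M) : nprod k (a + a') b = nprod k a b + nprod k a' b := by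
  refine ext' fun n w => ?_
  change J (a + a') b k 0 n w = J a b k 0 n w + J a' b k 0 n w
  simp only [J, P_add_left, P_add_right, smul_add]
  abel

theorem smul_nprod (k : ℤ) (r : F) (a b : Fld F M) : nprod k (r • a) b = r • nprod k a b := by
  refine ext' fun n w => ?_
  change J (r • a) b k 0 n w = r • J a b k 0 n w
  simp only [J, P_smul_left, P_smul_right, smul_sub]
  rw [smul_comm r]

/-! ### Locality -/

/-- The fields `a` and `b` commute after multiplication by `(z₁ - z₂)^N`. -/
def IsLocal (a b : Fld F M) : Prop := ∃ N : ℕ, ∀ m n w, J a b N m n w = 0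

theorem IsLocal.symm {a b : Fld F M} (h : IsLocal a b) : IsLocal b a := by
  obtain ⟨N, hN⟩ := h
  exact ⟨N, fun m n w => by rw [J_swap, hN, smul_zero, neg_zero]⟩

theorem IsLocal.exists_forall_ge {a b : Fld F M} (h : IsLocal a b) :
    ∃ N : ℕ, ∀ l : ℤ, N ≤ l → ∀ m n w, J a b l m n w = 0 := by
  obtain ⟨N, hN⟩ := h
  refine ⟨N, fun l hl => ?_⟩
  induction l, hl using Int.leInduction with
  | base => exact hN
  | succ l _ ih => intro m n w; rw [J_succ, ih, ih, sub_zero]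

theorem IsLocal.nprod_eq_zero {a b : Fld F M} (h : IsLocal a b) :
    ∃ N : ℕ, ∀ l : ℤ, N ≤ l → nprod l a b = 0 := by
  obtain ⟨N, hN⟩ := h.exists_forall_ge
  exact ⟨N, fun l hl => ext' fun n w => hN l hl 0 n w⟩

/-- The Jacobi identity follows from locality. -/
theorem IsLocal.jacobi {a b : Fld F M} (h : IsLocal a b) (l m n : ℤ) (w : M) :
    J a b l m n w = ∑ᶠ i : ℕ, (Ring.choose m i : ℤ) • (nprod (l + i) a b).1 (m + n - i) w := by
  obtain ⟨N, hN⟩ := h.exists_forall_ge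
  have hR : ∀ l : ℤ, ∀ B : ℕ, N ≤ l + B → ∀ m n, ∑ᶠ i : ℕ, (Ring.choose m i : ℤ) •
      (nprod (l + i) a b).1 (m + n - i) w =
      ∑ i ∈ Finset.range B, (Ring.choose m i : ℤ) • (nprod (l + i) a b).1 (m + n - i) w := by
    intro l B hB m n
    apply finsum_eq_sum_range
    intro i hi
    rw [nprod_apply, hN _ (by omega), smul_zero]
  -- Descending induction on l from N, where both sides vanish. At m = 0 the identity is the
  -- definition of the product of fields; other m are reached by the recursion in l.
  have main : ∀ j : ℕ, ∀ l : ℤ, l + j = N → ∀ m n, J a b l m n w =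
      ∑ᶠ i : ℕ, (Ring.choose m i : ℤ) • (nprod (l + i) a b).1 (m + n - i) w := by
    intro j
    induction j with
    | zero =>
      intro l hl m n
      rw [hR l 0 (by omega), hN _ (by omega)]
      simp
    | succ j ih =>
      intro l hl
      set R : ℤ → ℤ → M := fun m n => ∑ᶠ i : ℕ, (Ring.choose m i : ℤ) •
        (nprod (l + i) a b).1 (m + n - i) w with hRdef
      have hstep : ∀ m n, R (m + 1) n - R m (n + 1) = J a b (l + 1) m n w := by
        intro m n
        rw [ih (l + 1) (by omega) m n]
        simp only [hRdef]
        rw [hR l (j + 2) (by omega), hR l (j + 2) (by omega), hR (l + 1) (j + 1) (by omega),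
          Finset.sum_range_succ', Finset.sum_range_succ' _ (j + 1)]
        simp only [Ring.choose_zero_right, Nat.cast_zero, add_zero, sub_zero]
        have e0 : m + 1 + n = m + (n + 1) := by ring
        rw [e0, add_sub_add_right_eq_sub, ← Finset.sum_sub_distrib]
        refine Finset.sum_congr rfl fun i _ => ?_
        have e1 : l + ((i + 1 : ℕ) : ℤ) = l + 1 + i := by push_cast; ring
        have e2 : m + (n + 1) - ((i + 1 : ℕ) : ℤ) = m + n - i := by push_cast; ring
        rw [e1, e2, ← sub_smul, Ring.choose_succ_succ]
        congr 1
        ring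
      have h0 : ∀ n, J a b l 0 n w = R 0 n := by
        intro n
        simp only [hRdef]
        rw [finsum_eq_sum_range (B := 1)]
        · simp [nprod_apply]
        · intro i hi
          rw [Ring.choose_zero_pos ℤ (by omega), zero_smul]
      -- Both sides satisfy the recursion of `J_succ` and already agree for l + 1, so their
      -- difference is unchanged when (m + 1, n) is replaced by (m, n + 1). It therefore vanishes
      -- for all m once it vanishes at m = 0.
      have hE : ∀ m n, J a b l (m + 1) n w - R (m + 1) n = J a b l m (n + 1) w - R m (n + 1) := by
        intro m n
        have h1 := hstep m n
        rw [J_succ] at h1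
        rw [sub_eq_sub_iff_add_eq_add] at h1 ⊢
        rw [add_comm (J a b l (m + 1) n w), add_comm (J a b l m (n + 1) w)]
        rw [add_comm, ← h1]
      intro m
      induction m using Int.induction_on with
      | zero => exact h0
      | succ m ihm =>
        intro n
        have := hE m n
        rw [ihm (n + 1)] at this
        change J a b l (m + 1) n w = R (m + 1) n
        rw [← sub_eq_zero, this]
        exact sub_self _
      | pred m ihm =>
        intro n
        have := hE (-m - 1) (n - 1)
        rw [sub_add_cancel, sub_add_cancel, ihm (n - 1)] at this
        change J a b l (-m - 1) n w = R (-m - 1) n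
        rw [← sub_eq_zero, ← this]
        exact sub_self _
  by_cases hl : (N : ℤ) ≤ l
  · rw [hR l 0 (by omega), hN _ hl]
    simp
  · exact main (N - l).toNat l (by omega) m n

end Fld
end Fields
end

noncomputable section
namespace Fld

variable {F M : Type*} [Field F] [AddCommGroup M] [Module F M]

/-! ### Dong's lemma -/

/-- Shift of the arguments of a function of three integers. -/
def shift (x y z : ℤ) : Module.End ℤ (ℤ → ℤ → ℤ → M) where
  toFun f p q r := f (p + x) (q + y) (r + z)
  map_add' _ _ := rfl
  map_smul' _ _ := rfl

theorem shift_apply (x y z : ℤ) (f : ℤ → ℤ → ℤ → M) (p q r : ℤ) :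
    (shift x y z : Module.End ℤ (ℤ → ℤ → ℤ → M)) f p q r = f (p + x) (q + y) (r + z) := rfl

theorem shift_mul (x y z x' y' z' : ℤ) :
    (shift x y z * shift x' y' z' : Module.End ℤ (ℤ → ℤ → ℤ → M)) =
      shift (x + x') (y + y') (z + z') := by
  ext f p q r
  simp only [Module.End.mul_apply, shift_apply, add_assoc]

theorem shift_commute (x y z x' y' z' : ℤ) :
    Commute (shift x y z : Module.End ℤ (ℤ → ℤ → ℤ → M)) (shift x' y' z') := by
  rw [Commute, SemiconjBy, shift_mul, shift_mul, add_comm x, add_comm y, add_comm z]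

variable (M) in
/-- Multiplication by `z₁ - z₂`. -/
def D₁₂ : Module.End ℤ (ℤ → ℤ → ℤ → M) := shift 1 0 0 - shift 0 1 0

variable (M) in
/-- Multiplication by `z₁ - z₃`. -/
def D₁₃ : Module.End ℤ (ℤ → ℤ → ℤ → M) := shift 1 0 0 - shift 0 0 1

variable (M) in
/-- Multiplication by `z₂ - z₃`. -/
def D₂₃ : Module.End ℤ (ℤ → ℤ → ℤ → M) := shift 0 1 0 - shift 0 0 1

theorem D₁₃_commute_D₂₃ : Commute (D₁₃ M) (D₂₃ M) :=
  ((shift_commute _ _ _ _ _ _).sub_right (shift_commute _ _ _ _ _ _)).sub_left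
    ((shift_commute _ _ _ _ _ _).sub_right (shift_commute _ _ _ _ _ _))

theorem D₁₂_commute_D₂₃ : Commute (D₁₂ M) (D₂₃ M) :=
  ((shift_commute _ _ _ _ _ _).sub_right (shift_commute _ _ _ _ _ _)).sub_left
    ((shift_commute _ _ _ _ _ _).sub_right (shift_commute _ _ _ _ _ _))

theorem D₁₂_commute_D₁₃ : Commute (D₁₂ M) (D₁₃ M) :=
  ((shift_commute _ _ _ _ _ _).sub_right (shift_commute _ _ _ _ _ _)).sub_left
    ((shift_commute _ _ _ _ _ _).sub_right (shift_commute _ _ _ _ _ _))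

theorem shift_commute_D₁₃ (x y z : ℤ) : Commute (shift x y z) (D₁₃ M) :=
  (shift_commute _ _ _ _ _ _).sub_right (shift_commute _ _ _ _ _ _)

theorem shift_commute_D₂₃ (x y z : ℤ) : Commute (shift x y z) (D₂₃ M) :=
  (shift_commute _ _ _ _ _ _).sub_right (shift_commute _ _ _ _ _ _)

theorem commute_apply {R V : Type*} [Semiring R] [AddCommMonoid V] [Module R V]
    {A B : Module.End R V} (h : Commute A B) (v : V) : A (B v) = B (A v) :=
  LinearMap.congr_fun h v

/-- Two commuting operators, one nilpotent on `X` and one nilpotent on `C X`. -/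
theorem sub_pow_apply_eq_zero {V : Type*} [AddCommGroup V] {A B C : Module.End ℤ V} {X : V}
    (hAB : Commute A B) (hBC : Commute B C) (k : ℕ) : ∀ i j : ℕ, i + j = k →
    (A ^ i) (C X) = 0 → (B ^ j) X = 0 → ((A - B) ^ k) (C X) = 0 := by
  have hcomm : ∀ i, Commute (A ^ i) B := fun i => hAB.pow_left i
  intro i j hij hA hB
  have hB' : (B ^ j) (C X) = 0 := by
    rw [commute_apply (hBC.pow_left j), hB, map_zero]
  rw [sub_eq_add_neg, (hAB.neg_right).add_pow' k]
  rw [LinearMap.sum_apply]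
  refine Finset.sum_eq_zero fun p hp => ?_
  rw [Finset.HasAntidiagonal.mem_antidiagonal] at hp
  rw [LinearMap.smul_apply]
  rcases le_or_gt i p.1 with h | h
  · obtain ⟨d, hd⟩ := Nat.exists_eq_add_of_le h
    have hc : Commute (A ^ p.1) ((-B) ^ p.2) := (hAB.neg_right.pow_right p.2).pow_left p.1
    rw [hc.eq, hd, add_comm i d, pow_add A, Module.End.mul_apply, Module.End.mul_apply, hA,
      map_zero, map_zero, smul_zero]
  · obtain ⟨d, hd⟩ := Nat.exists_eq_add_of_le (show j ≤ p.2 by omega)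
    rw [hd, neg_pow, add_comm j d, pow_add B, Module.End.mul_apply, Module.End.mul_apply,
      Module.End.mul_apply, hB']
    simp

/-- A family of functions of which only finitely many do not vanish at each point. -/
def LocallyFinite₃ (f : ℕ → ℤ → ℤ → ℤ → M) : Prop :=
  ∀ p q r, ∃ B : ℕ, ∀ i, B ≤ i → f i p q r = 0

theorem LocallyFinite₃.sub_shift {f : ℕ → ℤ → ℤ → ℤ → M} (hf : LocallyFinite₃ f)
    (x y z x' y' z' : ℤ) :
    LocallyFinite₃ (fun i => (shift x y z - shift x' y' z' : Module.End ℤ _) (f i)) ∧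
    (fun p q r => ∑ᶠ i, ((shift x y z - shift x' y' z' : Module.End ℤ _) (f i)) p q r) =
      (shift x y z - shift x' y' z' : Module.End ℤ _) (fun p q r => ∑ᶠ i, f i p q r) := by
  have key : ∀ p q r, ∃ B : ℕ, (∀ i, B ≤ i → f i (p + x) (q + y) (r + z) = 0) ∧
      (∀ i, B ≤ i → f i (p + x') (q + y') (r + z') = 0) := by
    intro p q r
    obtain ⟨B, hB⟩ := hf (p + x) (q + y) (r + z)
    obtain ⟨B', hB'⟩ := hf (p + x') (q + y') (r + z')
    exact ⟨max B B', fun i hi => hB i (le_trans (le_max_left _ _) hi),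
      fun i hi => hB' i (le_trans (le_max_right _ _) hi)⟩
  have hval : ∀ i p q r, ((shift x y z - shift x' y' z' : Module.End ℤ _) (f i)) p q r =
      f i (p + x) (q + y) (r + z) - f i (p + x') (q + y') (r + z') := fun _ _ _ _ => rfl
  constructor
  · intro p q r
    obtain ⟨B, h1, h2⟩ := key p q r
    exact ⟨B, fun i hi => by simp only [hval]; rw [h1 i hi, h2 i hi, sub_zero]⟩
  · funext p q r
    obtain ⟨B, h1, h2⟩ := key p q r
    change _ = ∑ᶠ i, f i (p + x) (q + y) (r + z) - ∑ᶠ i, f i (p + x') (q + y') (r + z')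
    rw [finsum_eq_sum_range h1, finsum_eq_sum_range h2, ← Finset.sum_sub_distrib]
    simp only [hval]
    exact finsum_eq_sum_range fun i hi => by rw [h1 i hi, h2 i hi, sub_zero]

theorem LocallyFinite₃.pow {f : ℕ → ℤ → ℤ → ℤ → M} (hf : LocallyFinite₃ f)
    (x y z x' y' z' : ℤ) (n : ℕ) :
    LocallyFinite₃ (fun i => ((shift x y z - shift x' y' z' : Module.End ℤ _) ^ n) (f i)) ∧
    (fun p q r => ∑ᶠ i, (((shift x y z - shift x' y' z' : Module.End ℤ _) ^ n) (f i)) p q r) =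
      ((shift x y z - shift x' y' z' : Module.End ℤ _) ^ n) (fun p q r => ∑ᶠ i, f i p q r) := by
  induction n with
  | zero => exact ⟨hf, rfl⟩
  | succ n ih =>
    have := ih.1.sub_shift x y z x' y' z'
    simp only [pow_succ', Module.End.mul_apply]
    exact ⟨this.1, by rw [this.2, ih.2]⟩

/-- A locally finite sum of shifts of a function is killed by everything that kills it. -/
theorem finsum_shift_eq_zero {f : ℕ → ℤ → ℤ → ℤ → M} (hf : LocallyFinite₃ f)
    (Z : ℤ → ℤ → ℤ → M) {N : ℕ} (hZ : (D₁₃ M ^ N) ((D₂₃ M ^ N) Z) = 0)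
    (hshift : ∀ i, ∃ (e x y z : ℤ), f i = e • (shift x y z : Module.End ℤ (ℤ → ℤ → ℤ → M)) Z) :
    (D₁₃ M ^ N) ((D₂₃ M ^ N) (fun p q r => ∑ᶠ i, f i p q r)) = 0 := by
  have h1 := hf.pow 0 1 0 0 0 1 N
  have h2 := h1.1.pow 1 0 0 0 0 1 N
  rw [h1.2] at h2
  refine h2.2.symm.trans ?_
  funext p q r
  refine finsum_eq_zero_of_forall_eq_zero fun i => ?_
  obtain ⟨e, x, y, z, hi⟩ := hshift i
  have : (D₁₃ M ^ N) ((D₂₃ M ^ N) (f i)) = 0 := by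
    rw [hi, map_smul, map_smul, ← commute_apply ((shift_commute_D₂₃ x y z).pow_right N),
      ← commute_apply ((shift_commute_D₁₃ x y z).pow_right N), hZ, map_zero, smul_zero]
  exact congrFun (congrFun (congrFun this p) q) r

/-- By `J_succ` each factor z₂ - z₃ raises the exponent inside `J` by one, while `a` and `u` are
spectators in z₁. -/
theorem D₂₃_pow_J (a : ℤ → M → M) (hadd : ∀ p v w, a p (v - w) = a p v - a p w)
    (b c : Fld F M) (u : ℤ → M) (N : ℕ) :
    (D₂₃ M ^ N) (fun p q r => a p (J b c 0 q r (u p))) = fun p q r => a p (J b c N q r (u p)) := by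
  induction N with
  | zero => rfl
  | succ N ih =>
    rw [pow_succ', Module.End.mul_apply, ih]
    funext p q r
    change a (p + 0) (J b c N (q + 1) (r + 0) (u (p + 0))) -
      a (p + 0) (J b c N (q + 0) (r + 1) (u (p + 0))) = _
    simp only [add_zero]
    rw [← hadd, ← J_succ]
    push_cast
    rfl

theorem D₁₃_pow_J (a : ℤ → M → M) (hadd : ∀ p v w, a p (v - w) = a p v - a p w)
    (b c : Fld F M) (u : ℤ → M) (N : ℕ) :
    (D₁₃ M ^ N) (fun p q r => a q (J b c 0 p r (u q))) = fun p q r => a q (J b c N p r (u q)) := by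
  induction N with
  | zero => rfl
  | succ N ih =>
    rw [pow_succ', Module.End.mul_apply, ih]
    funext p q r
    change a (q + 0) (J b c N (p + 1) (r + 0) (u (q + 0))) -
      a (q + 0) (J b c N (p + 0) (r + 1) (u (q + 0))) = _
    simp only [add_zero]
    rw [← hadd, ← J_succ]
    push_cast
    rfl

/-- The commutator [ab, c] is a[b, c] + [a, c]b. The power of z₂ - z₃ kills the first summand and
the power of z₁ - z₃ the second. -/
theorem D_pow_eq_zero (a b c : Fld F M) {N : ℕ} (hac : ∀ m n w, J a c N m n w = 0)
    (hbc : ∀ m n w, J b c N m n w = 0) (v : M) :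
    (D₁₃ M ^ N) ((D₂₃ M ^ N)
      (fun p q r => a.1 p (b.1 q (c.1 r v)) - c.1 r (a.1 p (b.1 q v)))) = 0 := by
  have e : (fun p q r => a.1 p (b.1 q (c.1 r v)) - c.1 r (a.1 p (b.1 q v))) =
      (fun p q r => a.1 p (J b c 0 q r v)) + (fun p q r => J a c 0 p r (b.1 q v)) := by
    funext p q r
    simp only [Pi.add_apply, J_zero, map_sub]
    abel
  have h1 := D₂₃_pow_J (fun p v => a.1 p v) (fun p v w => map_sub _ _ _) b c (fun _ => v) N
  have h2 := D₁₃_pow_J (fun _ v => v) (fun p v w => rfl) a c (fun q => b.1 q v) N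
  rw [e, map_add, map_add, h1, commute_apply ((D₁₃_commute_D₂₃ (M := M).pow_left N).pow_right N),
    h2]
  simp only [hac, hbc, map_zero]
  have hz : (fun _ _ _ => 0 : ℤ → ℤ → ℤ → M) = 0 := rfl
  rw [hz, map_zero, map_zero, add_zero]

theorem D_pow_eq_zero' (a b c : Fld F M) {N : ℕ} (hac : ∀ m n w, J a c N m n w = 0)
    (hbc : ∀ m n w, J b c N m n w = 0) (v : M) :
    (D₁₃ M ^ N) ((D₂₃ M ^ N)
      (fun p q r => b.1 q (a.1 p (c.1 r v)) - c.1 r (b.1 q (a.1 p v)))) = 0 := by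
  have e : (fun p q r => b.1 q (a.1 p (c.1 r v)) - c.1 r (b.1 q (a.1 p v))) =
      (fun p q r => b.1 q (J a c 0 p r v)) + (fun p q r => J b c 0 q r (a.1 p v)) := by
    funext p q r
    simp only [Pi.add_apply, J_zero, map_sub]
    abel
  have h1 := D₁₃_pow_J (fun p v => b.1 p v) (fun p v w => map_sub _ _ _) a c (fun _ => v) N
  have h2 := D₂₃_pow_J (fun _ v => v) (fun p v w => rfl) b c (fun q => a.1 q v) N
  rw [e, map_add, map_add, h2, commute_apply ((D₁₃_commute_D₂₃ (M := M).pow_left N).pow_right N),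
    h1]
  simp only [hac, hbc, map_zero]
  have hz : (fun _ _ _ => 0 : ℤ → ℤ → ℤ → M) = 0 := rfl
  rw [hz, map_zero, map_zero, add_zero]

/-- Dong's lemma: products of fields that are local with respect to `c` and to each other are
local with respect to `c`. -/
theorem IsLocal.nprod {a b c : Fld F M} (hab : IsLocal a b) (hac : IsLocal a c)
    (hbc : IsLocal b c) (k : ℤ) : IsLocal (Fld.nprod k a b) c := by
  obtain ⟨K, hK⟩ := hab.exists_forall_ge
  obtain ⟨N₁, hN₁⟩ := hac.exists_forall_ge
  obtain ⟨N₂, hN₂⟩ := hbc.exists_forall_ge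
  set N := max N₁ N₂ with hN
  have hac' : ∀ m n w, J a c N m n w = 0 := hN₁ N (by omega)
  have hbc' : ∀ m n w, J b c N m n w = 0 := hN₂ N (by omega)
  -- The number of factors z₁ - z₂ that raise the exponent k to the order of locality of a and b.
  set K' := (K - k).toNat with hK'
  refine ⟨N + K' + N, fun m n v => ?_⟩
  let X : ℤ → ℤ → ℤ → ℤ → M := fun l p q r => J a b l p q (c.1 r v) - c.1 r (J a b l p q v)
  have hX1 : ∀ j : ℕ, (D₁₂ M ^ j) (X k) = X (k + j) := by
    intro j
    induction j with
    | zero => simp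
    | succ j ih =>
      rw [pow_succ', Module.End.mul_apply, ih]
      funext p q r
      change (J a b (k + j) (p + 1) (q + 0) (c.1 (r + 0) v) -
        c.1 (r + 0) (J a b (k + j) (p + 1) (q + 0) v)) -
        (J a b (k + j) (p + 0) (q + 1) (c.1 (r + 0) v) -
        c.1 (r + 0) (J a b (k + j) (p + 0) (q + 1) v)) =
        J a b (k + (j + 1 : ℕ)) p q (c.1 r v) - c.1 r (J a b (k + (j + 1 : ℕ)) p q v)
      have e : k + ((j + 1 : ℕ) : ℤ) = k + j + 1 := by push_cast; ring
      rw [e, J_succ, J_succ, map_sub]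
      simp only [add_zero]
      abel
  have hX2 : (D₁₂ M ^ K') (X k) = 0 := by
    rw [hX1]
    funext p q r
    change J a b _ p q (c.1 r v) - c.1 r (J a b _ p q v) = 0
    rw [hK _ (by omega), hK _ (by omega), map_zero, sub_zero]
  have hP : ∀ (x y : Fld F M) (p q : ℤ), ∀ r, ∃ B : ℕ, ∀ i : ℕ, B ≤ i →
      x.1 p (y.1 (q + i) (c.1 r v)) = 0 ∧ y.1 (q + i) v = 0 := by
    intro x y p q r
    obtain ⟨B, h1, h2⟩ := ((eventually_bound y q (c.1 r v)).and (eventually_bound y q v)).exists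
    exact ⟨B, fun i hi => ⟨by rw [h1 i hi, map_zero], h2 i hi⟩⟩
  -- Expanded in powers, `X k` is a locally finite combination of shifts of the commutators of ab
  -- and ba with c. Multiplications by differences of variables commute with shifts, so what kills
  -- these commutators kills `X k`.
  have hX3 : (D₁₃ M ^ N) ((D₂₃ M ^ N) (X k)) = 0 := by
    have eX : X k = (fun p q r => ∑ᶠ i : ℕ, ((-1) ^ i * Ring.choose k i : ℤ) •
        (a.1 (k + p - i) (b.1 (q + i) (c.1 r v)) - c.1 r (a.1 (k + p - i) (b.1 (q + i) v)))) -
        (k.negOnePow : ℤ) • (fun p q r => ∑ᶠ i : ℕ, ((-1) ^ i * Ring.choose k i : ℤ) •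
        (b.1 (k + q - i) (a.1 (p + i) (c.1 r v)) - c.1 r (b.1 (k + q - i) (a.1 (p + i) v)))) := by
      have aux : ∀ (x y : Fld F M) (p q r : ℤ), P x y k p q (c.1 r v) - c.1 r (P x y k p q v) =
          ∑ᶠ i : ℕ, ((-1) ^ i * Ring.choose k i : ℤ) • (x.1 (k + p - i) (y.1 (q + i) (c.1 r v)) -
            c.1 r (x.1 (k + p - i) (y.1 (q + i) v))) := by
        intro x y p q r
        obtain ⟨B, h1, h2⟩ := ((eventually_bound y q (c.1 r v)).and
          (eventually_bound y q v)).exists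
        rw [P_eq_sum x y k p h1, P_eq_sum x y k p h2, finsum_eq_sum_range (B := B), map_sum,
          ← Finset.sum_sub_distrib]
        · refine Finset.sum_congr rfl fun i _ => ?_
          rw [smul_sub, map_zsmul]
        · intro i hi
          rw [h1 i hi, h2 i hi]
          simp
      funext p q r
      change (P a b k p q (c.1 r v) - (k.negOnePow : ℤ) • P b a k q p (c.1 r v)) -
        c.1 r (P a b k p q v - (k.negOnePow : ℤ) • P b a k q p v) = _
      simp only [Pi.sub_apply, Pi.smul_apply]
      rw [← aux a b p q r, ← aux b a q p r, map_sub, map_zsmul, smul_sub]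
      abel
    rw [eX, map_sub, map_sub, map_smul, map_smul]
    rw [finsum_shift_eq_zero (f := fun (i : ℕ) p q r => ((-1) ^ i * Ring.choose k i : ℤ) •
        (a.1 (k + p - i) (b.1 (q + i) (c.1 r v)) - c.1 r (a.1 (k + p - i) (b.1 (q + i) v))))
        ?_ _ (D_pow_eq_zero a b c hac' hbc' v) ?_,
      finsum_shift_eq_zero (f := fun (i : ℕ) p q r => ((-1) ^ i * Ring.choose k i : ℤ) •
        (b.1 (k + q - i) (a.1 (p + i) (c.1 r v)) - c.1 r (b.1 (k + q - i) (a.1 (p + i) v))))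
        ?_ _ (D_pow_eq_zero' a b c hac' hbc' v) ?_, smul_zero, sub_zero]
    · intro p q r
      obtain ⟨B, h1, h2⟩ := ((eventually_bound a p (c.1 r v)).and (eventually_bound a p v)).exists
      exact ⟨B, fun i hi => by simp only [h1 i hi, h2 i hi, map_zero, sub_zero, smul_zero]⟩
    · intro i
      refine ⟨(-1) ^ i * Ring.choose k i, i, k - i, 0, ?_⟩
      funext p q r
      simp only [Pi.smul_apply, shift_apply, add_zero]
      have e : q + (k - i) = k + q - i := by ring
      rw [e]
    · intro p q r
      obtain ⟨B, h1, h2⟩ := ((eventually_bound b q (c.1 r v)).and (eventually_bound b q v)).exists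
      exact ⟨B, fun i hi => by simp only [h1 i hi, h2 i hi, map_zero, sub_zero, smul_zero]⟩
    · intro i
      refine ⟨(-1) ^ i * Ring.choose k i, k - i, i, 0, ?_⟩
      funext p q r
      simp only [Pi.smul_apply, shift_apply, add_zero]
      have e : p + (k - i) = k + p - i := by ring
      rw [e]
  -- The heart of Dong's lemma: in the binomial expansion of a high power of z₂ - z₃ = (z₁ - z₃) -
  -- (z₁ - z₂), each term contains enough factors of one kind to kill `X k`, the factors z₁ - z₃
  -- with the help of the reserved power of z₂ - z₃.
  have hD : D₂₃ M = D₁₃ M - D₁₂ M := by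
    simp only [D₁₂, D₁₃, D₂₃]; abel
  have hX4 : (D₂₃ M ^ (N + K' + N)) (X k) = 0 := by
    rw [pow_add, Module.End.mul_apply]
    have := sub_pow_apply_eq_zero (A := D₁₃ M) (B := D₁₂ M) (C := D₂₃ M ^ N) (X := X k)
      D₁₂_commute_D₁₃.symm (D₁₂_commute_D₂₃.pow_right N) (N + K') N K' rfl hX3 hX2
    rwa [← hD] at this
  -- The slice p = 0 of `X k` is the commutator of the product of a and b with c, because products
  -- are defined by the coefficient m = 0 of `J`.
  have hX5 : ∀ j : ℕ, ∀ q r, (D₂₃ M ^ j) (X k) 0 q r = J (Fld.nprod k a b) c j q r v := by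
    intro j
    induction j with
    | zero => intro q r; simp [J_zero, X, nprod_apply]
    | succ j ih =>
      intro q r
      rw [pow_succ', Module.End.mul_apply]
      change (D₂₃ M ^ j) (X k) (0 + 0) (q + 1) (r + 0) -
        (D₂₃ M ^ j) (X k) (0 + 0) (q + 0) (r + 1) = _
      simp only [add_zero]
      rw [ih, ih, ← J_succ]
      push_cast
      rfl
  rw [← hX5, hX4]
  rfl

end Fld
end

noncomputable section

/-! ### Binomial identities -/

namespace Ring

theorem choose_mul_choose_sub (k : ℤ) (i t : ℕ) :
    choose k i * choose (k - i) t = choose k t * choose (k - t) i := by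
  have h1 := choose_smul_choose k (Nat.le_add_right i t)
  have h2 := choose_smul_choose k (Nat.le_add_left t i)
  rw [Nat.add_sub_cancel_left] at h1
  rw [Nat.add_sub_cancel] at h2
  rw [← h1, ← h2, Nat.choose_symm_add]

theorem choose_add_mul_choose (k : ℤ) (i t : ℕ) :
    choose k (i + t) * choose ((i + t : ℕ) : ℤ) t = choose k t * choose (k - t) i := by
  have h2 := choose_smul_choose k (Nat.le_add_left t i)
  rw [Nat.add_sub_cancel] at h2
  rw [← h2, choose_natCast, nsmul_eq_mul, mul_comm]

theorem add_choose_eq_sum_range (r s : ℤ) (n : ℕ) :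
    choose (r + s) n = ∑ i ∈ Finset.range (n + 1), choose r i * choose s (n - i) := by
  rw [add_choose_eq n (Commute.all r s),
    Finset.Nat.sum_antidiagonal_eq_sum_range_succ (fun i j => choose r i * choose s j)]

theorem choose_eq_neg_one_pow_mul (n : ℤ) (j : ℕ) :
    choose n j = (-1) ^ j * choose ((j : ℤ) - n - 1) j := by
  have := choose_neg (-n) j
  rw [neg_neg] at this
  rw [this, Int.negOnePow_def, zpow_natCast, Units.smul_def, smul_eq_mul]
  have e : -n + (j : ℤ) - 1 = (j : ℤ) - n - 1 := by ring
  rw [e]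
  simp

/-- Negating the upper index of the second factor absorbs the signs and leaves a Vandermonde
convolution. -/
theorem sum_choose_mul_choose_add_sub (r n : ℤ) (j : ℕ) :
    ∑ i ∈ Finset.range (j + 1), (-1) ^ i * choose r i * choose (r + n - i) (j - i) =
      choose n j := by
  have h : ∀ i ∈ Finset.range (j + 1), (-1) ^ i * choose r i * choose (r + n - i) (j - i) =
      (-1) ^ j * (choose r i * choose ((j : ℤ) - r - n - 1) (j - i)) := by
    intro i hi
    rw [Finset.mem_range] at hi
    obtain ⟨d, rfl⟩ : ∃ d, j = i + d := ⟨j - i, by omega⟩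
    rw [Nat.add_sub_cancel_left, choose_eq_neg_one_pow_mul (r + n - i) d, pow_add]
    have e : (d : ℤ) - (r + n - i) - 1 = ((i + d : ℕ) : ℤ) - r - n - 1 := by push_cast; ring
    rw [e]
    ring
  rw [Finset.sum_congr rfl h, ← Finset.mul_sum, ← add_choose_eq_sum_range,
    choose_eq_neg_one_pow_mul n j]
  congr 2
  ring

end Ring

section Fields

variable {F M : Type*} [Field F] [AddCommGroup M] [Module F M]

namespace Fld

/-! ### The commutator formula for products of fields -/

/-- Serves to truncate all iterated expansions at one common bound, so that identities between
formally infinite sums become identities between finite sums over the same square. -/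
theorem eventually_sum_range_eq {g : ℕ → M} {f : ℕ → ℕ → M} (I : ℕ)
    (h1 : ∀ i, I ≤ i → ∀ j, f i j = 0)
    (h2 : ∀ i, ∀ᶠ J : ℕ in Filter.atTop, g i = ∑ j ∈ Finset.range J, f i j) :
    ∀ᶠ B : ℕ in Filter.atTop, ∑ i ∈ Finset.range B, g i =
      ∑ i ∈ Finset.range B, ∑ j ∈ Finset.range B, f i j := by
  have h3 : ∀ᶠ J : ℕ in Filter.atTop, ∀ i ∈ Finset.range I, g i = ∑ j ∈ Finset.range J, f i j :=
    (Filter.eventually_all_finset _).2 fun i _ => h2 i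
  filter_upwards [h3] with B hB
  refine Finset.sum_congr rfl fun i _ => ?_
  by_cases hi : i < I
  · exact hB i (Finset.mem_range.2 hi)
  · obtain ⟨J, hJ⟩ := (h2 i).exists
    rw [hJ, Finset.sum_eq_zero fun j _ => h1 i (not_lt.1 hi) j,
      Finset.sum_eq_zero fun j _ => h1 i (not_lt.1 hi) j]

/-- The coefficient `(-1)^i (k choose i)`. -/
def sgnChoose (k : ℤ) (i : ℕ) : ℤ := (-1) ^ i * Ring.choose k i

theorem P_eventually' (a b : Fld F M) (l m n : ℤ) (w : M) :
    ∀ᶠ B : ℕ in Filter.atTop, P a b l m n w =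
      ∑ i ∈ Finset.range B, sgnChoose l i • a.1 (l + m - i) (b.1 (n + i) w) :=
  P_eventually a b l m n w

theorem eventually_P_P (a b c : Fld F M) (k l n : ℤ) (w : M) : ∀ᶠ B : ℕ in Filter.atTop,
    ∑ i ∈ Finset.range B, sgnChoose k i • a.1 (k - i) (P b c l 0 (n + i) w) =
      ∑ i ∈ Finset.range B, ∑ j ∈ Finset.range B,
        (sgnChoose k i * sgnChoose l j) • a.1 (k - i) (b.1 (l - j) (c.1 (n + i + j) w)) := by
  obtain ⟨N, hN⟩ := exists_bound c w
  refine eventually_sum_range_eq (N - n).toNat (fun i hi j => ?_) (fun i => ?_)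
  · rw [hN _ (by omega), map_zero, map_zero, smul_zero]
  · filter_upwards [P_eventually' b c l 0 (n + i) w] with J hJ
    rw [hJ, map_sum, Finset.smul_sum]
    refine Finset.sum_congr rfl fun j _ => ?_
    rw [map_zsmul, smul_smul, add_zero]

theorem eventually_P_P_swap (a b c : Fld F M) (k l n : ℤ) (w : M) : ∀ᶠ B : ℕ in Filter.atTop,
    ∑ i ∈ Finset.range B, sgnChoose k i • a.1 (k - i) (P c b l (n + i) 0 w) =
      ∑ i ∈ Finset.range B, ∑ j ∈ Finset.range B,
        (sgnChoose k i * sgnChoose l j) • a.1 (k - i) (c.1 (l + n + i - j) (b.1 j w)) := by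
  obtain ⟨J₀, hJ₀⟩ := (eventually_bound b 0 w).exists
  simp only [zero_add] at hJ₀
  have h : ∀ᶠ I : ℕ in Filter.atTop, ∀ j ∈ Finset.range J₀, ∀ i, I ≤ i →
      c.1 (l + n + i - j) (b.1 j w) = 0 := by
    refine (Filter.eventually_all_finset _).2 fun j _ => ?_
    filter_upwards [eventually_bound c (l + n - j) (b.1 j w)] with I hI i hi
    have e : l + n + i - j = l + n - j + i := by ring
    rw [e, hI i hi]
  obtain ⟨I, hI⟩ := h.exists
  refine eventually_sum_range_eq I (fun i hi j => ?_) (fun i => ?_)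
  · by_cases hj : j < J₀
    · rw [hI j (Finset.mem_range.2 hj) i hi, map_zero, smul_zero]
    · rw [hJ₀ j (not_lt.1 hj), map_zero, map_zero, smul_zero]
  · filter_upwards [P_eventually' c b l (n + i) 0 w] with J hJ
    rw [hJ, map_sum, Finset.smul_sum]
    refine Finset.sum_congr rfl fun j _ => ?_
    rw [map_zsmul, smul_smul, zero_add, add_assoc l]

theorem eventually_P_right (a b c : Fld F M) (k l n : ℤ) (w : M) : ∀ᶠ B : ℕ in Filter.atTop,
    ∑ i ∈ Finset.range B, sgnChoose k i • P b c l 0 (k + n - i) (a.1 i w) =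
      ∑ i ∈ Finset.range B, ∑ j ∈ Finset.range B,
        (sgnChoose k i * sgnChoose l j) • b.1 (l - j) (c.1 (k + n + j - i) (a.1 i w)) := by
  obtain ⟨I, hI⟩ := (eventually_bound a 0 w).exists
  simp only [zero_add] at hI
  refine eventually_sum_range_eq I (fun i hi j => ?_) (fun i => ?_)
  · rw [hI i hi, map_zero, map_zero, smul_zero]
  · filter_upwards [P_eventually' b c l 0 (k + n - i) (a.1 i w)] with J hJ
    rw [hJ, Finset.smul_sum]
    refine Finset.sum_congr rfl fun j _ => ?_
    have e : k + n - i + j = k + n + j - i := by ring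
    rw [smul_smul, add_zero, e]

theorem eventually_P_right_swap (a b c : Fld F M) (k l n : ℤ) (w : M) : ∀ᶠ B : ℕ in Filter.atTop,
    ∑ i ∈ Finset.range B, sgnChoose k i • P c b l (k + n - i) 0 (a.1 i w) =
      ∑ i ∈ Finset.range B, ∑ j ∈ Finset.range B,
        (sgnChoose k i * sgnChoose l j) • c.1 (k + l + n - i - j) (b.1 j (a.1 i w)) := by
  obtain ⟨I, hI⟩ := (eventually_bound a 0 w).exists
  simp only [zero_add] at hI
  refine eventually_sum_range_eq I (fun i hi j => ?_) (fun i => ?_)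
  · rw [hI i hi, map_zero, map_zero, smul_zero]
  · filter_upwards [P_eventually' c b l (k + n - i) 0 (a.1 i w)] with J hJ
    rw [hJ, Finset.smul_sum]
    refine Finset.sum_congr rfl fun j _ => ?_
    have e : l + (k + n - i) - j = k + l + n - i - j := by ring
    rw [smul_smul, zero_add, e]

theorem sum_sum_smul_sub_add (s : Finset ℕ) (e : ℕ → ℕ → ℤ) (x y z u : ℕ → ℕ → M) (p q r : ℤ) :
    ∑ i ∈ s, ∑ j ∈ s, e i j • (x i j - p • y i j - q • z i j + r • u i j) =
      ∑ i ∈ s, ∑ j ∈ s, e i j • x i j - p • ∑ i ∈ s, ∑ j ∈ s, e i j • y i j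
        - q • ∑ i ∈ s, ∑ j ∈ s, e i j • z i j + r • ∑ i ∈ s, ∑ j ∈ s, e i j • u i j := by
  simp only [Finset.smul_sum, ← Finset.sum_sub_distrib, ← Finset.sum_add_distrib]
  refine Finset.sum_congr rfl fun i _ => Finset.sum_congr rfl fun j _ => ?_
  module

theorem sum_smul_sub_smul (s : Finset ℕ) (e : ℕ → ℤ) (x y : ℕ → M) (p : ℤ) :
    ∑ i ∈ s, e i • (x i - p • y i) = ∑ i ∈ s, e i • x i - p • ∑ i ∈ s, e i • y i := by
  simp only [Finset.smul_sum, ← Finset.sum_sub_distrib]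
  refine Finset.sum_congr rfl fun i _ => ?_
  module

theorem eventually_nprod_nprod (a b c : Fld F M) (k l n : ℤ) (w : M) :
    ∀ᶠ B : ℕ in Filter.atTop, (nprod k a (nprod l b c)).1 n w =
      ∑ i ∈ Finset.range B, ∑ j ∈ Finset.range B, (sgnChoose k i * sgnChoose l j) •
        (a.1 (k - i) (b.1 (l - j) (c.1 (n + i + j) w))
          - (l.negOnePow : ℤ) • a.1 (k - i) (c.1 (l + n + i - j) (b.1 j w))
          - (k.negOnePow : ℤ) • b.1 (l - j) (c.1 (k + n + j - i) (a.1 i w))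
          + ((k + l).negOnePow : ℤ) • c.1 (k + l + n - i - j) (b.1 j (a.1 i w))) := by
  filter_upwards [P_eventually' a (nprod l b c) k 0 n w, P_eventually' (nprod l b c) a k n 0 w,
    eventually_P_P a b c k l n w, eventually_P_P_swap a b c k l n w,
    eventually_P_right a b c k l n w, eventually_P_right_swap a b c k l n w]
    with B h1 h2 h3 h4 h5 h6
  rw [nprod_apply, J, h1, h2]
  simp only [nprod_apply, J, add_zero, zero_add, map_sub, map_zsmul]
  rw [sum_sum_smul_sub_add, sum_smul_sub_smul, sum_smul_sub_smul, h3, h4, h5, h6,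
    Int.negOnePow_add, Units.val_mul]
  module

/-- Of the four orders of a, b, c in a double product, those with c between a and b cancel against
the reversed double product; only commutators of a and b remain. -/
theorem eventually_nprod_comm (a b c : Fld F M) (k l n : ℤ) (w : M) :
    ∀ᶠ B : ℕ in Filter.atTop, (nprod k a (nprod l b c)).1 n w - (nprod l b (nprod k a c)).1 n w =
      ∑ i ∈ Finset.range B, ∑ j ∈ Finset.range B, (sgnChoose k i * sgnChoose l j) •
        ((a.1 (k - i) (b.1 (l - j) (c.1 (n + i + j) w))
            - b.1 (l - j) (a.1 (k - i) (c.1 (n + i + j) w)))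
          - ((k + l).negOnePow : ℤ) • c.1 (k + l + n - i - j)
            (a.1 i (b.1 j w) - b.1 j (a.1 i w))) := by
  filter_upwards [eventually_nprod_nprod a b c k l n w, eventually_nprod_nprod b a c l k n w]
    with B h1 h2
  rw [h1, h2, Finset.sum_comm (s := Finset.range B) (t := Finset.range B) (γ := ℕ)
    (f := fun i j => (sgnChoose l i * sgnChoose k j) • _), ← Finset.sum_sub_distrib]
  refine Finset.sum_congr rfl fun i _ => ?_
  rw [← Finset.sum_sub_distrib]
  refine Finset.sum_congr rfl fun j _ => ?_
  have e1 : n + j + i = n + i + j := by ring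
  have e2 : l + k + n - j - i = k + l + n - i - j := by ring
  rw [mul_comm (sgnChoose l j), ← smul_sub, e1, e2, add_comm l k, map_sub]
  congr 1
  rw [smul_sub]
  abel

theorem sum_range_square_eq (B : ℕ) {f : ℕ → ℕ → M} (h : ∀ i j, B ≤ i + j → f i j = 0) :
    ∑ i ∈ Finset.range B, ∑ j ∈ Finset.range B, f i j =
      ∑ s ∈ Finset.range B, ∑ i ∈ Finset.range (s + 1), f i (s - i) := by
  rw [Finset.sum_range_diag_flip]
  refine Finset.sum_congr rfl fun i hi => ?_
  symm
  apply Finset.sum_subset (Finset.range_subset_range.2 (Nat.sub_le _ _))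
  intro j _ hj
  rw [Finset.mem_range] at hi hj
  exact h i j (by omega)

/-- If the commutators of the modes of `a` and `b` are given by the fields `dₜ`, then so are the
commutators of the operators of multiplication by `a` and `b` on all fields. -/
theorem nprod_comm {a b : Fld F M} {N : ℕ} {d : ℕ → Fld F M}
    (hab : ∀ p q w, a.1 p (b.1 q w) - b.1 q (a.1 p w) =
      ∑ t ∈ Finset.range N, Ring.choose p t • (d t).1 (p + q - t) w)
    (c : Fld F M) (k l : ℤ) :
    nprod k a (nprod l b c) - nprod l b (nprod k a c) =
      ∑ t ∈ Finset.range N, Ring.choose k t • nprod (k + l - t) (d t) c := by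
  refine ext' fun n w => ?_
  have hsum : ∀ (g : ℕ → Fld F M), (∑ t ∈ Finset.range N, g t).1 n w =
      ∑ t ∈ Finset.range N, (g t).1 n w := by
    intro g
    simp
  change (nprod k a (nprod l b c)).1 n w - (nprod l b (nprod k a c)).1 n w = _
  rw [hsum]
  change _ = ∑ t ∈ Finset.range N, Ring.choose k t • (nprod (k + l - t) (d t) c).1 n w
  obtain ⟨Nc, hNc⟩ := exists_bound c w
  have hd : ∀ᶠ D : ℕ in Filter.atTop, ∀ t ∈ Finset.range N, ∀ i, D ≤ i → (d t).1 i w = 0 := by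
    refine (Filter.eventually_all_finset _).2 fun t _ => ?_
    filter_upwards [eventually_bound (d t) 0 w] with D hD i hi
    simpa using hD i hi
  obtain ⟨D, hD⟩ := hd.exists
  have hP1 : ∀ᶠ B : ℕ in Filter.atTop, ∀ t ∈ Finset.range N,
      P (d t) c (k + l - t) 0 n w = ∑ i ∈ Finset.range B,
        sgnChoose (k + l - t) i • (d t).1 (k + l - t - i) (c.1 (n + i) w) := by
    refine (Filter.eventually_all_finset _).2 fun t _ => ?_
    filter_upwards [P_eventually' (d t) c (k + l - t) 0 n w] with B hB
    rw [hB, add_zero]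
  obtain ⟨B, h0, h1, hB1, hB2⟩ := ((eventually_nprod_comm a b c k l n w).and (hP1.and
    ((Filter.eventually_ge_atTop (Nc - n).toNat).and
      (Filter.eventually_ge_atTop (D + N))))).exists
  have hP2 : ∀ t ∈ Finset.range N, P c (d t) (k + l - t) n 0 w = ∑ i ∈ Finset.range (B - t),
      sgnChoose (k + l - t) i • c.1 (k + l - t + n - i) ((d t).1 i w) := by
    intro t ht
    rw [P_eq_sum (B := B - t) c (d t) (k + l - t) n]
    · simp only [zero_add, sgnChoose]
    · intro i hi
      rw [Finset.mem_range] at ht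
      rw [zero_add, hD t (Finset.mem_range.2 ht) _ (by omega)]
  rw [h0]
  simp only [smul_sub _ (_ - _) (_ • _), smul_sub _ (P _ _ _ _ _ _) _, Finset.sum_sub_distrib,
    nprod_apply, J]
  congr 1
  -- Terms where c acts first. On a diagonal i + j = s the modes of dₜ and c are constant, and the
  -- coefficients are summed by Vandermonde.
  · rw [sum_range_square_eq]
    · have : ∀ t ∈ Finset.range N, Ring.choose k t • P (d t) c (k + l - t) 0 n w =
          ∑ i ∈ Finset.range B, Ring.choose k t • sgnChoose (k + l - t) i •
            (d t).1 (k + l - t - i) (c.1 (n + i) w) := by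
        intro t ht
        rw [h1 t ht, Finset.smul_sum]
      rw [Finset.sum_congr rfl this, Finset.sum_comm]
      refine Finset.sum_congr rfl fun s _ => ?_
      have e : ∀ i ∈ Finset.range (s + 1), (sgnChoose k i * sgnChoose l (s - i)) •
          (a.1 (k - i) (b.1 (l - (s - i : ℕ)) (c.1 (n + i + (s - i : ℕ)) w)) -
            b.1 (l - (s - i : ℕ)) (a.1 (k - i) (c.1 (n + i + (s - i : ℕ)) w))) =
          ∑ t ∈ Finset.range N, ((-1) ^ s * (Ring.choose k t *
            (Ring.choose (k - t) i * Ring.choose l (s - i)))) •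
            (d t).1 (k + l - t - s) (c.1 (n + s) w) := by
        intro i hi
        rw [Finset.mem_range] at hi
        have e1 : n + i + ((s - i : ℕ) : ℤ) = n + s := by omega
        have e2 : (-1 : ℤ) ^ s = (-1) ^ i * (-1) ^ (s - i) := by
          rw [← pow_add]; congr 1; omega
        rw [hab, e1, Finset.smul_sum]
        refine Finset.sum_congr rfl fun t _ => ?_
        have e3 : k - i + (l - ((s - i : ℕ) : ℤ)) - t = k + l - t - s := by omega
        rw [e3, smul_smul]
        congr 1
        simp only [sgnChoose, e2]
        linear_combination ((-1) ^ i * (-1) ^ (s - i) * Ring.choose l (s - i)) *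
          Ring.choose_mul_choose_sub k i t
      rw [Finset.sum_congr rfl e, Finset.sum_comm]
      refine Finset.sum_congr rfl fun t _ => ?_
      rw [← Finset.sum_smul, smul_smul, ← Finset.mul_sum, ← Finset.mul_sum,
        ← Ring.add_choose_eq_sum_range]
      congr 1
      rw [sgnChoose]
      have e4 : k - t + l = k + l - t := by ring
      rw [e4]
      ring
    · intro i j hij
      rw [hNc _ (by omega)]
      simp
  -- Terms where c acts last. Here the commutator of aᵢ and bⱼ brings in the binomial coefficient of
  -- i itself, so the t-th summand is shifted by t along the diagonals.
  · have : ∀ t ∈ Finset.range N, Ring.choose k t •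
        ((k + l - t).negOnePow : ℤ) • P c (d t) (k + l - t) n 0 w =
        ((k + l).negOnePow : ℤ) • ∑ i ∈ Finset.range (B - t), ((-1) ^ (i + t) *
          (Ring.choose k t * Ring.choose (k + l - t) i)) •
            c.1 (k + l - t + n - i) ((d t).1 i w) := by
      intro t ht
      have e : ((k + l - t).negOnePow : ℤ) = ((k + l).negOnePow : ℤ) * (-1) ^ t := by
        rw [Int.negOnePow_sub, Units.val_mul]
        congr 1
      rw [hP2 t ht, Finset.smul_sum, Finset.smul_sum, Finset.smul_sum]
      refine Finset.sum_congr rfl fun i _ => ?_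
      rw [smul_smul, smul_smul, smul_smul, e, sgnChoose]
      congr 1
      ring
    rw [Finset.sum_congr rfl this, ← Finset.smul_sum]
    simp only [smul_comm _ ((k + l).negOnePow : ℤ), ← Finset.smul_sum]
    congr 1
    have hcomm : ∀ i j : ℕ, B ≤ i + j → a.1 i (b.1 j w) - b.1 j (a.1 i w) = 0 := by
      intro i j hij
      rw [hab]
      refine Finset.sum_eq_zero fun t ht => ?_
      rw [Finset.mem_range] at ht
      obtain ⟨e, he⟩ : ∃ e : ℕ, (i : ℤ) + j - t = e := ⟨i + j - t, by omega⟩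
      rw [he, hD t (Finset.mem_range.2 ht) _ (by omega), smul_zero]
    rw [sum_range_square_eq]
    swap
    · intro i j hij
      rw [hcomm i j hij]
      simp
    have e : ∀ s ∈ Finset.range B, ∀ i ∈ Finset.range (s + 1),
        (sgnChoose k i * sgnChoose l (s - i)) • c.1 (k + l + n - i - (s - i : ℕ))
          (a.1 i (b.1 (s - i : ℕ) w) - b.1 (s - i : ℕ) (a.1 i w)) =
        ∑ t ∈ Finset.range N, ((-1) ^ s * (Ring.choose k i * Ring.choose (i : ℤ) t *
            Ring.choose l (s - i))) • c.1 (k + l + n - s) ((d t).1 (s - t) w) := by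
      intro s _ i hi
      rw [Finset.mem_range] at hi
      have e1 : k + l + n - i - ((s - i : ℕ) : ℤ) = k + l + n - s := by omega
      have e2 : (-1 : ℤ) ^ s = (-1) ^ i * (-1) ^ (s - i) := by
        rw [← pow_add]; congr 1; omega
      rw [hab, e1, map_sum, Finset.smul_sum]
      refine Finset.sum_congr rfl fun t _ => ?_
      have e3 : (i : ℤ) + ((s - i : ℕ) : ℤ) - t = s - t := by omega
      rw [e3, map_zsmul, smul_smul]
      congr 1
      simp only [sgnChoose, e2]
      ring
    rw [Finset.sum_congr rfl fun s hs => Finset.sum_congr rfl (e s hs)]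
    have e' : ∀ s ∈ Finset.range B, ∑ i ∈ Finset.range (s + 1), ∑ t ∈ Finset.range N,
        ((-1) ^ s * (Ring.choose k i * Ring.choose (i : ℤ) t *
            Ring.choose l (s - i))) • c.1 (k + l + n - s) ((d t).1 (s - t) w) =
        ∑ t ∈ Finset.range N, (∑ i ∈ Finset.range (s + 1), ((-1) ^ s * (Ring.choose k i *
          Ring.choose (i : ℤ) t * Ring.choose l (s - i)))) •
          c.1 (k + l + n - s) ((d t).1 (s - t) w) := by
      intro s _
      rw [Finset.sum_comm]
      simp only [Finset.sum_smul]
    rw [Finset.sum_congr rfl e', Finset.sum_comm]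
    refine Finset.sum_congr rfl fun t ht => ?_
    rw [Finset.mem_range] at ht
    have hBt : B = t + (B - t) := by omega
    have hz : ∀ i : ℕ, i < t → Ring.choose (i : ℤ) t = 0 := by
      intro i hi
      rw [Ring.choose_natCast, Nat.choose_eq_zero_of_lt hi]
      rfl
    -- The binomial coefficients of i < t over t vanish, so the first t diagonals, and then the
    -- first t terms of each later diagonal, drop out. This is the reason for the bound `B - t` on
    -- the other side.
    conv_lhs => rw [hBt]
    rw [Finset.sum_range_add, Finset.sum_eq_zero, zero_add]
    · refine Finset.sum_congr rfl fun s _ => ?_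
      rw [Finset.sum_subset (Finset.range_subset_range.2 (show t + s + 1 ≤ t + (s + 1) by omega))
        (fun x h1 h2 => absurd h1 (by simp at h2 ⊢; omega)), Finset.sum_range_add,
        Finset.sum_eq_zero, zero_add]
      · have e5 : k + l + n - ((t + s : ℕ) : ℤ) = k + l - t + n - s := by push_cast; ring
        have e6 : ((t + s : ℕ) : ℤ) - t = s := by push_cast; ring
        rw [e5, e6]
        congr 1
        have e7 : k + l - t = k - t + l := by ring
        rw [e7, Ring.add_choose_eq_sum_range, Finset.mul_sum, Finset.mul_sum]
        refine Finset.sum_congr rfl fun i hi => ?_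
        rw [Finset.mem_range] at hi
        have e8 : t + s - (t + i) = s - i := by omega
        rw [e8, add_comm t i, Ring.choose_add_mul_choose, add_comm t s]
        ring
      · intro i hi
        rw [Finset.mem_range] at hi
        rw [hz i hi]
        ring
    · intro s hs
      rw [Finset.mem_range] at hs
      rw [Finset.sum_eq_zero, zero_smul]
      intro i hi
      rw [Finset.mem_range] at hi
      rw [hz i (by omega)]
      ring

/-! ### The identity field and divided derivatives -/

variable (F M) in
/-- The identity field. -/
def one : Fld F M :=
  ⟨fun n => if n = -1 then LinearMap.id else 0, fun w => ⟨0, fun n hn => by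
    change (if n = -1 then LinearMap.id else 0 : Module.End F M) w = 0
    rw [if_neg (by omega)]; rfl⟩⟩

theorem one_apply (n : ℤ) (w : M) : (one F M).1 n w = if n = -1 then w else 0 := by
  change (if n = -1 then LinearMap.id else 0 : Module.End F M) w = _
  split_ifs <;> rfl

/-- The divided power `∂^j / j!` of the derivative of a field. -/
def hderiv (j : ℕ) (a : Fld F M) : Fld F M :=
  ⟨fun n => sgnChoose n j • a.1 (n - j), fun w => by
    obtain ⟨N, hN⟩ := a.2 w
    exact ⟨N + j, fun n hn => by rw [LinearMap.smul_apply, hN _ (by omega), smul_zero]⟩⟩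

theorem hderiv_apply (j : ℕ) (a : Fld F M) (n : ℤ) (w : M) :
    (hderiv j a).1 n w = sgnChoose n j • a.1 (n - j) w := rfl

theorem hderiv_zero (a : Fld F M) : hderiv 0 a = a :=
  ext' fun n w => by simp [hderiv_apply, sgnChoose]

theorem isLocal_one (a : Fld F M) : IsLocal a (one F M) :=
  ⟨0, fun m n w => by
    rw [Nat.cast_zero, J_zero, one_apply, one_apply]
    split_ifs <;> simp⟩

theorem nprod_one_of_nonneg (a : Fld F M) {k : ℤ} (hk : 0 ≤ k) : nprod k a (one F M) = 0 := by
  have h : ∀ l : ℤ, 0 ≤ l → ∀ m n w, J a (one F M) l m n w = 0 := by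
    intro l hl
    induction l, hl using Int.leInduction with
    | base =>
      intro m n w
      rw [J_zero, one_apply, one_apply]
      split_ifs <;> simp
    | succ l _ ih => intro m n w; rw [J_succ, ih, ih, sub_zero]
  exact ext' fun n w => h k hk 0 n w

theorem P_one_right (a : Fld F M) (l m n : ℤ) (w : M) : P a (one F M) l m n w =
    if n < 0 then sgnChoose l (-1 - n).toNat • a.1 (l + m + n + 1) w else 0 := by
  split_ifs with h
  · rw [P, finsum_eq_single _ (-1 - n).toNat]
    · have e : n + ((-1 - n).toNat : ℤ) = -1 := by omega
      have e' : l + m - ((-1 - n).toNat : ℤ) = l + m + n + 1 := by omega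
      rw [e, e', one_apply, if_pos rfl, sgnChoose]
    · intro i hi
      rw [one_apply, if_neg (by omega), map_zero, smul_zero]
  · exact P_eq_zero _ _ _ _ fun k hk => by rw [one_apply, if_neg (by omega)]

theorem P_one_left (a : Fld F M) (l m n : ℤ) (w : M) : P (one F M) a l m n w =
    if 0 ≤ l + m + 1 then sgnChoose l (l + m + 1).toNat • a.1 (n + (l + m + 1)) w else 0 := by
  split_ifs with h
  · rw [P, finsum_eq_single _ (l + m + 1).toNat]
    · have e : l + m - ((l + m + 1).toNat : ℤ) = -1 := by omega
      rw [e, one_apply, if_pos rfl, sgnChoose, Int.toNat_of_nonneg h]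
    · intro i hi
      rw [one_apply, if_neg (by omega), smul_zero]
  · refine finsum_eq_zero_of_forall_eq_zero fun i => ?_
    rw [one_apply, if_neg (by omega), smul_zero]

theorem sgnChoose_neg_sub_one (j : ℕ) (i : ℕ) :
    sgnChoose (-j - 1) i = Nat.choose (i + j) i := by
  rw [sgnChoose, Ring.choose_eq_neg_one_pow_mul, ← mul_assoc, ← pow_add, Even.neg_one_pow ⟨i, rfl⟩,
    one_mul]
  have e : (i : ℤ) - (-j - 1) - 1 = ((i + j : ℕ) : ℤ) := by push_cast; ring
  rw [e, Ring.choose_natCast]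

/-- Creation at the level of fields. For n < 0 only the first half of `J` contributes, for n ≥ 0
only the second, and symmetry of binomial coefficients gives the divided derivative in both ranges.
-/
theorem nprod_one_neg (a : Fld F M) (j : ℕ) : nprod (-j - 1) a (one F M) = hderiv j a := by
  refine ext' fun n w => ?_
  rw [nprod_apply, J, P_one_right, P_one_left, hderiv_apply]
  rcases lt_or_ge n 0 with h | h
  · rw [if_pos h, if_neg (by omega), smul_zero, sub_zero, sgnChoose_neg_sub_one]
    have e : (-j - 1 + 0 + n + 1 : ℤ) = n - j := by ring
    obtain ⟨i, hi⟩ : ∃ i : ℕ, n = -i - 1 := ⟨(-1 - n).toNat, by omega⟩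
    have e' : (-1 - n).toNat = i := by omega
    rw [e, e', hi, sgnChoose_neg_sub_one, Nat.choose_symm_add, add_comm i j]
  · rw [if_neg (by omega), zero_sub]
    obtain ⟨i, hi⟩ : ∃ i : ℕ, n = i := ⟨n.toNat, by omega⟩
    subst hi
    by_cases hji : j ≤ i
    · rw [if_pos (by omega)]
      have e : (-(j : ℤ) - 1 + i + 1).toNat = i - j := by omega
      have e' : (0 + (-(j : ℤ) - 1 + i + 1)) = i - j := by ring
      rw [e, e', sgnChoose_neg_sub_one, smul_smul, ← neg_smul, Nat.sub_add_cancel hji,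
        Nat.choose_symm hji, sgnChoose, Ring.choose_natCast]
      congr 1
      have e2 : ((-(j : ℤ) - 1).negOnePow : ℤ) = -(-1) ^ j := by
        rw [Int.negOnePow_sub, Int.negOnePow_neg, Int.negOnePow_def, zpow_natCast]
        simp
      rw [e2]
      simp
    · rw [if_neg (by omega), smul_zero, neg_zero, sgnChoose, Ring.choose_natCast,
        Nat.choose_eq_zero_of_lt (by omega)]
      simp

theorem sum_sgnChoose_left (k n : ℤ) (j s : ℕ) :
    ∑ i ∈ Finset.range (j + 1), (sgnChoose k s * (-1) ^ j) * ((-1) ^ i * Ring.choose (s : ℤ) i *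
      Ring.choose (s + (n - j) + j - i) (j - i)) = sgnChoose k s * sgnChoose n j := by
  rw [← Finset.mul_sum]
  have := Ring.sum_choose_mul_choose_add_sub s n j
  have e : ∀ i : ℕ, (s : ℤ) + (n - j) + j - i = s + n - i := fun i => by ring
  simp only [e]
  rw [this, sgnChoose, sgnChoose]
  ring

/-- One half of the Leibniz rule; `P_hderiv_right` is the other. Once the coefficients of a given
product of modes are collected, both are instances of `sum_choose_mul_choose_add_sub`. -/
theorem P_hderiv_left (a b : Fld F M) (k : ℤ) (j : ℕ) (n : ℤ) (w : M) :
    sgnChoose n j • P a b k 0 (n - j) w =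
      ∑ i ∈ Finset.range (j + 1), sgnChoose k i • P a (hderiv (j - i) b) (k - i) 0 n w := by
  obtain ⟨B, hB, hBj⟩ := ((eventually_bound b (n - j) w).and
    (Filter.eventually_ge_atTop j)).exists
  have h : ∀ i ∈ Finset.range (j + 1), sgnChoose k i • P a (hderiv (j - i) b) (k - i) 0 n w =
      ∑ s ∈ Finset.range B, ((sgnChoose k s * (-1) ^ j) * ((-1) ^ i * Ring.choose (s : ℤ) i *
      Ring.choose (s + (n - j) + j - i) (j - i))) • a.1 (k - s) (b.1 (n - j + s) w) := by
    intro i hi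
    rw [Finset.mem_range] at hi
    rw [P_eq_sum (B := B - i)]
    · have hBi : B = i + (B - i) := by omega
      conv_rhs => rw [hBi]
      have hz : ∀ s ∈ Finset.range i, ((sgnChoose k s * (-1) ^ j) * ((-1) ^ i *
          Ring.choose (s : ℤ) i * Ring.choose (s + (n - j) + j - i) (j - i))) •
          a.1 (k - s) (b.1 (n - j + s) w) = 0 := by
        intro s hs
        rw [Finset.mem_range] at hs
        rw [Ring.choose_natCast, Nat.choose_eq_zero_of_lt hs]
        simp
      rw [Finset.sum_range_add, Finset.sum_eq_zero hz, zero_add, Finset.smul_sum]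
      · refine Finset.sum_congr rfl fun t _ => ?_
        have e1 : k - i + 0 - t = k - ((i + t : ℕ) : ℤ) := by push_cast; ring
        have e2 : n + t - ((j - i : ℕ) : ℤ) = n - j + ((i + t : ℕ) : ℤ) := by omega
        have e3 : ((i + t : ℕ) : ℤ) + (n - j) + j - i = n + t := by push_cast; ring
        have e4 : (-1 : ℤ) ^ j = (-1) ^ i * (-1) ^ (j - i) := by
          rw [← pow_add]; congr 1; omega
        have e5 := Ring.choose_add_mul_choose k t i
        have e6 : (-1 : ℤ) ^ i * (-1) ^ i = 1 := by
          rw [← pow_add, Even.neg_one_pow ⟨i, rfl⟩]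
        rw [hderiv_apply, e1, e2, e3, map_zsmul, smul_smul, smul_smul, add_comm i t]
        congr 1
        simp only [sgnChoose, e4, pow_add]
        linear_combination (-(-1) ^ i * (-1) ^ t * (-1) ^ (j - i) *
          Ring.choose (n + t) (j - i)) * e5 -
          ((-1) ^ i * (-1) ^ t * (-1) ^ (j - i) * Ring.choose (n + t) (j - i) *
          Ring.choose k (t + i) * Ring.choose ((t + i : ℕ) : ℤ) i) * e6
    · intro t ht
      have e2 : n + t - ((j - i : ℕ) : ℤ) = n - j + ((i + t : ℕ) : ℤ) := by omega
      rw [hderiv_apply, e2, hB _ (by omega), smul_zero]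
  rw [Finset.sum_congr rfl h, Finset.sum_comm, P_eq_sum a b k 0 hB, Finset.smul_sum]
  refine Finset.sum_congr rfl fun s _ => ?_
  rw [← Finset.sum_smul, sum_sgnChoose_left, smul_smul, add_zero, mul_comm, sgnChoose, sgnChoose]

theorem P_hderiv_right (a b : Fld F M) (k : ℤ) (j : ℕ) (n : ℤ) (w : M) :
    sgnChoose n j • (k.negOnePow : ℤ) • P b a k (n - j) 0 w =
      ∑ i ∈ Finset.range (j + 1), sgnChoose k i • ((k - i).negOnePow : ℤ) •
        P (hderiv (j - i) b) a (k - i) n 0 w := by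
  obtain ⟨B, hB⟩ := (eventually_bound a 0 w).exists
  have h : ∀ i ∈ Finset.range (j + 1), sgnChoose k i • ((k - i).negOnePow : ℤ) •
        P (hderiv (j - i) b) a (k - i) n 0 w =
      ∑ t ∈ Finset.range B, ((k.negOnePow : ℤ) * sgnChoose k t * (-1) ^ j *
        ((-1) ^ i * Ring.choose (k - t) i * Ring.choose (k - t + n - i) (j - i))) •
        b.1 (k + (n - j) - t) (a.1 (0 + t) w) := by
    intro i hi
    rw [Finset.mem_range] at hi
    rw [P_eq_sum _ _ _ _ hB, Finset.smul_sum, Finset.smul_sum]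
    refine Finset.sum_congr rfl fun t _ => ?_
    have e1 : k - i + n - t - ((j - i : ℕ) : ℤ) = k + (n - j) - t := by omega
    have e2 : k - i + n - t = k - t + n - i := by ring
    have e : ((k - i).negOnePow : ℤ) = (k.negOnePow : ℤ) * (-1) ^ i := by
      rw [Int.negOnePow_sub, Units.val_mul]
      congr 1
    have e4 : (-1 : ℤ) ^ j = (-1) ^ i * (-1) ^ (j - i) := by
      rw [← pow_add]; congr 1; omega
    have e5 := Ring.choose_mul_choose_sub k i t
    rw [hderiv_apply, e1, e2, smul_smul, smul_smul, smul_smul]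
    congr 1
    simp only [sgnChoose, e, e4]
    linear_combination ((k.negOnePow : ℤ) * (-1) ^ i * (-1) ^ i * (-1) ^ t * (-1) ^ (j - i) *
      Ring.choose (k - t + n - i) (j - i)) * e5
  rw [Finset.sum_congr rfl h, Finset.sum_comm, P_eq_sum b a k _ hB, Finset.smul_sum,
    Finset.smul_sum]
  refine Finset.sum_congr rfl fun t _ => ?_
  rw [← Finset.sum_smul, ← Finset.mul_sum, Ring.sum_choose_mul_choose_add_sub, smul_smul,
    smul_smul]
  congr 1
  simp only [sgnChoose]
  ring

/-- The Leibniz rule for divided derivatives of products. -/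
theorem hderiv_nprod (a b : Fld F M) (k : ℤ) (j : ℕ) : hderiv j (nprod k a b) =
    ∑ i ∈ Finset.range (j + 1), sgnChoose k i • nprod (k - i) a (hderiv (j - i) b) := by
  refine ext' fun n w => ?_
  have hsum : ∀ (g : ℕ → Fld F M), (∑ t ∈ Finset.range (j + 1), g t).1 n w =
      ∑ t ∈ Finset.range (j + 1), (g t).1 n w := by
    intro g
    simp
  rw [hsum, hderiv_apply, nprod_apply, J, smul_sub, P_hderiv_left, P_hderiv_right,
    ← Finset.sum_sub_distrib]
  refine Finset.sum_congr rfl fun i _ => ?_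
  rw [← smul_sub]
  rfl

end Fld
end Fields
end

/-! ### Complements on products and locality. -/

noncomputable section

/-- In terms of the mode index p = m + 1 of ω the cocycle is half an integral binomial coefficient.
Hence the commutator of ω with itself has a single central term, at t = 3, also in characteristic
three. -/
theorem virCoeff_sub_one (F : Type*) [Field F] (p : ℤ) :
    virCoeff F (p - 1) = (Ring.choose p 3 : ℤ) / 2 := by
  have h1 := Ring.choose_smul_choose p (show 2 ≤ 3 by norm_num)
  have h2 := Ring.choose_smul_choose p (show 1 ≤ 2 by norm_num)
  norm_num [Ring.choose_one_right, Nat.choose] at h1 h2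
  have h3 := Vir.six_mul_div (p - 1)
  have h4 : 6 * Ring.choose p 3 = (p - 1) ^ 3 - (p - 1) := by
    linear_combination 2 * h1 + (p - 2) * h2
  have h5 : ((p - 1) ^ 3 - (p - 1)) / 6 = Ring.choose p 3 := by omega
  rw [virCoeff, h5]

section Fields

variable {F M : Type*} [Field F] [AddCommGroup M] [Module F M]

namespace Fld

theorem sum_apply {ι : Type*} (s : Finset ι) (g : ι → Fld F M) (n : ℤ) (w : M) :
    (∑ t ∈ s, g t).1 n w = ∑ t ∈ s, (g t).1 n w := by
  simp

theorem nprod_one_left (k : ℤ) (f : Fld F M) :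
    nprod k (one F M) f = if k = -1 then f else 0 := by
  refine ext' fun n w => ?_
  rw [nprod_apply, J, P_one_right, if_neg (by omega), smul_zero, sub_zero, P_one_left]
  rcases lt_trichotomy k (-1) with h | rfl | h
  · rw [if_neg (by omega), if_neg (by omega)]
    rfl
  · simp [sgnChoose]
  · rw [if_pos (by omega), if_neg (by omega)]
    obtain ⟨i, rfl⟩ : ∃ i : ℕ, k = i := ⟨k.toNat, by omega⟩
    have e : ((i : ℤ) + 0 + 1).toNat = i + 1 := by omega
    rw [e, sgnChoose, Ring.choose_natCast, Nat.choose_succ_self]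
    simp

/-- The two halves are the absorption identities (k - i)C(k,i) = kC(k-1,i) and (i + 1)C(k,i+1) =
kC(k-1,i). The term i = 0 of the second half is zero, which causes the shift of index there. -/
theorem nprod_hderiv_one (k : ℤ) (a b : Fld F M) :
    nprod k (hderiv 1 a) b = (-k) • nprod (k - 1) a b := by
  refine ext' fun n w => ?_
  change J (hderiv 1 a) b k 0 n w = (-k) • J a b (k - 1) 0 n w
  have hc : ∀ i : ℕ, Ring.choose k i * (k - i) = k * Ring.choose (k - 1) i := by
    intro i
    have := Ring.choose_mul_choose_sub k i 1
    simpa using this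
  have hc' : ∀ i : ℕ, Ring.choose k (i + 1) * (i + 1) = k * Ring.choose (k - 1) i := by
    intro i
    have := Ring.choose_add_mul_choose k i 1
    simpa using this
  rw [J, J, smul_sub]
  congr 1
  · obtain ⟨B, hB⟩ := (eventually_bound b n w).exists
    rw [P_eq_sum _ _ _ _ hB, P_eq_sum _ _ _ _ hB, Finset.smul_sum]
    refine Finset.sum_congr rfl fun i _ => ?_
    have e : k + 0 - i - ((1 : ℕ) : ℤ) = k - 1 + 0 - i := by push_cast; ring
    rw [hderiv_apply, e, smul_smul, smul_smul, sgnChoose, Ring.choose_one_right]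
    congr 1
    linear_combination (-(-1) ^ i) * hc i
  · obtain ⟨B, hB⟩ := (eventually_bound a 0 w).exists
    have hB' : ∀ i : ℕ, B + 1 ≤ i → (hderiv 1 a).1 (0 + i) w = 0 := by
      intro i hi
      obtain ⟨j, rfl⟩ : ∃ j, i = j + 1 := ⟨i - 1, by omega⟩
      have e : 0 + ((j + 1 : ℕ) : ℤ) - ((1 : ℕ) : ℤ) = 0 + j := by push_cast; ring
      rw [hderiv_apply, e, hB j (by omega), smul_zero]
    rw [P_eq_sum _ _ _ _ hB', P_eq_sum _ _ _ _ hB, Finset.sum_range_succ', Finset.smul_sum,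
      Finset.smul_sum]
    have e0 : (hderiv 1 a).1 (0 + ((0 : ℕ) : ℤ)) w = 0 := by
      rw [hderiv_apply]
      simp [sgnChoose]
    rw [e0, map_zero, smul_zero, add_zero, Finset.smul_sum]
    refine Finset.sum_congr rfl fun i _ => ?_
    have e : 0 + ((i + 1 : ℕ) : ℤ) - ((1 : ℕ) : ℤ) = 0 + i := by push_cast; ring
    have e' : k + n - ((i + 1 : ℕ) : ℤ) = k - 1 + n - i := by push_cast; ring
    have e2 : ((k - 1).negOnePow : ℤ) = -(k.negOnePow : ℤ) := by
      rw [Int.negOnePow_sub]; simp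
    rw [hderiv_apply, e, e', e2, map_zsmul, smul_smul, smul_smul, smul_smul, smul_smul, sgnChoose,
      Ring.choose_one_right]
    congr 1
    push_cast
    rw [pow_succ]
    linear_combination ((k.negOnePow : ℤ) * (-1) ^ i) * hc' i

/-- Fields whose commutators are given by finitely many fields are local. -/
theorem isLocal_of_comm {a b : Fld F M} {N : ℕ} {d : ℕ → Fld F M}
    (hab : ∀ p q w, a.1 p (b.1 q w) - b.1 q (a.1 p w) =
      ∑ t ∈ Finset.range N, Ring.choose p t • (d t).1 (p + q - t) w) : IsLocal a b := by
  -- Each factor z₁ - z₂ lowers the order of the derivatives of the delta function by one, so the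
  -- sum loses its first term; after N factors nothing is left.
  have key : ∀ l : ℕ, l ≤ N → ∀ m n w, J a b l m n w =
      ∑ t ∈ Finset.range (N - l), Ring.choose m t • (d (t + l)).1 (m + n - t) w := by
    intro l
    induction l with
    | zero => intro _ m n w; rw [Nat.cast_zero, J_zero, hab]; rfl
    | succ l ih =>
      intro hl m n w
      obtain ⟨K, hK⟩ : ∃ K, N - l = K + 1 := ⟨N - l - 1, by omega⟩
      have hK' : N - (l + 1) = K := by omega
      rw [Nat.cast_succ, J_succ, ih (by omega), ih (by omega), hK, hK', Finset.sum_range_succ',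
        Finset.sum_range_succ' _ K]
      simp only [Ring.choose_zero_right]
      have e0 : m + 1 + n = m + (n + 1) := by ring
      rw [e0, add_sub_add_right_eq_sub, ← Finset.sum_sub_distrib]
      refine Finset.sum_congr rfl fun t _ => ?_
      have e1 : m + (n + 1) - ((t + 1 : ℕ) : ℤ) = m + n - t := by push_cast; ring
      have e2 : t + 1 + l = t + (l + 1) := by ring
      rw [← sub_smul, e1, e2, Ring.choose_succ_succ]
      congr 1
      ring
  refine ⟨N, fun m n w => ?_⟩
  rw [key N le_rfl, Nat.sub_self]
  simp

theorem IsLocal.add {a a' b : Fld F M} (h : IsLocal a b) (h' : IsLocal a' b) :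
    IsLocal (a + a') b := by
  obtain ⟨N, hN⟩ := h.exists_forall_ge
  obtain ⟨N', hN'⟩ := h'.exists_forall_ge
  refine ⟨max N N', fun m n w => ?_⟩
  have e : J (a + a') b ((max N N' : ℕ) : ℤ) m n w =
      J a b ((max N N' : ℕ) : ℤ) m n w + J a' b ((max N N' : ℕ) : ℤ) m n w := by
    simp only [J, P_add_left, P_add_right, smul_add]; abel
  rw [e, hN _ (by omega), hN' _ (by omega), add_zero]

theorem IsLocal.smul {a b : Fld F M} (h : IsLocal a b) (r : F) : IsLocal (r • a) b := by
  obtain ⟨N, hN⟩ := h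
  refine ⟨N, fun m n w => ?_⟩
  have e : J (r • a) b N m n w = r • J a b N m n w := by
    simp only [J, P_smul_left, P_smul_right, smul_sub]
    rw [smul_comm r]
  rw [e, hN, smul_zero]

/-! ### The fields generated by a Virasoro field -/

/-- The modes `ω_{n+1}` satisfy the Virasoro relations. -/
def IsVirField (c : F) (ω : Fld F M) : Prop := IsVirRep (fun n => ω.1 (n + 1)) c

/-- The fields describing the commutators of the modes of a Virasoro field. -/
def virComm (c : F) (ω : Fld F M) : ℕ → Fld F M
  | 0 => hderiv 1 ω
  | 1 => (2 : ℤ) • ω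
  | 3 => (c / 2) • one F M
  | _ => 0

/-- The Virasoro relations as an operator product: the coefficients are ∂ω, 2ω, 0 and c/2. -/
theorem sum_virComm (c : F) (ω : Fld F M) (p q : ℤ) (w : M) :
    ∑ t ∈ Finset.range 4, Ring.choose p t • (virComm c ω t).1 (p + q - t) w =
      (((p - 1 : ℤ) : F) - (q - 1 : ℤ)) • ω.1 (p - 1 + (q - 1) + 1) w +
        if p - 1 + (q - 1) = 0 then (virCoeff F (p - 1) * c) • w else 0 := by
  symm
  rw [Finset.sum_range_succ, Finset.sum_range_succ, Finset.sum_range_succ,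
    Finset.sum_range_one]
  have e0 : (virComm c ω 0).1 (p + q - ((0 : ℕ) : ℤ)) w = (-(p + q)) • ω.1 (p + q - 1) w := by
    change (hderiv 1 ω).1 _ w = _
    rw [hderiv_apply, sgnChoose, Ring.choose_one_right]
    push_cast
    simp
  have e1 : (virComm c ω 1).1 (p + q - ((1 : ℕ) : ℤ)) w = (2 : ℤ) • ω.1 (p + q - 1) w := rfl
  have e2 : (virComm c ω 2).1 (p + q - ((2 : ℕ) : ℤ)) w = 0 := rfl
  have e3 : (virComm c ω 3).1 (p + q - ((3 : ℕ) : ℤ)) w =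
      (c / 2) • (one F M).1 (p + q - ((3 : ℕ) : ℤ)) w := rfl
  rw [e0, e1, e2, e3, Ring.choose_zero_right, Ring.choose_one_right, smul_zero, add_zero,
    smul_smul, smul_smul, ← add_smul, one_apply]
  have e4 : p - 1 + (q - 1) + 1 = p + q - 1 := by ring
  rw [e4]
  congr 1
  · rw [← Int.cast_smul_eq_zsmul F]
    congr 1
    push_cast
    ring
  · by_cases hpq : p - 1 + (q - 1) = 0
    · rw [if_pos hpq, if_pos (by push_cast; omega), virCoeff_sub_one,
        ← Int.cast_smul_eq_zsmul F, smul_smul]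
      congr 1
      ring
    · rw [if_neg hpq, if_neg (by push_cast; omega), smul_zero, smul_zero]

theorem IsVirField.comm {c : F} {ω : Fld F M} (H : IsVirField c ω) (p q : ℤ) (w : M) :
    ω.1 p (ω.1 q w) - ω.1 q (ω.1 p w) =
      ∑ t ∈ Finset.range 4, Ring.choose p t • (virComm c ω t).1 (p + q - t) w := by
  have h := IsVirRep.comm H (p - 1) (q - 1) w
  simp only [sub_add_cancel] at h
  rw [h, sum_virComm]

theorem isVirField_of_comm {c : F} {ω : Fld F M}
    (h : ∀ p q w, ω.1 p (ω.1 q w) - ω.1 q (ω.1 p w) =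
      ∑ t ∈ Finset.range 4, Ring.choose p t • (virComm c ω t).1 (p + q - t) w) :
    IsVirField c ω where
  comm m n w := by
    rw [h, sum_virComm]
    simp only [add_sub_cancel_right]

theorem IsVirField.isLocal {c : F} {ω : Fld F M} (H : IsVirField c ω) : IsLocal ω ω :=
  isLocal_of_comm H.comm

/-- The operator of multiplication by a field. -/
def nprodEnd (k : ℤ) (a : Fld F M) : Module.End F (Fld F M) where
  toFun := nprod k a
  map_add' := nprod_add k a
  map_smul' r b := nprod_smul k r a b

/-- `nprod_comm` carries the commutators of the modes of ω over to products with ω, and the products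
with ∂ω, 2ω and c/2 reassemble into the same relations. This is what lets the Verma module act on
fields. -/
theorem IsVirField.isVirRep_nprod {c : F} {ω : Fld F M} (H : IsVirField c ω) :
    IsVirRep (fun n => nprodEnd (n + 1) ω) c where
  comm m n f := by
    change nprod (m + 1) ω (nprod (n + 1) ω f) - nprod (n + 1) ω (nprod (m + 1) ω f) =
      ((m : F) - n) • nprod (m + n + 1) ω f + _
    rw [nprod_comm H.comm, Finset.sum_range_succ, Finset.sum_range_succ, Finset.sum_range_succ,
      Finset.sum_range_one]
    have e0 : nprod (m + 1 + (n + 1) - ((0 : ℕ) : ℤ)) (virComm c ω 0) f =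
        (-(m + n + 2)) • nprod (m + n + 1) ω f := by
      change nprod _ (hderiv 1 ω) f = _
      rw [nprod_hderiv_one]
      congr 2
      · push_cast; ring
      · push_cast; ring
    have e1 : nprod (m + 1 + (n + 1) - ((1 : ℕ) : ℤ)) (virComm c ω 1) f =
        (2 : ℤ) • nprod (m + n + 1) ω f := by
      change nprod _ ((2 : ℤ) • ω) f = _
      rw [← Int.cast_smul_eq_zsmul F, smul_nprod, ← Int.cast_smul_eq_zsmul F]
      congr 2
      push_cast; ring
    have e2 : nprod (m + 1 + (n + 1) - ((2 : ℕ) : ℤ)) (virComm c ω 2) f = 0 := by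
      change nprod _ 0 f = 0
      have := smul_nprod (m + 1 + (n + 1) - ((2 : ℕ) : ℤ)) (0 : F) 0 f
      rwa [zero_smul, zero_smul] at this
    have e3 : nprod (m + 1 + (n + 1) - ((3 : ℕ) : ℤ)) (virComm c ω 3) f =
        (c / 2) • if m + n = 0 then f else 0 := by
      change nprod _ ((c / 2) • one F M) f = _
      rw [smul_nprod, nprod_one_left]
      congr 1
      by_cases h : m + n = 0
      · rw [if_pos h, if_pos (by push_cast; omega)]
      · rw [if_neg h, if_neg (by push_cast; omega)]
    rw [e0, e1, e2, e3, Ring.choose_zero_right, Ring.choose_one_right, smul_zero, add_zero,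
      smul_smul, smul_smul, ← add_smul]
    congr 1
    · rw [← Int.cast_smul_eq_zsmul F]
      congr 1
      push_cast
      ring
    · have := virCoeff_sub_one F (m + 1)
      rw [add_sub_cancel_right] at this
      by_cases h : m + n = 0
      · rw [if_pos h, if_pos h, this, ← Int.cast_smul_eq_zsmul F, smul_smul]
        congr 1
        ring
      · rw [if_neg h, if_neg h, smul_zero, smul_zero]

theorem IsVirField.exists_Y {c : F} {ω : Fld F M} (H : IsVirField c ω) :
    ∃ φ : Verma c 0 →ₗ[F] Fld F M, φ (Verma.gen c 0) = one F M ∧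
      ∀ n x, φ ⁅Vir.L F n, x⁆ = nprod (n + 1) ω (φ x) := by
  obtain ⟨φ, h1, h2⟩ := Verma.exists_lift (h := 0) H.isVirRep_nprod (one F M)
    (by
      change nprod (0 + 1) ω (one F M) = _
      rw [nprod_one_of_nonneg _ (by norm_num), zero_smul])
    (fun n hn => nprod_one_of_nonneg _ (by omega))
  exact ⟨φ, h1, h2⟩

/-- The fields attached to the vectors of the Verma module of highest weight zero. -/
def IsVirField.Y {c : F} {ω : Fld F M} (H : IsVirField c ω) : Verma c 0 →ₗ[F] Fld F M :=
  H.exists_Y.choose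

namespace IsVirField

variable {c : F} {ω : Fld F M} (H : IsVirField c ω)

theorem Y_gen : H.Y (Verma.gen c 0) = one F M := H.exists_Y.choose_spec.1

theorem Y_lie (n : ℤ) (x : Verma c 0) : H.Y ⁅Vir.L F n, x⁆ = nprod (n + 1) ω (H.Y x) :=
  H.exists_Y.choose_spec.2 n x

/-- Dong's lemma for a product of ω and Y(x) needs ω and Y(x) to be local to each other, so this is
carried along in the induction. -/
theorem isLocal_Y_of_isLocal {b : Fld F M} (hb : IsLocal ω b) (x : Verma c 0) :
    IsLocal (H.Y x) b := by
  have key : ∀ x : Verma c 0, IsLocal ω (H.Y x) ∧ IsLocal (H.Y x) b := by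
    intro x
    induction x using Verma.induction with
    | hgen => rw [Y_gen]; exact ⟨isLocal_one _, (isLocal_one _).symm⟩
    | hL n x hx =>
      rw [Y_lie]
      exact ⟨(IsLocal.nprod hx.1 H.isLocal hx.1.symm _).symm,
        IsLocal.nprod hx.1 hb hx.2 _⟩
    | hadd x y hx hy =>
      rw [map_add]
      exact ⟨(hx.1.symm.add hy.1.symm).symm, hx.2.add hy.2⟩
    | hsmul a x hx =>
      rw [map_smul]
      exact ⟨(hx.1.symm.smul a).symm, hx.2.smul a⟩
  exact (key x).2

theorem isLocal_Y_left (x : Verma c 0) : IsLocal ω (H.Y x) :=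
  (H.isLocal_Y_of_isLocal H.isLocal x).symm

theorem isLocal_Y (x y : Verma c 0) : IsLocal (H.Y x) (H.Y y) :=
  H.isLocal_Y_of_isLocal (H.isLocal_Y_left y) x

/-- The Jacobi identity with l = 0. The bound may be enlarged at will, so that formulas on different
modules can be compared term by term. -/
theorem exists_comm_Y (x : Verma c 0) : ∃ N : ℕ, ∀ N', N ≤ N' → ∀ p q w,
    ω.1 p ((H.Y x).1 q w) - (H.Y x).1 q (ω.1 p w) =
      ∑ t ∈ Finset.range N', Ring.choose p t • (H.Y ⁅Vir.L F (t - 1), x⁆).1 (p + q - t) w := by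
  obtain ⟨N, hN⟩ := (H.isLocal_Y_left x).nprod_eq_zero
  refine ⟨N, fun N' hN' p q w => ?_⟩
  have := (H.isLocal_Y_left x).jacobi 0 p q w
  rw [J_zero] at this
  rw [this, finsum_eq_sum_range (B := N')]
  · refine Finset.sum_congr rfl fun t _ => ?_
    rw [Y_lie, sub_add_cancel, zero_add]
  · intro t ht
    have := hN (0 + t) (by omega)
    rw [this]
    exact smul_zero _

/-- On the vacuum both sides vanish. Passing from x to Lₙx produces the bracket of L₋₁ and Lₙ on one
side and the Leibniz rule on the other. -/
theorem Y_lie_neg_one (x : Verma c 0) : H.Y ⁅Vir.L F (-1), x⁆ = hderiv 1 (H.Y x) := by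
  have h0 : ∀ a : Fld F M, hderiv 1 a = nprod (-2) a (one F M) := fun a =>
    (nprod_one_neg a 1).symm
  induction x using Verma.induction with
  | hgen =>
    rw [Y_lie, Y_gen, h0, nprod_one_left, nprod_one_of_nonneg _ (by norm_num),
      if_neg (by norm_num)]
  | hL n x hx =>
    rw [Verma.lie_L_L, map_add, map_add, map_smul, Y_lie, hx, Y_lie, Y_lie, hderiv_nprod,
      Finset.sum_range_succ, Finset.sum_range_one]
    have e : (if -1 + n = 0 then (virCoeff F (-1) * c) • x else 0) = 0 := by
      have : virCoeff F (-1) = 0 := by simp [virCoeff]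
      rw [this]; simp
    have e' : -1 + n + 1 = n := by ring
    have e2 : n + 1 - ((1 : ℕ) : ℤ) = n := by push_cast; ring
    rw [e, map_zero, add_zero, e']
    simp only [Nat.sub_zero, Nat.sub_self, hderiv_zero, sgnChoose, Ring.choose_zero_right,
      Ring.choose_one_right, e2, Nat.cast_zero, sub_zero]
    rw [← Int.cast_smul_eq_zsmul F, ← Int.cast_smul_eq_zsmul F]
    push_cast
    module
  | hadd x y hx hy =>
    rw [lie_add, map_add, map_add, hx, hy, h0, h0, h0, add_nprod]
  | hsmul a x hx =>
    rw [lie_smul, map_smul, map_smul, hx, h0, h0, smul_nprod]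

/-! ### Stability and gradings -/

theorem finsum_mem_submodule {N : Submodule F M} {f : ℕ → M} (hf : ∀ i, f i ∈ N) :
    ∑ᶠ i, f i ∈ N :=
  finsum_induction (· ∈ N) N.zero_mem (fun _ _ => N.add_mem) hf

/-- The field `a` is homogeneous of weight `s` for the family of subspaces `D`. -/
def _root_.Fld.HasWeight (D : ℤ → Submodule F M) (s : ℤ) (a : Fld F M) : Prop :=
  ∀ n k, ∀ w ∈ D k, a.1 n w ∈ D (k + s - n - 1)

theorem _root_.Fld.HasWeight.nprod {D : ℤ → Submodule F M} {s t : ℤ} {a b : Fld F M}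
    (ha : HasWeight D s a) (hb : HasWeight D t b) (k : ℤ) :
    HasWeight D (s + t - k - 1) (nprod k a b) := by
  have hP : ∀ {s t : ℤ} {a b : Fld F M}, HasWeight D s a → HasWeight D t b →
      ∀ l m n r, ∀ w ∈ D r, P a b l m n w ∈ D (r + (s + t - l) - m - n - 1 - 1) := by
    intro s t a b ha hb l m n r w hw
    refine finsum_mem_submodule fun i => Submodule.smul_of_tower_mem _ _ ?_
    have := ha (l + m - i) _ _ (hb (n + i) r w hw)
    convert this using 2
    ring
  intro n r w hw
  rw [nprod_apply, J]
  refine Submodule.sub_mem _ ?_ (Submodule.smul_of_tower_mem _ _ ?_)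
  · convert hP ha hb k 0 n r w hw using 2
    ring
  · convert hP hb ha k n 0 r w hw using 2
    ring

theorem hasWeight_one (D : ℤ → Submodule F M) : HasWeight D 0 (one F M) := by
  intro n k w hw
  rw [one_apply]
  split_ifs with h
  · subst h
    convert hw using 2
    ring
  · exact zero_mem _

theorem hasWeight_Y {D : ℤ → Submodule F M} (hD : HasWeight D 2 ω) {s : ℤ} {x : Verma c 0}
    (hx : x ∈ Verma.deg c 0 s) : HasWeight D s (H.Y x) := by
  have hword : ∀ l : List ℕ, HasWeight D (l.sum : ℤ) (H.Y (Verma.word c 0 l)) := by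
    intro l
    induction l with
    | nil => rw [Verma.word_nil, Y_gen]; simpa using hasWeight_one D
    | cons k l ih =>
      rw [Verma.word_cons, Y_lie]
      convert hD.nprod ih (-k + 1) using 1
      rw [List.sum_cons]
      push_cast
      ring
  rw [Verma.deg_eq_span] at hx
  induction hx using Submodule.span_induction with
  | mem x hx =>
    obtain ⟨l, -, rfl, rfl⟩ := hx
    exact hword l
  | zero =>
    intro n k w _
    rw [map_zero]
    exact zero_mem _
  | add x y _ _ hx hy =>
    intro n k w hw
    rw [map_add]
    exact add_mem (hx n k w hw) (hy n k w hw)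
  | smul a x _ hx =>
    intro n k w hw
    rw [map_smul]
    exact Submodule.smul_mem _ a (hx n k w hw)

/-- A subspace stable under the Virasoro operators is stable under all modes. -/
theorem Y_mem {N : Submodule F M} (hN : ∀ n, ∀ w ∈ N, ω.1 n w ∈ N) (x : Verma c 0) (n : ℤ) {w : M}
    (hw : w ∈ N) : (H.Y x).1 n w ∈ N := by
  -- For a constant family of subspaces the weight condition says nothing but stability.
  have hD : HasWeight (fun _ => N) 2 ω := fun n _ w hw => hN n w hw
  induction x using Verma.induction_neg generalizing n w with
  | hgen => exact H.hasWeight_Y hD Verma.gen_mem_deg n 0 w hw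
  | h0 => rw [map_zero]; exact zero_mem _
  | hL k m x hk hx _ => exact H.hasWeight_Y hD (Verma.lie_L_neg_mem_deg hk hx) n 0 w hw
  | hadd x y hx hy => rw [map_add]; exact add_mem (hx n hw) (hy n hw)
  | hsmul a x hx => rw [map_smul]; exact Submodule.smul_mem _ a (hx n hw)

/-- Linear maps commuting with the Virasoro operators commute with all modes. -/
theorem map_Y {M' : Type*} [AddCommGroup M'] [Module F M'] {ω' : Fld F M'} (H' : IsVirField c ω')
    {e : M →ₗ[F] M'} (he : ∀ n w, e (ω.1 n w) = ω'.1 n (e w)) (x : Verma c 0) (n : ℤ) (w : M) :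
    e ((H.Y x).1 n w) = (H'.Y x).1 n (e w) := by
  have hP : ∀ {a b : Fld F M} {a' b' : Fld F M'}, (∀ n w, e (a.1 n w) = a'.1 n (e w)) →
      (∀ n w, e (b.1 n w) = b'.1 n (e w)) → ∀ l m n w, e (P a b l m n w) = P a' b' l m n (e w) := by
    intro a b a' b' ha hb l m n w
    obtain ⟨B, h1, h2⟩ := ((P_eventually a b l m n w).and (P_eventually a' b' l m n (e w))).exists
    rw [h1, h2, map_sum]
    refine Finset.sum_congr rfl fun i _ => ?_
    rw [map_zsmul, ha, hb]
  induction x using Verma.induction generalizing n w with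
  | hgen =>
    rw [Y_gen, Y_gen, one_apply, one_apply]
    split_ifs <;> simp
  | hL k x hx =>
    rw [Y_lie, Y_lie, nprod_apply, nprod_apply, J, J, map_sub, map_zsmul, hP he hx, hP hx he]
  | hadd x y hx hy =>
    rw [map_add, map_add]
    change e (_ + _) = (H'.Y x).1 n (e w) + (H'.Y y).1 n (e w)
    rw [← hx, ← hy, ← map_add]
  | hsmul a x hx =>
    rw [map_smul, map_smul]
    change e (a • _) = a • (H'.Y x).1 n (e w)
    rw [← hx, ← map_smul e]

/-! ### Highest weight vectors -/

/-- Vectors killed by `Lₙ` for `n > 0`. -/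
def IsSingular (ω : Fld F M) (v : M) : Prop := ∀ n, 2 ≤ n → ω.1 n v = 0

theorem isSingular_apply_one (H : IsVirField c ω) {v : M} (hv : IsSingular ω v) : IsSingular ω (ω.1 1 v) := by
  intro n hn
  have := IsVirRep.comm H (n - 1) 0 v
  simp only [sub_add_cancel, zero_add, add_zero] at this
  rw [hv n hn, if_neg (by omega), map_zero, sub_zero] at this
  simpa using this

theorem P_eq_sum_two (x : Fld F M) {v : M} (hv : IsSingular ω v) (l m : ℤ) :
    P x ω l m 0 v = x.1 (l + m) (ω.1 0 v) - l • x.1 (l + m - 1) (ω.1 1 v) := by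
  rw [P_eq_sum (B := 2)]
  · rw [Finset.sum_range_succ, Finset.sum_range_one]
    simp [sub_eq_add_neg]
  · intro i hi
    exact hv _ (by omega)

/-- On a singular vector the only modes of ω that act with nonnegative index are ω₀ and ω₁, so the
product formula for L₋ₙx has two terms; the one with ω₀ is evaluated by translation covariance. The
outcome is a recursion for the weight preserving mode of every word, in terms of L₀ alone. -/
theorem Y_singular {v : M} (hv : IsSingular ω v) {s : ℤ} {x : Verma c 0}
    (hx : x ∈ Verma.deg c 0 s) :
    (∀ k, s ≤ k → (H.Y x).1 k v = 0) ∧ ∀ n : ℕ, 1 ≤ n →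
      (H.Y ⁅Vir.L F (-(n : ℤ)), x⁆).1 (s + n - 1) v = (-1 : ℤ) ^ n •
        (s • (H.Y x).1 (s - 1) v + ((n : ℤ) - 1) • (H.Y x).1 (s - 1) (ω.1 1 v)) := by
  -- the second claim follows from the first one
  have hstep : ∀ (x : Verma c 0) (s : ℤ) (v : M), IsSingular ω v →
      (∀ v, IsSingular ω v → ∀ k, s ≤ k → (H.Y x).1 k v = 0) → ∀ n : ℕ, 1 ≤ n → ∀ k, s ≤ k →
      (H.Y ⁅Vir.L F (-(n : ℤ)), x⁆).1 (k + n - 1) v = (-1 : ℤ) ^ n •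
        (k • (H.Y x).1 (k - 1) v + ((n : ℤ) - 1) • (H.Y x).1 (k - 1) (ω.1 1 v)) := by
    intro x s v hv h n hn k hk
    rw [Y_lie, nprod_apply, J, P_eq_zero _ _ _ _ (fun j hj => h v hv j (by omega)),
      P_eq_sum_two _ hv, zero_sub]
    have e : -(n : ℤ) + 1 + (k + n - 1) = k := by ring
    rw [e]
    -- The commutator of ω₀ with a mode of x is the corresponding mode of L₋₁x, a derivative; the
    -- other term of the commutator vanishes because the k-th mode of x already kills v.
    have h1 : (H.Y x).1 k (ω.1 0 v) = k • (H.Y x).1 (k - 1) v := by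
      have h2 := (H.isLocal_Y_left x).jacobi 0 0 k v
      rw [J_zero, finsum_eq_single _ 0, h v hv k hk, map_zero, zero_sub] at h2
      · have h3 := H.Y_lie_neg_one x
        rw [Y_lie] at h3
        simp only [Ring.choose_zero_right, one_smul, Nat.cast_zero, add_zero, sub_zero,
          zero_add] at h2
        rw [neg_add_cancel] at h3
        rw [h3, hderiv_apply, sgnChoose, Ring.choose_one_right, Nat.cast_one] at h2
        rw [← neg_eq_iff_eq_neg.2 h2.symm, pow_one, neg_one_mul, neg_smul, neg_neg]
      · intro i hi
        rw [Ring.choose_zero_pos ℤ (by omega), zero_smul]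
    have e2 : ((-(n : ℤ) + 1).negOnePow : ℤ) = -(-1) ^ n := by
      rw [Int.negOnePow_succ, Int.negOnePow_neg, Int.negOnePow_def, zpow_natCast]
      simp
    rw [h1, e2, neg_smul, neg_neg]
    congr 1
    module
  have hword : ∀ l : List ℕ, (∀ k ∈ l, 1 ≤ k) → ∀ v, IsSingular ω v → ∀ k, (l.sum : ℤ) ≤ k →
      (H.Y (Verma.word c 0 l)).1 k v = 0 := by
    intro l hl
    induction l with
    | nil =>
      intro v hv k hk
      rw [Verma.word_nil, Y_gen, one_apply, if_neg (by simp at hk; omega)]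
    | cons m l ih =>
      intro v hv k hk
      have ih' := ih fun k hk => hl k (List.mem_cons_of_mem _ hk)
      have hm := hl m List.mem_cons_self
      rw [List.sum_cons, Nat.cast_add] at hk
      obtain ⟨k', rfl⟩ : ∃ k', k = k' + m - 1 := ⟨k - m + 1, by ring⟩
      rw [Verma.word_cons, hstep _ l.sum v hv ih' m hm k' (by omega),
        ih' v hv _ (by omega), ih' _ (isSingular_apply_one H hv) _ (by omega)]
      simp
  have hfirst : ∀ v, IsSingular ω v → ∀ k, s ≤ k → (H.Y x).1 k v = 0 := by
    intro v hv k hk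
    rw [Verma.deg_eq_span] at hx
    induction hx using Submodule.span_induction with
    | mem x hx =>
      obtain ⟨l, hl, rfl, rfl⟩ := hx
      exact hword l hl v hv k hk
    | zero => rw [map_zero]; rfl
    | add x y _ _ hx hy =>
      rw [map_add]
      change (H.Y x).1 k v + (H.Y y).1 k v = 0
      rw [hx, hy, add_zero]
    | smul a x _ hx =>
      rw [map_smul]
      change a • (H.Y x).1 k v = 0
      rw [hx, smul_zero]
  exact ⟨hfirst v hv, fun n hn => hstep x s v hv hfirst n hn s le_rfl⟩

end IsVirField
end Fld
end Fields
end

noncomputable section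

open Fld

/-! ### Fields that factor through L(c,0), and the Virasoro field of L(c,h). -/

namespace Fld

variable {F M : Type*} [Field F] [AddCommGroup M] [Module F M]

theorem J_eq_finsum (a b : Fld F M) (l m n : ℤ) (w : M) : J a b l m n w =
    (∑ᶠ i : ℕ, ((-1) ^ i * Ring.choose l i : ℤ) • a.1 (l + m - i) (b.1 (n + i) w))
      - (∑ᶠ i : ℕ, ((l.negOnePow : ℤ) * (-1) ^ i * Ring.choose l i : ℤ) •
          b.1 (l + n - i) (a.1 (m + i) w)) := by
  rw [J, P]
  congr 1
  obtain ⟨B, hB⟩ := (eventually_bound a m w).exists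
  rw [P_eq_sum _ _ _ _ hB, finsum_eq_sum_range (B := B), Finset.smul_sum]
  · refine Finset.sum_congr rfl fun i _ => ?_
    rw [smul_smul, mul_assoc]
  · intro i hi
    rw [hB i hi, map_zero, smul_zero]

namespace IsVirField

variable {c : F} {ω : Fld F M}

theorem Y_omega (H : IsVirField c ω) : H.Y ⁅Vir.L F (-2), Verma.gen c 0⁆ = ω := by
  rw [Y_lie, Y_gen]
  exact (nprod_one_neg ω 0).trans (hderiv_zero ω)

/-- The fields attached to the vectors of the Verma module depend only on their images in the
irreducible quotient. -/
def IsGood (H : IsVirField c ω) : Prop := ∀ x ∈ Verma.maxGraded c 0, H.Y x = 0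

theorem IsGood.exists_irrY {H : IsVirField c ω} (hH : H.IsGood) :
    ∃ Y : VirIrr c 0 →ₗ[F] Fld F M, ∀ x, Y (VirIrr.mk c 0 x) = H.Y x :=
  ⟨Submodule.liftQ (Verma.maxGraded c 0).toSubmodule H.Y fun x hx => hH x hx, fun x =>
    Submodule.liftQ_apply (Verma.maxGraded c 0).toSubmodule H.Y x⟩

/-- The fields attached to the vectors of the irreducible quotient. -/
def IsGood.irrY {H : IsVirField c ω} (hH : H.IsGood) : VirIrr c 0 →ₗ[F] Fld F M :=
  hH.exists_irrY.choose

theorem IsGood.irrY_mk {H : IsVirField c ω} (hH : H.IsGood) (x : Verma c 0) :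
    hH.irrY (VirIrr.mk c 0 x) = H.Y x := hH.exists_irrY.choose_spec x

theorem IsGood.irrY_gen {H : IsVirField c ω} (hH : H.IsGood) :
    hH.irrY (VirIrr.gen c 0) = one F M := by
  rw [← VirIrr.mk_gen, irrY_mk, Y_gen]

theorem IsGood.irrY_lie {H : IsVirField c ω} (hH : H.IsGood) (n : ℤ) (x : VirIrr c 0) :
    hH.irrY ⁅Vir.L F n, x⁆ = nprod (n + 1) ω (hH.irrY x) := by
  obtain ⟨x, rfl⟩ := VirIrr.mk_surjective x
  rw [← VirIrr.mk_lie, irrY_mk, irrY_mk, Y_lie]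

end IsVirField
end Fld

namespace VirIrr

variable {F : Type*} [Field F] {c h : F}

variable (c h) in
/-- The Virasoro field of `L(c,h)`. -/
def field : Fld F (VirIrr c h) :=
  ⟨fun n => op c h (n - 1), fun w => by
    induction w using induction_neg with
    | hgen => exact ⟨2, fun n hn => lie_L_pos_gen (by omega)⟩
    | h0 => exact ⟨0, fun n _ => map_zero _⟩
    | hL k n x hk hx _ =>
      refine ⟨n + k + 2, fun m hm => ?_⟩
      have h1 := lie_L_mem_deg (m - 1) (lie_L_mem_deg (-k) hx)
      rw [deg_neg (by omega), Submodule.mem_bot] at h1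
      exact h1
    | hadd x y hx hy =>
      obtain ⟨N, hN⟩ := hx
      obtain ⟨K, hK⟩ := hy
      exact ⟨max N K, fun n hn => by
        rw [map_add, hN n (le_trans (le_max_left _ _) hn), hK n (le_trans (le_max_right _ _) hn),
          add_zero]⟩
    | hsmul a x hx =>
      obtain ⟨N, hN⟩ := hx
      exact ⟨N, fun n hn => by rw [map_smul, hN n hn, smul_zero]⟩⟩

theorem field_apply (n : ℤ) (x : VirIrr c h) : (field c h).1 n x = ⁅Vir.L F (n - 1), x⁆ := rfl

theorem isVirField_field : IsVirField c (field c h) where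
  comm m n v := by
    have := (isVirRep_op (c := c) (h := h)).comm m n v
    simp only [op_apply] at this
    simp only [field_apply, add_sub_cancel_right, this]

theorem hasWeight_field : HasWeight (deg c h) 2 (field c h) := by
  intro n k w hw
  have := lie_L_mem_deg (n - 1) hw
  rw [field_apply]
  convert this using 2
  ring

theorem isSingular_gen : IsVirField.IsSingular (field c h) (gen c h) := fun _ _ =>
  lie_L_pos_gen (by omega)

variable (c h) in
/-- The fields on `L(c,h)` attached to the vectors of the Verma module. -/
def Y : Verma c 0 →ₗ[F] Fld F (VirIrr c h) := (isVirField_field (c := c) (h := h)).Y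

theorem Y_lie (n : ℤ) (x : Verma c 0) : Y c h ⁅Vir.L F n, x⁆ = nprod (n + 1) (field c h) (Y c h x) :=
  IsVirField.Y_lie _ n x

theorem exists_comm_Y (x : Verma c 0) : ∃ N : ℕ, ∀ m q w,
    ⁅Vir.L F m, (Y c h x).1 q w⁆ = (Y c h x).1 q ⁅Vir.L F m, w⁆ +
      ∑ t ∈ Finset.range N, Ring.choose (m + 1) t •
        (Y c h ⁅Vir.L F (t - 1), x⁆).1 (m + 1 + q - t) w := by
  obtain ⟨N, hN⟩ := (isVirField_field (c := c) (h := h)).exists_comm_Y x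
  refine ⟨N, fun m q w => ?_⟩
  have := hN N le_rfl (m + 1) q w
  rw [sub_eq_iff_eq_add] at this
  simp only [field_apply, add_sub_cancel_right] at this
  rw [add_comm]
  exact this

/-- The values of all fields attached to elements of W span a submodule of L(c,h), since W is stable
under the Lₙ. Under the hypothesis this span has no component of degree zero, so it misses the
generator and is zero by simplicity. -/
theorem isGood_field (hgen₀ : Verma.gen c 0 ≠ 0) (hgen : Verma.gen c h ≠ 0)
    (H : ∀ s, ∀ x ∈ Verma.deg c 0 s, x ∈ Verma.maxGraded c 0 →
      (Y c h x).1 (s - 1) (gen c h) = 0) :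
    (isVirField_field (c := c) (h := h)).IsGood := by
  -- the degree zero components vanish
  have h0 : ∀ y : VirIrr c h, ∀ x ∈ Verma.maxGraded c 0, ∀ n,
      split hgen ((Y c h x).1 n y) 0 = 0 := by
    intro y
    induction y using induction_neg with
    | hgen =>
      intro x hx n
      have hx' : ∀ k, split hgen ((Y c h (Verma.split c 0 x k)).1 n (gen c h)) 0 = 0 := by
        intro k
        have hk := (Verma.isGrading (c := c) (h := 0)).mem x k
        by_cases hn : n = k - 1
        · rw [hn, H k _ hk (Verma.split_mem_maxGraded hgen₀ hx k), LinearMap.map_zero, Finsupp.zero_apply]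
        · have := (isVirField_field (c := c) (h := h)).hasWeight_Y hasWeight_field hk n 0 _
            gen_mem_deg
          have e := (isGrading hgen).eq_single _ _ this
          rw [Y, e, Finsupp.single_apply, if_neg (by omega)]
      have hs := (Verma.isGrading (c := c) (h := 0)).sum_eq x
      rw [← hs, Finsupp.sum, map_sum, Fld.sum_apply, map_sum, Finsupp.finsetSum_apply]
      exact Finset.sum_eq_zero fun k _ => hx' k
    | h0 => intro x _ n; rw [LinearMap.map_zero, LinearMap.map_zero, Finsupp.zero_apply]
    | hL k m y hk hy ih =>
      intro x hx n
      obtain ⟨N, hN⟩ := exists_comm_Y (c := c) (h := h) x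
      have h1 := hN (-k) n y
      rw [← sub_eq_iff_eq_add] at h1
      rw [← h1, map_sub, Finsupp.sub_apply, split_lie, map_sum, Finsupp.finsetSum_apply,
        Finset.sum_eq_zero, sub_zero]
      -- Once L₋ₖ stands on the left, the component of degree zero comes from a component of degree
      -- -k, which is zero; the commutator terms are modes of other elements of W on the shorter
      -- word.
      · have h2 := (isGrading hgen).mem ((Y c h x).1 n y) (0 + -k)
        rw [deg_neg (by omega), Submodule.mem_bot] at h2
        rw [h2, lie_zero]
      · intro t _
        rw [map_zsmul, Finsupp.smul_apply, ih _ ((Verma.maxGraded c 0).lie_mem hx), smul_zero]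
    | hadd y z hy hz =>
      intro x hx n
      rw [map_add, map_add, Finsupp.add_apply, hy x hx, hz x hx, add_zero]
    | hsmul a y hy =>
      intro x hx n
      rw [map_smul, map_smul, Finsupp.smul_apply, hy x hx, smul_zero]
  let N : Submodule F (VirIrr c h) :=
    Submodule.span F {w | ∃ x ∈ Verma.maxGraded c 0, ∃ n y, w = (Y c h x).1 n y}
  have hN : N = ⊥ := by
    refine (eq_bot_or_eq_top hgen N fun m w hw => ?_).resolve_right fun htop => ?_
    · induction hw using Submodule.span_induction with
      | mem w hw =>
        obtain ⟨x, hx, n, y, rfl⟩ := hw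
        obtain ⟨K, hK⟩ := exists_comm_Y (c := c) (h := h) x
        rw [hK]
        refine add_mem (Submodule.subset_span ⟨x, hx, n, _, rfl⟩)
          (sum_mem fun t _ => Submodule.smul_of_tower_mem _ _ (Submodule.subset_span
            ⟨_, (Verma.maxGraded c 0).lie_mem hx, _, _, rfl⟩))
      | zero => rw [lie_zero]; exact zero_mem _
      | add x y _ _ hx hy => rw [lie_add]; exact add_mem hx hy
      | smul a x _ hx => rw [lie_smul]; exact Submodule.smul_mem _ a hx
    · have hg : gen c h ∈ N := by rw [htop]; trivial
      have hz : ∀ w ∈ N, split hgen w 0 = 0 := by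
        intro w hw
        induction hw using Submodule.span_induction with
        | mem w hw =>
          obtain ⟨x, hx, n, y, rfl⟩ := hw
          exact h0 y x hx n
        | zero => rw [LinearMap.map_zero, Finsupp.zero_apply]
        | add x y _ _ hx hy => rw [map_add, Finsupp.add_apply, hx, hy, add_zero]
        | smul a x _ hx => rw [map_smul, Finsupp.smul_apply, hx, smul_zero]
      have := hz _ hg
      rw [(isGrading hgen).eq_single _ _ gen_mem_deg, Finsupp.single_eq_same] at this
      exact gen_ne_zero hgen this
  intro x hx
  refine ext' fun n w => ?_
  have : (Y c h x).1 n w ∈ N := Submodule.subset_span ⟨x, hx, n, w, rfl⟩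
  rw [hN, Submodule.mem_bot] at this
  exact this

/-! ### The vacuum module -/

/-- L₁L₋₁ acts on the generator as 2L₀, which is zero, so L₋₁ of the generator is singular and hence
of degree zero. It is also of degree one. -/
theorem lie_L_neg_one_gen (hgen : Verma.gen c 0 ≠ 0) : ⁅Vir.L F (-1), gen c 0⁆ = 0 := by
  have h1 : ⁅Vir.L F (-1), gen c 0⁆ ∈ deg c 0 0 := by
    refine mem_deg_zero_of_lie_eq_zero hgen fun n hn => ?_
    rw [lie_L_L, lie_L_pos_gen hn, lie_zero, zero_add]
    have e : (if n + -1 = 0 then (virCoeff F n * c) • gen c 0 else 0) = 0 := by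
      split_ifs with h
      · obtain rfl : n = 1 := by omega
        simp [virCoeff]
      · rfl
    rw [e, add_zero]
    rcases (show n = 1 ∨ 1 < n by omega) with rfl | h
    · have : (1 : ℤ) + -1 = 0 := by norm_num
      rw [this, lie_L_zero_gen, zero_smul, smul_zero]
    · rw [lie_L_pos_gen (by omega), smul_zero]
  have h2 : ⁅Vir.L F (-1), gen c 0⁆ ∈ deg c 0 1 := by
    simpa using lie_L_mem_deg (-1) (gen_mem_deg (c := c) (h := 0))
  have e1 := (isGrading hgen).eq_single _ _ h1
  have e2 := (isGrading hgen).eq_single _ _ h2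
  have := congrArg (fun f => f 1) (e1.symm.trans e2)
  simpa using this.symm

theorem field_gen_eq_zero (hgen : Verma.gen c 0 ≠ 0) {n : ℤ} (hn : 0 ≤ n) :
    (field c 0).1 n (gen c 0) = 0 := by
  rw [field_apply]
  rcases (show n = 0 ∨ n = 1 ∨ 1 < n by omega) with rfl | rfl | h
  · exact lie_L_neg_one_gen hgen
  · rw [sub_self, lie_L_zero_gen, zero_smul]
  · exact lie_L_pos_gen (by omega)

theorem Y_lie_gen (hgen : Verma.gen c 0 ≠ 0) (m n : ℤ) (x : Verma c 0) :
    (Y c 0 ⁅Vir.L F m, x⁆).1 n (gen c 0) = P (field c 0) (Y c 0 x) (m + 1) 0 n (gen c 0) := by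
  rw [Y_lie, nprod_apply, J, P_eq_zero (Y c 0 x) _ _ _ fun k hk => field_gen_eq_zero hgen hk,
    smul_zero, sub_zero]

theorem Y_gen_eq_zero (hgen : Verma.gen c 0 ≠ 0) (x : Verma c 0) {n : ℤ} (hn : 0 ≤ n) :
    (Y c 0 x).1 n (gen c 0) = 0 := by
  induction x using Verma.induction generalizing n with
  | hgen => rw [Y, IsVirField.Y_gen, one_apply, if_neg (by omega)]
  | hL m x hx =>
    rw [Y_lie_gen hgen, P_eq_zero]
    exact fun k hk => hx (le_trans hn hk)
  | hadd x y hx hy =>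
    rw [map_add]
    change (Y c 0 x).1 n _ + (Y c 0 y).1 n _ = 0
    rw [hx hn, hy hn, add_zero]
  | hsmul a x hx =>
    rw [map_smul]
    change a • (Y c 0 x).1 n _ = 0
    rw [hx hn, smul_zero]

theorem Y_neg_one_gen (hgen : Verma.gen c 0 ≠ 0) (x : Verma c 0) :
    (Y c 0 x).1 (-1) (gen c 0) = mk c 0 x := by
  induction x using Verma.induction with
  | hgen => rw [Y, IsVirField.Y_gen, one_apply, if_pos rfl, mk_gen]
  | hL m x hx =>
    rw [Y_lie_gen hgen, P_eq_sum (B := 1)]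
    · simp [hx, field_apply, mk_lie]
    · intro i hi
      exact Y_gen_eq_zero hgen x (by omega)
  | hadd x y hx hy => rw [map_add, map_add, ← hx, ← hy]; rfl
  | hsmul a x hx => rw [map_smul, map_smul, ← hx]; rfl

/-- In positive degree s the relevant mode s - 1 is nonnegative and kills the vacuum; in degree at
most zero the maximal graded submodule has no nonzero homogeneous elements. -/
theorem isGood_field_zero (hgen : Verma.gen c 0 ≠ 0) :
    (isVirField_field (c := c) (h := 0)).IsGood := by
  refine isGood_field hgen hgen fun s x hx hxW => ?_
  rcases le_or_gt 1 s with hs | hs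
  · exact Y_gen_eq_zero hgen x (by omega)
  · have hx0 : x = 0 := by
      rcases (show s < 0 ∨ s = 0 by omega) with h | rfl
      · rwa [Verma.deg_neg h, Submodule.mem_bot] at hx
      · have h1 := Verma.split_zero_of_mem_maxGraded hgen hxW
        rwa [Verma.isGrading.eq_single _ _ hx, Finsupp.single_eq_same] at h1
    rw [hx0, map_zero]
    rfl

end VirIrr

namespace Fld.IsVirField

variable {F M : Type*} [Field F] [AddCommGroup M] [Module F M] {c : F} {ω : Fld F M}
  {H : IsVirField c ω}

/-- Negative modes on the vacuum are divided translates, and translation becomes differentiation of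
fields; both sides expand by the same Leibniz rule. -/
theorem IsGood.irrY_neg_gen (hgen : Verma.gen c 0 ≠ 0) (hH : H.IsGood) (u : Verma c 0) (j : ℕ) :
    hH.irrY ((VirIrr.Y c 0 u).1 (-j - 1) (VirIrr.gen c 0)) = hderiv j (H.Y u) := by
  induction u using Verma.induction generalizing j with
  | hgen =>
    rw [VirIrr.Y, Y_gen, Y_gen, ← nprod_one_neg, nprod_one_left, one_apply]
    split_ifs
    · exact hH.irrY_gen
    · exact map_zero _
  | hL m x hx =>
    rw [VirIrr.Y_lie_gen hgen, P_eq_sum (B := j + 1), map_sum, Y_lie, hderiv_nprod]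
    · refine Finset.sum_congr rfl fun i hi => ?_
      rw [Finset.mem_range] at hi
      have e : -(j : ℤ) - 1 + i = -((j - i : ℕ) : ℤ) - 1 := by omega
      rw [map_zsmul, VirIrr.field_apply, hH.irrY_lie, e, hx, sgnChoose]
      congr 2
      ring
    · intro i hi
      exact VirIrr.Y_gen_eq_zero hgen x (by omega)
  | hadd x y hx hy =>
    rw [map_add, map_add, ← nprod_one_neg, add_nprod, nprod_one_neg, nprod_one_neg, ← hx, ← hy,
      ← map_add hH.irrY]
    rfl
  | hsmul a x hx =>
    rw [map_smul, map_smul, ← nprod_one_neg, smul_nprod, nprod_one_neg, ← hx, ← map_smul hH.irrY]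
    rfl

/-- Products of fields are given by the modes on the vacuum module. -/
theorem IsGood.irrY_mode (hgen : Verma.gen c 0 ≠ 0) (hH : H.IsGood) (u v : Verma c 0) (l : ℤ) :
    hH.irrY ((VirIrr.Y c 0 u).1 l (VirIrr.mk c 0 v)) = nprod l (H.Y u) (H.Y v) := by
  induction v using Verma.induction generalizing u l with
  | hgen =>
    rw [Y_gen, VirIrr.mk_gen]
    rcases le_or_gt 0 l with hl | hl
    · rw [VirIrr.Y_gen_eq_zero hgen u hl, map_zero, nprod_one_of_nonneg _ hl]
    · obtain ⟨j, rfl⟩ : ∃ j : ℕ, l = -j - 1 := ⟨(-1 - l).toNat, by omega⟩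
      rw [nprod_one_neg, irrY_neg_gen hgen]
  | hL m y hy =>
    obtain ⟨N₁, h₁⟩ := (VirIrr.isVirField_field (c := c) (h := 0)).exists_comm_Y u
    obtain ⟨N₂, h₂⟩ := H.exists_comm_Y u
    -- The commutator formulas on the vacuum module and on M are cut off at the same bound, so that
    -- they match term by term.
    have e₁ := h₁ (max N₁ N₂) (le_max_left _ _) (m + 1) l (VirIrr.mk c 0 y)
    have e₂ := nprod_comm (h₂ (max N₁ N₂) (le_max_right _ _)) (H.Y y) (m + 1) l
    rw [sub_eq_iff_eq_add', ← sub_eq_iff_eq_add] at e₁ e₂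
    rw [VirIrr.field_apply, VirIrr.field_apply, add_sub_cancel_right, ← VirIrr.mk_lie] at e₁
    rw [Y_lie, ← e₂]
    change hH.irrY (((VirIrr.isVirField_field (c := c) (h := 0)).Y u).1 l _) = _
    rw [← e₁, map_sub, hH.irrY_lie, map_sum]
    congr 1
    · congr 1
      exact hy u l
    · refine Finset.sum_congr rfl fun t _ => ?_
      rw [map_zsmul]
      congr 1
      exact hy _ _
  | hadd x y hx hy => rw [map_add, map_add, map_add, map_add, nprod_add, hx, hy]
  | hsmul a x hx => rw [map_smul, map_smul, map_smul, map_smul, nprod_smul, hx]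

end Fld.IsVirField
end

noncomputable section

open Fld

/-! ### The vertex operator algebra L(c,0) and its modules L(c,h). -/

namespace Fld.IsVirField

variable {F M : Type*} [Field F] [AddCommGroup M] [Module F M] {c : F} {ω : Fld F M}
  {H : IsVirField c ω}

/-- The modes of the vectors of the vacuum module. -/
def IsGood.modes (hH : H.IsGood) : VirIrr c 0 →ₗ[F] (ℤ → Module.End F M) :=
  (Fld F M).subtype ∘ₗ hH.irrY

theorem IsGood.modes_apply (hH : H.IsGood) (u : VirIrr c 0) (n : ℤ) (w : M) :
    hH.modes u n w = (hH.irrY u).1 n w := rfl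

theorem IsGood.modes_omega (hH : H.IsGood) (n : ℤ) (w : M) :
    hH.modes ⁅Vir.L F (-2), VirIrr.gen c 0⁆ n w = ω.1 n w := by
  rw [modes_apply, ← VirIrr.mk_gen, ← VirIrr.mk_lie, irrY_mk, Y_omega]

theorem IsGood.modes_gen (hH : H.IsGood) (n : ℤ) (w : M) :
    hH.modes (VirIrr.gen c 0) n w = if n = -1 then w else 0 := by
  rw [modes_apply, irrY_gen, one_apply]

/-- Locality gives the Jacobi identity with products of fields on the right; `irrY_mode` identifies
these with the fields of the products of vectors. -/
theorem IsGood.jacobi (hgen : Verma.gen c 0 ≠ 0) (hH : H.IsGood) :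
    JacobiIdentity (VirIrr.isGood_field_zero hgen).modes hH.modes := by
  intro u v w l m n
  obtain ⟨u, rfl⟩ := VirIrr.mk_surjective u
  obtain ⟨v, rfl⟩ := VirIrr.mk_surjective v
  simp only [modes_apply]
  rw [irrY_mk, irrY_mk, irrY_mk, ← J_eq_finsum, (H.isLocal_Y u v).jacobi]
  refine finsum_congr fun i => ?_
  rw [← hH.irrY_mode hgen]
  rfl

theorem IsGood.hasWeight (hH : H.IsGood) {D : ℤ → Submodule F M} (hD : HasWeight D 2 ω) {s : ℤ}
    {u : VirIrr c 0} (hu : u ∈ VirIrr.deg c 0 s) : HasWeight D s (hH.irrY u) := by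
  obtain ⟨u, hu, rfl⟩ := hu
  change HasWeight D s (hH.irrY (VirIrr.mk c 0 u))
  rw [irrY_mk]
  exact H.hasWeight_Y hD hu

end Fld.IsVirField

namespace VirIrr

variable {F : Type*} [Field F] {c h : F}

/-- The vertex operator algebra `L(c,0)`. -/
def voa (hgen : Verma.gen c 0 ≠ 0) : VertexOperatorAlgebra F (VirIrr c 0) where
  Y := (isGood_field_zero hgen).modes
  deg := deg c 0
  vac := gen c 0
  ω := ⁅Vir.L F (-2), gen c 0⁆
  c := c
  isInternal := (isGrading hgen).isInternal
  finite_deg := finite_deg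
  bounded_below := ⟨0, fun _ hn => deg_neg hn⟩
  vac_mem := gen_mem_deg
  ω_mem := by simpa using lie_L_mem_deg (-2) (gen_mem_deg (c := c) (h := 0))
  mode_mem s t n u v hu hv := by
    have := (isGood_field_zero hgen).hasWeight hasWeight_field hu n t v hv
    rwa [add_comm t s] at this
  truncation u v := ((isGood_field_zero hgen).irrY u).2 v
  vacuum n v := (isGood_field_zero hgen).modes_gen n v
  creation v := by
    obtain ⟨v, rfl⟩ := mk_surjective v
    simp only [IsVirField.IsGood.modes_apply, IsVirField.IsGood.irrY_mk]
    exact ⟨fun n hn => Y_gen_eq_zero hgen v hn, Y_neg_one_gen hgen v⟩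
  virasoro m n v := by
    simp only [IsVirField.IsGood.modes_omega]
    exact IsVirRep.comm isVirField_field m n v
  derivative v w n := by
    obtain ⟨v, rfl⟩ := mk_surjective v
    rw [IsVirField.IsGood.modes_omega, field_apply, IsVirField.IsGood.modes_apply,
      IsVirField.IsGood.modes_apply, ← mk_lie, IsVirField.IsGood.irrY_mk,
      IsVirField.IsGood.irrY_mk]
    have := (isVirField_field (c := c) (h := 0)).Y_lie_neg_one v
    have e : (0 : ℤ) - 1 = -1 := by norm_num
    rw [e, this, hderiv_apply, sgnChoose, Ring.choose_one_right]
    simp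
  degree n v hv := by
    rw [IsVirField.IsGood.modes_omega, field_apply, sub_self, lie_L_zero hv, zero_add,
      Int.cast_smul_eq_zsmul]
  jacobi := (isGood_field_zero hgen).jacobi hgen

theorem voa_isVirasoro (hgen : Verma.gen c 0 ≠ 0) : (voa hgen).IsVirasoro where
  vac_eq := rfl
  ω_eq := rfl
  mode_ω n x := by
    refine ((isGood_field_zero hgen).modes_omega (n + 1) x).trans ?_
    rw [field_apply, add_sub_cancel_right]
  c_eq := rfl
  deg_eq _ := rfl

/-- The admissible module `L(c,h)`. -/
def admissible (hgen₀ : Verma.gen c 0 ≠ 0) (hgen : Verma.gen c h ≠ 0)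
    (hH : (isVirField_field (c := c) (h := h)).IsGood) :
    AdmissibleModule (voa hgen₀) (VirIrr c h) where
  Y := hH.modes
  truncation u w := (hH.irrY u).2 w
  vacuum n w := hH.modes_gen n w
  jacobi := hH.jacobi hgen₀
  gr := deg c h
  gr_neg _ hn := deg_neg hn
  isInternal := (isGrading hgen).isInternal
  mode_mem _ m n _ w hu hw := hH.hasWeight hasWeight_field hu m n w hw

theorem admissible_isStandard (hgen₀ : Verma.gen c 0 ≠ 0) (hgen : Verma.gen c h ≠ 0)
    (hH : (isVirField_field (c := c) (h := h)).IsGood) :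
    (admissible hgen₀ hgen hH).IsStandard := by
  refine ⟨fun n w => ?_, fun _ => rfl⟩
  refine (hH.modes_omega (n + 1) w).trans ?_
  rw [field_apply, add_sub_cancel_right]

theorem isIrreducible_of_extendsVir {V : VertexOperatorAlgebra F (VirIrr c 0)}
    (hgen : Verma.gen c h ≠ 0) {W : WeakModule V (VirIrr c h)} (hW : W.ExtendsVir) :
    W.IsIrreducible := by
  refine ⟨⟨gen c h, 0, gen_ne_zero hgen⟩, fun N hN => ?_⟩
  refine eq_bot_or_eq_top hgen N fun n x hx => ?_
  rw [← hW]
  exact hN _ _ x hx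

/-- An isomorphism sends the generator to a singular vector, hence into degree zero, where L₀ acts
as h'. -/
theorem eq_of_isIsomorphic {V : VertexOperatorAlgebra F (VirIrr c 0)} {h' : F}
    (hgen : Verma.gen c h ≠ 0) (hgen' : Verma.gen c h' ≠ 0) {W : WeakModule V (VirIrr c h)}
    {W' : WeakModule V (VirIrr c h')} (hW : W.ExtendsVir) (hW' : W'.ExtendsVir)
    (hiso : W.IsIsomorphic W') : h = h' := by
  obtain ⟨e, he⟩ := hiso
  have he' : ∀ n w, e ⁅Vir.L F n, w⁆ = ⁅Vir.L F n, e w⁆ := fun n w => by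
    rw [← hW, ← hW', he]
  have h1 : e (gen c h) ∈ deg c h' 0 := by
    refine mem_deg_zero_of_lie_eq_zero hgen' fun n hn => ?_
    rw [← he', lie_L_pos_gen hn, map_zero]
  have h2 := lie_L_zero h1
  rw [← he', lie_L_zero_gen, map_smul] at h2
  have h3 : e (gen c h) ≠ 0 := by
    rw [Ne, LinearEquiv.map_eq_zero_iff]
    exact gen_ne_zero hgen
  rw [← sub_eq_zero, ← sub_smul, smul_eq_zero] at h2
  have h4 := h2.resolve_right h3
  rw [Int.cast_zero, add_zero, sub_eq_zero] at h4
  exact h4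

end VirIrr

/-! ### Weak modules -/

namespace WeakModule

variable {F : Type*} [Field F] {c : F} {V : VertexOperatorAlgebra F (VirIrr c 0)} {M : Type*}
  [AddCommGroup M] [Module F M] (W : WeakModule V M)

/-- The vertex operators as fields. -/
def fld (u : VirIrr c 0) : Fld F M := ⟨W.Y u, W.truncation u⟩

theorem fld_apply (u : VirIrr c 0) (n : ℤ) (w : M) : (W.fld u).1 n w = W.Y u n w := rfl

theorem fld_add (u v : VirIrr c 0) : W.fld (u + v) = W.fld u + W.fld v :=
  Subtype.ext (map_add W.Y u v)

theorem fld_smul (a : F) (u : VirIrr c 0) : W.fld (a • u) = a • W.fld u :=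
  Subtype.ext (map_smul W.Y a u)

theorem fld_zero : W.fld 0 = 0 := Subtype.ext (map_zero W.Y)

theorem fld_jacobi (u v : VirIrr c 0) (l m n : ℤ) (w : M) : J (W.fld u) (W.fld v) l m n w =
    ∑ᶠ i : ℕ, (Ring.choose m i : ℤ) • (W.fld (V.Y u (l + i) v)).1 (m + n - i) w := by
  rw [J_eq_finsum]
  exact W.jacobi u v w l m n

theorem fld_nprod (u v : VirIrr c 0) (l : ℤ) :
    nprod l (W.fld u) (W.fld v) = W.fld (V.Y u l v) := by
  refine ext' fun n w => ?_
  rw [nprod_apply, fld_jacobi, finsum_eq_single _ 0]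
  · simp
  · intro i hi
    rw [Ring.choose_zero_pos ℤ (by omega), zero_smul]

theorem fld_vac : W.fld V.vac = one F M :=
  ext' fun n w => by rw [fld_apply, W.vacuum, one_apply]

theorem fld_lie (hV : V.IsVirasoro) (n : ℤ) (x : VirIrr c 0) :
    W.fld ⁅Vir.L F n, x⁆ = nprod (n + 1) (W.fld V.ω) (W.fld x) := by
  rw [fld_nprod, hV.mode_ω]

/-- By the Jacobi identity with l = 0 the commutators of the modes of ω are given by the vectors
ω₀ω, ω₁ω, ... of L(c,0), which are L₋₁ω, 2ω, 0, (c/2)·1 and then 0. So the relations hold on every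
weak module, with no assumption on the Virasoro action. -/
theorem isVirField_fld (hV : V.IsVirasoro) : IsVirField c (W.fld V.ω) := by
  have hgen1 : ⁅Vir.L F (-1), VirIrr.gen c 0⁆ = 0 := by
    have := (V.creation V.ω).1 0 le_rfl
    rw [hV.vac_eq] at this
    have h2 := hV.mode_ω (-1) (VirIrr.gen c 0)
    rw [← h2]
    exact this
  have hpos : ∀ n : ℤ, 0 ≤ n → ⁅Vir.L F n, VirIrr.gen c 0⁆ = 0 := by
    intro n hn
    rcases eq_or_lt_of_le hn with rfl | h
    · rw [VirIrr.lie_L_zero_gen, zero_smul]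
    · exact VirIrr.lie_L_pos_gen h
  have hone : W.fld (VirIrr.gen c 0) = one F M := by rw [← hV.vac_eq, fld_vac]
  have hω : W.fld ⁅Vir.L F (-2), VirIrr.gen c 0⁆ = W.fld V.ω := by rw [hV.ω_eq]
  have hprod : ∀ t : ℕ, W.fld (V.Y V.ω (0 + t) V.ω) =
      if t < 4 then virComm c (W.fld V.ω) t else 0 := by
    intro t
    have h1 : V.Y V.ω (0 + t) V.ω = ⁅Vir.L F (t - 1), ⁅Vir.L F (-2), VirIrr.gen c 0⁆⁆ := by
      have := hV.mode_ω ((t : ℤ) - 1) V.ω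
      rw [sub_add_cancel] at this
      rw [zero_add, this, hV.ω_eq]
    match t with
    | 0 =>
      have h2 := W.fld_nprod V.ω V.vac (-2)
      -- The derivative and creation axioms express L₋₁ω as a product of ω with the vacuum, whose
      -- field is a derivative.
      have h3 : V.Y V.ω (-2) V.vac = ⁅Vir.L F (-1), V.ω⁆ := by
        have h4 := (V.creation (V.Y V.ω 0 V.ω)).2
        rw [V.derivative] at h4
        have h5 := hV.mode_ω (-1) V.ω
        rw [← h5]
        simpa using h4
      rw [h3, fld_vac] at h2
      rw [h1, ← hV.ω_eq]
      have e : ((0 : ℕ) : ℤ) - 1 = -1 := by norm_num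
      rw [e, ← h2, if_pos (by norm_num)]
      exact nprod_one_neg _ 1
    | 1 =>
      have e : ((1 : ℕ) : ℤ) - 1 = 0 := by norm_num
      have h2 : ⁅Vir.L F (-2), VirIrr.gen c 0⁆ ∈ VirIrr.deg c 0 2 := by
        simpa using VirIrr.lie_L_mem_deg (-2) (VirIrr.gen_mem_deg (c := c) (h := 0))
      rw [h1, e, VirIrr.lie_L_zero h2, zero_add, fld_smul, hω, if_pos (by norm_num)]
      change _ = (2 : ℤ) • W.fld V.ω
      exact Int.cast_smul_eq_zsmul F (2 : ℤ) (W.fld V.ω)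
    | 2 =>
      have e : ((2 : ℕ) : ℤ) - 1 = 1 := by norm_num
      have e' : (1 : ℤ) + -2 = -1 := by norm_num
      rw [h1, e, VirIrr.lie_L_L, hpos 1 (by norm_num), e', hgen1, if_neg (by norm_num)]
      simp only [lie_zero, smul_zero, add_zero, fld_zero]
      rfl
    | 3 =>
      have e : ((3 : ℕ) : ℤ) - 1 = 2 := by norm_num
      have e' : (2 : ℤ) + -2 = 0 := by norm_num
      have e2 : virCoeff F 2 = 1 / 2 := by
        norm_num [virCoeff]
      rw [h1, e, VirIrr.lie_L_L, hpos 2 (by norm_num), e', hpos 0 le_rfl, if_pos rfl, lie_zero,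
        smul_zero, zero_add, zero_add, fld_smul, hone, if_pos (by norm_num), e2]
      change _ = (c / 2) • one F M
      congr 1
      ring
    | t + 4 =>
      rw [h1, VirIrr.lie_L_L, hpos _ (by push_cast; omega), hpos _ (by push_cast; omega),
        if_neg (by push_cast; omega), if_neg (by omega)]
      simp only [lie_zero, smul_zero, add_zero, fld_zero]
  refine isVirField_of_comm fun p q w => ?_
  rw [← J_zero, fld_jacobi, finsum_eq_sum_range (B := 4)]
  · refine Finset.sum_congr rfl fun t ht => ?_
    rw [Finset.mem_range] at ht
    rw [hprod, if_pos ht]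
  · intro t ht
    rw [hprod, if_neg (by omega)]
    exact smul_zero _

/-- L(c,0) is generated from the vacuum by ω, and the Jacobi identity turns products of vectors into
products of fields; so a weak module is determined by the modes of ω. -/
theorem fld_mk (hV : V.IsVirasoro) (x : Verma c 0) :
    W.fld (VirIrr.mk c 0 x) = (W.isVirField_fld hV).Y x := by
  induction x using Verma.induction with
  | hgen => rw [IsVirField.Y_gen, VirIrr.mk_gen, ← hV.vac_eq, fld_vac]
  | hL n x hx => rw [IsVirField.Y_lie, VirIrr.mk_lie, fld_lie W hV, hx]
  | hadd x y hx hy => rw [map_add, map_add, fld_add, hx, hy]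
  | hsmul a x hx => rw [map_smul, map_smul, fld_smul, hx]

theorem isGood_fld (hV : V.IsVirasoro) : (W.isVirField_fld hV).IsGood := by
  intro x hx
  rw [← fld_mk W hV, VirIrr.mk_eq_zero.2 hx, fld_zero]

/-- Linear isomorphisms commuting with the Virasoro operators are isomorphisms. -/
theorem isIsomorphic_of_lie (hV : V.IsVirasoro) {M' : Type*} [AddCommGroup M'] [Module F M']
    (W' : WeakModule V M') (e : M ≃ₗ[F] M') (he : ∀ n w, e (W.Y V.ω n w) = W'.Y V.ω n (e w)) :
    W.IsIsomorphic W' := by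
  refine ⟨e, fun u n w => ?_⟩
  obtain ⟨x, rfl⟩ := VirIrr.mk_surjective u
  have := (W.isVirField_fld hV).map_Y (W'.isVirField_fld hV) (e := e.toLinearMap) he x n w
  rw [← fld_mk W hV, ← fld_mk W' hV] at this
  exact this

end WeakModule

/-! ### Uniqueness of the structure on L(c,0). -/

namespace VirIrr

variable {F : Type*} [Field F] {c : F}

/-- Any other structure is a weak module over itself with the same field for ω, hence with the same
fields throughout. -/
theorem voa_unique (hgen : Verma.gen c 0 ≠ 0) (V : VertexOperatorAlgebra F (VirIrr c 0))
    (hV : V.IsVirasoro) : V = voa hgen := by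
  let W : WeakModule V (VirIrr c 0) := ⟨V.Y, V.truncation, V.vacuum, V.jacobi⟩
  have hW : W.fld V.ω = field c 0 := by
    refine ext' fun n w => ?_
    have := hV.mode_ω (n - 1) w
    rw [sub_add_cancel] at this
    exact this
  have hY : V.Y = (voa hgen).Y := by
    ext u n w
    obtain ⟨x, rfl⟩ := mk_surjective u
    have h1 := W.fld_mk hV x
    have h2 := (W.isVirField_fld hV).map_Y (isVirField_field (c := c) (h := 0))
      (e := LinearMap.id) (fun n w => by rw [hW]; rfl) x n w
    rw [← h1] at h2
    refine h2.trans ?_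
    change _ = ((isGood_field_zero hgen).irrY (mk c 0 x)).1 n w
    rw [IsVirField.IsGood.irrY_mk]
    rfl
  exact VertexOperatorAlgebra.ext hY (funext hV.deg_eq) hV.vac_eq hV.ω_eq hV.c_eq

end VirIrr
end

noncomputable section

open Fld

/-! ### The singular vector of degree six -/

namespace Verma

variable (F : Type*) [Field F]

/-- The vector of degree six of `V(1/2,0)` that vanishes in the irreducible quotient. -/
def sing : Verma (1 / 2 : F) 0 :=
  (64 : F) • word _ _ [2, 2, 2] + (93 : F) • word _ _ [3, 3] - (264 : F) • word _ _ [4, 2]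
    - (108 : F) • word _ _ [6]

theorem sing_mem_deg : sing F ∈ deg (1 / 2 : F) 0 6 := by
  refine sub_mem (sub_mem (add_mem ?_ ?_) ?_) ?_ <;>
    refine Submodule.smul_mem _ _ (word_mem_deg ?_ ?_) <;> simp

end Verma

namespace VirIrr

variable {F : Type*} [Field F] {c h : F}

/-- Here and in `lie_neg_neg` the side conditions orient the commutation relations for rewriting:
nonnegative modes move right towards the vacuum, negative modes are put in increasing order. -/
theorem lie_pos_neg (m n : ℤ) (x : VirIrr c h) (_ : 0 ≤ m) (_ : n < 0) :
    ⁅Vir.L F m, ⁅Vir.L F n, x⁆⁆ = ⁅Vir.L F n, ⁅Vir.L F m, x⁆⁆ +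
      (((m : F) - n) • ⁅Vir.L F (m + n), x⁆ +
        if m + n = 0 then (virCoeff F m * c) • x else 0) := lie_L_L m n x

theorem lie_neg_neg (m n : ℤ) (x : VirIrr c h) (_ : m < 0) (_ : n < m) :
    ⁅Vir.L F m, ⁅Vir.L F n, x⁆⁆ = ⁅Vir.L F n, ⁅Vir.L F m, x⁆⁆ +
      (((m : F) - n) • ⁅Vir.L F (m + n), x⁆ +
        if m + n = 0 then (virCoeff F m * c) • x else 0) := lie_L_L m n x

/-- Direct computation shows that Lₙ kills the vector for n ≤ 6, and degree reasons do so for n > 6.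
Being singular it lies in degree zero, and it also lies in degree six, so it vanishes. The relation
L₋₁·1 = 0 allows words without the letter 1. -/
theorem mk_sing (h2 : (2 : F) ≠ 0) (hgen : Verma.gen (1 / 2 : F) 0 ≠ 0) :
    mk (1 / 2 : F) 0 (Verma.sing F) = 0 := by
  have hdeg : mk (1 / 2 : F) 0 (Verma.sing F) ∈ deg (1 / 2 : F) 0 6 :=
    mk_mem_deg (Verma.sing_mem_deg F)
  have hg0 : ∀ n : ℤ, -1 ≤ n → ⁅Vir.L F n, gen (1 / 2 : F) 0⁆ = 0 := by
    intro n hn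
    rcases (show n = -1 ∨ n = 0 ∨ 0 < n by omega) with rfl | rfl | h
    · exact lie_L_neg_one_gen hgen
    · rw [lie_L_zero_gen, zero_smul]
    · exact lie_L_pos_gen h
  have e2 : virCoeff F 2 = 1 / 2 := by norm_num [virCoeff]
  have e3 : virCoeff F 3 = 4 / 2 := by norm_num [virCoeff]
  have e4 : virCoeff F 4 = 10 / 2 := by norm_num [virCoeff]
  have e6 : virCoeff F 6 = 35 / 2 := by norm_num [virCoeff]
  have hw : mk (1 / 2 : F) 0 (Verma.sing F) = (64 : F) • ⁅Vir.L F (-2), ⁅Vir.L F (-2),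
      ⁅Vir.L F (-2), gen (1 / 2 : F) 0⁆⁆⁆ + (93 : F) • ⁅Vir.L F (-3), ⁅Vir.L F (-3),
      gen (1 / 2 : F) 0⁆⁆ - (264 : F) • ⁅Vir.L F (-4), ⁅Vir.L F (-2), gen (1 / 2 : F) 0⁆⁆
      - (108 : F) • ⁅Vir.L F (-6), gen (1 / 2 : F) 0⁆ := by
    simp [Verma.sing, Verma.word, mk_lie, mk_gen]
  have hzero : mk (1 / 2 : F) 0 (Verma.sing F) ∈ deg (1 / 2 : F) 0 0 := by
    refine mem_deg_zero_of_lie_eq_zero hgen fun n hn => ?_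
    rcases le_or_gt n 6 with hn6 | hn6
    · rw [hw]
      have : n = 1 ∨ n = 2 ∨ n = 3 ∨ n = 4 ∨ n = 5 ∨ n = 6 := by omega
      rcases this with rfl | rfl | rfl | rfl | rfl | rfl
      all_goals
        simp (disch := norm_num) only [lie_add, lie_sub, lie_smul, lie_pos_neg, lie_neg_neg, hg0,
          lie_zero, smul_zero, add_zero, zero_add, sub_zero]
        norm_num [e2, e3, e4, e6, hg0]
        try (match_scalars <;> field_simp <;> ring)
    · have := lie_L_mem_deg n hdeg
      rwa [deg_neg (by omega), Submodule.mem_bot] at this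
  have e1 := (isGrading hgen).eq_single _ _ hzero
  have e2 := (isGrading hgen).eq_single _ _ hdeg
  have := congrArg (fun f => f 6) (e1.symm.trans e2)
  simpa using this.symm

end VirIrr

/-! ### The cubic equation for L₀ on singular vectors. -/

namespace Fld.IsVirField

variable {F M : Type*} [Field F] [AddCommGroup M] [Module F M] {ω : Fld F M}

theorem Y_word_cons {c : F} (H : IsVirField c ω) {v : M} (hv : IsSingular ω v) (n : ℕ) (hn : 1 ≤ n)
    (l : List ℕ) (hl : ∀ k ∈ l, 1 ≤ k) (s : ℕ) (hs : l.sum = s) :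
    (H.Y (Verma.word c 0 (n :: l))).1 ((n + s : ℕ) - 1) v = (-1 : ℤ) ^ n •
      ((s : ℤ) • (H.Y (Verma.word c 0 l)).1 ((s : ℤ) - 1) v +
        ((n : ℤ) - 1) • (H.Y (Verma.word c 0 l)).1 ((s : ℤ) - 1) (ω.1 1 v)) := by
  have := (H.Y_singular hv (Verma.word_mem_deg hl (n := s) (by rw [hs]))).2 n hn
  have e : ((n + s : ℕ) : ℤ) - 1 = s + n - 1 := by push_cast; ring
  rw [← this, Verma.word_cons, e]

/-- The cubic equation for `L₀` on vectors killed by all `Lₙ` with `n > 0`. -/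
theorem IsGood.cubic {H : IsVirField (1 / 2 : F) ω} (h2 : (2 : F) ≠ 0)
    (hgen : Verma.gen (1 / 2 : F) 0 ≠ 0) (hH : H.IsGood) {v : M} (hv : IsSingular ω v) :
    (64 : F) • ω.1 1 (ω.1 1 (ω.1 1 v)) - (36 : F) • ω.1 1 (ω.1 1 v) + (2 : F) • ω.1 1 v = 0 := by
  have hs : ∀ {v}, IsSingular ω v → IsSingular ω (ω.1 1 v) := isSingular_apply_one H
  have h0 : ∀ v, (H.Y (Verma.word (1 / 2) 0 [])).1 (((0 : ℕ) : ℤ) - 1) v = v := by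
    intro v
    rw [Verma.word_nil, Y_gen, one_apply, if_pos (by norm_num)]
  have w2 : ∀ {v}, IsSingular ω v →
      (H.Y (Verma.word (1 / 2) 0 [2])).1 (((2 : ℕ) : ℤ) - 1) v = ω.1 1 v := by
    intro v hv
    have := H.Y_word_cons hv 2 (by norm_num) [] (by simp) 0 (by simp)
    rw [h0, h0] at this
    simpa using this
  have w3 : ∀ {v}, IsSingular ω v →
      (H.Y (Verma.word (1 / 2) 0 [3])).1 (((3 : ℕ) : ℤ) - 1) v = -(2 : ℤ) • ω.1 1 v := by
    intro v hv
    have := H.Y_word_cons hv 3 (by norm_num) [] (by simp) 0 (by simp)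
    rw [h0, h0] at this
    rw [this]
    push_cast
    module
  have w22 : ∀ {v}, IsSingular ω v →
      (H.Y (Verma.word (1 / 2) 0 [2, 2])).1 (((4 : ℕ) : ℤ) - 1) v =
        (2 : ℤ) • ω.1 1 v + ω.1 1 (ω.1 1 v) := by
    intro v hv
    have := H.Y_word_cons hv 2 (by norm_num) [2] (by simp) 2 (by simp)
    rw [w2 hv, w2 (hs hv)] at this
    rw [this]
    push_cast
    module
  have w222 : (H.Y (Verma.word (1 / 2) 0 [2, 2, 2])).1 (((6 : ℕ) : ℤ) - 1) v =
        (8 : ℤ) • ω.1 1 v + (6 : ℤ) • ω.1 1 (ω.1 1 v) + ω.1 1 (ω.1 1 (ω.1 1 v)) := by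
    have := H.Y_word_cons hv 2 (by norm_num) [2, 2] (by simp) 4 (by simp)
    rw [w22 hv, w22 (hs hv)] at this
    rw [this]
    push_cast
    module
  have w33 : (H.Y (Verma.word (1 / 2) 0 [3, 3])).1 (((6 : ℕ) : ℤ) - 1) v =
        (6 : ℤ) • ω.1 1 v + (4 : ℤ) • ω.1 1 (ω.1 1 v) := by
    have := H.Y_word_cons hv 3 (by norm_num) [3] (by simp) 3 (by simp)
    rw [w3 hv, w3 (hs hv)] at this
    rw [this]
    push_cast
    module
  have w42 : (H.Y (Verma.word (1 / 2) 0 [4, 2])).1 (((6 : ℕ) : ℤ) - 1) v =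
        (2 : ℤ) • ω.1 1 v + (3 : ℤ) • ω.1 1 (ω.1 1 v) := by
    have := H.Y_word_cons hv 4 (by norm_num) [2] (by simp) 2 (by simp)
    rw [w2 hv, w2 (hs hv)] at this
    rw [this]
    push_cast
    module
  have w6 : (H.Y (Verma.word (1 / 2) 0 [6])).1 (((6 : ℕ) : ℤ) - 1) v = (5 : ℤ) • ω.1 1 v := by
    have := H.Y_word_cons hv 6 (by norm_num) [] (by simp) 0 (by simp)
    rw [h0, h0] at this
    rw [this]
    push_cast
    module
  have hz := hH (Verma.sing F) (VirIrr.mk_eq_zero.1 (VirIrr.mk_sing h2 hgen))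
  have hz' : (H.Y (Verma.sing F)).1 (((6 : ℕ) : ℤ) - 1) v = 0 := by rw [hz]; rfl
  rw [Verma.sing, map_sub, map_sub, map_add, map_smul, map_smul, map_smul, map_smul] at hz'
  change (64 : F) • (H.Y (Verma.word (1 / 2) 0 [2, 2, 2])).1 (((6 : ℕ) : ℤ) - 1) v +
    (93 : F) • (H.Y (Verma.word (1 / 2) 0 [3, 3])).1 (((6 : ℕ) : ℤ) - 1) v -
    (264 : F) • (H.Y (Verma.word (1 / 2) 0 [4, 2])).1 (((6 : ℕ) : ℤ) - 1) v -
    (108 : F) • (H.Y (Verma.word (1 / 2) 0 [6])).1 (((6 : ℕ) : ℤ) - 1) v = 0 at hz'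
  rw [w222, w33, w42, w6] at hz'
  rw [← hz']
  simp only [← Int.cast_smul_eq_zsmul F]
  push_cast
  module

theorem IsGood.weight_eq {H : IsVirField (1 / 2 : F) ω} (h2 : (2 : F) ≠ 0)
    (hgen : Verma.gen (1 / 2 : F) 0 ≠ 0) (hH : H.IsGood) {v : M} (hv : IsSingular ω v)
    (hv0 : v ≠ 0) {h : F} (hh : ω.1 1 v = h • v) : h = 0 ∨ h = 1 / 2 ∨ h = 1 / 16 := by
  have h1 := hH.cubic h2 hgen hv
  simp only [hh, map_smul, smul_smul] at h1
  rw [← sub_smul, ← add_smul, smul_eq_zero] at h1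
  have h16 : (16 : F) ≠ 0 := by
    have : (16 : F) = 2 ^ 4 := by norm_num
    rw [this]
    exact pow_ne_zero 4 h2
  have h3 : 2 * (h * ((2 * h - 1) * (16 * h - 1))) = 0 := by
    linear_combination h1.resolve_right hv0
  have h4 := (mul_eq_zero.1 h3).resolve_left h2
  rcases mul_eq_zero.1 h4 with h5 | h5
  · exact Or.inl h5
  rcases mul_eq_zero.1 h5 with h6 | h6
  · right; left
    rw [eq_div_iff h2]
    linear_combination h6
  · right; right
    rw [eq_div_iff h16]
    linear_combination h6

/-- No eigenvalue of L₀ is given in advance. With T = L₀ the last nonzero vector among v, Tv and (2T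
- 1)Tv is an eigenvector, with eigenvalue 0, 1/2 or 1/16, because the cubic is 2T(2T - 1)(16T - 1).
Membership in the span keeps it in the graded component of v. -/
theorem IsGood.exists_eigenvector {H : IsVirField (1 / 2 : F) ω} (h2 : (2 : F) ≠ 0)
    (hgen : Verma.gen (1 / 2 : F) 0 ≠ 0) (hH : H.IsGood) {v : M} (hv : IsSingular ω v)
    (hv0 : v ≠ 0) : ∃ h : F, ∃ u ∈ Submodule.span F {v, ω.1 1 v, ω.1 1 (ω.1 1 v)},
      u ≠ 0 ∧ ω.1 1 u = h • u := by
  have h16 : (16 : F) ≠ 0 := by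
    have : (16 : F) = 2 ^ 4 := by norm_num
    rw [this]
    exact pow_ne_zero 4 h2
  have m0 : v ∈ Submodule.span F {v, ω.1 1 v, ω.1 1 (ω.1 1 v)} :=
    Submodule.subset_span (by simp)
  have m1 : ω.1 1 v ∈ Submodule.span F {v, ω.1 1 v, ω.1 1 (ω.1 1 v)} :=
    Submodule.subset_span (by simp)
  have m2 : ω.1 1 (ω.1 1 v) ∈ Submodule.span F {v, ω.1 1 v, ω.1 1 (ω.1 1 v)} :=
    Submodule.subset_span (by simp)
  by_cases h1 : ω.1 1 v = 0
  · exact ⟨0, v, m0, hv0, by rw [h1, zero_smul]⟩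
  by_cases h3 : (2 : F) • ω.1 1 (ω.1 1 v) - ω.1 1 v = 0
  · refine ⟨1 / 2, _, m1, h1, ?_⟩
    rw [sub_eq_zero] at h3
    rw [← h3, smul_smul, one_div, inv_mul_cancel₀ h2, one_smul, h3]
  · refine ⟨1 / 16, _, sub_mem (Submodule.smul_mem _ (2 : F) m2) m1, h3, ?_⟩
    have h4 := hH.cubic h2 hgen hv
    have h5 : (2 : F) • ((16 : F) • ω.1 1 ((2 : F) • ω.1 1 (ω.1 1 v) - ω.1 1 v) -
        ((2 : F) • ω.1 1 (ω.1 1 v) - ω.1 1 v)) = 0 := by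
      rw [← h4, map_sub, map_smul]
      module
    have h6 := (smul_eq_zero.1 h5).resolve_left h2
    rw [sub_eq_zero] at h6
    nth_rewrite 2 [← h6]
    rw [smul_smul, one_div, inv_mul_cancel₀ h16, one_smul]

end Fld.IsVirField
end

noncomputable section

open Fld

/-! ### Classification of irreducible admissible modules. -/

namespace Verma

variable {F M : Type*} [Field F] [AddCommGroup M] [Module F M] {c h : F} {ω : Fld F M}

theorem map_mem_of_hasWeight {D : ℤ → Submodule F M} (hD : HasWeight D 2 ω)
    {φ : Verma c h →ₗ[F] M} (hφ : ∀ n x, φ ⁅Vir.L F n, x⁆ = ω.1 (n + 1) (φ x)) {r : ℤ}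
    (hr : φ (gen c h) ∈ D r) {k : ℤ} {x : Verma c h} (hx : x ∈ deg c h k) : φ x ∈ D (r + k) := by
  rw [deg_eq_span] at hx
  induction hx using Submodule.span_induction with
  | mem x hx =>
    obtain ⟨l, -, rfl, rfl⟩ := hx
    induction l with
    | nil => simpa [word_nil] using hr
    | cons m l ih =>
      rw [word_cons, hφ]
      convert hD _ _ _ ih using 2
      rw [List.sum_cons]
      push_cast
      ring
  | zero => rw [map_zero]; exact zero_mem _
  | add x y _ _ hx hy => rw [map_add]; exact add_mem hx hy
  | smul a x _ hx => rw [map_smul]; exact Submodule.smul_mem _ a hx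

end Verma

theorem AdmissibleModule.hasWeight_fld {F : Type*} [Field F] {c : F}
    {V : VertexOperatorAlgebra F (VirIrr c 0)} {M : Type*} [AddCommGroup M] [Module F M]
    (W : AdmissibleModule V M) : HasWeight W.gr 2 (W.fld V.ω) := by
  intro n k w hw
  exact W.mode_mem 2 n k V.ω w V.ω_mem hw

namespace AdmissibleModule

variable {F : Type*} [Field F] {c : F} {V : VertexOperatorAlgebra F (VirIrr c 0)} {M : Type*}
  [AddCommGroup M] [Module F M] (W : AdmissibleModule V M)

theorem isSubmodule_of_stable (hV : V.IsVirasoro) {N : Submodule F M}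
    (hN : ∀ n, ∀ w ∈ N, W.Y V.ω n w ∈ N) : W.IsSubmodule N := by
  intro u n w hw
  obtain ⟨x, rfl⟩ := VirIrr.mk_surjective u
  have := (W.isVirField_fld hV).Y_mem hN x n hw
  rw [← W.fld_mk hV] at this
  exact this

theorem exists_minimal (hM : Nontrivial M) : ∃ r : ℤ, W.gr r ≠ ⊥ ∧ ∀ k < r, W.gr k = ⊥ := by
  have hex : ∃ n : ℕ, W.gr n ≠ ⊥ := by
    by_contra hcon
    push Not at hcon
    have hbot : ∀ k, W.gr k = ⊥ := by
      intro k
      rcases lt_or_ge k 0 with hk | hk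
      · exact W.gr_neg k hk
      · lift k to ℕ using hk
        exact hcon k
    have htop := W.isInternal.submodule_iSup_eq_top
    rw [iSup_eq_bot.2 hbot] at htop
    exact bot_ne_top htop
  classical
  refine ⟨Nat.find hex, Nat.find_spec hex, fun k hk => ?_⟩
  rcases lt_or_ge k 0 with hk0 | hk0
  · exact W.gr_neg k hk0
  · lift k to ℕ using hk0
    have := Nat.find_min hex (m := k) (by exact_mod_cast hk)
    rwa [not_not] at this

theorem isSingular_of_mem {r : ℤ} (hr : ∀ k < r, W.gr k = ⊥) {v : M} (hv : v ∈ W.gr r) :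
    IsVirField.IsSingular (W.fld V.ω) v := by
  intro n hn
  have := W.hasWeight_fld n r v hv
  rwa [hr _ (by omega), Submodule.mem_bot] at this

/-- An irreducible admissible module with a singular eigenvector of `L₀` in its lowest component is
the irreducible highest weight module. -/
theorem exists_equiv (hV : V.IsVirasoro) (hW : W.IsGradedIrreducible) {r : ℤ} {u : M} {h : F}
    (hu : u ∈ W.gr r) (hu0 : u ≠ 0) (hr : ∀ k < r, W.gr k = ⊥)
    (hh : W.Y V.ω 1 u = h • u) : Verma.gen c h ≠ 0 ∧ ∃ e : M ≃ₗ[F] VirIrr c h,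
      ∀ n w, e (W.Y V.ω n w) = (VirIrr.field c h).1 n (e w) := by
  have hsing := W.isSingular_of_mem hr hu
  obtain ⟨φ, hφ0, hφ⟩ := Verma.exists_lift (h := h) (W.isVirField_fld hV) u
    (by rw [zero_add]; exact hh) (fun n hn => hsing _ (by omega))
  have hgen : Verma.gen c h ≠ 0 := by
    intro h0
    rw [h0, map_zero] at hφ0
    exact hu0 hφ0.symm
  have hφ' : ∀ n x, φ ⁅Vir.L F n, x⁆ = (W.fld V.ω).1 (n + 1) (φ x) := hφ
  have hdeg : ∀ {k x}, x ∈ Verma.deg c h k → φ x ∈ W.gr (r + k) := fun hx =>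
    Verma.map_mem_of_hasWeight W.hasWeight_fld hφ' (by rw [hφ0]; exact hu) hx
  have hsum : ∀ x, φ x = (Verma.split c h x).sum fun _ y => φ y := by
    intro x
    conv_lhs => rw [← Verma.isGrading.sum_eq x]
    rw [Finsupp.sum, map_sum, Finsupp.sum]
  -- images of graded submodules are graded submodules
  have hsub : ∀ N : LieSubmodule F (Vir F) (Verma c h),
      (∀ x ∈ N, ∀ k, Verma.split c h x k ∈ N) →
      N.toSubmodule.map φ = ⊥ ∨ N.toSubmodule.map φ = ⊤ := by
    intro N hN
    refine hW.2 _ (W.isSubmodule_of_stable hV ?_) (le_antisymm ?_ ?_)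
    · rintro n _ ⟨x, hx, rfl⟩
      have := hφ' (n - 1) x
      rw [sub_add_cancel] at this
      exact ⟨_, N.lie_mem hx, this⟩
    · rintro _ ⟨x, hx, rfl⟩
      rw [hsum]
      refine sum_mem fun k _ => ?_
      exact Submodule.mem_iSup_of_mem (r + k) ⟨⟨_, hN x hx k, rfl⟩,
        hdeg (Verma.isGrading.mem x k)⟩
    · exact iSup_le fun k => inf_le_left
  have hsurj : Function.Surjective φ := by
    rcases hsub ⊤ (fun _ _ _ => trivial) with hb | ht
    · exfalso
      apply hu0
      have : u ∈ (⊤ : LieSubmodule F (Vir F) (Verma c h)).toSubmodule.map φ :=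
        ⟨Verma.gen c h, trivial, hφ0⟩
      rwa [hb, Submodule.mem_bot] at this
    · intro w
      have : w ∈ (⊤ : LieSubmodule F (Vir F) (Verma c h)).toSubmodule.map φ := by
        rw [ht]; trivial
      obtain ⟨x, -, hx⟩ := this
      exact ⟨x, hx⟩
  classical
  let := W.isInternal.chooseDecomposition
  -- φ shifts degrees by r, so the lowest component of an image comes from degree zero, where it is
  -- a multiple of `u`.
  have hcomp : ∀ x, (DirectSum.decompose W.gr (φ x) r : M) = φ (Verma.split c h x 0) := by
    intro x
    rw [hsum, Finsupp.sum, DirectSum.decompose_sum, DFinsupp.finsetSum_apply,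
      AddSubmonoidClass.coe_finsetSum]
    rw [Finset.sum_eq_single 0]
    · exact DirectSum.decompose_of_mem_same _ (by simpa using hdeg (Verma.isGrading.mem x 0))
    · intro k _ hk
      exact DirectSum.decompose_of_mem_ne _ (hdeg (Verma.isGrading.mem x k)) (by omega)
    · intro h0
      rw [Finsupp.notMem_support_iff.1 h0, map_zero, DirectSum.decompose_zero]
      rfl
  -- If φ(x) = 0 then no product of the Lₘ applied to x has a component of degree zero, since φ is
  -- injective there; so x lies in the radical. Conversely, the image of the maximal graded
  -- submodule is a graded submodule that misses `u`, hence zero.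
  have hker : ∀ x, φ x = 0 ↔ x ∈ Verma.maxGraded c h := by
    intro x
    constructor
    · intro hx
      rw [Verma.maxGraded_eq_radical hgen, Verma.mem_radical]
      intro l
      have hact : φ (Verma.act (F := F) l x) = 0 := by
        induction l with
        | nil => exact hx
        | cons m l ih => rw [Verma.act_cons, hφ', ih, map_zero]
      have h1 := hcomp (Verma.act (F := F) l x)
      rw [hact, DirectSum.decompose_zero] at h1
      obtain ⟨a, ha⟩ := Verma.mem_deg_zero (Verma.isGrading.mem (Verma.act (F := F) l x) 0)
      rw [ha, map_smul, hφ0] at h1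
      rw [ha, (smul_eq_zero.1 h1.symm).resolve_right hu0, zero_smul]
    · intro hx
      rcases hsub (Verma.maxGraded c h) (fun _ => Verma.split_mem_maxGraded hgen) with hb | ht
      · have : φ x ∈ (Verma.maxGraded c h).toSubmodule.map φ := ⟨x, hx, rfl⟩
        rwa [hb, Submodule.mem_bot] at this
      · exfalso
        have : u ∈ (Verma.maxGraded c h).toSubmodule.map φ := by rw [ht]; trivial
        obtain ⟨y, hy, hyu⟩ := this
        have h1 := hcomp y
        rw [hyu, Verma.split_zero_of_mem_maxGraded hgen hy, map_zero,
          DirectSum.decompose_of_mem_same _ hu] at h1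
        exact hu0 h1
  refine ⟨hgen, ?_⟩
  obtain ⟨f, hf⟩ : ∃ f : VirIrr c h →ₗ[F] M, ∀ x, f (VirIrr.mk c h x) = φ x :=
    ⟨Submodule.liftQ (Verma.maxGraded c h).toSubmodule φ fun x hx => (hker x).2 hx, fun x =>
      Submodule.liftQ_apply (Verma.maxGraded c h).toSubmodule φ x⟩
  have hbij : Function.Bijective f := by
    constructor
    · rw [injective_iff_map_eq_zero]
      intro y hy
      obtain ⟨x, rfl⟩ := VirIrr.mk_surjective y
      rw [hf, hker] at hy
      exact VirIrr.mk_eq_zero.2 hy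
    · intro w
      obtain ⟨x, rfl⟩ := hsurj w
      exact ⟨_, hf x⟩
  let e := LinearEquiv.ofBijective f hbij
  refine ⟨e.symm, fun n w => ?_⟩
  rw [LinearEquiv.symm_apply_eq]
  obtain ⟨y, rfl⟩ := e.surjective w
  rw [LinearEquiv.symm_apply_apply, VirIrr.field_apply]
  obtain ⟨x, rfl⟩ := VirIrr.mk_surjective y
  rw [← VirIrr.mk_lie]
  change W.Y V.ω n (f _) = f _
  rw [hf, hf, hφ', sub_add_cancel]
  rfl

end AdmissibleModule

namespace VirIrr

variable {F : Type*} [Field F]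

/-- Classification of the irreducible admissible modules up to the determination of the highest
weights that occur. -/
theorem exists_equiv_of_isGradedIrreducible {V : VertexOperatorAlgebra F (VirIrr (1 / 2 : F) 0)}
    (hV : V.IsVirasoro) (h2 : (2 : F) ≠ 0) (hgen₀ : Verma.gen (1 / 2 : F) 0 ≠ 0)
    {M : Type*} [AddCommGroup M] [Module F M] (W : AdmissibleModule V M)
    (hW : W.IsGradedIrreducible) : ∃ h : F, (h = 0 ∨ h = 1 / 2 ∨ h = 1 / 16) ∧
      Verma.gen (1 / 2) h ≠ 0 ∧ (isVirField_field (c := 1 / 2) (h := h)).IsGood ∧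
      ∃ e : M ≃ₗ[F] VirIrr (1 / 2) h, ∀ n w, e (W.Y V.ω n w) = (field (1 / 2) h).1 n (e w) := by
  obtain ⟨r, hr0, hr⟩ := W.exists_minimal hW.1
  obtain ⟨v, hv, hv0⟩ := Submodule.exists_mem_ne_zero_of_ne_bot hr0
  have hgood := W.isGood_fld hV
  obtain ⟨h, u, hu, hu0, hh⟩ := hgood.exists_eigenvector h2 hgen₀ (W.isSingular_of_mem hr hv) hv0
  have hT : ∀ w ∈ W.gr r, (W.fld V.ω).1 1 w ∈ W.gr r := by
    intro w hw
    convert W.hasWeight_fld 1 r w hw using 2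
    ring
  have hur : u ∈ W.gr r := by
    refine Submodule.span_le.2 ?_ hu
    rintro x (rfl | rfl | rfl)
    · exact hv
    · exact hT _ hv
    · exact hT _ (hT _ hv)
  obtain ⟨hgen, e, he⟩ := W.exists_equiv hV hW hur hu0 hr hh
  refine ⟨h, hgood.weight_eq h2 hgen₀ (W.isSingular_of_mem hr hur) hu0 hh, hgen, ?_, e, he⟩
  -- Goodness is transported along the isomorphism: the fields on L(1/2,h) are conjugate to those on
  -- M, where elements of W act as zero.
  intro x hx
  refine ext' fun n w => ?_
  obtain ⟨y, rfl⟩ := e.surjective w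
  have := (W.isVirField_fld hV).map_Y (isVirField_field (c := 1 / 2) (h := h))
    (e := e.toLinearMap) he x n y
  refine this.symm.trans ?_
  rw [hgood x hx]
  exact map_zero _

theorem isIsomorphic_of_equiv {c h : F} {V : VertexOperatorAlgebra F (VirIrr c 0)}
    (hV : V.IsVirasoro) {M : Type*} [AddCommGroup M] [Module F M] {W : WeakModule V M}
    {W' : WeakModule V (VirIrr c h)} (hW' : W'.ExtendsVir) (e : M ≃ₗ[F] VirIrr c h)
    (he : ∀ n w, e (W.Y V.ω n w) = (field c h).1 n (e w)) : W.IsIsomorphic W' := by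
  refine W.isIsomorphic_of_lie hV W' e fun n w => ?_
  have := hW' (n - 1) (e w)
  rw [sub_add_cancel] at this
  rw [this, he, field_apply]

/-- The theorem, given the existence of the highest weight modules and of the module structures. -/
theorem main_of_isGood (hF : ringChar F ≠ 2) (hgen₀ : Verma.gen (1 / 2 : F) 0 ≠ 0)
    (hgen₁ : Verma.gen (1 / 2 : F) (1 / 2) ≠ 0) (hgen₂ : Verma.gen (1 / 2 : F) (1 / 16) ≠ 0)
    (hgood₁ : ringChar F ≠ 7 → (isVirField_field (c := 1 / 2) (h := (1 / 2 : F))).IsGood)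
    (hgood₂ : ringChar F ≠ 7 → (isVirField_field (c := 1 / 2) (h := (1 / 16 : F))).IsGood) :
    ∃ V : VertexOperatorAlgebra F (VirIrr (1 / 2 : F) 0),
      V.IsVirasoro ∧
      (∀ V' : VertexOperatorAlgebra F (VirIrr (1 / 2 : F) 0), V'.IsVirasoro → V' = V) ∧
      (∀ (M : Type*) [AddCommGroup M] [Module F M] [LieRingModule (Vir F) M]
          [LieModule F (Vir F) M] (h : F) (W : WeakModule V M),
          IsHighestWeightModule M (1 / 2 : F) h → W.ExtendsVir →
          (ringChar F ≠ 7 → h = 0 ∨ h = 1 / 2 ∨ h = 1 / 16) ∧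
          (ringChar F = 7 → h = 0 ∨ h = 1 / 2)) ∧
      (ringChar F ≠ 7 →
        ∃ (A₀ : AdmissibleModule V (VirIrr (1 / 2 : F) 0))
          (A₁ : AdmissibleModule V (VirIrr (1 / 2 : F) (1 / 2)))
          (A₂ : AdmissibleModule V (VirIrr (1 / 2 : F) (1 / 16))),
          A₀.IsStandard ∧ A₁.IsStandard ∧ A₂.IsStandard ∧
          A₀.IsIrreducible ∧ A₁.IsIrreducible ∧ A₂.IsIrreducible ∧
          ¬ A₀.IsIsomorphic A₁.toWeakModule ∧
          ¬ A₀.IsIsomorphic A₂.toWeakModule ∧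
          ¬ A₁.IsIsomorphic A₂.toWeakModule ∧
          ∀ (M : Type*) [AddCommGroup M] [Module F M] (W : AdmissibleModule V M),
            W.IsGradedIrreducible →
            W.IsIsomorphic A₀.toWeakModule ∨ W.IsIsomorphic A₁.toWeakModule ∨
              W.IsIsomorphic A₂.toWeakModule) ∧
      (ringChar F = 7 →
        ∀ (M : Type*) [AddCommGroup M] [Module F M] (W : AdmissibleModule V M),
          W.IsGradedIrreducible →
          (∃ A₀ : AdmissibleModule V (VirIrr (1 / 2 : F) 0),
            A₀.IsStandard ∧ W.IsIsomorphic A₀.toWeakModule) ∨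
          (∃ A₁ : AdmissibleModule V (VirIrr (1 / 2 : F) (1 / 2)),
            A₁.IsStandard ∧ W.IsIsomorphic A₁.toWeakModule)) := by
  have h2 : (2 : F) ≠ 0 := Ring.two_ne_zero hF
  have h16 : (16 : F) ≠ 0 := by
    have : (16 : F) = 2 ^ 4 := by norm_num
    rw [this]
    exact pow_ne_zero 4 h2
  have hV := voa_isVirasoro hgen₀
  -- In characteristic seven 16 = 2, so the second and third weights coincide.
  have h7 : ringChar F = 7 → (1 / 16 : F) = 1 / 2 := by
    intro h7
    have : ((7 : ℕ) : F) = 0 := by rw [← h7]; exact ringChar.Nat.cast_ringChar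
    rw [div_eq_div_iff h16 h2]
    push_cast at this
    linear_combination (-2) * this
  have h7' : ringChar F ≠ 7 → (7 : F) ≠ 0 := by
    intro h7 h0
    have hd : ringChar F ∣ 7 := by
      rw [← ringChar.spec]
      exact_mod_cast h0
    rcases (Nat.dvd_prime (by norm_num)).1 hd with h1 | h1
    · have := (ringChar.spec F 1).2 (by rw [h1])
      simp at this
    · exact h7 h1
  refine ⟨voa hgen₀, hV, voa_unique hgen₀, ?_, ?_, ?_⟩
  · intro M _ _ _ _ h W hM hW
    obtain ⟨v, hv, -⟩ := hM
    have key : h = 0 ∨ h = 1 / 2 ∨ h = 1 / 16 := by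
      refine (W.isGood_fld hV).weight_eq h2 hgen₀ (v := v) (fun n hn => ?_) hv.ne_zero ?_
      · have := hW (n - 1) v
        rw [sub_add_cancel, hv.lie_L_pos _ (by omega)] at this
        exact this
      · have := hW 0 v
        rw [hv.lie_L_zero] at this
        exact this
    refine ⟨fun _ => key, fun hc => ?_⟩
    rw [h7 hc] at key
    tauto
  · intro hc
    have hs₀ := admissible_isStandard hgen₀ hgen₀ (isGood_field_zero hgen₀)
    have hs₁ := admissible_isStandard hgen₀ hgen₁ (hgood₁ hc)
    have hs₂ := admissible_isStandard hgen₀ hgen₂ (hgood₂ hc)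
    refine ⟨admissible hgen₀ hgen₀ (isGood_field_zero hgen₀),
      admissible hgen₀ hgen₁ (hgood₁ hc), admissible hgen₀ hgen₂ (hgood₂ hc), hs₀, hs₁, hs₂,
      isIrreducible_of_extendsVir hgen₀ hs₀.1, isIrreducible_of_extendsVir hgen₁ hs₁.1,
      isIrreducible_of_extendsVir hgen₂ hs₂.1, fun hiso => ?_, fun hiso => ?_, fun hiso => ?_, ?_⟩
    · have := eq_of_isIsomorphic hgen₀ hgen₁ hs₀.1 hs₁.1 hiso
      exact one_div_ne_zero h2 this.symm
    · have := eq_of_isIsomorphic hgen₀ hgen₂ hs₀.1 hs₂.1 hiso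
      exact one_div_ne_zero h16 this.symm
    · have := eq_of_isIsomorphic hgen₁ hgen₂ hs₁.1 hs₂.1 hiso
      rw [div_eq_div_iff h2 h16] at this
      refine h7' hc (mul_left_cancel₀ h2 ?_)
      linear_combination this
    · intro M _ _ W hW
      obtain ⟨h, hh, -, -, e, he⟩ := exists_equiv_of_isGradedIrreducible hV h2 hgen₀ W hW
      rcases hh with rfl | rfl | rfl
      · exact Or.inl (isIsomorphic_of_equiv hV hs₀.1 e he)
      · exact Or.inr (Or.inl (isIsomorphic_of_equiv hV hs₁.1 e he))
      · exact Or.inr (Or.inr (isIsomorphic_of_equiv hV hs₂.1 e he))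
  -- In characteristic seven no module structure on L(1/2,1/2) is constructed. The one that is
  -- needed is carried over from the given module through `hgood`.
  · intro hc M _ _ W hW
    obtain ⟨h, hh, hgen, hgood, e, he⟩ := exists_equiv_of_isGradedIrreducible hV h2 hgen₀ W hW
    have hs := admissible_isStandard hgen₀ hgen hgood
    rw [h7 hc, or_self] at hh
    rcases hh with rfl | rfl
    · exact Or.inl ⟨_, hs, isIsomorphic_of_equiv hV hs.1 e he⟩
    · exact Or.inr ⟨_, hs, isIsomorphic_of_equiv hV hs.1 e he⟩

end VirIrr
end

noncomputable section

/-! ### The fermionic Fock space -/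

/-- The exterior algebra on countably many generators. -/
abbrev Fock (F : Type*) [Field F] : Type _ := ExteriorAlgebra F (ℕ →₀ F)

namespace Fock

variable {F : Type*} [Field F]

/-- The creation operator `w ↦ eᵢ ∧ w`. -/
def cr (i : ℕ) : Module.End F (Fock F) :=
  LinearMap.mulLeft F (ExteriorAlgebra.ι F (Finsupp.single i (1 : F)))

/-- The annihilation operator: contraction with the `i`-th coordinate. -/
def an (i : ℕ) : Module.End F (Fock F) :=
  CliffordAlgebra.contractLeft (Q := (0 : QuadraticForm F (ℕ →₀ F))) (Finsupp.lapply i)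

/-- The projection onto the scalars. -/
def ε : Fock F →ₗ[F] F := (ExteriorAlgebra.algebraMapInv (R := F) (M := ℕ →₀ F)).toLinearMap

theorem cr_apply (i : ℕ) (w : Fock F) :
    cr i w = ExteriorAlgebra.ι F (Finsupp.single i (1 : F)) * w := rfl

theorem ε_one : ε (1 : Fock F) = 1 := by simp [ε]

theorem ε_cr (i : ℕ) (w : Fock F) : ε (cr i w) = 0 := by
  simp [ε, cr_apply, ExteriorAlgebra.algebraMapInv]

theorem an_one (i : ℕ) : an i (1 : Fock F) = 0 := CliffordAlgebra.contractLeft_one _ _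

theorem an_cr (i j : ℕ) (w : Fock F) :
    an i (cr j w) = (if i = j then w else 0) - cr j (an i w) := by
  have h := CliffordAlgebra.contractLeft_ι_mul (Q := (0 : QuadraticForm F (ℕ →₀ F)))
    (d := Finsupp.lapply i) (Finsupp.single j (1 : F)) w
  refine h.trans ?_
  congr 1
  rcases eq_or_ne i j with rfl | hij
  · simp
  · simp [hij, Finsupp.single_eq_of_ne hij]

theorem cr_cr (i j : ℕ) (w : Fock F) : cr i (cr j w) = -cr j (cr i w) := by
  rw [eq_neg_iff_add_eq_zero, cr_apply, cr_apply, cr_apply, cr_apply, ← mul_assoc, ← mul_assoc,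
    ← add_mul, ExteriorAlgebra.ι_add_mul_swap, zero_mul]

theorem cr_self (i : ℕ) (w : Fock F) : cr i (cr i w) = 0 := by
  rw [cr_apply, cr_apply, ← mul_assoc, ExteriorAlgebra.ι_sq_zero, zero_mul]

theorem an_an (i j : ℕ) (w : Fock F) : an i (an j w) = -an j (an i w) :=
  CliffordAlgebra.contractLeft_comm (Q := (0 : QuadraticForm F (ℕ →₀ F))) (d := Finsupp.lapply i)
    (d' := Finsupp.lapply j) w

theorem an_self (i : ℕ) (w : Fock F) : an i (an i w) = 0 :=
  CliffordAlgebra.contractLeft_contractLeft (Q := (0 : QuadraticForm F (ℕ →₀ F)))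
    (d := Finsupp.lapply i) w

theorem induction {p : Fock F → Prop} (one : p 1) (add : ∀ x y, p x → p y → p (x + y))
    (smul : ∀ (a : F) x, p x → p (a • x)) (cr : ∀ i x, p x → p (cr i x)) (x : Fock F) : p x := by
  have zero : p 0 := by simpa using smul 0 1 one
  induction x using CliffordAlgebra.left_induction with
  | algebraMap r => rw [Algebra.algebraMap_eq_smul_one]; exact smul r _ one
  | add x y hx hy => exact add x y hx hy
  | ι_mul x m hx =>
    induction m using Finsupp.induction_linear with
    | zero => rw [map_zero, zero_mul]; exact zero
    | add f g hf hg => rw [map_add, add_mul]; exact add _ _ hf hg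
    | single i a =>
      have h := smul a _ (cr i x hx)
      have e : a • Fock.cr i x
          = CliffordAlgebra.ι (0 : QuadraticForm F (ℕ →₀ F)) (Finsupp.single i a) * x := by
        have : (Finsupp.single i a : ℕ →₀ F) = a • Finsupp.single i 1 := by simp
        rw [this, map_smul, smul_mul_assoc]; rfl
      rwa [e] at h

/-- Linear maps out of the Fock space that agree on `1` and are compatible with the creation
operators agree. -/
theorem hom_ext {N : Type*} [AddCommGroup N] [Module F N] {f g : Fock F →ₗ[F] N}
    (h1 : f 1 = g 1) (hcr : ∀ i w, f w = g w → f (cr i w) = g (cr i w)) : f = g := by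
  refine LinearMap.ext fun w => ?_
  induction w using induction with
  | one => exact h1
  | add x y hx hy => rw [map_add, map_add, hx, hy]
  | smul a x hx => rw [map_smul, map_smul, hx]
  | cr i x hx => exact hcr i x hx

theorem exists_an_eq_zero (w : Fock F) : ∃ N, ∀ i ≥ N, an i w = 0 := by
  induction w using induction with
  | one => exact ⟨0, fun i _ => an_one i⟩
  | add x y hx hy =>
    obtain ⟨N, hN⟩ := hx
    obtain ⟨N', hN'⟩ := hy
    refine ⟨max N N', fun i hi => ?_⟩
    rw [map_add, hN i (le_trans (le_max_left _ _) hi), hN' i (le_trans (le_max_right _ _) hi),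
      add_zero]
  | smul a x hx =>
    obtain ⟨N, hN⟩ := hx
    exact ⟨N, fun i hi => by rw [map_smul, hN i hi, smul_zero]⟩
  | cr j x hx =>
    obtain ⟨N, hN⟩ := hx
    refine ⟨max N (j + 1), fun i hi => ?_⟩
    have h1 : N ≤ i := le_trans (le_max_left _ _) hi
    have h2 : i ≠ j := by have := le_trans (le_max_right N (j + 1)) hi; omega
    rw [an_cr, if_neg h2, hN i h1, map_zero, sub_zero]

/-- The composite of the operators `aᵢ a*ᵢ`, `i < N`. -/
def proj : ℕ → Module.End F (Fock F)
  | 0 => LinearMap.id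
  | N + 1 => proj N ∘ₗ an N ∘ₗ cr N

theorem proj_one (N : ℕ) : proj N (1 : Fock F) = 1 := by
  induction N with
  | zero => rfl
  | succ N ih => simp [proj, an_cr, an_one, ih]

theorem an_cr_cr {i j : ℕ} (h : i ≠ j) (w : Fock F) : an i (cr i (cr j w)) = cr j (an i (cr i w)) := by
  rw [cr_cr i j, map_neg, an_cr, if_neg h, zero_sub, neg_neg]

theorem proj_cr (N j : ℕ) (w : Fock F) :
    proj N (cr j w) = if j < N then 0 else cr j (proj N w) := by
  induction N generalizing w with
  | zero => rfl
  | succ N ih =>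
    simp only [proj, LinearMap.comp_apply]
    rcases eq_or_ne N j with rfl | h
    · simp [cr_self]
    · rw [an_cr_cr h, ih]
      by_cases hj : j < N
      · rw [if_pos hj, if_pos (by omega)]
      · rw [if_neg hj, if_neg (by omega)]

/-- The composite of the i-th creation operator followed by the i-th annihilation operator projects
onto the vectors free of eᵢ, so after enough factors only the scalar part of w is left. -/
theorem exists_proj_eq (w : Fock F) : ∃ N, ∀ M ≥ N, proj M w = ε w • 1 := by
  induction w using induction with
  | one => exact ⟨0, fun M _ => by rw [proj_one, ε_one, one_smul]⟩
  | add x y hx hy =>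
    obtain ⟨N, hN⟩ := hx
    obtain ⟨N', hN'⟩ := hy
    refine ⟨max N N', fun i hi => ?_⟩
    rw [map_add, map_add, hN i (le_trans (le_max_left _ _) hi),
      hN' i (le_trans (le_max_right _ _) hi), add_smul]
  | smul a x hx =>
    obtain ⟨N, hN⟩ := hx
    exact ⟨N, fun i hi => by rw [map_smul, map_smul, hN i hi, smul_smul, smul_eq_mul]⟩
  | cr j x hx =>
    refine ⟨j + 1, fun i hi => ?_⟩
    rw [proj_cr, if_pos (by omega), ε_cr, zero_smul]

/-- A vector killed by all annihilation operators is a scalar. -/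
theorem eq_smul_one_of_an_eq_zero {w : Fock F} (h : ∀ i, an i w = 0) : w = ε w • 1 := by
  obtain ⟨N, hN⟩ := exists_proj_eq w
  rw [← hN N le_rfl]
  clear hN
  induction N with
  | zero => rfl
  | succ N ih =>
    simp only [proj, LinearMap.comp_apply]
    rw [an_cr, if_pos rfl, h N, map_zero, sub_zero]
    exact ih

/-- A vector is zero when all its iterated contractions have zero scalar component. -/
theorem eq_zero_of_ε_eq_zero {w : Fock F}
    (h : ∀ l : List ℕ, ε (l.foldl (fun x i => an i x) w) = 0) : w = 0 := by
  obtain ⟨N, hN⟩ := exists_an_eq_zero w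
  have key : ∀ (k : ℕ) (w : Fock F), (∀ i ≥ k, an i w = 0) →
      (∀ l : List ℕ, ε (l.foldl (fun x i => an i x) w) = 0) → w = 0 := by
    intro k
    induction k with
    | zero =>
      intro w hw h
      rw [eq_smul_one_of_an_eq_zero fun i => hw i (Nat.zero_le i), show ε w = 0 from h [], zero_smul]
    | succ k ih =>
      intro w hw h
      -- The vector `an k w` is itself killed by all annihilation operators from k on, so the
      -- induction applies to it before it applies to w.
      have hk : an k w = 0 := by
        refine ih _ (fun i hi => ?_) fun l => h (k :: l)
        rcases eq_or_lt_of_le hi with rfl | hlt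
        · exact an_self _ _
        · rw [an_an, hw i hlt, map_zero, neg_zero]
      refine ih w (fun i hi => ?_) h
      rcases eq_or_lt_of_le hi with rfl | hlt
      · exact hk
      · exact hw i hlt
  exact key N w hN h

end Fock

end

noncomputable section

/-! ### Fermions and their bilinear expressions -/

/-- The operators `Ψₖ` on the Fock space are the modes of a free fermion with
`{Ψₖ, Ψₗ} = δ_{k+l,-τ}`, and `1` is a vacuum for them. -/
structure IsFermi {F : Type*} [Field F] (Ψ : ℤ → Module.End F (Fock F)) (τ : ℤ) : Prop where
  anti : ∀ k l w, Ψ k (Ψ l w) + Ψ l (Ψ k w) = if k + l = -τ then w else 0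
  trunc : ∀ w, ∃ N : ℤ, ∀ k ≥ N, Ψ k w = 0
  vac : ∀ k, -τ < k → Ψ k 1 = 0
  ε_neg : ∀ k < 0, ∀ w, Fock.ε (Ψ k w) = 0
  nonneg : 0 ≤ τ
  le_one : τ ≤ 1

namespace IsFermi

open Fock

variable {F : Type*} [Field F] {Ψ : ℤ → Module.End F (Fock F)} {τ : ℤ}

variable (Ψ) in
/-- The normally ordered product `:Ψᵢ Ψⱼ:`. -/
def normal (i j : ℤ) : Module.End F (Fock F) := if 0 ≤ j then Ψ i ∘ₗ Ψ j else -(Ψ j ∘ₗ Ψ i)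

theorem normal_of_nonneg {i j : ℤ} (h : 0 ≤ j) (w : Fock F) : normal Ψ i j w = Ψ i (Ψ j w) := by
  rw [normal, if_pos h]; rfl

theorem normal_of_neg {i j : ℤ} (h : j < 0) (w : Fock F) : normal Ψ i j w = -Ψ j (Ψ i w) := by
  rw [normal, if_neg (by omega)]; rfl

theorem swap (H : IsFermi Ψ τ) (k l : ℤ) (w : Fock F) :
    Ψ k (Ψ l w) = (if k + l = -τ then w else 0) - Ψ l (Ψ k w) := by
  rw [← H.anti k l w]; abel

theorem exists_normal_eq_zero (H : IsFermi Ψ τ) (s : ℤ) (w : Fock F) :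
    ∃ B : ℕ, ∀ k, k ∉ Finset.Icc (-B : ℤ) B → normal Ψ (s - k) k w = 0 := by
  obtain ⟨N, hN⟩ := H.trunc w
  refine ⟨(|N| + |s|).toNat, fun k hk => ?_⟩
  have h1 := le_abs_self N
  have h2 := neg_abs_le s
  have h3 := abs_nonneg N
  have h4 := abs_nonneg s
  rw [Int.toNat_of_nonneg (by omega), Finset.mem_Icc, not_and_or, not_le, not_le] at hk
  rcases hk with hk | hk
  · rw [normal_of_neg (by omega), hN _ (by omega), map_zero, neg_zero]
  · rw [normal_of_nonneg (by omega), hN _ (by omega), map_zero]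

theorem support_finite (H : IsFermi Ψ τ) (c : ℤ → F) (s : ℤ) (w : Fock F) :
    (Function.support fun k : ℤ => c k • normal Ψ (s - k) k w).Finite := by
  obtain ⟨B, hB⟩ := H.exists_normal_eq_zero s w
  refine (Finset.Icc (-B : ℤ) B).finite_toSet.subset fun k hk => ?_
  by_contra h
  exact hk (by simp only [hB k h, smul_zero])

/-- The operator `∑ₖ c(k) :Ψₛ₋ₖ Ψₖ:`. -/
def bil (H : IsFermi Ψ τ) (c : ℤ → F) (s : ℤ) : Module.End F (Fock F) where
  toFun w := ∑ᶠ k : ℤ, c k • normal Ψ (s - k) k w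
  map_add' v w := by
    rw [← finsum_add_distrib (H.support_finite c s v) (H.support_finite c s w)]
    simp only [map_add, smul_add]
  map_smul' a w := by
    simp only [map_smul, RingHom.id_apply]
    rw [smul_finsum' a (H.support_finite c s w)]
    exact finsum_congr fun k => smul_comm _ _ _

theorem bil_apply (H : IsFermi Ψ τ) (c : ℤ → F) (s : ℤ) (w : Fock F) :
    H.bil c s w = ∑ᶠ k : ℤ, c k • normal Ψ (s - k) k w := rfl

theorem map_bil (H : IsFermi Ψ τ) {N : Type*} [AddCommGroup N] [Module F N] (f : Fock F →ₗ[F] N)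
    (c : ℤ → F) (s : ℤ) (w : Fock F) :
    f (H.bil c s w) = ∑ᶠ k : ℤ, c k • f (normal Ψ (s - k) k w) := by
  rw [bil_apply, map_finsum f (H.support_finite c s w)]
  simp only [map_smul]

theorem normal_comm (H : IsFermi Ψ τ) (i j l : ℤ) (w : Fock F) :
    normal Ψ i j (Ψ l w) - Ψ l (normal Ψ i j w) =
      (if j + l = -τ then Ψ i w else 0) - if i + l = -τ then Ψ j w else 0 := by
  have h1 := H.swap j l w
  have h2 := H.swap i l w
  have h3 := H.swap i l (Ψ j w)
  have h4 := H.swap j l (Ψ i w)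
  by_cases hj : 0 ≤ j
  · rw [normal_of_nonneg hj, normal_of_nonneg hj, h1, map_sub, h3]
    split_ifs <;> (try rw [map_zero]) <;> abel
  · rw [normal_of_neg (by omega), normal_of_neg (by omega), h2, map_sub, h4, map_neg]
    split_ifs <;> (try rw [map_zero]) <;> abel

/-- The operator Ψₗ contracts with either factor of the normally ordered product, and each
contraction selects one summand: k = -τ - l for the right factor and k = s + τ + l for the left one.
-/
theorem bil_comm (H : IsFermi Ψ τ) (c : ℤ → F) (s l : ℤ) (w : Fock F) :
    H.bil c s (Ψ l w) - Ψ l (H.bil c s w) = (c (-τ - l) - c (s + τ + l)) • Ψ (s + τ + l) w := by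
  have hfin := (H.support_finite c s w)
  have hfin' : (Function.support fun k : ℤ => c k • Ψ l (normal Ψ (s - k) k w)).Finite := by
    refine hfin.subset fun k hk h => hk ?_
    have h' := congrArg (Ψ l) h
    simpa only [map_smul, map_zero] using h'
  rw [map_bil, bil_apply, ← finsum_sub_distrib (H.support_finite c s _) hfin']
  simp only [← smul_sub, H.normal_comm]
  have e : ∀ k : ℤ, c k • ((if k + l = -τ then Ψ (s - k) w else 0) -
      if s - k + l = -τ then Ψ k w else 0) =
      (if k = -τ - l then c (-τ - l) • Ψ (s + τ + l) w else 0) -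
        if k = s + τ + l then c (s + τ + l) • Ψ (s + τ + l) w else 0 := by
    intro k
    rw [smul_sub, smul_ite, smul_ite, smul_zero]
    congr 1
    · by_cases h : k = -τ - l
      · rw [if_pos h, if_pos (by omega), h]; congr 2; congr 1; omega
      · rw [if_neg h, if_neg (by omega)]
    · by_cases h : k = s + τ + l
      · rw [if_pos h, if_pos (by omega), h]
      · rw [if_neg h, if_neg (by omega)]
  rw [finsum_congr e, finsum_sub_distrib, finsum_eq_single _ (-τ - l), finsum_eq_single _ (s + τ + l),
    if_pos rfl, if_pos rfl, sub_smul]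
  · intro k hk; rw [if_neg hk]
  · intro k hk; rw [if_neg hk]
  · refine (Set.finite_singleton (-τ - l)).subset fun k hk => ?_
    by_contra h
    exact hk (if_neg h)
  · refine (Set.finite_singleton (s + τ + l)).subset fun k hk => ?_
    by_contra h
    exact hk (if_neg h)

/-- Two sign changes cancel in each quadratic term. Used for the parity operator and for the extra
zero mode of the Ramond space. -/
theorem bil_comm_of_anti (H : IsFermi Ψ τ) {X : Module.End F (Fock F)}
    (hX : ∀ k w, X (Ψ k w) = -Ψ k (X w)) (c : ℤ → F) (s : ℤ) (w : Fock F) :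
    X (H.bil c s w) = H.bil c s (X w) := by
  rw [map_bil, bil_apply]
  refine finsum_congr fun k => ?_
  congr 1
  by_cases hk : 0 ≤ k
  · rw [normal_of_nonneg hk, normal_of_nonneg hk, hX, hX, map_neg, neg_neg]
  · rw [normal_of_neg (by omega), normal_of_neg (by omega), map_neg, hX, hX, map_neg, neg_neg]

theorem twoPoint_of_ne (H : IsFermi Ψ τ) {a b : ℤ} (hab : a + b ≠ -τ) : ε (Ψ a (Ψ b 1)) = 0 := by
  have hτ := H.nonneg
  have hτ' := H.le_one
  rcases lt_or_ge a 0 with ha | ha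
  · exact H.ε_neg a ha _
  rw [H.swap, if_neg hab, zero_sub, map_neg, neg_eq_zero]
  by_cases ha' : -τ < a
  · rw [H.vac a ha', map_zero, map_zero]
  rcases lt_or_ge b 0 with hb | hb
  · exact H.ε_neg b hb _
  · have h := H.swap b a (1 : Fock F)
    rw [if_neg (by omega), zero_sub, H.vac b (by omega), map_zero, neg_zero] at h
    rw [h, map_zero]

theorem twoPoint_of_pos (H : IsFermi Ψ τ) {a b : ℤ} (hab : a + b = -τ) (ha : -τ < a) :
    ε (Ψ a (Ψ b 1)) = 1 := by
  rw [H.swap, if_pos hab, H.vac a ha, map_zero, sub_zero, ε_one]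

theorem twoPoint_zero (H : IsFermi Ψ 0) : 2 * ε (Ψ 0 (Ψ 0 1)) = 1 := by
  have h := congrArg ε (H.anti 0 0 1)
  rw [map_add, if_pos (by omega), ε_one, ← two_mul] at h
  exact h

theorem exists_bil_eq_zero (H : IsFermi Ψ τ) (w : Fock F) :
    ∃ N : ℤ, ∀ s ≥ N, ∀ c : ℤ → F, H.bil c s w = 0 := by
  obtain ⟨N, hN⟩ := H.trunc w
  refine ⟨|N| + |N| + |τ| + 1, fun s hs c => finsum_eq_zero_of_forall_eq_zero fun k => ?_⟩
  have h1 := le_abs_self N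
  have h2 := neg_abs_le τ
  have h3 := abs_nonneg N
  have h4 := abs_nonneg τ
  rcases lt_or_ge k 0 with hk | hk
  · rw [normal_of_neg hk, hN _ (by omega), map_zero, neg_zero, smul_zero]
  · rw [normal_of_nonneg hk]
    rcases le_or_gt N k with hk' | hk'
    · rw [hN k hk', map_zero, smul_zero]
    · rw [H.swap, hN (s - k) (by omega), map_zero, sub_zero, if_neg (by omega), smul_zero]

/-- The coefficients of the Virasoro field of the fermion. -/
def coeff (F : Type*) [Field F] (τ k : ℤ) : F := ((k : F) + τ / 2) / 2

/-- The Virasoro operators of the fermion, up to a constant. -/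
def ℓ (H : IsFermi Ψ τ) (n : ℤ) : Module.End F (Fock F) := H.bil (coeff F τ) (n - τ)

theorem ℓ_comm (h2 : (2 : F) ≠ 0) (H : IsFermi Ψ τ) (n l : ℤ) (w : Fock F) :
    H.ℓ n (Ψ l w) - Ψ l (H.ℓ n w) = -((l : F) + τ / 2 + n / 2) • Ψ (n + l) w := by
  rw [ℓ, bil_comm, show n - τ + τ + l = n + l by ring]
  congr 1
  simp only [coeff]
  push_cast
  field_simp
  ring

/-- The only nonnegative mode that does not kill the vacuum is Ψ₀ in the Ramond case, and its
coefficient is zero. -/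
theorem coeff_smul_vac (H : IsFermi Ψ τ) {k : ℤ} (hk : 0 ≤ k) :
    coeff F τ k • Ψ k (1 : Fock F) = 0 := by
  have hτ := H.nonneg
  by_cases h : -τ < k
  · rw [H.vac k h, smul_zero]
  · obtain rfl : k = 0 := by omega
    obtain rfl : τ = 0 := by omega
    simp [coeff]

theorem ℓ_vac (H : IsFermi Ψ τ) {n : ℤ} (hn : 0 ≤ n) : H.ℓ n 1 = 0 := by
  have hτ := H.le_one
  rw [ℓ, bil_apply]
  refine finsum_eq_zero_of_forall_eq_zero fun k => ?_
  rcases lt_or_ge k 0 with hk | hk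
  · rw [normal_of_neg hk, H.vac _ (by omega), map_zero, neg_zero, smul_zero]
  · rw [normal_of_nonneg hk, ← map_smul, H.coeff_smul_vac hk, map_zero]

theorem ε_ℓ (H : IsFermi Ψ τ) {n : ℤ} (hn : n ≤ 0) (w : Fock F) : ε (H.ℓ n w) = 0 := by
  have hτ := H.nonneg
  rw [ℓ, map_bil]
  refine finsum_eq_zero_of_forall_eq_zero fun k => ?_
  rcases lt_or_ge k 0 with hk | hk
  · rw [normal_of_neg hk, map_neg, H.ε_neg k hk, neg_zero, smul_zero]
  · rw [normal_of_nonneg hk]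
    by_cases h : n - τ - k < 0
    · rw [H.ε_neg _ h, smul_zero]
    · obtain rfl : k = 0 := by omega
      obtain rfl : τ = 0 := by omega
      simp [coeff]

/-- Terms with k ≥ 0 kill the vacuum. For k < 0 the outer operator is moved past Ψₖ; what then
begins with Ψₖ has no scalar part, so only the commutator contributes. -/
theorem ε_ℓ_ℓ (h2 : (2 : F) ≠ 0) (H : IsFermi Ψ τ) {m n : ℤ} :
    ε (H.ℓ m (H.ℓ n 1)) = ∑ᶠ k : ℤ, if k < 0 then
      coeff F τ k * ((k : F) + τ / 2 + m / 2) * ε (Ψ (m + k) (Ψ (n - τ - k) 1)) else 0 := by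
  have e : ε (H.ℓ m (H.ℓ n 1)) = (ε ∘ₗ H.ℓ m) (H.ℓ n 1) := rfl
  rw [e, ℓ.eq_def H n, map_bil]
  refine finsum_congr fun k => ?_
  split_ifs with hk
  · rw [normal_of_neg hk, map_neg, LinearMap.comp_apply,
      eq_add_of_sub_eq (H.ℓ_comm h2 m k (Ψ (n - τ - k) 1)), map_add, H.ε_neg k hk, add_zero, map_smul,
      smul_eq_mul, smul_eq_mul]
    ring
  · rw [normal_of_nonneg (by omega), ← map_smul, ← map_smul, H.coeff_smul_vac (by omega), map_zero,
      map_zero]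

theorem ε_ℓ_ℓ_of_ne (h2 : (2 : F) ≠ 0) (H : IsFermi Ψ τ) {m n : ℤ}
    (hmn : m + n ≠ 0) : ε (H.ℓ m (H.ℓ n 1)) = 0 := by
  rw [H.ε_ℓ_ℓ h2]
  refine finsum_eq_zero_of_forall_eq_zero fun k => ?_
  rw [H.twoPoint_of_ne (by omega), mul_zero, ite_self]

theorem ε_ℓ_ℓ_neg (h2 : (2 : F) ≠ 0) (H : IsFermi Ψ τ) {m : ℕ} :
    ε (H.ℓ m (H.ℓ (-m) 1)) = ∑ j ∈ Finset.range m,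
      coeff F τ (-(j + 1)) * (-((j : F) + 1) + τ / 2 + m / 2) *
        ε (Ψ (m - (j + 1)) (Ψ (-m - τ + (j + 1)) 1)) := by
  rw [H.ε_ℓ_ℓ h2]
  have hinj : Function.Injective fun j : ℕ => -((j : ℤ) + 1) := fun i j h => by simpa using h
  rw [finsum_eq_sum_of_support_subset (s := (Finset.range m).map ⟨_, hinj⟩), Finset.sum_map]
  · refine Finset.sum_congr rfl fun j hj => ?_
    simp only [Function.Embedding.coeFn_mk]
    rw [if_pos (by omega)]
    push_cast
    congr 3
  · intro k hk
    simp only [Finset.coe_map, Set.mem_image, Finset.coe_range, Set.mem_Iio,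
      Function.Embedding.coeFn_mk]
    by_contra hc
    apply hk
    simp only
    split_ifs with hk'
    · rw [H.ε_neg _ (lt_of_not_ge fun h => hc ⟨(-k - 1).toNat, by omega, by omega⟩), mul_zero]
    · rfl

/-- The failure of the relation for `[ℓ m, ℓ n]`. -/
def defect (H : IsFermi Ψ τ) (m n : ℤ) : Module.End F (Fock F) :=
  H.ℓ m ∘ₗ H.ℓ n - H.ℓ n ∘ₗ H.ℓ m - ((m : F) - n) • H.ℓ (m + n)

theorem defect_apply (H : IsFermi Ψ τ) (m n : ℤ) (w : Fock F) :
    H.defect m n w = H.ℓ m (H.ℓ n w) - H.ℓ n (H.ℓ m w) - ((m : F) - n) • H.ℓ (m + n) w := rfl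

/-- The commutators with the ℓ n act on the modes of the fermion through the Witt algebra, so the
failure of the Virasoro relation commutes with all modes. -/
theorem defect_comm (h2 : (2 : F) ≠ 0) (H : IsFermi Ψ τ) (m n l : ℤ) (w : Fock F) :
    H.defect m n (Ψ l w) = Ψ l (H.defect m n w) := by
  have hc := fun n l w => eq_add_of_sub_eq (H.ℓ_comm h2 n l w)
  rw [defect_apply, defect_apply, hc, hc, hc, map_add, map_add, map_smul, map_smul, hc, hc, hc, hc,
    map_sub, map_sub, map_smul, show m + (n + l) = m + n + l by ring,
    show n + (m + l) = m + n + l by ring]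
  match_scalars <;> field_simp <;> ring

theorem defect_swap (H : IsFermi Ψ τ) (m n : ℤ) : H.defect m n = -H.defect n m := by
  refine LinearMap.ext fun w => ?_
  rw [LinearMap.neg_apply, defect_apply, defect_apply, add_comm n m]
  module

theorem ε_defect (h2 : (2 : F) ≠ 0) (H : IsFermi Ψ τ) {h₀ : F}
    (hε : ∀ m : ℕ, 0 < m → ε (H.ℓ m (H.ℓ (-m) 1)) = virCoeff F m * (1 / 2) + 2 * m * h₀) {m n : ℤ}
    (hmn : n ≤ m) : ε (H.defect m n 1) =
      if m + n = 0 then virCoeff F m * (1 / 2) + 2 * m * h₀ else 0 := by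
  have h0 : ∀ k, ε (H.ℓ k 1) = 0 := by
    intro k
    rcases le_or_gt 0 k with hk | hk
    · rw [H.ℓ_vac hk, map_zero]
    · exact H.ε_ℓ hk.le _
  rw [defect_apply, map_sub, map_sub, map_smul, h0, smul_zero, sub_zero]
  rcases le_or_gt m 0 with hm | hm
  · rw [H.ε_ℓ hm, H.ε_ℓ (by omega), sub_zero]
    split_ifs with h
    · obtain rfl : m = 0 := by omega
      simp [virCoeff]
    · rfl
  · rw [H.ℓ_vac hm.le, map_zero, map_zero, sub_zero]
    rcases le_or_gt 0 n with hn | hn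
    · rw [H.ℓ_vac hn, map_zero, map_zero, if_neg (by omega)]
    · split_ifs with h
      · lift m to ℕ using hm.le
        obtain rfl : n = -m := by omega
        rw [hε m (by omega)]
        simp
      · exact H.ε_ℓ_ℓ_of_ne h2 h

/-- A Schur argument: the defect commutes with all creation and annihilation operators, hence is a
scalar, read off from the vacuum by the two-point sum in `hε`. The operator Φ is needed in the
Ramond case, where the creation and annihilation operators of index zero are not combinations of the
modes; it anticommutes with every Ψₖ, so it commutes with quadratic expressions. The constant h₀
absorbs the part of the sum that is linear in m. -/
theorem isVirRep_of_comm (h2 : (2 : F) ≠ 0) (H : IsFermi Ψ τ) (h₀ : F) (Φ : Module.End F (Fock F))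
    (hΦ : ∀ k w, Φ (Ψ k w) = -Ψ k (Φ w))
    (hcr : ∀ i, cr i ∈ Submodule.span F (insert Φ (Set.range Ψ)))
    (han : ∀ i, an i ∈ Submodule.span F (insert Φ (Set.range Ψ)))
    (hε : ∀ m : ℕ, 0 < m → ε (H.ℓ m (H.ℓ (-m) 1)) = virCoeff F m * (1 / 2) + 2 * m * h₀) :
    IsVirRep (fun n => H.ℓ n + if n = 0 then h₀ • LinearMap.id else 0) (1 / 2 : F) := by
  have hspan : ∀ m n, ∀ X ∈ Submodule.span F (insert Φ (Set.range Ψ)), ∀ w,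
      H.defect m n (X w) = X (H.defect m n w) := by
    intro m n X hX w
    induction hX using Submodule.span_induction with
    | mem X hX =>
      rcases hX with rfl | ⟨l, rfl⟩
      · simp only [defect_apply, ℓ, ← H.bil_comm_of_anti hΦ, map_sub, map_smul]
      · exact H.defect_comm h2 m n l w
    | zero => simp
    | add X Y _ _ hX hY => rw [LinearMap.add_apply, LinearMap.add_apply, map_add, hX, hY]
    | smul a X _ hX => rw [LinearMap.smul_apply, LinearMap.smul_apply, map_smul, hX]
  have hscalar : ∀ m n w, H.defect m n w = ε (H.defect m n 1) • w := by
    intro m n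
    have h1 : H.defect m n = ε (H.defect m n 1) • LinearMap.id := by
      refine hom_ext ?_ fun i w hw => ?_
      · refine eq_smul_one_of_an_eq_zero fun i => ?_
        rw [← hspan m n _ (han i), an_one, map_zero]
      · rw [hspan m n _ (hcr i), hw]
        simp only [LinearMap.smul_apply, LinearMap.id_apply, map_smul]
    intro w
    conv_lhs => rw [h1]
    rfl
  have hval : ∀ m n, ε (H.defect m n 1) =
      if m + n = 0 then virCoeff F m * (1 / 2) + 2 * m * h₀ else 0 := by
    intro m n
    rcases le_total n m with hmn | hmn
    · exact H.ε_defect h2 hε hmn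
    · rw [defect_swap, LinearMap.neg_apply, map_neg, H.ε_defect h2 hε hmn, add_comm n m]
      split_ifs with h
      · obtain rfl : n = -m := by omega
        rw [Vir.virCoeff_neg]
        push_cast
        ring
      · exact neg_zero
  refine ⟨fun m n w => ?_⟩
  have h := hscalar m n w
  rw [hval, defect_apply, sub_eq_iff_eq_add] at h
  have e : ∀ (k : ℤ) (w : Fock F), (H.ℓ k + if k = 0 then h₀ • LinearMap.id else 0 : Module.End F (Fock F)) w =
      H.ℓ k w + if k = 0 then h₀ • w else 0 := by
    intro k w
    rw [LinearMap.add_apply]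
    split_ifs <;> rfl
  have e' : ∀ (k : ℤ) (w : Fock F), (if k = 0 then h₀ • w else 0) = (if k = 0 then h₀ else 0) • w := by
    intro k w
    split_ifs
    · rfl
    · rw [zero_smul]
  simp only [e, e', map_add, map_smul]
  have h' : H.ℓ m (H.ℓ n w) = H.ℓ n (H.ℓ m w) + ((if m + n = 0 then
      virCoeff F m * (1 / 2) + 2 * m * h₀ else 0) • w + ((m : F) - n) • H.ℓ (m + n) w) := by
    rw [← h]; abel
  rw [h']
  by_cases hmn : m + n = 0
  · simp only [if_pos hmn]
    obtain rfl : n = -m := by omega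
    push_cast
    module
  · simp only [if_neg hmn]
    module

end IsFermi

end

noncomputable section

namespace Fock

variable {F : Type*} [Field F]

/-! ### The Neveu–Schwarz fermion -/

/-- The modes of the Neveu–Schwarz fermion. -/
def ns : ℤ → Module.End F (Fock F)
  | .ofNat i => an i
  | .negSucc i => cr i

theorem ns_natCast (i : ℕ) : ns (F := F) i = an i := rfl

theorem ns_neg (i : ℕ) : ns (F := F) (-(i : ℤ) - 1) = cr i := by
  rw [show -(i : ℤ) - 1 = Int.negSucc i by omega]; rfl

theorem isFermi_ns : IsFermi (ns (F := F)) 1 where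
  anti k l w := by
    rcases k with k | k <;> rcases l with l | l
    · rw [if_neg (by simp only [Int.ofNat_eq_natCast]; omega)]
      exact (congrArg (· + an l (an k w)) (an_an k l w)).trans (neg_add_cancel _)
    · refine (congrArg (· + cr l (an k w)) (an_cr k l w)).trans ((sub_add_cancel _ _).trans ?_)
      exact if_congr (by simp only [Int.ofNat_eq_natCast]; omega) rfl rfl
    · refine (congrArg (cr k (an l w) + ·) (an_cr l k w)).trans ((add_sub_cancel _ _).trans ?_)
      exact if_congr (by simp only [Int.ofNat_eq_natCast]; omega) rfl rfl
    · rw [if_neg (by omega)]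
      exact (congrArg (· + cr l (cr k w)) (cr_cr k l w)).trans (neg_add_cancel _)
  trunc w := by
    obtain ⟨N, hN⟩ := exists_an_eq_zero w
    refine ⟨N, fun k hk => ?_⟩
    lift k to ℕ using by omega
    exact hN k (by omega)
  vac k hk := by
    lift k to ℕ using by omega
    exact an_one k
  ε_neg k hk w := by
    obtain ⟨i, rfl⟩ := Int.eq_negSucc_of_lt_zero hk
    exact ε_cr i w
  nonneg := zero_le_one
  le_one := le_rfl

/-- The Virasoro operators on the Neveu–Schwarz Fock space. -/
def nsL (n : ℤ) : Module.End F (Fock F) := isFermi_ns.ℓ n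

/-- Stated over the integers, so that the division by six in the cocycle is exact in characteristic
three as well. -/
theorem sum_ns (m : ℕ) : ∑ j ∈ Finset.range m, (2 * (j : ℤ) + 1) * (2 * j + 1 - m) =
    2 * (((m : ℤ) ^ 3 - m) / 6) := by
  have h := Vir.six_mul_div (m : ℤ)
  have key : ∀ (m : ℕ) (a : ℤ), 3 * ∑ j ∈ Finset.range m, (2 * (j : ℤ) + 1) * (2 * j + 1 - a) =
      m * (4 * (m : ℤ) ^ 2 - 1) - 3 * a * m ^ 2 := by
    intro m a
    induction m with
    | zero => simp
    | succ m ih => rw [Finset.sum_range_succ, mul_add, ih]; push_cast; ring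
  have := key m m
  have e : (m : ℤ) * (4 * (m : ℤ) ^ 2 - 1) - 3 * m * m ^ 2 = (m : ℤ) ^ 3 - m := by ring
  omega

theorem isVirRep_nsL (h2 : (2 : F) ≠ 0) : IsVirRep (nsL (F := F)) (1 / 2 : F) := by
  have H := isFermi_ns.isVirRep_of_comm (F := F) h2 0 0 (by simp)
    (fun i => Submodule.subset_span (Or.inr ⟨-(i : ℤ) - 1, ns_neg i⟩))
    (fun i => Submodule.subset_span (Or.inr ⟨i, rfl⟩)) fun m hm => by
      rw [isFermi_ns.ε_ℓ_ℓ_neg h2, mul_zero, add_zero, virCoeff]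
      have e : ∀ j ∈ Finset.range m, IsFermi.coeff F 1 (-(j + 1)) *
          (-((j : F) + 1) + (1 : ℤ) / 2 + m / 2) *
            ε (ns ((m : ℤ) - (j + 1)) (ns (-(m : ℤ) - 1 + (j + 1)) (1 : Fock F))) =
          (((2 * (j : ℤ) + 1) * (2 * j + 1 - m) : ℤ) : F) / 8 := by
        intro j hj
        rw [Finset.mem_range] at hj
        rw [isFermi_ns.twoPoint_of_pos (by omega) (by omega), IsFermi.coeff]
        have h8 : (8 : F) ≠ 0 := by
          have : (8 : F) = 2 ^ 3 := by norm_num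
          rw [this]; exact pow_ne_zero _ h2
        push_cast
        field_simp
        ring
      have h8 : (8 : F) ≠ 0 := by
        have : (8 : F) = 2 ^ 3 := by norm_num
        rw [this]; exact pow_ne_zero _ h2
      rw [Finset.sum_congr rfl e, ← Finset.sum_div, ← Int.cast_sum, sum_ns]
      push_cast
      field_simp
      ring
  convert H using 2 with n
  simp [nsL]

/-! ### The Ramond fermion -/

/-- The modes of the Ramond fermion. -/
def ram : ℤ → Module.End F (Fock F)
  | .ofNat 0 => cr 0 + (1 / 2 : F) • an 0
  | .ofNat (i + 1) => an (i + 1)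
  | .negSucc i => cr (i + 1)

theorem ram_pos {i : ℕ} (hi : 0 < i) : ram (F := F) i = an i := by
  obtain ⟨i, rfl⟩ : ∃ j, i = j + 1 := ⟨i - 1, by omega⟩
  rfl

theorem ram_neg {i : ℕ} (hi : 0 < i) : ram (F := F) (-(i : ℤ)) = cr i := by
  obtain ⟨i, rfl⟩ : ∃ j, i = j + 1 := ⟨i - 1, by omega⟩
  rfl

theorem ram_zero : ram (F := F) 0 = cr 0 + (1 / 2 : F) • an 0 := rfl

theorem ram_zero_apply (w : Fock F) : ram 0 w = cr 0 w + (1 / 2 : F) • an 0 w := rfl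

theorem ram_cases (k : ℤ) : k = 0 ∨ (∃ i : ℕ, 0 < i ∧ k = i) ∨ ∃ i : ℕ, 0 < i ∧ k = -(i : ℤ) := by
  rcases lt_trichotomy k 0 with h | h | h
  · exact .inr (.inr ⟨k.natAbs, by omega, by omega⟩)
  · exact .inl h
  · exact .inr (.inl ⟨k.natAbs, by omega, by omega⟩)

theorem isFermi_ram (h2 : (2 : F) ≠ 0) : IsFermi (ram (F := F)) 0 where
  anti k l w := by
    rcases ram_cases k with rfl | ⟨i, hi, rfl⟩ | ⟨i, hi, rfl⟩ <;>
    rcases ram_cases l with rfl | ⟨j, hj, rfl⟩ | ⟨j, hj, rfl⟩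
    · simp only [ram_zero_apply, map_add, map_smul, cr_self, an_self, an_cr, if_true]
      rw [if_pos (by omega)]
      match_scalars <;> field_simp <;> ring
    · rw [ram_pos hj, ram_zero_apply, ram_zero_apply, map_add, map_smul, an_cr, an_an j 0,
        if_neg (by omega), if_neg (by omega)]
      module
    · rw [ram_neg hj, ram_zero_apply, ram_zero_apply, map_add, map_smul, an_cr, cr_cr j 0,
        if_neg (by omega), if_neg (by omega)]
      module
    · rw [ram_pos hi, ram_zero_apply, ram_zero_apply, map_add, map_smul, an_cr, an_an i 0,
        if_neg (by omega), if_neg (by omega)]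
      module
    · rw [ram_pos hi, ram_pos hj, an_an i j, if_neg (by omega)]
      module
    · rw [ram_pos hi, ram_neg hj, an_cr, sub_add_cancel]
      exact if_congr (by omega) rfl rfl
    · rw [ram_neg hi, ram_zero_apply, ram_zero_apply, map_add, map_smul, an_cr, cr_cr i 0,
        if_neg (by omega), if_neg (by omega)]
      module
    · rw [ram_neg hi, ram_pos hj, an_cr, add_sub_cancel]
      exact if_congr (by omega) rfl rfl
    · rw [ram_neg hi, ram_neg hj, cr_cr i j, if_neg (by omega)]
      module
  trunc w := by
    obtain ⟨N, hN⟩ := exists_an_eq_zero w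
    refine ⟨N + 1, fun k hk => ?_⟩
    lift k to ℕ using by omega
    rw [ram_pos (by omega)]
    exact hN k (by omega)
  vac k hk := by
    lift k to ℕ using by omega
    rw [ram_pos (by omega)]
    exact an_one k
  ε_neg k hk w := by
    obtain ⟨i, rfl⟩ := Int.eq_negSucc_of_lt_zero hk
    exact ε_cr (i + 1) w
  nonneg := le_rfl
  le_one := zero_le_one

theorem sum_ram (m : ℕ) : 2 * ∑ j ∈ Finset.range m, ((j : ℤ) + 1) * (2 * (j + 1) - m) =
    2 * (((m : ℤ) ^ 3 - m) / 6) + m + (m : ℤ) ^ 2 := by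
  have h := Vir.six_mul_div (m : ℤ)
  have key : ∀ (m : ℕ) (a : ℤ), 6 * ∑ j ∈ Finset.range m, ((j : ℤ) + 1) * (2 * (j + 1) - a) =
      2 * m * (m + 1) * (2 * m + 1) - 3 * a * m * (m + 1) := by
    intro m a
    induction m with
    | zero => simp
    | succ m ih => rw [Finset.sum_range_succ, mul_add, ih]; push_cast; ring
  have := key m m
  have e : 2 * (m : ℤ) * (m + 1) * (2 * m + 1) - 3 * m * m * (m + 1) =
    (m : ℤ) ^ 3 - m + 3 * m + 3 * (m : ℤ) ^ 2 := by ring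
  omega

/-- Compared with the cocycle the Ramond two-point sum has an extra term m/8 = 2m/16, hence the
shift of L₀ by 1/16. The second combination of the zero modes plays the role of Φ. -/
theorem isVirRep_ram (h2 : (2 : F) ≠ 0) : IsVirRep (fun n => (isFermi_ram (F := F) h2).ℓ n +
    if n = 0 then (1 / 16 : F) • LinearMap.id else 0) (1 / 2 : F) := by
  have h16 : (16 : F) ≠ 0 := by
    have : (16 : F) = 2 ^ 4 := by norm_num
    rw [this]; exact pow_ne_zero _ h2
  have h8 : (8 : F) ≠ 0 := by
    have : (8 : F) = 2 ^ 3 := by norm_num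
    rw [this]; exact pow_ne_zero _ h2
  have h4 : (4 : F) ≠ 0 := by
    have : (4 : F) = 2 ^ 2 := by norm_num
    rw [this]; exact pow_ne_zero _ h2
  have hΦ₀ : cr 0 - (1 / 2 : F) • an 0 ∈ Submodule.span F
      (insert (cr 0 - (1 / 2 : F) • an 0) (Set.range (ram (F := F)))) :=
    Submodule.subset_span (Or.inl rfl)
  have hΨ : ∀ k, ram k ∈ Submodule.span F
      (insert (cr 0 - (1 / 2 : F) • an 0) (Set.range (ram (F := F)))) :=
    fun k => Submodule.subset_span (Or.inr ⟨k, rfl⟩)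
  refine (isFermi_ram (F := F) h2).isVirRep_of_comm h2 (1 / 16) (cr 0 - (1 / 2 : F) • an 0)
    (fun k w => ?_) (fun i => ?_) (fun i => ?_) fun m hm => ?_
  · simp only [LinearMap.sub_apply, LinearMap.smul_apply]
    rcases ram_cases k with rfl | ⟨i, hi, rfl⟩ | ⟨i, hi, rfl⟩
    · simp only [ram_zero_apply, map_add, map_sub, map_smul, cr_self, an_self, an_cr, if_true]
      module
    · rw [ram_pos hi, map_sub, map_smul, an_cr, an_an i 0, if_neg (by omega)]
      module
    · rw [ram_neg hi, map_sub, map_smul, an_cr, cr_cr i 0, if_neg (by omega)]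
      module
  · rcases Nat.eq_zero_or_pos i with rfl | hi
    · have h := Submodule.smul_mem _ (1 / 2 : F) (Submodule.add_mem _ hΦ₀ (hΨ 0))
      rw [ram_zero] at h
      convert h using 1
      match_scalars <;> field_simp <;> norm_num
    · rw [← ram_neg hi]; exact hΨ _
  · rcases Nat.eq_zero_or_pos i with rfl | hi
    · have h := Submodule.sub_mem _ (hΨ 0) hΦ₀
      rw [ram_zero] at h
      convert h using 1
      match_scalars <;> field_simp <;> norm_num
    · rw [← ram_pos hi]; exact hΨ _
  -- The last term j = m - 1 pairs Ψ₀ with itself, and its two-point value is 1/2 instead of 1; the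
  -- correction m²/8 cancels the square in `sum_ram`.
  · have e : ∀ j ∈ Finset.range m, IsFermi.coeff F 0 (-(j + 1)) *
        (-((j : F) + 1) + (0 : ℤ) / 2 + m / 2) *
          ε (ram ((m : ℤ) - (j + 1)) (ram (-(m : ℤ) - 0 + (j + 1)) (1 : Fock F))) =
        ((((j : ℤ) + 1) * (2 * (j + 1) - m) : ℤ) : F) / 4 -
          if j = m - 1 then (m : F) ^ 2 / 8 else 0 := by
      intro j hj
      rw [Finset.mem_range] at hj
      rw [IsFermi.coeff]
      by_cases h : j = m - 1
      · obtain rfl : m = j + 1 := by omega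
        rw [if_pos h]
        have h0 : ε (ram (((j + 1 : ℕ) : ℤ) - (j + 1)) (ram (-((j + 1 : ℕ) : ℤ) - 0 + (j + 1))
            (1 : Fock F))) = 1 / 2 := by
          rw [show (((j + 1 : ℕ) : ℤ) - (j + 1)) = 0 by omega,
            show (-((j + 1 : ℕ) : ℤ) - 0 + (j + 1)) = 0 by omega, eq_div_iff h2, mul_comm]
          exact (isFermi_ram h2).twoPoint_zero
        rw [h0]
        push_cast
        field_simp
        ring
      · rw [(isFermi_ram h2).twoPoint_of_pos (by omega) (by omega), if_neg h]
        push_cast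
        field_simp
        ring
    have hs := congrArg (fun z : ℤ => (z : F)) (sum_ram m)
    rw [Int.cast_mul] at hs
    rw [(isFermi_ram h2).ε_ℓ_ℓ_neg h2, Finset.sum_congr rfl e, Finset.sum_sub_distrib,
      ← Finset.sum_div, ← Int.cast_sum, Finset.sum_ite_eq', if_pos (Finset.mem_range.2 (by omega)),
      virCoeff]
    push_cast at hs ⊢
    have hs' : ∑ x ∈ Finset.range m, ((x : F) + 1) * (2 * (x + 1) - m) =
        (2 * (((m ^ 3 - m) / 6 : ℤ) : F) + m + m ^ 2) / 2 := by
      rw [eq_div_iff h2, ← hs]; ring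
    rw [hs']
    field_simp
    ring

/-- The Ramond vacuum is a nonzero highest weight vector of this weight, and the Verma module maps
onto what it generates. -/
theorem gen_one_sixteenth_ne_zero (h2 : (2 : F) ≠ 0) : Verma.gen (1 / 2 : F) (1 / 16) ≠ 0 := by
  intro h
  obtain ⟨φ, hφ, -⟩ := Verma.exists_lift (h := (1 / 16 : F)) (isVirRep_ram h2) 1
    (by
      have : (isFermi_ram h2).ℓ 0 (1 : Fock F) = 0 := (isFermi_ram h2).ℓ_vac le_rfl
      simp [this])
    (fun n hn => by
      have : (isFermi_ram h2).ℓ n (1 : Fock F) = 0 := (isFermi_ram h2).ℓ_vac hn.le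
      simp [this, hn.ne'])
  rw [h, map_zero] at hφ
  exact one_ne_zero hφ.symm

/-! ### The Virasoro action on the Neveu–Schwarz space -/

theorem nsL_one {n : ℤ} (hn : -1 ≤ n) : nsL n (1 : Fock F) = 0 := by
  rcases le_or_gt 0 n with h | h
  · exact isFermi_ns.ℓ_vac h
  obtain rfl : n = -1 := by omega
  rw [nsL, IsFermi.ℓ, IsFermi.bil_apply]
  refine finsum_eq_zero_of_forall_eq_zero fun k => ?_
  rcases lt_or_ge k 0 with hk | hk
  · rw [IsFermi.normal_of_neg hk]
    rcases eq_or_ne k (-1) with rfl | hk'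
    · have h0 : ns (-1) (ns (-1) (1 : Fock F)) = 0 := cr_self 0 1
      rw [show (-1 : ℤ) - 1 - -1 = -1 by omega, h0, neg_zero, smul_zero]
    · rw [isFermi_ns.vac _ (by omega), map_zero, neg_zero, smul_zero]
  · rw [IsFermi.normal_of_nonneg hk, isFermi_ns.vac _ (by omega), map_zero, smul_zero]

theorem nsL_ns (h2 : (2 : F) ≠ 0) (n l : ℤ) (w : Fock F) :
    nsL n (ns l w) = ns l (nsL n w) - ((l : F) + 1 / 2 + n / 2) • ns (n + l) w := by
  have h := isFermi_ns.ℓ_comm h2 n l w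
  rw [sub_eq_iff_eq_add] at h
  rw [nsL, h]
  push_cast
  module

theorem nsL_single (h2 : (2 : F) ≠ 0) {n : ℤ} (hn : 0 ≤ n) :
    nsL n (cr 0 (1 : Fock F)) = if n = 0 then (1 / 2 : F) • cr 0 1 else 0 := by
  have h := nsL_ns h2 n (-1) (1 : Fock F)
  rw [nsL_one (by omega), map_zero] at h
  refine h.trans ?_
  split_ifs with h0
  · subst h0
    rw [show (0 : ℤ) + -1 = -1 by omega, show ns (-1) (1 : Fock F) = cr 0 1 from rfl]
    push_cast
    match_scalars
    field_simp
    ring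
  · rw [isFermi_ns.vac _ (by omega), smul_zero, sub_zero]

theorem gen_zero_ne_zero (h2 : (2 : F) ≠ 0) : Verma.gen (1 / 2 : F) 0 ≠ 0 := by
  intro h
  obtain ⟨φ, hφ, -⟩ := Verma.exists_lift (h := (0 : F)) (isVirRep_nsL h2) 1
    (by rw [nsL_one (by omega), zero_smul]) (fun n hn => nsL_one (by omega))
  rw [h, map_zero] at hφ
  exact one_ne_zero hφ.symm

theorem cr_one_ne_zero (i : ℕ) : cr i (1 : Fock F) ≠ 0 := by
  intro h
  have h' := an_cr i i (1 : Fock F)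
  rw [h, map_zero, an_one, map_zero, sub_zero, if_pos rfl] at h'
  exact one_ne_zero h'.symm

theorem gen_one_half_ne_zero (h2 : (2 : F) ≠ 0) : Verma.gen (1 / 2 : F) (1 / 2) ≠ 0 := by
  intro h
  obtain ⟨φ, hφ, -⟩ := Verma.exists_lift (h := (1 / 2 : F)) (isVirRep_nsL h2) (cr 0 1)
    (by rw [nsL_single h2 le_rfl, if_pos rfl])
    (fun n hn => by rw [nsL_single h2 hn.le, if_neg hn.ne'])
  rw [h, map_zero] at hφ
  exact cr_one_ne_zero 0 hφ.symm

/-- The field of the Neveu–Schwarz fermion. -/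
def ψ : Fld F (Fock F) := ⟨ns, isFermi_ns.trunc⟩

/-- The Virasoro field of the Neveu–Schwarz space. -/
def nsω : Fld F (Fock F) := ⟨fun n => nsL (n - 1), fun w => by
  obtain ⟨N, hN⟩ := isFermi_ns.exists_bil_eq_zero w
  exact ⟨N + 2, fun n hn => hN _ (by omega) _⟩⟩

theorem nsω_apply (n : ℤ) (w : Fock F) : nsω.1 n w = nsL (n - 1) w := rfl

theorem ψ_apply (n : ℤ) (w : Fock F) : ψ.1 n w = ns n w := rfl

theorem isVirField_nsω (h2 : (2 : F) ≠ 0) : Fld.IsVirField (1 / 2 : F) (nsω (F := F)) := by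
  have h := isVirRep_nsL (F := F) h2
  unfold Fld.IsVirField
  convert h using 2 with n
  exact congrArg nsL (by omega)

/-- The fermion is primary of weight 1/2: only ∂ψ and ψ/2 occur in the commutators with ω. -/
theorem isLocal_nsω_ψ (h2 : (2 : F) ≠ 0) : Fld.IsLocal (nsω (F := F)) ψ := by
  refine Fld.isLocal_of_comm (N := 2) (d := fun t => if t = 0 then Fld.hderiv 1 ψ else (1 / 2 : F) • ψ)
    fun p q w => ?_
  rw [Finset.sum_range_succ, Finset.sum_range_one, nsω_apply, ψ_apply, nsω_apply, ψ_apply,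
    nsL_ns h2]
  simp only [if_true, one_ne_zero, if_false, Fld.hderiv_apply]
  have e1 : (((1 / 2 : F) • ψ : Fld F (Fock F)).1 (p + q - (1 : ℕ)) w) =
    (1 / 2 : F) • ns (p + q - 1) w := rfl
  rw [e1, ψ_apply, show p - 1 + q = p + q - 1 by ring,
    show p + q - (0 : ℕ) - (1 : ℕ) = p + q - 1 by push_cast; ring]
  simp only [Fld.sgnChoose, Ring.choose_zero_right, Ring.choose_one_right, ← Int.cast_smul_eq_zsmul F,
    smul_smul]
  push_cast
  match_scalars
  all_goals field_simp
  all_goals ring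

end Fock

end

noncomputable section

namespace Fld

theorem sgnChoose_zero_right (k : ℤ) : sgnChoose k 0 = 1 := by simp [sgnChoose]

theorem sum_sgnChoose_mul (k l : ℤ) (t : ℕ) :
    ∑ i ∈ Finset.range (t + 1), sgnChoose k i * sgnChoose l (t - i) = sgnChoose (k + l) t := by
  rw [sgnChoose, Ring.add_choose_eq_sum_range, Finset.mul_sum]
  refine Finset.sum_congr rfl fun i hi => ?_
  have : i + (t - i) = t := by have := Finset.mem_range.1 hi; omega
  simp only [sgnChoose]
  conv_rhs => rw [← this, pow_add]
  rw [Nat.add_sub_cancel_left]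
  ring

theorem sub_mul_sgnChoose (k : ℤ) (i : ℕ) : (k - i) * sgnChoose k i = k * sgnChoose (k - 1) i := by
  have h := Ring.choose_mul_choose_sub k i 1
  rw [Ring.choose_one_right, Ring.choose_one_right, Nat.cast_one] at h
  simp only [sgnChoose]
  linear_combination (-1) ^ i * h

theorem sgnChoose_eq_zero {n k : ℕ} (h : n < k) : sgnChoose n k = 0 := by
  rw [sgnChoose, Ring.choose_natCast, Nat.choose_eq_zero_of_lt h]; simp

end Fld

namespace Fock

open Fld

variable {F : Type*} [Field F]

/-! ### Translation -/

/-- The linear map `eₐ ↦ C(a+k,k) eₐ₊ₖ`. -/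
def shiftVec (k : ℕ) : (ℕ →₀ F) →ₗ[F] (ℕ →₀ F) :=
  Finsupp.linearCombination F fun a => Finsupp.single (a + k) ((a + k).choose k : F)

theorem shiftVec_single (k a : ℕ) : shiftVec k (Finsupp.single a (1 : F)) =
    ((a + k).choose k : F) • Finsupp.single (a + k) 1 := by
  simp [shiftVec]

/-- The algebra homomorphism `eₐ ↦ ∑ₖ C(a+k,k) eₐ₊ₖ zᵏ`. -/
def translateHom : Fock F →ₐ[F] PowerSeries (Fock F) :=
  ExteriorAlgebra.lift F ⟨
    { toFun := fun m => PowerSeries.mk fun k => ExteriorAlgebra.ι F (shiftVec k m)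
      map_add' := fun x y => by ext k; simp
      map_smul' := fun a x => by ext k; simp }, fun m => by
    ext n
    rw [PowerSeries.coeff_mul]
    -- In the square of a series with coefficients of degree one in the exterior algebra, the terms
    -- for (i,j) and (j,i) cancel and the diagonal terms are squares, hence zero.
    refine Finset.sum_involution (fun p _ => (p.2, p.1)) ?_ ?_ ?_ ?_
    · intro p _
      exact ExteriorAlgebra.ι_add_mul_swap _ _
    · rintro ⟨i, j⟩ _ hp h
      obtain rfl : j = i := (Prod.mk.inj h).1
      exact hp (ExteriorAlgebra.ι_sq_zero _)
    · intro p hp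
      rw [Finset.HasAntidiagonal.mem_antidiagonal] at hp ⊢
      rw [← hp, add_comm]
    · intro p _
      rfl⟩

/-- The coefficient of `zᵏ` in `translateHom`; it plays the role of `L₋₁ᵏ / k!`. -/
def T (k : ℕ) : Module.End F (Fock F) where
  toFun w := PowerSeries.coeff k (translateHom w)
  map_add' x y := by simp
  map_smul' a x := by rw [map_smul]; rfl

theorem T_apply (k : ℕ) (w : Fock F) : T k w = PowerSeries.coeff k (translateHom w) := rfl

theorem T_one (k : ℕ) : T k (1 : Fock F) = if k = 0 then 1 else 0 := by
  rw [T_apply, map_one, PowerSeries.coeff_one]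

theorem T_cr (k a : ℕ) (w : Fock F) : T k (cr a w) =
    ∑ i ∈ Finset.range (k + 1), ((a + i).choose i : F) • cr (a + i) (T (k - i) w) := by
  have e : translateHom (ExteriorAlgebra.ι F (Finsupp.single a (1 : F))) =
      PowerSeries.mk fun k => ExteriorAlgebra.ι F (shiftVec k (Finsupp.single a (1 : F))) :=
    ExteriorAlgebra.lift_ι_apply F _ _ _
  rw [T_apply, cr_apply, map_mul, e, PowerSeries.coeff_mul,
    Finset.Nat.sum_antidiagonal_eq_sum_range_succ (fun i j =>
      PowerSeries.coeff i (PowerSeries.mk fun k =>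
        ExteriorAlgebra.ι F (shiftVec k (Finsupp.single a (1 : F)))) *
      PowerSeries.coeff j (translateHom w))]
  refine Finset.sum_congr rfl fun i _ => ?_
  rw [PowerSeries.coeff_mk, shiftVec_single, map_smul, smul_mul_assoc]
  rfl

theorem T_zero : T 0 = (LinearMap.id : Module.End F (Fock F)) := by
  refine hom_ext (by rw [T_one]; rfl) fun i w hw => ?_
  rw [T_cr, Finset.sum_range_one, hw]
  simp

theorem ε_T {k : ℕ} (hk : k ≠ 0) (w : Fock F) : ε (T k w) = 0 := by
  have : ε ∘ₗ T k = (0 : Fock F →ₗ[F] F) := by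
    refine hom_ext (by simp [T_one, hk]) fun i w _ => ?_
    rw [LinearMap.comp_apply, T_cr, map_sum, LinearMap.zero_apply]
    refine Finset.sum_eq_zero fun j _ => ?_
    rw [map_smul, ε_cr, smul_zero]
  exact LinearMap.congr_fun this w

theorem T_ns_neg (k a : ℕ) (w : Fock F) : T k (ns (-(a : ℤ) - 1) w) =
    ∑ i ∈ Finset.range (k + 1), sgnChoose (-(a : ℤ) - 1) i • ns (-(a : ℤ) - 1 - i) (T (k - i) w) := by
  rw [ns_neg, T_cr]
  refine Finset.sum_congr rfl fun i _ => ?_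
  rw [show -(a : ℤ) - 1 - i = -((a + i : ℕ) : ℤ) - 1 by push_cast; ring, ns_neg,
    sgnChoose_neg_sub_one, ← Int.cast_smul_eq_zsmul F, add_comm i a, Int.cast_natCast]

/-- Rearrangement of the composite of two expansions. -/
theorem sum_sum_comp {N : Type*} [AddCommGroup N] [Module F N] (a b : ℕ → ℤ)
    (A B : ℕ → Module.End F N) (f : ℕ → N) (k : ℕ) :
    ∑ i ∈ Finset.range (k + 1), a i • A i
        (∑ j ∈ Finset.range (k - i + 1), b j • B j (f (k - i - j))) =
      ∑ t ∈ Finset.range (k + 1), ∑ i ∈ Finset.range (t + 1),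
        (a i * b (t - i)) • A i (B (t - i) (f (k - t))) := by
  have h := Finset.sum_range_diag_flip (k + 1)
    fun i j => (a i * b j) • A i (B j (f (k - i - j)))
  refine Eq.trans ?_ (h.symm.trans ?_)
  · refine Finset.sum_congr rfl fun i hi => ?_
    rw [Finset.mem_range] at hi
    rw [map_sum, Finset.smul_sum, show k - i + 1 = k + 1 - i by omega]
    refine Finset.sum_congr rfl fun j _ => ?_
    rw [map_zsmul, smul_smul]
  · refine Finset.sum_congr rfl fun t ht => Finset.sum_congr rfl fun i hi => ?_
    rw [Finset.mem_range] at ht hi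
    rw [show k - i - (t - i) = k - t by omega]

theorem sum_sum_comp' {N : Type*} [AddCommGroup N] [Module F N] (a b : ℕ → ℤ)
    (A B : ℕ → Module.End F N) (f : ℕ → N) (k : ℕ) :
    ∑ j ∈ Finset.range (k + 1), b j • B j
        (∑ i ∈ Finset.range (k - j + 1), a i • A i (f (k - j - i))) =
      ∑ t ∈ Finset.range (k + 1), ∑ i ∈ Finset.range (t + 1),
        (a i * b (t - i)) • B (t - i) (A i (f (k - t))) := by
  rw [sum_sum_comp b a B A f k]
  refine Finset.sum_congr rfl fun t _ => ?_
  rw [← Finset.sum_range_reflect]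
  refine Finset.sum_congr rfl fun i hi => ?_
  rw [Finset.mem_range] at hi
  rw [show t + 1 - 1 - i = t - i by omega, show t - (t - i) = i by omega, mul_comm]

/-- Translation covariance of the fermion. For creation operators it is the definition of T. For
annihilation operators one moves past the creation operators of the vector; the anticommutators
combine by Vandermonde and cancel except for the one expected, at t = 0. -/
theorem T_ns (k : ℕ) (l : ℤ) (w : Fock F) : T k (ns l w) =
    ∑ i ∈ Finset.range (k + 1), sgnChoose l i • ns (l - i) (T (k - i) w) := by
  rcases lt_or_ge l 0 with hl | hl
  · obtain ⟨a, rfl⟩ : ∃ a : ℕ, l = -(a : ℤ) - 1 := ⟨(-l - 1).toNat, by omega⟩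
    exact T_ns_neg k a w
  lift l to ℕ using hl
  induction w using induction generalizing k with
  | one =>
    rw [isFermi_ns.vac _ (by omega), map_zero]
    refine (Finset.sum_eq_zero fun i hi => ?_).symm
    rw [Finset.mem_range] at hi
    rw [T_one]
    split_ifs with h
    · rcases lt_or_ge l i with hli | hli
      · rw [sgnChoose_eq_zero hli, zero_smul]
      · rw [isFermi_ns.vac _ (by omega), smul_zero]
    · rw [map_zero, smul_zero]
  | add x y hx hy => simp only [map_add, hx, hy, smul_add, Finset.sum_add_distrib]
  | smul a x hx =>
    simp only [map_smul, hx, Finset.smul_sum]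
    exact Finset.sum_congr rfl fun i _ => smul_comm _ _ _
  | cr a x hx =>
    rw [← ns_neg]
    have h1 : ∀ i, T i (ns (-(a : ℤ) - 1) x) = _ := fun i => T_ns_neg i a x
    simp only [h1]
    rw [isFermi_ns.swap, map_sub, T_ns_neg]
    simp only [hx]
    rw [sum_sum_comp (sgnChoose l) (sgnChoose (-(a : ℤ) - 1)) (fun i => ns ((l : ℤ) - i))
      (fun i => ns (-(a : ℤ) - 1 - i)) (fun i => T i x),
      sum_sum_comp' (sgnChoose l) (sgnChoose (-(a : ℤ) - 1)) (fun i => ns ((l : ℤ) - i))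
      (fun i => ns (-(a : ℤ) - 1 - i)) (fun i => T i x), sub_eq_iff_eq_add, ← Finset.sum_add_distrib]
    have h2 : ∀ t ∈ Finset.range (k + 1),
        ∑ i ∈ Finset.range (t + 1), (sgnChoose l i * sgnChoose (-(a : ℤ) - 1) (t - i)) •
          ns ((l : ℤ) - i) (ns (-(a : ℤ) - 1 - (t - i : ℕ)) (T (k - t) x)) +
        ∑ i ∈ Finset.range (t + 1), (sgnChoose l i * sgnChoose (-(a : ℤ) - 1) (t - i)) •
          ns (-(a : ℤ) - 1 - (t - i : ℕ)) (ns ((l : ℤ) - i) (T (k - t) x)) =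
        if t = 0 then (if (l : ℤ) + (-(a : ℤ) - 1) = -1 then T k x else 0) else 0 := by
      intro t _
      rw [← Finset.sum_add_distrib]
      have h3 : ∀ i ∈ Finset.range (t + 1),
          (sgnChoose l i * sgnChoose (-(a : ℤ) - 1) (t - i)) •
            ns ((l : ℤ) - i) (ns (-(a : ℤ) - 1 - (t - i : ℕ)) (T (k - t) x)) +
          (sgnChoose l i * sgnChoose (-(a : ℤ) - 1) (t - i)) •
            ns (-(a : ℤ) - 1 - (t - i : ℕ)) (ns ((l : ℤ) - i) (T (k - t) x)) =
          (sgnChoose l i * sgnChoose (-(a : ℤ) - 1) (t - i)) •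
            if (l : ℤ) + (-(a : ℤ) - 1) - t = -1 then T (k - t) x else 0 := by
        intro i hi
        rw [Finset.mem_range] at hi
        rw [← smul_add, isFermi_ns.anti]
        congr 1
        exact if_congr (by omega) rfl rfl
      rw [Finset.sum_congr rfl h3, ← Finset.sum_smul, sum_sgnChoose_mul]
      rcases Nat.eq_zero_or_pos t with rfl | ht
      · rw [sgnChoose_zero_right, one_smul, if_pos rfl]
        exact if_congr (by omega) rfl rfl
      · rw [if_neg (by omega : t ≠ 0)]
        split_ifs with h
        -- An anticommutator at order t > 0 could be nonzero only if its total coefficient were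
        -- C(t-1,t), which is zero.
        · rw [show (l : ℤ) + (-(a : ℤ) - 1) = ((t - 1 : ℕ) : ℤ) by omega,
            sgnChoose_eq_zero (by omega), zero_smul]
        · rw [smul_zero]
    rw [Finset.sum_congr rfl h2, Finset.sum_ite_eq', if_pos (Finset.mem_range.2 (by omega))]
    split_ifs
    · rfl
    · exact map_zero _

theorem sum_sgnChoose_mul_weight (n l : ℤ) (t : ℕ) :
    ∑ i ∈ Finset.range (t + 1), sgnChoose (n + 1) i * sgnChoose l (t - i) *
      (2 * (l - (t - i : ℕ)) + (n + 1 - i)) = (2 * l + n + 1) * sgnChoose (n + l) t := by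
  have e : ∀ i ∈ Finset.range (t + 1), sgnChoose (n + 1) i * sgnChoose l (t - i) *
      (2 * (l - (t - i : ℕ)) + (n + 1 - i)) =
      2 * l * (sgnChoose (n + 1) i * sgnChoose (l - 1) (t - i)) +
        (n + 1) * (sgnChoose n i * sgnChoose l (t - i)) := by
    intro i _
    have h1 := sub_mul_sgnChoose l (t - i)
    have h2 := sub_mul_sgnChoose (n + 1) i
    rw [add_sub_cancel_right] at h2
    linear_combination 2 * sgnChoose (n + 1) i * h1 + sgnChoose l (t - i) * h2
  rw [Finset.sum_congr rfl e, Finset.sum_add_distrib, ← Finset.mul_sum, ← Finset.mul_sum,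
    sum_sgnChoose_mul, sum_sgnChoose_mul, show n + 1 + (l - 1) = n + l by ring]
  ring

/-- The failure of the covariance of the Virasoro field under translations. -/
def nsLDefect (k : ℕ) (n : ℤ) : Module.End F (Fock F) :=
  T k ∘ₗ nsL n - ∑ i ∈ Finset.range (k + 1), sgnChoose (n + 1) i • (nsL (n - i) ∘ₗ T (k - i))

theorem nsLDefect_apply (k : ℕ) (n : ℤ) (w : Fock F) : nsLDefect k n w = T k (nsL n w) -
    ∑ i ∈ Finset.range (k + 1), sgnChoose (n + 1) i • nsL (n - i) (T (k - i) w) := by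
  rw [nsLDefect, LinearMap.sub_apply, LinearMap.sum_apply]
  rfl

theorem nsLDefect_ns (h2 : (2 : F) ≠ 0) (k : ℕ) (n l : ℤ) (w : Fock F) :
    nsLDefect k n (ns l w) =
      ∑ i ∈ Finset.range (k + 1), sgnChoose l i • ns (l - i) (nsLDefect (k - i) n w) := by
  rw [nsLDefect_apply]
  simp only [nsLDefect_apply, T_ns, map_sub, smul_sub, Finset.sum_sub_distrib]
  rw [nsL_ns h2, map_sub, map_smul, T_ns, T_ns,
    sum_sum_comp (sgnChoose (n + 1)) (sgnChoose l) (fun i => nsL (n - i)) (fun i => ns (l - i))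
      (fun i => T i w),
    sum_sum_comp' (sgnChoose (n + 1)) (sgnChoose l) (fun i => nsL (n - i)) (fun i => ns (l - i))
      (fun i => T i w), sub_sub, sub_right_inj, Finset.smul_sum,
    ← Finset.sum_add_distrib]
  refine Finset.sum_congr rfl fun t _ => ?_
  have e : ∀ i ∈ Finset.range (t + 1), (sgnChoose (n + 1) i * sgnChoose l (t - i)) •
      nsL (n - i) (ns (l - (t - i : ℕ)) (T (k - t) w)) =
      (sgnChoose (n + 1) i * sgnChoose l (t - i)) •
        ns (l - (t - i : ℕ)) (nsL (n - i) (T (k - t) w)) -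
      (((sgnChoose (n + 1) i * sgnChoose l (t - i) * (2 * (l - (t - i : ℕ)) + (n + 1 - i)) : ℤ) : F)
        / 2) • ns (n + l - t) (T (k - t) w) := by
    intro i hi
    rw [Finset.mem_range] at hi
    rw [nsL_ns h2, smul_sub, show n - i + (l - (t - i : ℕ)) = n + l - t by omega]
    congr 1
    rw [← Int.cast_smul_eq_zsmul F, smul_smul]
    congr 1
    push_cast
    field_simp
    ring
  rw [Finset.sum_congr rfl e, Finset.sum_sub_distrib, ← Finset.sum_smul, ← Finset.sum_div,
    ← Int.cast_sum, sum_sgnChoose_mul_weight, add_sub_left_comm, add_eq_left, sub_eq_zero,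
    ← Int.cast_smul_eq_zsmul F, smul_smul]
  congr 1
  push_cast
  field_simp
  ring

theorem ε_nsL_one (n : ℤ) : ε (nsL n (1 : Fock F)) = 0 := by
  rcases le_or_gt 0 n with hn | hn
  · rw [nsL_one (by omega), map_zero]
  · exact isFermi_ns.ε_ℓ hn.le 1

/-- Once the defects of lower order vanish, the defect of order k commutes with all modes of the
fermion (`nsLDefect_ns`). It is therefore a scalar, and its value on the vacuum has no scalar part.
-/
theorem T_nsL (h2 : (2 : F) ≠ 0) (k : ℕ) (n : ℤ) (w : Fock F) : T k (nsL n w) =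
    ∑ i ∈ Finset.range (k + 1), sgnChoose (n + 1) i • nsL (n - i) (T (k - i) w) := by
  suffices h : nsLDefect k n = (0 : Module.End F (Fock F)) by
    rw [← sub_eq_zero, ← nsLDefect_apply, h, LinearMap.zero_apply]
  induction k using Nat.strong_induction_on with
  | h k ih =>
    have hcomm : ∀ l (w : Fock F), nsLDefect k n (ns l w) = ns l (nsLDefect k n w) := by
      intro l w
      rw [nsLDefect_ns h2, Finset.sum_range_succ', Finset.sum_eq_zero]
      · simp [sgnChoose_zero_right]
      · intro i hi
        rw [Finset.mem_range] at hi
        rw [ih _ (by omega), LinearMap.zero_apply, map_zero, smul_zero]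
    refine hom_ext ?_ fun i w hw => ?_
    · rw [LinearMap.zero_apply, eq_smul_one_of_an_eq_zero (w := nsLDefect k n 1) fun i => by
        rw [← ns_natCast, ← hcomm, isFermi_ns.vac _ (by omega), map_zero]]
      have : ε (nsLDefect k n (1 : Fock F)) = 0 := by
        rw [nsLDefect_apply, map_sub, map_sum, Finset.sum_eq_zero, sub_zero]
        · rcases Nat.eq_zero_or_pos k with rfl | hk
          · rw [T_zero]; exact ε_nsL_one n
          · exact ε_T hk.ne' _
        · intro i _
          rw [T_one, map_zsmul]
          split_ifs
          · rw [ε_nsL_one, smul_zero]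
          · simp
      rw [this, zero_smul]
    · rw [← ns_neg, hcomm, hw]
      simp

/-- The image of `x` under the homomorphism from the Verma module that sends the generator
to the vacuum. -/
def toFock (h2 : (2 : F) ≠ 0) : Verma (1 / 2 : F) 0 →ₗ[F] Fock F :=
  LinearMap.applyₗ (1 : Fock F) ∘ₗ LinearMap.proj (-1) ∘ₗ (Fld F (Fock F)).subtype ∘ₗ
    (isVirField_nsω h2).Y

theorem toFock_apply (h2 : (2 : F) ≠ 0) (x : Verma (1 / 2 : F) 0) :
    toFock h2 x = ((isVirField_nsω h2).Y x).1 (-1) 1 := rfl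

/-- The creation property on the Fock space, with the divided powers T in place of the exponential
of L₋₁. Nonnegative modes and the formula for negative ones are proved together, since the first
claim makes the sums in the second finite. -/
theorem Y_vac (h2 : (2 : F) ≠ 0) (x : Verma (1 / 2 : F) 0) :
    (∀ n ≥ 0, ((isVirField_nsω h2).Y x).1 n 1 = 0) ∧
      ∀ k : ℕ, ((isVirField_nsω h2).Y x).1 (-(k : ℤ) - 1) 1 = T k (toFock h2 x) := by
  induction x using Verma.induction with
  | hgen =>
    simp only [toFock_apply, IsVirField.Y_gen, one_apply]
    refine ⟨fun n hn => by rw [if_neg (by omega)], fun k => ?_⟩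
    rw [if_pos trivial, T_one]
    exact if_congr (by omega) rfl rfl
  | hL n x hx =>
    obtain ⟨h0, hk⟩ := hx
    have hω : ∀ r : ℤ, P ((isVirField_nsω h2).Y x) nsω (n + 1) r 0 1 = 0 := fun r =>
      P_eq_zero _ _ _ _ fun k hk => nsL_one (by omega)
    have key : ∀ k : ℕ, ((isVirField_nsω h2).Y ⁅Vir.L F n, x⁆).1 (-(k : ℤ) - 1) 1 =
        T k (nsL n (toFock h2 x)) := by
      intro k
      rw [IsVirField.Y_lie, nprod_apply, J, hω, smul_zero, sub_zero,
        P_eq_sum (B := k + 1) _ _ _ _ fun i hi => h0 _ (by omega), T_nsL h2]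
      refine Finset.sum_congr rfl fun i hi => ?_
      rw [Finset.mem_range] at hi
      rw [show -(k : ℤ) - 1 + i = -((k - i : ℕ) : ℤ) - 1 by omega, hk, nsω_apply,
        show n + 1 + 0 - i - 1 = n - i by ring]
      rfl
    have e : toFock h2 ⁅Vir.L F n, x⁆ = nsL n (toFock h2 x) := by
      have := key 0
      rw [T_zero] at this
      exact this
    refine ⟨fun m hm => ?_, fun k => by rw [key, e]⟩
    rw [IsVirField.Y_lie, nprod_apply, J, hω, smul_zero, sub_zero]
    exact P_eq_zero _ _ _ _ fun k hk => h0 k (by omega)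
  | hadd x y hx hy =>
    refine ⟨fun n hn => ?_, fun k => ?_⟩
    · have := congrArg₂ (· + ·) (hx.1 n hn) (hy.1 n hn)
      rw [map_add]
      simpa using this
    · have := congrArg₂ (· + ·) (hx.2 k) (hy.2 k)
      rw [map_add, map_add, map_add, ← this]
      rfl
  | hsmul a x hx =>
    refine ⟨fun n hn => ?_, fun k => ?_⟩
    · have := congrArg (a • ·) (hx.1 n hn)
      rw [map_smul]
      simpa using this
    · have := congrArg (a • ·) (hx.2 k)
      rw [map_smul, map_smul, map_smul, ← this]
      rfl

theorem toFock_gen (h2 : (2 : F) ≠ 0) : toFock h2 (Verma.gen (1 / 2 : F) 0) = 1 := by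
  rw [toFock_apply, IsVirField.Y_gen, one_apply, if_pos rfl]

theorem toFock_lie (h2 : (2 : F) ≠ 0) (n : ℤ) (x : Verma (1 / 2 : F) 0) :
    toFock h2 ⁅Vir.L F n, x⁆ = nsL n (toFock h2 x) := by
  rw [toFock_apply, IsVirField.Y_lie, nprod_apply, J,
    P_eq_zero _ nsω _ _ (fun k hk => nsL_one (by omega)), smul_zero, sub_zero,
    P_eq_sum (B := 1) _ _ _ _ fun i hi => (Y_vac h2 x).1 _ (by omega), Finset.sum_range_one]
  simp [nsω_apply, toFock_apply]

end Fock

end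

noncomputable section

namespace Fock

open Fld

variable {F : Type*} [Field F]

/-! ### Quadratic fields -/

/-- A field that is local with the fermion and kills the vacuum is zero. -/
theorem eq_zero_of_isLocal_ψ {D : Fld F (Fock F)} (hD : IsLocal D ψ) (h1 : ∀ n, D.1 n 1 = 0) :
    D = 0 := by
  obtain ⟨N, hN⟩ := hD
  have step : ∀ w : Fock F, (∀ m, D.1 m w = 0) → ∀ m n, D.1 m (ns n w) = 0 := by
    intro w hw
    -- Since D kills w, locality says that (z₁ - z₂)^N D(z₁)ψ(z₂)w = 0. Factors are removed one at a
    -- time: if z₁ - z₂ times a series vanishes, its coefficients are constant along m + n, and they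
    -- vanish for large n.
    have hP : ∀ l : ℕ, l ≤ N → ∀ m n, P D ψ (N - l : ℕ) m n w = 0 := by
      intro l hl
      induction l with
      | zero =>
        intro m n
        have h := hN m n w
        rw [J, P_eq_zero ψ D _ _ (fun k _ => hw k), smul_zero, sub_zero] at h
        exact h
      | succ l ih =>
        have hs : ∀ m n, P D ψ (N - (l + 1) : ℕ) m n w = P D ψ (N - (l + 1) : ℕ) (m - 1) (n + 1) w := by
          intro m n
          have h := ih (by omega) (m - 1) n
          rw [show ((N - l : ℕ) : ℤ) = ((N - (l + 1) : ℕ) : ℤ) + 1 by omega, P_succ, sub_eq_zero,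
            sub_add_cancel] at h
          exact h
        have hs' : ∀ (j : ℕ) m n,
            P D ψ (N - (l + 1) : ℕ) m n w = P D ψ (N - (l + 1) : ℕ) (m - j) (n + j) w := by
          intro j
          induction j with
          | zero => intro m n; simp
          | succ j ih =>
            intro m n
            rw [ih, hs]
            congr 1 <;> push_cast <;> ring
        intro m n
        obtain ⟨B, hB⟩ := exists_bound ψ w
        rw [hs' (B - n).toNat m n]
        exact P_eq_zero _ _ _ _ fun k hk => hB k (by omega)
    intro m n
    have h := hP N le_rfl m n
    rw [Nat.sub_self, Nat.cast_zero, P_zero] at h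
    exact h
  refine ext' fun m w => ?_
  change D.1 m w = 0
  induction w using induction generalizing m with
  | one => exact h1 m
  | add x y hx hy => rw [map_add, hx, hy, add_zero]
  | smul a x hx => rw [map_smul, hx, smul_zero]
  | cr i x hx => rw [← ns_neg]; exact step x hx m _

/-- The coefficients of the field of `eₐ e_b`. -/
def quadCoeff (F : Type*) [Field F] (a b : ℕ) (s k : ℤ) : F :=
  ((Ring.choose (-(s - k) - 1) a * Ring.choose (-k - 1) b : ℤ) : F)

/-- The field of the vector `eₐ e_b`. -/
def quad (a b : ℕ) : Fld F (Fock F) :=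
  ⟨fun n => isFermi_ns.bil (quadCoeff F a b (n - 1 - a - b)) (n - 1 - a - b), fun w => by
    obtain ⟨N, hN⟩ := isFermi_ns.exists_bil_eq_zero w
    exact ⟨N + 1 + a + b, fun n hn => hN _ (by omega) _⟩⟩

theorem quad_apply (a b : ℕ) (n : ℤ) (w : Fock F) : (quad a b).1 n w =
    isFermi_ns.bil (quadCoeff F a b (n - 1 - a - b)) (n - 1 - a - b) w := rfl

theorem quad_ns (a b : ℕ) (n l : ℤ) (w : Fock F) :
    (quad a b).1 n (ns l w) - ns l ((quad a b).1 n w) =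
      ((Ring.choose (-(n + l - a - b) - 1) a * Ring.choose l b
        - Ring.choose l a * Ring.choose (-(n + l - a - b) - 1) b : ℤ) : F) •
        ns (n + l - a - b) w := by
  rw [quad_apply, quad_apply, IsFermi.bil_comm,
    show n - 1 - a - b + 1 + l = n + l - a - b by ring]
  congr 1
  simp only [quadCoeff]
  rw [← Int.cast_sub]
  congr 3 <;> congr 1 <;> ring

/-- Rewrites a binomial coefficient in M - m as a combination of the C(m,t) whose coefficients
depend only on M, the shape that `isLocal_of_comm` requires with M the sum of the two modes. -/
theorem choose_eq_sum (M m : ℤ) (b : ℕ) : Ring.choose (M - m) b =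
    ∑ t ∈ Finset.range (b + 1), Ring.choose m t * ((-1) ^ b * Ring.choose (b - M - 1) (b - t)) := by
  rw [Ring.choose_eq_neg_one_pow_mul, show (b : ℤ) - (M - m) - 1 = m + (b - M - 1) by ring,
    Ring.add_choose_eq_sum_range, Finset.mul_sum]
  exact Finset.sum_congr rfl fun t _ => by ring

theorem choose_eq_sum_of_le (M m : ℤ) {b N : ℕ} (h : b < N) : Ring.choose (M - m) b =
    ∑ t ∈ Finset.range N, Ring.choose m t *
      (if t ≤ b then (-1) ^ b * Ring.choose (b - M - 1) (b - t) else 0) := by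
  rw [choose_eq_sum, ← Finset.sum_subset (Finset.range_mono (by omega : b + 1 ≤ N))]
  · refine Finset.sum_congr rfl fun t ht => ?_
    rw [Finset.mem_range] at ht
    rw [if_pos (by omega)]
  · intro t _ ht
    rw [Finset.mem_range] at ht
    rw [if_neg (by omega), mul_zero]

/-- For fixed p + q the coefficient in the commutator is a polynomial in p, so it expands in
finitely many C(p,t); the expansion coefficients define the fields `d`. -/
theorem isLocal_quad_ψ (a b : ℕ) : IsLocal (quad (F := F) a b) ψ := by
  let e : ℕ → ℕ → ℤ → ℤ := fun b t M =>
    if t ≤ b then (-1) ^ b * Ring.choose (b - M - 1) (b - t) else 0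
  let d : ℕ → Fld F (Fock F) := fun t => ⟨fun n =>
    ((Ring.choose (-(n + t - a - b) - 1) a * e b t (n + t)
      - e a t (n + t) * Ring.choose (-(n + t - a - b) - 1) b : ℤ) : F) • ns (n + t - a - b), fun w => by
    obtain ⟨N, hN⟩ := isFermi_ns.trunc w
    refine ⟨N + a + b, fun n hn => ?_⟩
    rw [LinearMap.smul_apply, hN _ (by omega), smul_zero]⟩
  refine isLocal_of_comm (N := a + b + 1) (d := d) fun p q w => ?_
  rw [ψ_apply, ψ_apply, quad_ns]
  have hd : ∀ t ∈ Finset.range (a + b + 1), Ring.choose p t • (d t).1 (p + q - t) w =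
      ((Ring.choose (-(p + q - a - b) - 1) a * (Ring.choose p t * e b t (p + q))
      - (Ring.choose p t * e a t (p + q)) * Ring.choose (-(p + q - a - b) - 1) b : ℤ) : F) •
        ns (p + q - a - b) w := by
    intro t _
    simp only [d, LinearMap.smul_apply, sub_add_cancel]
    rw [← Int.cast_smul_eq_zsmul F, smul_smul, ← Int.cast_mul]
    congr 2
    ring
  rw [Finset.sum_congr rfl hd, ← Finset.sum_smul, ← Int.cast_sum, Finset.sum_sub_distrib,
    ← Finset.mul_sum, ← Finset.sum_mul, ← choose_eq_sum_of_le _ _ (by omega),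
    ← choose_eq_sum_of_le _ _ (by omega), add_sub_cancel_left]

theorem quad_term_eq_zero (a b : ℕ) {s k : ℤ} (h : 0 ≤ k ∨ 0 ≤ s - k) :
    quadCoeff F a b s k • IsFermi.normal ns (s - k) k (1 : Fock F) = 0 := by
  rcases lt_or_ge k 0 with hk | hk
  · rw [IsFermi.normal_of_neg hk, isFermi_ns.vac _ (by omega), map_zero, neg_zero, smul_zero]
  · rw [IsFermi.normal_of_nonneg hk, isFermi_ns.vac _ (by omega), map_zero, smul_zero]

theorem quad_term (a b a' b' : ℕ) {s k : ℤ} (hs : s - k = -(a' : ℤ) - 1) (hk : k = -(b' : ℤ) - 1) :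
    quadCoeff F a b s k • IsFermi.normal ns (s - k) k (1 : Fock F) =
      ((a'.choose a : F) * b'.choose b) • cr a' (cr b' 1) := by
  rw [IsFermi.normal_of_neg (by omega), quadCoeff, hs, hk, ns_neg, ns_neg, cr_cr b' a', neg_neg,
    show -(-(a' : ℤ) - 1) - 1 = a' by ring, show -(-(b' : ℤ) - 1) - 1 = b' by ring,
    Ring.choose_natCast, Ring.choose_natCast]
  push_cast
  rfl

/-- The indices of the two creation operators in a term add up to a + b - n - 1, so one lies below a
or the other below b, and a binomial coefficient vanishes. -/
theorem quad_vac_of_nonneg (a b : ℕ) {n : ℤ} (hn : 0 ≤ n) : (quad (F := F) a b).1 n 1 = 0 := by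
  rw [quad_apply, IsFermi.bil_apply]
  refine finsum_eq_zero_of_forall_eq_zero fun k => ?_
  by_cases h : 0 ≤ k ∨ 0 ≤ n - 1 - a - b - k
  · exact quad_term_eq_zero a b h
  · rw [quad_term a b (-(n - 1 - a - b - k) - 1).toNat (-k - 1).toNat (by omega) (by omega)]
    by_cases ha : (-(n - 1 - a - b - k) - 1).toNat < a
    · rw [Nat.choose_eq_zero_of_lt ha, Nat.cast_zero, zero_mul, zero_smul]
    · rw [Nat.choose_eq_zero_of_lt (n := (-k - 1).toNat) (k := b) (by omega), Nat.cast_zero, mul_zero,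
        zero_smul]

theorem T_cr_cr_one (j a b : ℕ) : T j (cr a (cr b (1 : Fock F))) = ∑ i ∈ Finset.range (j + 1),
    (((a + (j - i)).choose a : F) * (b + i).choose b) • cr (a + (j - i)) (cr (b + i) 1) := by
  have h : ∀ j, T j (cr b (1 : Fock F)) = ((b + j).choose b : F) • cr (b + j) 1 := by
    intro j
    rw [T_cr, Finset.sum_eq_single j]
    · rw [Nat.sub_self, T_one, if_pos rfl, Nat.choose_symm_add]
    · intro i hi hij
      rw [Finset.mem_range] at hi
      rw [T_one, if_neg (by omega), map_zero, smul_zero]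
    · intro hj
      exact absurd (Finset.mem_range.2 (by omega)) hj
  rw [T_cr, ← Finset.sum_range_reflect]
  refine Finset.sum_congr rfl fun i hi => ?_
  rw [Finset.mem_range] at hi
  rw [show j + 1 - 1 - i = j - i by omega, show j - (j - i) = i by omega, h, map_smul, smul_smul,
    Nat.choose_symm_add (a := a) (b := j - i)]

theorem quad_vac (a b j : ℕ) : (quad (F := F) a b).1 (-(j : ℤ) - 1) 1 = T j (cr a (cr b 1)) := by
  have hinj : Function.Injective fun i : ℕ => -((b + i : ℕ) : ℤ) - 1 := fun i j h => by simpa using h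
  rw [quad_apply, IsFermi.bil_apply,
    finsum_eq_sum_of_support_subset (s := (Finset.range (j + 1)).map ⟨_, hinj⟩), Finset.sum_map,
    T_cr_cr_one]
  · refine Finset.sum_congr rfl fun i hi => ?_
    rw [Finset.mem_range] at hi
    exact quad_term a b (a + (j - i)) (b + i)
      (by simp only [Function.Embedding.coeFn_mk]; omega) rfl
  · intro k hk
    simp only [Finset.coe_map, Set.mem_image, Finset.coe_range, Set.mem_Iio,
      Function.Embedding.coeFn_mk]
    by_contra hc
    apply hk
    by_cases h : 0 ≤ k ∨ 0 ≤ -(j : ℤ) - 1 - 1 - a - b - k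
    · exact quad_term_eq_zero a b h
    · simp only
      rw [quad_term a b (-(-(j : ℤ) - 1 - 1 - a - b - k) - 1).toNat (-k - 1).toNat (by omega)
        (by omega)]
      by_cases hb : (-k - 1).toNat < b
      · rw [Nat.choose_eq_zero_of_lt hb, Nat.cast_zero, mul_zero, zero_smul]
      · have ha : (-(-(j : ℤ) - 1 - 1 - a - b - k) - 1).toNat < a := by
          by_contra ha
          exact hc ⟨(-k - 1).toNat - b, by omega, by omega⟩
        rw [Nat.choose_eq_zero_of_lt ha, Nat.cast_zero, zero_mul, zero_smul]

/-- Both fields are local with ψ and agree on the vacuum, so their difference is zero by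
`eq_zero_of_isLocal_ψ`. -/
theorem Y_eq_quad (h2 : (2 : F) ≠ 0) {x : Verma (1 / 2 : F) 0} {a b : ℕ}
    (hx : toFock h2 x = cr a (cr b 1)) : (isVirField_nsω h2).Y x = quad a b := by
  have hloc : IsLocal ((isVirField_nsω h2).Y x + (-1 : F) • quad a b) ψ :=
    ((isVirField_nsω h2).isLocal_Y_of_isLocal (isLocal_nsω_ψ h2) x).add ((isLocal_quad_ψ a b).smul _)
  have h := eq_zero_of_isLocal_ψ hloc fun n => by
    have e : ((isVirField_nsω h2).Y x + (-1 : F) • quad a b).1 n 1 =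
      ((isVirField_nsω h2).Y x).1 n 1 + (-1 : F) • (quad a b).1 n 1 := rfl
    rw [e]
    rcases lt_or_ge n 0 with hn | hn
    · obtain ⟨k, rfl⟩ : ∃ k : ℕ, n = -(k : ℤ) - 1 := ⟨(-n - 1).toNat, by omega⟩
      rw [(Y_vac h2 x).2, quad_vac, hx]
      module
    · rw [(Y_vac h2 x).1 n hn, quad_vac_of_nonneg a b hn]
      module
  rw [← sub_eq_zero, sub_eq_add_neg, ← h]
  module

theorem Y_eq_zero (h2 : (2 : F) ≠ 0) {x : Verma (1 / 2 : F) 0} (hx : toFock h2 x = 0) :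
    (isVirField_nsω h2).Y x = 0 := by
  refine eq_zero_of_isLocal_ψ ((isVirField_nsω h2).isLocal_Y_of_isLocal (isLocal_nsω_ψ h2) x) fun n => ?_
  rcases lt_or_ge n 0 with hn | hn
  · obtain ⟨k, rfl⟩ : ∃ k : ℕ, n = -(k : ℤ) - 1 := ⟨(-n - 1).toNat, by omega⟩
    rw [(Y_vac h2 x).2, hx, map_zero]
  · exact (Y_vac h2 x).1 n hn

/-- Once eₐe_b lies in the image of V(1/2,0), its quadratic field is one of the fields Y(x), and
these preserve the image. -/
theorem quad_mem_range (h2 : (2 : F) ≠ 0) {a b : ℕ} {w : Fock F}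
    (hab : cr a (cr b 1) ∈ LinearMap.range (toFock h2)) (n : ℤ) (hw : w ∈ LinearMap.range (toFock h2)) :
    (quad a b).1 n w ∈ LinearMap.range (toFock h2) := by
  obtain ⟨x, hx⟩ := hab
  rw [← Y_eq_quad h2 hx]
  refine (isVirField_nsω h2).Y_mem (fun n w hw => ?_) x n hw
  obtain ⟨y, rfl⟩ := hw
  exact ⟨⁅Vir.L F (n - 1), y⁆, toFock_lie h2 _ y⟩

end Fock

end

noncomputable section

/-! ### Binomial coefficients modulo a prime. -/

namespace Nat

/-- Lucas's theorem: the only nonzero digit of p^j is a single 1, so the binomial coefficient is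
congruent to the j-th digit of n. -/
theorem choose_prime_pow_modEq {p : ℕ} [Fact p.Prime] (j n : ℕ) :
    (n.choose (p ^ j) : ℤ) ≡ ((n / p ^ j : ℕ) : ℤ) [ZMOD p] := by
  induction j generalizing n with
  | zero => simp
  | succ j ih =>
    have hp : 0 < p := (Fact.out : p.Prime).pos
    have h := Choose.choose_modEq_choose_mod_mul_choose_div (n := n) (k := p ^ (j + 1)) (p := p)
    rw [show p ^ (j + 1) % p = 0 by rw [pow_succ, Nat.mul_mod_left],
      show p ^ (j + 1) / p = p ^ j by rw [pow_succ, Nat.mul_div_cancel _ hp], Nat.choose_zero_right,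
      Nat.cast_one, one_mul] at h
    refine h.trans ((ih (n / p)).trans ?_)
    rw [Nat.div_div_eq_div_mul, pow_succ']

theorem cast_choose_prime_pow (F : Type*) [Field F] {p : ℕ} [CharP F p] (hp : p.Prime) (j n : ℕ) :
    (n.choose (p ^ j) : F) = ((n / p ^ j : ℕ) : F) := by
  have := Fact.mk hp
  have h := choose_prime_pow_modEq (p := p) j n
  have := (CharP.intCast_eq_intCast F p).2 h
  rwa [Int.cast_natCast, Int.cast_natCast] at this

/-- In characteristic different from two, some binomial coefficient `C(t,k)` with odd `k` is
nonzero. -/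
theorem exists_odd_choose_ne_zero (F : Type*) [Field F] (h2 : (2 : F) ≠ 0) {t : ℕ} (ht : t ≠ 0) :
    ∃ k ≤ t, Odd k ∧ (t.choose k : F) ≠ 0 := by
  obtain ⟨p, hp⟩ := CharP.exists F
  rcases CharP.char_is_prime_or_zero F p with hpp | rfl
  · have hodd : Odd p := hpp.odd_of_ne_two fun h => h2 (by
      have := CharP.cast_eq_zero F p
      rw [h] at this
      exact_mod_cast this)
    -- With t = p^j m and p not dividing m, the index k = p^j is odd and C(t,k) is m modulo p.
    obtain ⟨j, m, hm, rfl⟩ := Nat.exists_eq_pow_mul_and_not_dvd ht p hpp.ne_one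
    have hm0 : 0 < m := Nat.pos_of_ne_zero fun h => hm (h ▸ dvd_zero p)
    refine ⟨p ^ j, Nat.le_mul_of_pos_right _ hm0, hodd.pow, ?_⟩
    rw [cast_choose_prime_pow F hpp, Nat.mul_div_cancel_left _ (pow_pos hpp.pos j)]
    exact fun h => hm ((CharP.cast_eq_zero_iff F p m).1 h)
  · have := CharP.charP_to_charZero F
    exact ⟨1, Nat.one_le_iff_ne_zero.2 ht, odd_one, by rw [Nat.choose_one_right]; exact_mod_cast ht⟩

end Nat

namespace Fock

open Fld

variable {F : Type*} [Field F]

/-! ### Linear relations among the vectors eₜ e_{S-t}. -/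

section Relations

variable {N : Type*} [AddCommGroup N] [Module F N] {S : ℕ} {μ : ℕ → N}

/-- Choose k odd with C(t,k) nonzero; the relation at i = t - k then determines μ(t) from an earlier
value, and trinomial revision shows that signed binomials solve it. The case t = S is left out,
since k could then have to be S. -/
theorem eq_smul_of_relations (h2 : (2 : F) ≠ 0)
    (rel : ∀ k, Odd k → k < S → ∀ i, i + k ≤ S →
      ((i + k).choose k : F) • μ (i + k) + ((S - i).choose k : F) • μ i = 0) :
    ∀ t < S, μ t = ((-1) ^ t * (S.choose t : F)) • μ 0 := by
  intro t
  induction t using Nat.strong_induction_on with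
  | _ t ih =>
    intro ht
    rcases Nat.eq_zero_or_pos t with rfl | ht0
    · simp
    obtain ⟨k, hkt, hk, hne⟩ := Nat.exists_odd_choose_ne_zero F h2 ht0.ne'
    have hk0 := hk.pos
    have h := rel k hk (by omega) (t - k) (by omega)
    rw [Nat.sub_add_cancel hkt, ih (t - k) (by omega) (by omega), smul_smul,
      add_eq_zero_iff_eq_neg, ← neg_smul] at h
    have hc : (S.choose t : F) * t.choose k = S.choose (t - k) * (S - (t - k)).choose k := by
      have h' := Nat.choose_mul (n := S) (k := t) (s := t - k) (by omega)
      rw [Nat.choose_symm hkt, show t - (t - k) = k by omega] at h'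
      rw [← Nat.cast_mul, h', Nat.cast_mul]
    have hsgn : (-1 : F) ^ t = -(-1) ^ (t - k) := by
      conv_lhs => rw [← Nat.sub_add_cancel hkt, pow_add, hk.neg_one_pow]
      ring
    have h3 : ((t.choose k : F)) • μ t = (t.choose k : F) • (((-1) ^ t * (S.choose t : F)) • μ 0) := by
      rw [h, smul_smul]
      congr 1
      rw [hsgn]
      linear_combination (-1) ^ (t - k) * hc
    exact smul_right_injective N hne h3

/-- If S = -1 in F, write S + 1 = p^j m with p not dividing m; taking a = p^j in `H3` gives 2m = 0.
Otherwise 3S = 2. Then S = 3 would mean 7 = 0, the only use of that hypothesis, and for larger S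
taking a = 3 gives S(S + 1)(S - 1) = 0, against 3S = 2. -/
theorem exists_relation_ne_zero (h2 : (2 : F) ≠ 0) (h7 : (7 : F) ≠ 0) (hS : 3 ≤ S) (hodd : Odd S)
    (H2 : (3 * (S : F) - 2) * (S + 1) = 0)
    (H3 : ∀ a, Odd a → 3 ≤ a → a < S →
      -(S : F) + (S.choose a : F) + ((S - 1 + a).choose a : F) = 0) : False := by
  obtain ⟨p, hp⟩ := CharP.exists F
  rcases CharP.char_is_prime_or_zero F p with hpp | rfl
  · have hpodd : Odd p := hpp.odd_of_ne_two fun h => h2 (by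
      have := CharP.cast_eq_zero F p
      rw [h] at this
      exact_mod_cast this)
    by_cases hS1 : (S : F) + 1 = 0
    · have hdvd : p ∣ S + 1 := (CharP.cast_eq_zero_iff F p (S + 1)).1 (by push_cast; exact hS1)
      obtain ⟨j, m, hm, hjm⟩ := Nat.exists_eq_pow_mul_and_not_dvd (n := S + 1) (by omega) p hpp.ne_one
      have hj : j ≠ 0 := by
        rintro rfl
        rw [pow_zero, one_mul] at hjm
        exact hm (hjm ▸ hdvd)
      have hpj : 3 ≤ p ^ j := by
        have h3 : 3 ≤ p := by
          have := hpp.two_le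
          obtain ⟨r, hr⟩ := hpodd
          omega
        exact h3.trans (Nat.le_self_pow hj p)
      have hpjodd : Odd (p ^ j) := hpodd.pow
      -- S + 1 is even while p^j is odd, so m = 1 is impossible; this leaves room for a = p^j below
      -- S.
      have hm2 : 2 ≤ m := by
        by_contra hlt
        have : m = 0 ∨ m = 1 := by omega
        rcases this with rfl | rfl
        · omega
        · rw [mul_one] at hjm
          rw [← hjm] at hpjodd
          obtain ⟨r, hr⟩ := hodd
          obtain ⟨r', hr'⟩ := hpjodd
          omega
      have hle : 2 * p ^ j ≤ S + 1 := by
        rw [hjm, mul_comm]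
        exact Nat.mul_le_mul_left _ hm2
      have h := H3 (p ^ j) hpjodd hpj (by omega)
      have d1 : S / p ^ j = m - 1 := by
        obtain ⟨m, rfl⟩ : ∃ m', m = m' + 1 := ⟨m - 1, by omega⟩
        rw [mul_add, mul_one] at hjm
        rw [show S = p ^ j - 1 + p ^ j * m by omega, Nat.add_mul_div_left _ _ (by omega),
          Nat.div_eq_of_lt (by omega)]
        omega
      have d2 : (S - 1 + p ^ j) / p ^ j = m := by
        obtain ⟨m, rfl⟩ : ∃ m', m = m' + 1 := ⟨m - 1, by omega⟩
        rw [mul_add, mul_one] at hjm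
        rw [show S - 1 + p ^ j = p ^ j - 2 + p ^ j * (m + 1) by rw [mul_add]; omega,
          Nat.add_mul_div_left _ _ (by omega), Nat.div_eq_of_lt (by omega)]
        omega
      rw [Nat.cast_choose_prime_pow F hpp, Nat.cast_choose_prime_pow F hpp, d1, d2,
        Nat.cast_sub (by omega)] at h
      have hm' : (m : F) ≠ 0 := fun h => hm ((CharP.cast_eq_zero_iff F p m).1 h)
      have : (2 : F) * m = 0 := by push_cast at h; linear_combination h + hS1
      exact (mul_ne_zero h2 hm') this
    · have H2' : 3 * (S : F) - 2 = 0 := (mul_eq_zero.1 H2).resolve_right hS1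
      have hS3 : S ≠ 3 := by
        rintro rfl
        apply h7
        push_cast at H2'
        linear_combination H2'
      have h := H3 3 (by decide) le_rfl (by omega)
      have key : 3 * (S.choose 3 + (S - 1 + 3).choose 3 : ℤ) = S ^ 3 + 2 * S := by
        obtain ⟨r, rfl⟩ : ∃ r, S = r + 2 := ⟨S - 2, by omega⟩
        have e1 := Nat.add_one_mul_choose_eq (r + 1) 2
        have e2 := Nat.add_one_mul_choose_eq r 1
        have e3 := Nat.add_one_mul_choose_eq (r + 3) 2
        have e4 := Nat.add_one_mul_choose_eq (r + 2) 1
        rw [Nat.choose_one_right] at e2 e4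
        rw [show r + 2 - 1 + 3 = r + 3 + 1 by omega]
        zify at e1 e2 e3 e4
        push_cast
        have : 2 * (3 * (((r + 2).choose 3 : ℤ) + (r + 3 + 1).choose 3)) =
            2 * (((r : ℤ) + 2) ^ 3 + 2 * (r + 2)) := by
          linear_combination -2 * e1 - (r + 2) * e2 - 2 * e3 - (r + 4) * e4
        omega
      have hF : (S : F) * (S + 1) * (S - 1) = 0 := by
        have := congrArg (fun z : ℤ => (z : F)) key
        push_cast at this
        linear_combination 3 * h - this
      have h3 : (S : F) ≠ 0 := by
        intro h0
        rw [h0] at H2'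
        apply h2
        linear_combination -H2'
      have h1 : (S : F) - 1 ≠ 0 := by
        intro h0
        apply one_ne_zero (α := F)
        linear_combination H2' - 3 * h0
      exact mul_ne_zero (mul_ne_zero h3 hS1) h1 hF
  · have := CharP.charP_to_charZero F
    have h1 : ((3 * (S : ℤ) - 2) * (S + 1) : ℤ) = 0 := by exact_mod_cast H2
    rcases mul_eq_zero.1 h1 with h | h <;> omega

/-- All μ(t) with t < S are signed binomial multiples of μ(0). For even S these are symmetric under
t to S - t while `anti` makes them antisymmetric, so the inner ones vanish, and one more relation
with an odd k kills μ(0). For odd S the two symmetries agree, and `rel₂` and `rel₃` are needed. -/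
theorem eq_zero_of_relations (h2 : (2 : F) ≠ 0) (h7 : (7 : F) ≠ 0) (hS : 2 ≤ S)
    (anti : ∀ t ≤ S, μ (S - t) = -μ t)
    (rel₁ : ∀ k, Odd k → k < S → ∀ i, i + k ≤ S →
      ((i + k).choose k : F) • μ (i + k) + ((S - i).choose k : F) • μ i = 0)
    (rel₂ : 3 ≤ S → (2 * (S : F) - 1) • μ S + (3 : F) • μ (S - 2) = 0)
    (rel₃ : ∀ a, Odd a → 3 ≤ a → a < S →
      μ 1 + ((S.choose a : F) + (S - 1 + a).choose a) • μ 0 = 0) {t : ℕ} (ht : t ≤ S) : μ t = 0 := by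
  have hμ := eq_smul_of_relations h2 rel₁
  have hSanti : μ S = -μ 0 := by simpa using anti 0 (by omega)
  suffices h0 : μ 0 = 0 by
    rcases eq_or_lt_of_le ht with rfl | h
    · rw [hSanti, h0, neg_zero]
    · rw [hμ t h, h0, smul_zero]
  by_contra hne
  have hsm : ∀ r : F, r • μ 0 = 0 → r = 0 := fun r hr => (smul_eq_zero.1 hr).resolve_right hne
  rcases Nat.even_or_odd S with hev | hodd
  · have hzero : ∀ t, 0 < t → t < S → μ t = 0 := by
      intro t ht0 htS
      have h1 := hμ (S - t) (by omega)
      have e : (-1 : F) ^ (S - t) = (-1) ^ t := by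
        have : Even (S - t) ↔ Even t := by
          rw [Nat.even_sub htS.le]; tauto
        rcases Nat.even_or_odd t with h | h
        · rw [h.neg_one_pow, (this.2 h).neg_one_pow]
        · rw [h.neg_one_pow, (Nat.not_even_iff_odd.1 (mt this.1 (Nat.not_even_iff_odd.2 h))).neg_one_pow]
      rw [anti t htS.le, Nat.choose_symm htS.le, e, ← hμ t htS] at h1
      have h3 : (2 : F) • μ t = 0 := by
        rw [two_smul]
        nth_rewrite 1 [← h1]
        exact neg_add_cancel _
      exact (smul_eq_zero.1 h3).resolve_left h2
    obtain ⟨k, hkS, hk, hkne⟩ := Nat.exists_odd_choose_ne_zero F h2 (by omega : S ≠ 0)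
    have hkS' : k < S := lt_of_le_of_ne hkS fun h => (Nat.not_even_iff_odd.2 hk) (h ▸ hev)
    have hk0 := hk.pos
    have h := rel₁ k hk hkS' (S - k) (by omega)
    rw [hzero (S - k) (by omega) (by omega), smul_zero, add_zero, Nat.sub_add_cancel hkS, hSanti,
      smul_neg, neg_eq_zero] at h
    exact hkne (hsm _ h)
  · have hS3 : 3 ≤ S := by
      obtain ⟨r, hr⟩ := hodd
      omega
    refine exists_relation_ne_zero (F := F) h2 h7 hS3 hodd ?_ fun a ha ha3 haS => ?_
    · have h := rel₂ hS3
      rw [hSanti, anti 2 (by omega), hμ 2 (by omega)] at h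
      have hc : (2 : F) * S.choose 2 = S * (S - 1) := by
        obtain ⟨r, rfl⟩ : ∃ r, S = r + 1 := ⟨S - 1, by omega⟩
        have e := Nat.add_one_mul_choose_eq r 1
        rw [Nat.choose_one_right] at e
        have e' := congrArg (fun z : ℕ => (z : F)) e
        push_cast at e' ⊢
        linear_combination -e'
      apply hsm
      -- After multiplication by -2 the coefficient is 2(2S - 1) + 3S(S - 1) = (3S - 2)(S + 1).
      have := congrArg (fun x => -(2 : F) • x) h
      simp only [smul_zero] at this
      rw [← this]
      match_scalars
      linear_combination -3 * hc
    · have h := rel₃ a ha ha3 haS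
      rw [hμ 1 (by omega), Nat.choose_one_right] at h
      apply hsm
      rw [← h]
      module

end Relations

/-! ### Generation of the even part -/

/-- For odd k the sign in the upper negation makes the two contractions add up. -/
theorem quad_odd_cr {k : ℕ} (hk : Odd k) {n : ℤ} {i i' : ℕ} (hi : (i' : ℤ) = i + k - n) (w : Fock F) :
    (quad k 0).1 n (cr i w) = cr i ((quad k 0).1 n w) +
      ((i'.choose k : F) + (i + k).choose k) • cr i' w := by
  have h := quad_ns (F := F) k 0 n (-(i : ℤ) - 1) w
  rw [show n + (-(i : ℤ) - 1) - k - (0 : ℕ) = -(i' : ℤ) - 1 by push_cast; omega, ns_neg, ns_neg,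
    sub_eq_iff_eq_add'] at h
  rw [h, Ring.choose_zero_right, Ring.choose_zero_right,
    show -(-(i' : ℤ) - 1) - 1 = i' by ring, Ring.choose_natCast,
    Ring.choose_eq_neg_one_pow_mul, show (k : ℤ) - (-(i : ℤ) - 1) - 1 = ((i + k : ℕ) : ℤ) by push_cast; ring,
    Ring.choose_natCast, hk.neg_one_pow]
  congr 2
  push_cast
  ring

theorem nsL_cr (h2 : (2 : F) ≠ 0) (i n : ℕ) (w : Fock F) :
    nsL (-(n : ℤ)) (cr i w) = cr i (nsL (-(n : ℤ)) w) + ((i : F) + 1 / 2 + n / 2) • cr (i + n) w := by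
  have h := nsL_ns h2 (-(n : ℤ)) (-(i : ℤ) - 1) w
  rw [show -(n : ℤ) + (-(i : ℤ) - 1) = -((i + n : ℕ) : ℤ) - 1 by push_cast; ring, ns_neg, ns_neg] at h
  rw [h, sub_eq_add_neg, ← neg_smul]
  congr 2
  push_cast
  field_simp
  ring

theorem nsL_neg_two_one (h2 : (2 : F) ≠ 0) :
    nsL (-2) (1 : Fock F) = (1 / 2 : F) • cr 1 (cr 0 1) := by
  rw [nsL, IsFermi.ℓ, IsFermi.bil_apply, finsum_eq_sum_of_support_subset (s := {-2, -1}),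
    Finset.sum_pair (by decide), IsFermi.normal_of_neg (by decide), IsFermi.normal_of_neg (by decide)]
  · have e1 : ns (-2) (ns (-2 - 1 - -2) (1 : Fock F)) = cr 1 (cr 0 1) := rfl
    have e2 : ns (-1) (ns (-2 - 1 - -1) (1 : Fock F)) = cr 0 (cr 1 1) := rfl
    have h4 : (4 : F) ≠ 0 := by
      have : (4 : F) = 2 ^ 2 := by norm_num
      rw [this]; exact pow_ne_zero _ h2
    rw [e1, e2, cr_cr 0 1, IsFermi.coeff, IsFermi.coeff]
    push_cast
    match_scalars
    field_simp
    norm_num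
  · intro k hk
    by_contra hc
    simp only [Finset.coe_insert, Finset.coe_singleton, Set.mem_insert_iff, Set.mem_singleton_iff,
      not_or] at hc
    apply hk
    rcases lt_or_ge k 0 with h | h
    · simp only [IsFermi.normal_of_neg h]
      rw [isFermi_ns.vac _ (by omega), map_zero, neg_zero, smul_zero]
    · simp only [IsFermi.normal_of_nonneg h]
      rw [isFermi_ns.vac _ (by omega), map_zero, smul_zero]

/-- Induction on S = i + j. Modes of the quadratic fields of e_k e₀ with odd k < S, and L₋₂,
preserve the image U; applied to quadratic vectors of smaller index sum they give relations modulo U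
among the eₜ e_{S-t}, and these force all of them to vanish. -/
theorem cr_cr_one_mem_range (h2 : (2 : F) ≠ 0) (h7 : (7 : F) ≠ 0) (i j : ℕ) :
    cr i (cr j 1) ∈ LinearMap.range (toFock h2) := by
  obtain ⟨S, hS⟩ : ∃ S, i + j = S := ⟨_, rfl⟩
  induction S using Nat.strong_induction_on generalizing i j with
  | _ S ih =>
    set U := LinearMap.range (toFock h2) with hU
    have hL : ∀ n, ∀ w ∈ U, nsL n w ∈ U := by
      rintro n _ ⟨y, rfl⟩
      exact ⟨⁅Vir.L F n, y⁆, toFock_lie h2 _ y⟩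
    have h1 : (1 : Fock F) ∈ U := ⟨_, toFock_gen h2⟩
    rcases Nat.lt_or_ge S 2 with hS2 | hS2
    · have h10 : cr 1 (cr 0 (1 : Fock F)) ∈ U := by
        have h := U.smul_mem (2 : F) (hL (-2) 1 h1)
        rw [nsL_neg_two_one h2, smul_smul, mul_one_div_cancel h2, one_smul] at h
        exact h
      have : (i = 0 ∧ j = 0) ∨ (i = 1 ∧ j = 0) ∨ (i = 0 ∧ j = 1) := by omega
      rcases this with ⟨rfl, rfl⟩ | ⟨rfl, rfl⟩ | ⟨rfl, rfl⟩
      · rw [cr_self]; exact U.zero_mem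
      · exact h10
      · rw [cr_cr]; exact U.neg_mem h10
    let μ : ℕ → Fock F ⧸ U := fun t => U.mkQ (cr t (cr (S - t) 1))
    have hmk : ∀ w ∈ U, U.mkQ w = 0 := fun w hw => (Submodule.Quotient.mk_eq_zero U).2 hw
    -- The n-th mode of the field of e_k e₀ acts as a derivation: it raises either index by k - n,
    -- and its value on the vacuum vanishes as n ≥ 0.
    have hquad : ∀ (k : ℕ) (n : ℤ), Odd k → k < S → 0 ≤ n → ∀ i j i' j' : ℕ, i + j < S →
        (i' : ℤ) = i + k - n → (j' : ℤ) = j + k - n →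
        ((i'.choose k : F) + (i + k).choose k) • U.mkQ (cr i' (cr j 1)) +
        ((j'.choose k : F) + (j + k).choose k) • U.mkQ (cr i (cr j' 1)) = 0 := by
      intro k n hk hkS hn i j i' j' hij hi' hj'
      have h := hmk _ (quad_mem_range h2 (ih k hkS k 0 (by omega)) n (ih (i + j) hij i j rfl))
      rw [quad_odd_cr hk hi', quad_odd_cr hk hj', quad_vac_of_nonneg k 0 hn, map_zero, zero_add,
        map_smul, map_add, map_smul, map_smul, add_comm] at h
      exact h
    have key := eq_zero_of_relations (F := F) (μ := μ) h2 h7 hS2 ?_ ?_ ?_ ?_ (t := i) (by omega)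
    · rw [← Submodule.Quotient.mk_eq_zero U, ← key]
      simp only [μ, Submodule.mkQ_apply, ← hS, Nat.add_sub_cancel_left]
    · intro t ht
      simp only [μ]
      rw [show S - (S - t) = t by omega, cr_cr, map_neg]
    -- The zeroth mode, applied to eᵢ e_{S-k-i}. Both binomial coefficients coincide, hence the
    -- factor 2 to be cancelled.
    · intro k hk hkS i hik
      have h := hquad k 0 hk hkS le_rfl i (S - k - i) (i + k) (S - i) (by have := hk.pos; omega)
        (by omega) (by omega)
      rw [show S - k - i + k = S - i by omega, ← two_mul, ← two_mul, mul_smul, mul_smul,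
        ← smul_add, smul_eq_zero] at h
      have h' := h.resolve_left h2
      simp only [μ]
      rwa [show S - (i + k) = S - k - i by omega]
    -- L₋₂ applied to e_{S-2} e₀; its action on the vacuum is a multiple of e₁e₀, and it contributes
    -- e_{S-2} e₁ e₀ only after passing e₀, which kills it.
    · intro hS3
      have h := hmk _ (hL (-2) _ (ih (S - 2) (by omega) (S - 2) 0 (by omega)))
      have e : ∀ (i : ℕ) (w : Fock F), nsL (-2) (cr i w) =
          cr i (nsL (-2) w) + ((i : F) + 1 / 2 + (2 : ℕ) / 2) • cr (i + 2) w :=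
        fun i w => nsL_cr h2 i 2 w
      rw [e, e, nsL_neg_two_one h2] at h
      rw [map_smul, cr_cr 0 1, cr_self, map_zero, neg_zero, smul_zero, zero_add, map_add, map_smul,
        map_smul, map_smul, Nat.cast_sub (by omega), show S - 2 + 2 = S by omega] at h
      have h' := congrArg (fun x => (2 : F) • x) h
      simp only [smul_zero] at h'
      simp only [μ]
      rw [Nat.sub_self, show S - (S - 2) = 2 by omega, ← h']
      simp only [zero_add]
      match_scalars <;> field_simp <;> ring
    -- The mode a - 1 of the field of eₐe₀, applied to e₀ e_{S-1}: each index can grow by one, and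
    -- C(1,a) = 0 because a ≥ 3.
    · intro a ha ha3 haS
      have h := hquad a (a - 1) ha haS (by omega) 0 (S - 1) 1 S (by omega) (by omega) (by omega)
      rw [Nat.choose_eq_zero_of_lt (by omega : 1 < a), zero_add, Nat.choose_self, Nat.cast_zero,
        Nat.cast_one, zero_add, one_smul] at h
      exact h

/-- The monomial `e_{i₁} ⋯ e_{iᵣ}`. -/
def word (l : List ℕ) : Fock F := l.foldr (fun i w => cr i w) 1

theorem word_cons (i : ℕ) (l : List ℕ) : word (F := F) (i :: l) = cr i (word l) := rfl

variable (F) in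
/-- The span of the monomials of length `n`. -/
def wordSpan (n : ℕ) : Submodule F (Fock F) :=
  Submodule.span F {x | ∃ l : List ℕ, l.length = n ∧ x = word l}

theorem word_mem (l : List ℕ) : word l ∈ wordSpan F l.length := Submodule.subset_span ⟨l, rfl, rfl⟩

theorem cr_mem_wordSpan (i : ℕ) {n : ℕ} {w : Fock F} (hw : w ∈ wordSpan F n) :
    cr i w ∈ wordSpan F (n + 1) := by
  induction hw using Submodule.span_induction with
  | mem x hx =>
    obtain ⟨l, rfl, rfl⟩ := hx
    exact word_mem (i :: l)
  | zero => rw [map_zero]; exact zero_mem _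
  | add x y _ _ hx hy => rw [map_add]; exact add_mem hx hy
  | smul a x _ hx => rw [map_smul]; exact Submodule.smul_mem _ a hx

/-- The mode -1 of the field of eₐe_b is multiplication by eₐe_b up to contractions, which produce
monomials shorter by two. This drives the induction on length in `wordSpan_le_range`. -/
theorem quad_word (a b : ℕ) (l : List ℕ) :
    (quad a b).1 (-1) (word l) - cr a (cr b (word l)) ∈ wordSpan F l.length := by
  induction l with
  | nil =>
    have h := quad_vac (F := F) a b 0
    rw [T_zero, Nat.cast_zero, neg_zero, zero_sub] at h
    rw [show word (F := F) [] = 1 from rfl, h, LinearMap.id_apply, sub_self]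
    exact zero_mem _
  | cons i l ih =>
    have h := quad_ns (F := F) a b (-1) (-(i : ℤ) - 1) (word l)
    rw [show -1 + (-(i : ℤ) - 1) - a - b = -((i + a + b + 1 : ℕ) : ℤ) - 1 by push_cast; ring, ns_neg,
      ns_neg, sub_eq_iff_eq_add] at h
    rw [word_cons, h, cr_cr b i, map_neg, cr_cr a i, neg_neg, add_sub_assoc, ← map_sub]
    exact add_mem (Submodule.smul_mem _ _ (cr_mem_wordSpan _ (word_mem l))) (cr_mem_wordSpan i ih)

theorem wordSpan_le_range (h2 : (2 : F) ≠ 0) (h7 : (7 : F) ≠ 0) (n : ℕ) :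
    wordSpan F (2 * n) ≤ LinearMap.range (toFock h2) := by
  induction n with
  | zero =>
    refine Submodule.span_le.2 ?_
    rintro _ ⟨l, hl, rfl⟩
    obtain rfl := List.length_eq_zero_iff.1 hl
    exact ⟨_, toFock_gen h2⟩
  | succ n ih =>
    refine Submodule.span_le.2 ?_
    rintro _ ⟨l, hl, rfl⟩
    match l, hl with
    | a :: b :: l, hl =>
      have hl' : l.length = 2 * n := by simp only [List.length_cons] at hl; omega
      have h := quad_word (F := F) a b l
      rw [hl'] at h
      have hw : word l ∈ LinearMap.range (toFock h2) := ih (hl' ▸ word_mem l)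
      have hq := quad_mem_range h2 (cr_cr_one_mem_range h2 h7 a b) (-1) hw
      have := Submodule.sub_mem _ hq (ih h)
      rwa [sub_sub_cancel] at this

end Fock

end

noncomputable section

namespace Fock

open Fld

variable {F : Type*} [Field F]

/-! ### The invariant form -/

/-- The dual of a vector of `⨁ F eᵢ` with respect to the basis. -/
def dualVec : (ℕ →₀ F) →ₗ[F] Module.Dual F (ℕ →₀ F) :=
  Finsupp.linearCombination F fun i => Finsupp.lapply i

/-- Transposed contraction. -/
def transContract : (ℕ →₀ F) →ₗ[F] Module.End F (Module.Dual F (Fock F)) where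
  toFun m :=
    { toFun := fun f => f ∘ₗ
        CliffordAlgebra.contractLeft (Q := (0 : QuadraticForm F (ℕ →₀ F))) (dualVec m)
      map_add' := fun _ _ => rfl
      map_smul' := fun _ _ => rfl }
  map_add' x y := by ext f w; simp
  map_smul' a x := by ext f w; simp

/-- The bilinear form for which `cr i` and `an i` are adjoint, with `(1, w) = ε w`. -/
def form (u : Fock F) : Module.Dual F (Fock F) :=
  ExteriorAlgebra.lift F ⟨transContract (F := F), fun m => by
    refine LinearMap.ext fun f => LinearMap.ext fun w => ?_
    change f (CliffordAlgebra.contractLeft (dualVec m) (CliffordAlgebra.contractLeft (dualVec m) w)) = 0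
    rw [CliffordAlgebra.contractLeft_contractLeft, map_zero]⟩ u ε

theorem form_add (u v : Fock F) : form (u + v) = form u + form v := by simp [form]

theorem form_smul (a : F) (u : Fock F) : form (a • u) = a • form u := by simp [form]

theorem form_one (w : Fock F) : form 1 w = ε w := by simp [form]

theorem form_cr (i : ℕ) (u w : Fock F) : form (cr i u) w = form u (an i w) := by
  rw [form, cr_apply, map_mul, ExteriorAlgebra.lift_ι_apply]
  have : dualVec (Finsupp.single i (1 : F)) = Finsupp.lapply i := by simp [dualVec]
  change form u (CliffordAlgebra.contractLeft (dualVec (Finsupp.single i (1 : F))) w) = _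
  rw [this]
  rfl

theorem form_neg (u w : Fock F) : form (-u) w = -form u w := by
  rw [← neg_one_smul F u, form_smul]; simp

theorem form_sub (u v w : Fock F) : form (u - v) w = form u w - form v w := by
  rw [sub_eq_add_neg, form_add, LinearMap.add_apply, form_neg, sub_eq_add_neg]

theorem form_zero (w : Fock F) : form 0 w = 0 := by
  rw [← zero_smul F (0 : Fock F), form_smul, zero_smul, LinearMap.zero_apply]

theorem form_an (i : ℕ) (u w : Fock F) : form (an i u) w = form u (cr i w) := by
  induction u using induction generalizing w with
  | one => rw [an_one, form_zero, form_one, ε_cr]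
  | add x y hx hy =>
    rw [map_add, form_add, form_add, LinearMap.add_apply, LinearMap.add_apply, hx, hy]
  | smul a x hx => rw [map_smul, form_smul, form_smul, LinearMap.smul_apply, LinearMap.smul_apply, hx]
  | cr j x hx =>
    rw [an_cr, form_sub, form_cr, form_cr, hx, an_cr, map_sub]
    rcases eq_or_ne i j with rfl | h
    · rw [if_pos rfl, if_pos rfl]
    · rw [if_neg h, if_neg h.symm, form_zero, map_zero]

theorem form_ns (k : ℤ) (u w : Fock F) : form (ns k u) w = form u (ns (-1 - k) w) := by
  rcases lt_or_ge k 0 with hk | hk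
  · obtain ⟨a, rfl⟩ : ∃ a : ℕ, k = -(a : ℤ) - 1 := ⟨(-k - 1).toNat, by omega⟩
    rw [ns_neg, form_cr, show -1 - (-(a : ℤ) - 1) = a by ring, ns_natCast]
  · lift k to ℕ using hk
    rw [ns_natCast, form_an, show -1 - (k : ℤ) = -(k : ℤ) - 1 by ring, ns_neg]

theorem form_apply_one (u : Fock F) : form u 1 = ε u := by
  induction u using induction with
  | one => exact form_one 1
  | add x y hx hy => rw [form_add, LinearMap.add_apply, hx, hy, map_add]
  | smul a x hx => rw [form_smul, LinearMap.smul_apply, hx, map_smul]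
  | cr i x hx => rw [form_cr, an_one, map_zero, ε_cr]

/-- Lₙ and L₋ₙ are adjoint. The difference of the two sides is unchanged when a mode of the fermion
passes from the left argument to the right as its adjoint (`step`), so it reduces to the vacuum,
first in one argument and then in the other. -/
theorem form_nsL (h2 : (2 : F) ≠ 0) (n : ℤ) (u w : Fock F) :
    form (nsL n u) w = form u (nsL (-n) w) := by
  have step : ∀ (l : ℤ) (u w : Fock F), form (nsL n (ns l u)) w - form (ns l u) (nsL (-n) w) =
      form (nsL n u) (ns (-1 - l) w) - form u (nsL (-n) (ns (-1 - l) w)) := by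
    intro l u w
    rw [nsL_ns h2, nsL_ns h2, form_sub, form_smul, LinearMap.smul_apply, form_ns, form_ns, form_ns,
      map_sub, map_smul, show -1 - (n + l) = -n + (-1 - l) by ring, smul_eq_mul, smul_eq_mul]
    push_cast
    field_simp
    ring
  have hone : ∀ w : Fock F, form (nsL n 1) w = form 1 (nsL (-n) w) := by
    intro w
    induction w using induction with
    | one => rw [form_apply_one, form_one, ε_nsL_one, ε_nsL_one]
    | add x y hx hy => rw [map_add, map_add, map_add, hx, hy]
    | smul a x hx => rw [map_smul, map_smul, map_smul, hx]
    | cr i x _ =>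
      have h := step i 1 x
      rw [isFermi_ns.vac _ (by omega), map_zero, form_zero, form_zero, sub_zero,
        show -1 - (i : ℤ) = -(i : ℤ) - 1 by ring, ns_neg] at h
      exact (sub_eq_zero.1 h.symm)
  induction u using induction generalizing w with
  | one => exact hone w
  | add x y hx hy =>
    rw [map_add, form_add, form_add, LinearMap.add_apply, LinearMap.add_apply, hx, hy]
  | smul a x hx =>
    rw [map_smul, form_smul, form_smul, LinearMap.smul_apply, LinearMap.smul_apply, hx]
  | cr i x hx =>
    have h := step (-(i : ℤ) - 1) x w
    rw [hx, sub_self, ns_neg] at h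
    exact sub_eq_zero.1 h

/-! ### Parity -/

/-- The parity operator. -/
def parity : Module.End F (Fock F) :=
  (CliffordAlgebra.involute (Q := (0 : QuadraticForm F (ℕ →₀ F)))).toLinearMap

theorem parity_one : parity (1 : Fock F) = 1 := map_one CliffordAlgebra.involute

theorem parity_cr (i : ℕ) (w : Fock F) : parity (cr i w) = -cr i (parity w) := by
  refine (map_mul CliffordAlgebra.involute _ _).trans ?_
  rw [show CliffordAlgebra.involute (ExteriorAlgebra.ι F (Finsupp.single i (1 : F))) =
    -ExteriorAlgebra.ι F (Finsupp.single i (1 : F)) from CliffordAlgebra.involute_ι _, neg_mul]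
  rfl

theorem parity_an (i : ℕ) (w : Fock F) : parity (an i w) = -an i (parity w) := by
  induction w using induction with
  | one => rw [parity_one, an_one, map_zero, neg_zero]
  | add x y hx hy => rw [map_add, map_add, hx, hy, map_add, map_add, neg_add]
  | smul a x hx => rw [map_smul, map_smul, hx, map_smul, map_smul, smul_neg]
  | cr j x hx =>
    rw [an_cr, map_sub, parity_cr, parity_cr, hx, map_neg, map_neg, an_cr]
    split_ifs <;> (try rw [map_zero]) <;> abel

theorem ε_parity (w : Fock F) : ε (parity w) = ε w := by
  induction w using induction with
  | one => rw [parity_one]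
  | add x y hx hy => rw [map_add, map_add, hx, hy, map_add]
  | smul a x hx => rw [map_smul, map_smul, hx, map_smul]
  | cr j x hx => rw [parity_cr, map_neg, ε_cr, ε_cr, neg_zero]

theorem parity_nsL (n : ℤ) (w : Fock F) : parity (nsL n w) = nsL n (parity w) := by
  refine isFermi_ns.bil_comm_of_anti (fun k w => ?_) _ _ w
  rcases k with k | k
  · exact parity_an k w
  · exact parity_cr k w

theorem parity_toFock (h2 : (2 : F) ≠ 0) (x : Verma (1 / 2 : F) 0) :
    parity (toFock h2 x) = toFock h2 x := by
  induction x using Verma.induction with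
  | hgen => rw [toFock_gen, parity_one]
  | hL n x hx => rw [toFock_lie, parity_nsL, hx]
  | hadd x y hx hy => rw [map_add, map_add, hx, hy]
  | hsmul a x hx => rw [map_smul, map_smul, hx]

theorem parity_foldl (l : List ℕ) (w : Fock F) :
    parity (l.foldl (fun x i => an i x) w) = (-1 : F) ^ l.length •
      l.foldl (fun x i => an i x) (parity w) := by
  induction l generalizing w with
  | nil => simp
  | cons i l ih =>
    have h : ∀ (l : List ℕ) (w : Fock F), l.foldl (fun x i => an i x) (-w) =
        -l.foldl (fun x i => an i x) w := by
      intro l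
      induction l with
      | nil => intro w; rfl
      | cons i l ih => intro w; rw [List.foldl_cons, map_neg, ih, List.foldl_cons]
    rw [List.foldl_cons, ih, parity_an, h, List.foldl_cons, List.length_cons, pow_succ]
    module

theorem form_word (l : List ℕ) (w : Fock F) :
    form (word l) w = ε (l.foldl (fun x i => an i x) w) := by
  induction l generalizing w with
  | nil => exact form_one w
  | cons i l ih => rw [word_cons, form_cr, ih, List.foldl_cons]

/-! ### The kernel of the map to the Fock space -/

theorem ε_toFock (h2 : (2 : F) ≠ 0) (x : Verma (1 / 2 : F) 0) :
    ε (toFock h2 x) • Verma.gen (1 / 2 : F) 0 = Verma.split (1 / 2) 0 x 0 := by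
  induction x using Verma.induction_neg with
  | hgen => rw [toFock_gen, ε_one, one_smul, Verma.split_gen, Finsupp.single_eq_same]
  | h0 => simp
  | hL k n x hk hx _ =>
    have h : ε (toFock h2 ⁅Vir.L F (-(k : ℤ)), x⁆) = 0 := by
      rw [toFock_lie]
      exact isFermi_ns.ε_ℓ (by omega) _
    have h' := Verma.isGrading.mem x (0 + -(k : ℤ))
    rw [Verma.deg_neg (by omega), Submodule.mem_bot] at h'
    rw [h, zero_smul, Verma.split_lie, h', lie_zero]
  | hadd x y hx hy => rw [map_add, map_add, add_smul, hx, hy, map_add, Finsupp.add_apply]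
  | hsmul a x hx =>
    rw [map_smul, map_smul, smul_eq_mul, mul_smul, hx, map_smul, Finsupp.smul_apply]

/-- By adjointness the operators that create y move onto x and stay inside the maximal graded
submodule; what remains is the scalar part of an element with no component of degree zero. -/
theorem form_toFock (h2 : (2 : F) ≠ 0) {x : Verma (1 / 2 : F) 0} (hx : x ∈ Verma.maxGraded (1 / 2) 0)
    (y : Verma (1 / 2 : F) 0) : form (toFock h2 y) (toFock h2 x) = 0 := by
  induction y using Verma.induction generalizing x with
  | hgen =>
    have h := ε_toFock h2 x
    rw [Verma.split_zero_of_mem_maxGraded (gen_zero_ne_zero h2) hx, smul_eq_zero] at h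
    rw [toFock_gen, form_one]
    exact h.resolve_right (gen_zero_ne_zero h2)
  | hL n y hy =>
    rw [toFock_lie, form_nsL h2, ← toFock_lie]
    exact hy (LieSubmodule.lie_mem _ hx)
  | hadd y z hy hz => rw [map_add, form_add, LinearMap.add_apply, hy hx, hz hx, add_zero]
  | hsmul a y hy => rw [map_smul, form_smul, LinearMap.smul_apply, hy hx, smul_zero]

/-- A vector whose iterated contractions have no scalar part is zero. Contractions of even length
are pairings with even monomials, which lie in the image of V(1/2,0); those of odd length vanish by
parity. -/
theorem toFock_eq_zero (h2 : (2 : F) ≠ 0) (h7 : (7 : F) ≠ 0) {x : Verma (1 / 2 : F) 0}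
    (hx : x ∈ Verma.maxGraded (1 / 2) 0) : toFock h2 x = 0 := by
  refine eq_zero_of_ε_eq_zero fun l => ?_
  rcases Nat.even_or_odd l.length with ⟨n, hn⟩ | hodd
  · have hl := word_mem (F := F) l
    rw [hn, ← two_mul] at hl
    obtain ⟨y, hy⟩ := wordSpan_le_range h2 h7 n hl
    rw [← form_word, ← hy]
    exact form_toFock h2 hx y
  · have h := ε_parity (l.foldl (fun x i => an i x) (toFock h2 x))
    rw [parity_foldl, parity_toFock, hodd.neg_one_pow, neg_one_smul, map_neg] at h
    have h' : (2 : F) * ε (l.foldl (fun x i => an i x) (toFock h2 x)) = 0 := by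
      rw [two_mul]
      nth_rewrite 1 [← h]
      exact neg_add_cancel _
    exact (mul_eq_zero.1 h').resolve_left h2

end Fock

/-! ### The module L(1/2,1/2). -/

namespace Fld.IsVirField

variable {F : Type*} [Field F]

/-- The action of the weight preserving modes on singular vectors is determined by the weight. -/
theorem exists_Y_singular_eq {M M' : Type*} [AddCommGroup M] [Module F M] [AddCommGroup M'] [Module F M']
    {ω : Fld F M} {ω' : Fld F M'} {c h : F} (H : IsVirField c ω) (H' : IsVirField c ω') {v : M} {v' : M'}
    (hv : IsSingular ω v) (hv' : IsSingular ω' v') (h1 : ω.1 1 v = h • v) (h1' : ω'.1 1 v' = h • v')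
    {s : ℤ} {x : Verma c 0} (hx : x ∈ Verma.deg c 0 s) :
    ∃ t : F, (H.Y x).1 (s - 1) v = t • v ∧ (H'.Y x).1 (s - 1) v' = t • v' := by
  rw [Verma.deg_eq_span] at hx
  induction hx using Submodule.span_induction with
  | mem x hx =>
    obtain ⟨l, hl, rfl, rfl⟩ := hx
    induction l with
    | nil =>
      refine ⟨1, ?_, ?_⟩ <;> rw [Verma.word_nil, Y_gen, one_apply, if_pos (by simp), one_smul]
    | cons n l ih =>
      obtain ⟨t, ht, ht'⟩ := ih fun k hk => hl k (List.mem_cons_of_mem _ hk)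
      refine ⟨(-1) ^ n * (l.sum * t + (n - 1) * (h * t)), ?_, ?_⟩
      · rw [List.sum_cons, H.Y_word_cons hv n (hl n List.mem_cons_self) l
          (fun k hk => hl k (List.mem_cons_of_mem _ hk)) _ rfl, h1, map_smul, ht]
        simp only [← Int.cast_smul_eq_zsmul F]
        simp only [Int.cast_natCast, Int.cast_sub, Int.cast_one, Int.cast_pow, Int.cast_neg]
        module
      · rw [List.sum_cons, H'.Y_word_cons hv' n (hl n List.mem_cons_self) l
          (fun k hk => hl k (List.mem_cons_of_mem _ hk)) _ rfl, h1', map_smul, ht']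
        simp only [← Int.cast_smul_eq_zsmul F]
        simp only [Int.cast_natCast, Int.cast_sub, Int.cast_one, Int.cast_pow, Int.cast_neg]
        module
  | zero => exact ⟨0, by simp⟩
  | add x y _ _ hx hy =>
    obtain ⟨t, ht, ht'⟩ := hx
    obtain ⟨r, hr, hr'⟩ := hy
    refine ⟨t + r, ?_, ?_⟩
    · rw [map_add, add_smul, ← ht, ← hr]; rfl
    · rw [map_add, add_smul, ← ht', ← hr']; rfl
  | smul a x _ hx =>
    obtain ⟨t, ht, ht'⟩ := hx
    refine ⟨a * t, ?_, ?_⟩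
    · rw [map_smul, mul_smul, ← ht]; rfl
    · rw [map_smul, mul_smul, ← ht']; rfl

end Fld.IsVirField

namespace VirIrr

open Fock Fld

variable {F : Type*} [Field F]

/-- In the Fock space e₀ is singular of weight 1/2, and the fields of elements of W vanish there.
The scalar by which the weight preserving mode acts is the same on e₀ and on the generator. -/
theorem isGood_field_one_half (h2 : (2 : F) ≠ 0) (h7 : (7 : F) ≠ 0) :
    (isVirField_field (c := 1 / 2) (h := (1 / 2 : F))).IsGood := by
  refine isGood_field (gen_zero_ne_zero h2) (gen_one_half_ne_zero h2) fun s x hx hxW => ?_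
  obtain ⟨t, ht, ht'⟩ := (isVirField_nsω h2).exists_Y_singular_eq (isVirField_field (c := 1 / 2)
    (h := (1 / 2 : F))) (v := cr 0 1) (v' := gen (1 / 2) (1 / 2)) (h := 1 / 2)
    (fun n hn => by rw [nsω_apply, nsL_single h2 (by omega), if_neg (by omega)])
    isSingular_gen (by rw [nsω_apply, sub_self, nsL_single h2 le_rfl, if_pos rfl])
    (by rw [field_apply, sub_self, lie_L_zero_gen]) hx
  rw [Y_eq_zero h2 (toFock_eq_zero h2 h7 hxW)] at ht
  have ht0 : t = 0 := by
    have : t • cr 0 (1 : Fock F) = 0 := ht.symm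
    exact (smul_eq_zero.1 this).resolve_right (cr_one_ne_zero 0)
  rw [ht0, zero_smul] at ht'
  exact ht'

end VirIrr

end

noncomputable section

namespace Fock

open Fld

variable {F : Type*} [Field F]

/-! ### Binomial coefficients of exponent `±1/2` -/

/-- Weighting the terms by i and using the symmetry i to n - i gives half of n times the sum;
combined with the recursion of central binomials this yields a first order recursion for the sum. -/
theorem sum_centralBinom_mul (n : ℕ) : ∑ i ∈ Finset.range (n + 1),
    (i.centralBinom : ℤ) * (n - i).centralBinom = 4 ^ n := by
  let S : ℕ → ℤ := fun n => ∑ i ∈ Finset.range (n + 1), (i.centralBinom : ℤ) * (n - i).centralBinom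
  have hw : ∀ n, 2 * ∑ i ∈ Finset.range (n + 1), (i : ℤ) * (i.centralBinom * (n - i).centralBinom) =
      n * S n := by
    intro n
    have h := Finset.sum_range_reflect
      (fun i : ℕ => (i : ℤ) * ((i.centralBinom : ℤ) * (n - i).centralBinom)) (n + 1)
    rw [two_mul]
    nth_rewrite 1 [← h]
    rw [← Finset.sum_add_distrib, Finset.mul_sum]
    refine Finset.sum_congr rfl fun i hi => ?_
    rw [Finset.mem_range] at hi
    rw [show n + 1 - 1 - i = n - i by omega, show n - (n - i) = i by omega,
      Nat.cast_sub (by omega : i ≤ n)]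
    ring
  have hrec : ∀ n, S (n + 1) = 4 * S n := by
    intro n
    have h1 := hw (n + 1)
    rw [Finset.sum_range_succ'] at h1
    have h2 : ∀ i ∈ Finset.range (n + 1), ((i + 1 : ℕ) : ℤ) *
        ((i + 1).centralBinom * (n + 1 - (i + 1)).centralBinom) =
        4 * ((i : ℤ) * (i.centralBinom * (n - i).centralBinom)) +
          2 * (i.centralBinom * (n - i).centralBinom) := by
      intro i _
      have h3 := Nat.succ_mul_centralBinom_succ i
      zify at h3
      rw [Nat.add_sub_add_right]
      push_cast
      linear_combination ((n - i).centralBinom : ℤ) * h3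
    rw [Finset.sum_congr rfl h2, Finset.sum_add_distrib, ← Finset.mul_sum, ← Finset.mul_sum,
      Nat.cast_zero, zero_mul, add_zero] at h1
    have h4 := hw n
    have h5 : ((n : ℤ) + 1) * S (n + 1) = (n + 1) * (4 * S n) := by
      push_cast at h1
      simp only [S] at h1 h4 ⊢
      linear_combination 4 * h4 - h1
    exact mul_left_cancel₀ (by omega) h5
  change S n = 4 ^ n
  induction n with
  | zero => simp [S]
  | succ n ih => rw [hrec, ih, pow_succ']

variable (F) in
/-- The binomial coefficients `C(-1/2, m)`. -/
def bet (m : ℤ) : F := if 0 ≤ m then (-1 / 4) ^ m.toNat * (m.toNat.centralBinom : F) else 0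

variable (F) in
/-- The binomial coefficients `C(1/2, m)`. -/
def gam (m : ℤ) : F := bet F m + bet F (m - 1)

theorem bet_natCast (k : ℕ) : bet F k = (-1 / 4) ^ k * (k.centralBinom : F) := by
  rw [bet, if_pos (by omega), Int.toNat_natCast]

theorem bet_neg {m : ℤ} (hm : m < 0) : bet F m = 0 := if_neg (by omega)

theorem bet_zero : bet F 0 = 1 := by simp [bet]

theorem gam_neg {m : ℤ} (hm : m < 0) : gam F m = 0 := by
  rw [gam, bet_neg hm, bet_neg (by omega), add_zero]

theorem gam_zero : gam F 0 = 1 := by rw [gam, bet_zero, bet_neg (by omega), add_zero]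

theorem bet_succ (h2 : (2 : F) ≠ 0) (m : ℤ) : ((m : F) + 1) * bet F (m + 1) = -(m + 1 / 2) * bet F m := by
  have h4 : (4 : F) ≠ 0 := by
    have : (4 : F) = 2 ^ 2 := by norm_num
    rw [this]; exact pow_ne_zero _ h2
  rcases lt_trichotomy m (-1) with h | rfl | h
  · rw [bet_neg (by omega), bet_neg (by omega), mul_zero, mul_zero]
  · rw [bet_neg (m := -1) (by omega)]; simp
  · lift m to ℕ using by omega
    have h3 := congrArg (fun z : ℕ => (z : F)) (Nat.succ_mul_centralBinom_succ m)
    rw [show (m : ℤ) + 1 = ((m + 1 : ℕ) : ℤ) by push_cast; ring, bet_natCast, bet_natCast, pow_succ]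
    push_cast at h3 ⊢
    generalize (-1 / 4 : F) ^ m = q
    field_simp
    linear_combination -2 * q * h3

theorem gam_succ (h2 : (2 : F) ≠ 0) (m : ℤ) : ((m : F) + 1) * gam F (m + 1) = -(m - 1 / 2) * gam F m := by
  have h := bet_succ h2 m
  have h' := bet_succ h2 (m - 1)
  rw [sub_add_cancel] at h'
  rw [gam, gam, add_sub_cancel_right]
  push_cast at h'
  field_simp at h h' ⊢
  linear_combination h + h'

/-- The power series `(1 + X)^(-1/2)`. -/
def betSeries : PowerSeries F := PowerSeries.mk fun k => bet F k

/-- The power series `(1 + X)^(1/2)`. -/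
def gamSeries : PowerSeries F := PowerSeries.mk fun k => gam F k

theorem gamSeries_eq : gamSeries = (1 + PowerSeries.X) * betSeries (F := F) := by
  ext k
  rw [add_mul, one_mul, map_add, gamSeries, betSeries, PowerSeries.coeff_mk, PowerSeries.coeff_mk, gam]
  congr 1
  cases k with
  | zero => rw [bet_neg (by simp), PowerSeries.coeff_zero_X_mul]
  | succ k => rw [PowerSeries.coeff_succ_X_mul, PowerSeries.coeff_mk]; congr 1; push_cast; ring

/-- The square of `betSeries` is the geometric series of (1 + X)⁻¹, by the convolution of central
binomials, and `gamSeries` is (1 + X) times `betSeries`. -/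
theorem gamSeries_mul_betSeries (h2 : (2 : F) ≠ 0) : gamSeries * betSeries = (1 : PowerSeries F) := by
  have h4 : (4 : F) ≠ 0 := by
    have : (4 : F) = 2 ^ 2 := by norm_num
    rw [this]; exact pow_ne_zero _ h2
  have hsq : ∀ n, PowerSeries.coeff n (betSeries * betSeries (F := F)) = (-1) ^ n := by
    intro n
    rw [PowerSeries.coeff_mul, Finset.Nat.sum_antidiagonal_eq_sum_range_succ
      (fun i j => PowerSeries.coeff i (betSeries (F := F)) * PowerSeries.coeff j betSeries)]
    have e : ∀ i ∈ Finset.range (n + 1), PowerSeries.coeff i (betSeries (F := F)) *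
        PowerSeries.coeff (n - i) betSeries =
        (-1 / 4) ^ n * (((i.centralBinom : ℤ) * (n - i).centralBinom : ℤ) : F) := by
      intro i hi
      rw [Finset.mem_range] at hi
      rw [betSeries, PowerSeries.coeff_mk, PowerSeries.coeff_mk, bet_natCast, bet_natCast]
      have : (-1 / 4 : F) ^ n = (-1 / 4) ^ i * (-1 / 4) ^ (n - i) := by
        rw [← pow_add]; congr 1; omega
      rw [this]
      push_cast
      ring
    rw [Finset.sum_congr rfl e, ← Finset.mul_sum, ← Int.cast_sum, sum_centralBinom_mul]
    push_cast
    rw [← mul_pow, div_mul_cancel₀ _ h4]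
  rw [gamSeries_eq, mul_assoc, add_mul, one_mul]
  ext n
  rw [map_add, hsq, PowerSeries.coeff_one]
  cases n with
  | zero => simp
  | succ n => rw [PowerSeries.coeff_succ_X_mul, hsq, if_neg (by omega)]; ring

theorem sum_gam_mul_bet (h2 : (2 : F) ≠ 0) (n : ℕ) : ∑ k ∈ Finset.range (n + 1),
    gam F k * bet F (n - k : ℕ) = if n = 0 then 1 else 0 := by
  rw [← PowerSeries.coeff_one, ← gamSeries_mul_betSeries h2, PowerSeries.coeff_mul,
    Finset.Nat.sum_antidiagonal_eq_sum_range_succ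
      (fun i j => PowerSeries.coeff i (gamSeries (F := F)) * PowerSeries.coeff j betSeries)]
  simp [gamSeries, betSeries]

theorem sum_bet_mul_gam (h2 : (2 : F) ≠ 0) (n : ℕ) : ∑ k ∈ Finset.range (n + 1),
    bet F k * gam F (n - k : ℕ) = if n = 0 then 1 else 0 := by
  rw [← sum_gam_mul_bet h2, ← Finset.sum_range_reflect]
  refine Finset.sum_congr rfl fun k hk => ?_
  rw [Finset.mem_range] at hk
  rw [show n + 1 - 1 - k = n - k by omega, show n - (n - k) = k by omega, mul_comm]

theorem sum_gam_mul_gam (h2 : (2 : F) ≠ 0) (n : ℕ) (hn : 2 ≤ n) : ∑ k ∈ Finset.range (n + 1),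
    gam F k * gam F (n - k : ℕ) = 0 := by
  have h : gamSeries * gamSeries = 1 + PowerSeries.X (R := F) := by
    nth_rewrite 2 [gamSeries_eq]
    rw [mul_left_comm, gamSeries_mul_betSeries h2, mul_one]
  have h' := congrArg (PowerSeries.coeff n) h
  rw [PowerSeries.coeff_mul, Finset.Nat.sum_antidiagonal_eq_sum_range_succ
      (fun i j => PowerSeries.coeff i (gamSeries (F := F)) * PowerSeries.coeff j gamSeries), map_add,
      PowerSeries.coeff_one, PowerSeries.coeff_X, if_neg (by omega), if_neg (by omega), add_zero] at h'
  rw [← h']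
  simp [gamSeries]

/-- Inversion of a convolution. -/
theorem sum_smul_sum_smul {N : Type*} [AddCommGroup N] [Module F N] {p q : ℕ → F}
    (hpq : ∀ n, ∑ k ∈ Finset.range (n + 1), p k * q (n - k) = if n = 0 then 1 else 0) (x : ℕ → N)
    (n : ℕ) : ∑ j ∈ Finset.range (n + 1), p j •
      ∑ k ∈ Finset.range (n - j + 1), q k • x (n - j - k) = x n := by
  have h := Finset.sum_range_diag_flip (n + 1) fun j k => (p j * q k) • x (n - j - k)
  have e : ∀ j ∈ Finset.range (n + 1), p j • ∑ k ∈ Finset.range (n - j + 1), q k • x (n - j - k) =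
      ∑ k ∈ Finset.range (n + 1 - j), (p j * q k) • x (n - j - k) := by
    intro j hj
    rw [Finset.mem_range] at hj
    rw [Finset.smul_sum, show n - j + 1 = n + 1 - j by omega]
    exact Finset.sum_congr rfl fun k _ => smul_smul _ _ _
  rw [Finset.sum_congr rfl e, ← h, Finset.sum_eq_single 0]
  · simpa using congrArg (· • x n) (hpq 0)
  · intro t ht ht0
    rw [Finset.mem_range] at ht
    have e' : ∀ k ∈ Finset.range (t + 1), (p k * q (t - k)) • x (n - k - (t - k)) =
        (p k * q (t - k)) • x (n - t) := by
      intro k hk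
      rw [Finset.mem_range] at hk
      rw [show n - k - (t - k) = n - t by omega]
    rw [Finset.sum_congr rfl e', ← Finset.sum_smul, hpq, if_neg ht0, zero_smul]
  · intro h0
    exact absurd (Finset.mem_range.2 (by omega)) h0

end Fock

end

noncomputable section

namespace Fock

open Fld

variable {F : Type*} [Field F]

/-! ### Linear combinations of the modes of the fermion -/

/-- Contraction with a functional. -/
def contract (d : Module.Dual F (ℕ →₀ F)) : Module.End F (Fock F) :=
  CliffordAlgebra.contractLeft (Q := (0 : QuadraticForm F (ℕ →₀ F))) d

theorem contract_one (d : Module.Dual F (ℕ →₀ F)) : contract d (1 : Fock F) = 0 :=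
  CliffordAlgebra.contractLeft_one _ _

theorem contract_ι_mul (d : Module.Dual F (ℕ →₀ F)) (m : ℕ →₀ F) (w : Fock F) :
    contract d (ExteriorAlgebra.ι F m * w) = d m • w - ExteriorAlgebra.ι F m * contract d w :=
  CliffordAlgebra.contractLeft_ι_mul (Q := (0 : QuadraticForm F (ℕ →₀ F))) (d := d) m w

theorem exists_contract_eq_sum (d : Module.Dual F (ℕ →₀ F)) (w : Fock F) : ∃ N : ℕ, ∀ N' ≥ N,
    contract d w = ∑ b ∈ Finset.range N', d (Finsupp.single b 1) • an b w := by
  induction w using induction with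
  | one => exact ⟨0, fun N' _ => by simp [contract_one, an_one]⟩
  | add x y hx hy =>
    obtain ⟨N, hN⟩ := hx
    obtain ⟨K, hK⟩ := hy
    refine ⟨max N K, fun N' hN' => ?_⟩
    rw [map_add, hN N' (by omega), hK N' (by omega), ← Finset.sum_add_distrib]
    simp only [map_add, smul_add]
  | smul a x hx =>
    obtain ⟨N, hN⟩ := hx
    refine ⟨N, fun N' hN' => ?_⟩
    rw [map_smul, hN N' hN', Finset.smul_sum]
    exact Finset.sum_congr rfl fun b _ => by rw [map_smul, smul_comm]
  | cr j x hx =>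
    obtain ⟨N, hN⟩ := hx
    refine ⟨max N (j + 1), fun N' hN' => ?_⟩
    have e : ∀ b ∈ Finset.range N', d (Finsupp.single b 1) • an b (cr j x) =
        (if b = j then d (Finsupp.single j 1) • x else 0) -
          cr j (d (Finsupp.single b 1) • an b x) := by
      intro b _
      rw [an_cr, smul_sub, map_smul]
      congr 1
      rcases eq_or_ne b j with rfl | h
      · rw [if_pos rfl, if_pos rfl]
      · rw [if_neg h, if_neg h, smul_zero]
    rw [cr_apply, contract_ι_mul, ← cr_apply, ← cr_apply, hN N' (by omega), Finset.sum_congr rfl e,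
      Finset.sum_sub_distrib, Finset.sum_ite_eq', if_pos (Finset.mem_range.2 (by omega)), map_sum]

/-- The operator `∑ₘ r(m) Ψₘ`. -/
def comb (r : ℤ → F) (w : Fock F) : Fock F := ∑ᶠ m : ℤ, r m • ns m w

theorem support_comb_finite {r : ℤ → F} {K : ℤ} (hr : ∀ m < K, r m = 0) (w : Fock F) :
    (Function.support fun m : ℤ => r m • ns m w).Finite := by
  obtain ⟨N, hN⟩ := isFermi_ns.trunc w
  refine (Set.finite_Ico K N).subset fun m hm => ?_
  by_contra h
  rw [Set.mem_Ico, not_and_or, not_le, not_lt] at h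
  apply hm
  rcases h with h | h
  · simp only [hr m h, zero_smul]
  · simp only [hN m h, smul_zero]

/-- The negative modes form a finite sum of creation operators; the nonnegative ones, possibly
infinitely many, assemble into contraction with a single functional. -/
theorem comb_eq {r : ℤ → F} {K : ℕ} (hr : ∀ m < -(K : ℤ), r m = 0) (w : Fock F) :
    comb r w = ∑ a ∈ Finset.range K, r (-(a : ℤ) - 1) • cr a w +
      contract (Finsupp.linearCombination F fun b : ℕ => r b) w := by
  obtain ⟨N, hN⟩ := exists_contract_eq_sum (Finsupp.linearCombination F fun b : ℕ => r b) w
  obtain ⟨N₁, hN₁⟩ := isFermi_ns.trunc w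
  have hinj : Function.Injective fun i : ℕ => -(i : ℤ) - 1 := fun i j h => by simpa using h
  have hdisj : Disjoint ((Finset.range K).map ⟨_, hinj⟩)
      ((Finset.range (max N N₁.toNat)).map ⟨_, Nat.cast_injective (R := ℤ)⟩) := by
    rw [Finset.disjoint_left]
    intro m hm hm'
    simp only [Finset.mem_map, Function.Embedding.coeFn_mk] at hm hm'
    obtain ⟨a, -, rfl⟩ := hm
    obtain ⟨b, -, hb⟩ := hm'
    omega
  rw [hN _ (le_max_left N N₁.toNat), comb, finsum_eq_sum_of_support_subset
    (s := (Finset.range K).map ⟨_, hinj⟩ ∪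
      (Finset.range (max N N₁.toNat)).map ⟨_, Nat.cast_injective (R := ℤ)⟩),
    Finset.sum_union hdisj, Finset.sum_map, Finset.sum_map]
  · congr 1
    · refine Finset.sum_congr rfl fun a _ => ?_
      simp only [Function.Embedding.coeFn_mk, ns_neg]
    · refine Finset.sum_congr rfl fun b _ => ?_
      simp only [Function.Embedding.coeFn_mk, ns_natCast]
      simp
  · intro m hm
    by_contra hc
    apply hm
    simp only [Finset.coe_union, Finset.coe_map, Set.mem_union, Set.mem_image, Finset.coe_range,
      Set.mem_Iio, Function.Embedding.coeFn_mk, not_or] at hc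
    rcases lt_or_ge m 0 with h | h
    · simp only
      rw [hr m (lt_of_not_ge fun h' => hc.1 ⟨(-m - 1).toNat, by omega, by omega⟩), zero_smul]
    · simp only
      rw [hN₁ m (le_of_not_gt fun h' => hc.2 ⟨m.toNat, by omega, by omega⟩), smul_zero]

/-- The action of `ad Lₙ` on the coefficients of a linear combination of the `Ψₘ`. -/
def adCoeff (n : ℤ) (r : ℤ → F) (m : ℤ) : F := -((m : F) + 1 / 2 - n / 2) * r (m - n)

theorem nsL_comb (h2 : (2 : F) ≠ 0) (n : ℤ) {r : ℤ → F} {K : ℤ} (hr : ∀ m < K, r m = 0) (w : Fock F) :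
    nsL n (comb r w) = comb r (nsL n w) + comb (adCoeff n r) w := by
  have hr' : ∀ m < K + n, adCoeff n r m = 0 := fun m hm => by
    rw [adCoeff, hr _ (by omega), mul_zero]
  have hshift : comb (adCoeff n r) w = ∑ᶠ m : ℤ, adCoeff n r (m + n) • ns (m + n) w :=
    (finsum_comp_equiv (Equiv.addRight n)).symm
  have hfin : (Function.support fun m : ℤ => adCoeff n r (m + n) • ns (m + n) w).Finite :=
    (support_comb_finite hr' w).preimage (f := fun m => m + n) (add_left_injective n).injOn
  rw [hshift, comb, comb, map_finsum _ (support_comb_finite hr w),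
    ← finsum_add_distrib (support_comb_finite hr _) hfin]
  refine finsum_congr fun m => ?_
  rw [map_smul, nsL_ns h2, adCoeff, add_sub_cancel_right, add_comm m n]
  push_cast
  match_scalars <;> field_simp <;> ring

theorem comb_linear {r s t : ℤ → F} {a b : F} {K : ℤ} (hs : ∀ m < K, s m = 0) (ht : ∀ m < K, t m = 0)
    (h : ∀ m, r m = a * s m + b * t m) (w : Fock F) : comb r w = a • comb s w + b • comb t w := by
  rw [comb, comb, comb, smul_finsum' a (support_comb_finite hs w),
    smul_finsum' b (support_comb_finite ht w), ← finsum_add_distrib]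
  · exact finsum_congr fun m => by rw [h]; module
  · exact (support_comb_finite hs w).subset fun m hm h => hm (by simp only at h ⊢; rw [h, smul_zero])
  · exact (support_comb_finite ht w).subset fun m hm h => hm (by simp only at h ⊢; rw [h, smul_zero])

/-! ### The functional of the twisted sector -/

variable (F) in
/-- The coefficients of the operators annihilated by the functional of the twisted sector. -/
def twCoeff (N : ℕ) (m : ℤ) : F := gam F (m + N + 1) - if N = 0 then bet F m / 2 else 0

variable (F) in
/-- The creation part of the operator with coefficients `twCoeff`. -/
def twVec (N : ℕ) : ℕ →₀ F := ∑ k ∈ Finset.range (N + 1), gam F k • Finsupp.single (N - k) 1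

variable (F) in
/-- The annihilation part of the operator with coefficients `twCoeff`. -/
def twDual (N : ℕ) : Module.Dual F (ℕ →₀ F) :=
  Finsupp.linearCombination F fun b : ℕ => twCoeff F N b

variable (F) in
/-- The bilinear form that describes the functional of the twisted sector. -/
def twForm : LinearMap.BilinForm F (ℕ →₀ F) :=
  Finsupp.linearCombination F fun a => ∑ k ∈ Finset.range (a + 1), bet F k • twDual F (a - k)

theorem twForm_single (a : ℕ) : twForm F (Finsupp.single a 1) =
    ∑ k ∈ Finset.range (a + 1), bet F k • twDual F (a - k) := by
  rw [twForm, Finsupp.linearCombination_single, one_smul]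

theorem twForm_twVec (h2 : (2 : F) ≠ 0) (N : ℕ) : twForm F (twVec F N) = twDual F N := by
  rw [twVec, map_sum]
  simp only [map_smul, twForm_single]
  exact sum_smul_sum_smul (sum_gam_mul_bet h2) _ N

theorem single_eq_sum_twVec (h2 : (2 : F) ≠ 0) (a : ℕ) : (Finsupp.single a 1 : ℕ →₀ F) =
    ∑ k ∈ Finset.range (a + 1), bet F k • twVec F (a - k) :=
  (sum_smul_sum_smul (p := fun k => bet F k) (q := fun k => gam F k) (sum_bet_mul_gam h2)
    (fun k => (Finsupp.single k 1 : ℕ →₀ F)) a).symm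

theorem twDual_twVec (N M : ℕ) : twDual F N (twVec F M) =
    ∑ k ∈ Finset.range (M + 1), gam F k * twCoeff F N (M - k : ℕ) := by
  rw [twVec, map_sum]
  refine Finset.sum_congr rfl fun k _ => ?_
  rw [map_smul, twDual, Finsupp.linearCombination_single, smul_eq_mul, one_smul]

/-- The two pairings are the two parts of the coefficient of X^(N+M+1) in the square of `gamSeries`,
which is 1 + X, so they cancel when N + M > 0. For N = M = 0 the coefficient is 1, and the
correction by half of `bet` in `twCoeff` removes it. -/
theorem twDual_antisymm (h2 : (2 : F) ≠ 0) (N M : ℕ) :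
    twDual F N (twVec F M) + twDual F M (twVec F N) = 0 := by
  have hg : ∀ N M : ℕ, twDual F N (twVec F M) = ∑ k ∈ Finset.range (M + 1),
      gam F k * gam F (N + M + 1 - k : ℕ) - if N = 0 ∧ M = 0 then 1 / 2 else 0 := by
    intro N M
    rw [twDual_twVec]
    have e : ∀ k ∈ Finset.range (M + 1), gam F k * twCoeff F N (M - k : ℕ) =
        gam F k * gam F (N + M + 1 - k : ℕ) -
          (if N = 0 then 1 / 2 else 0) * (gam F k * bet F (M - k : ℕ)) := by
      intro k hk
      rw [Finset.mem_range] at hk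
      rw [twCoeff, show ((M - k : ℕ) : ℤ) + N + 1 = ((N + M + 1 - k : ℕ) : ℤ) by omega]
      split_ifs <;> ring
    rw [Finset.sum_congr rfl e, Finset.sum_sub_distrib, ← Finset.mul_sum, sum_gam_mul_bet h2]
    congr 1
    by_cases hN : N = 0 <;> by_cases hM : M = 0 <;> simp [hN, hM]
  rw [hg, hg]
  by_cases h0 : N = 0 ∧ M = 0
  · obtain ⟨rfl, rfl⟩ := h0
    have h1 : (gam F 1 : F) = 1 / 2 := by
      have := gam_succ h2 0
      rw [gam_zero] at this
      simpa using this
    simp [gam_zero, h1]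
  · rw [if_neg h0, if_neg (by tauto), sub_zero, sub_zero]
    have h := sum_gam_mul_gam (F := F) h2 (N + M + 1) (by omega)
    rw [show N + M + 1 + 1 = (M + 1) + (N + 1) by omega, Finset.sum_range_add] at h
    rw [← h]
    congr 1
    rw [← Finset.sum_range_reflect]
    refine Finset.sum_congr rfl fun k hk => ?_
    rw [Finset.mem_range] at hk
    rw [mul_comm, show M + N + 1 - (N + 1 - 1 - k) = M + 1 + k by omega,
      show N + M + 1 - (M + 1 + k) = N + 1 - 1 - k by omega]

/-- Antisymmetry on the vectors `twVec`, which span, extends bilinearly. An alternating form has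
zero quadratic form, so changing the form by it maps the exterior algebra to itself. -/
theorem twForm_self (h2 : (2 : F) ≠ 0) (v : ℕ →₀ F) : twForm F v v = 0 := by
  have h1 : ∀ N v, twForm F (twVec F N) v + twForm F v (twVec F N) = 0 := by
    intro N v
    induction v using Finsupp.induction_linear with
    | zero => simp
    | add x y hx hy =>
      simp only [map_add, LinearMap.add_apply]
      linear_combination hx + hy
    | single a r =>
      have : (Finsupp.single a r : ℕ →₀ F) = r • Finsupp.single a 1 := by simp
      rw [this, single_eq_sum_twVec h2]
      simp only [map_smul, map_sum, LinearMap.smul_apply, LinearMap.sum_apply, twForm_twVec h2,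
        smul_eq_mul]
      rw [← mul_add, ← Finset.sum_add_distrib, Finset.sum_eq_zero, mul_zero]
      intro k _
      rw [← mul_add, twDual_antisymm h2, mul_zero]
  have h3 : ∀ u v, twForm F u v + twForm F v u = 0 := by
    intro u v
    induction u using Finsupp.induction_linear with
    | zero => simp
    | add x y hx hy =>
      simp only [map_add, LinearMap.add_apply]
      linear_combination hx + hy
    | single a r =>
      have : (Finsupp.single a r : ℕ →₀ F) = r • Finsupp.single a 1 := by simp
      rw [this, single_eq_sum_twVec h2]
      simp only [map_smul, map_sum, LinearMap.smul_apply, LinearMap.sum_apply, smul_eq_mul]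
      rw [← mul_add, ← Finset.sum_add_distrib, Finset.sum_eq_zero, mul_zero]
      intro k _
      rw [← mul_add, h1, mul_zero]
  have h4 := h3 v v
  rw [← two_mul] at h4
  exact (mul_eq_zero.1 h4).resolve_left h2

theorem twForm_toQuadraticMap (h2 : (2 : F) ≠ 0) : (twForm F).toQuadraticMap =
    (0 : QuadraticForm F (ℕ →₀ F)) - 0 := by
  ext v
  simp [twForm_self h2]

/-- The automorphism of the Fock space that defines the functional of the twisted sector. -/
def twEquiv (h2 : (2 : F) ≠ 0) : Fock F ≃ₗ[F] Fock F :=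
  CliffordAlgebra.changeFormEquiv (twForm_toQuadraticMap h2)

theorem twEquiv_one (h2 : (2 : F) ≠ 0) : twEquiv h2 1 = 1 :=
  CliffordAlgebra.changeForm_one (twForm_toQuadraticMap h2)

theorem twEquiv_ι_mul (h2 : (2 : F) ≠ 0) (m : ℕ →₀ F) (w : Fock F) :
    twEquiv h2 (ExteriorAlgebra.ι F m * w) =
      ExteriorAlgebra.ι F m * twEquiv h2 w - contract (twForm F m) (twEquiv h2 w) :=
  CliffordAlgebra.changeForm_ι_mul (twForm_toQuadraticMap h2) m w

theorem twEquiv_contract (h2 : (2 : F) ≠ 0) (d : Module.Dual F (ℕ →₀ F)) (w : Fock F) :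
    twEquiv h2 (contract d w) = contract d (twEquiv h2 w) :=
  CliffordAlgebra.changeForm_contractLeft (twForm_toQuadraticMap h2) d w

/-- The functional of the twisted sector. -/
def tw (h2 : (2 : F) ≠ 0) : Fock F →ₗ[F] F := ε ∘ₗ (twEquiv h2).toLinearMap

theorem tw_one (h2 : (2 : F) ≠ 0) : tw h2 1 = 1 := by
  change ε (twEquiv h2 1) = 1
  rw [twEquiv_one, ε_one]

theorem ε_ι_mul (m : ℕ →₀ F) (w : Fock F) : ε (ExteriorAlgebra.ι F m * w) = 0 := by
  simp [ε, ExteriorAlgebra.algebraMapInv]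

/-- The scalar part of a product with a vector is zero, so only the contraction term of the change
of form survives. -/
theorem tw_ι_mul (h2 : (2 : F) ≠ 0) (m : ℕ →₀ F) (w : Fock F) :
    tw h2 (ExteriorAlgebra.ι F m * w) = -tw h2 (contract (twForm F m) w) := by
  change ε (twEquiv h2 _) = -ε (twEquiv h2 _)
  rw [twEquiv_ι_mul, twEquiv_contract, map_sub, ε_ι_mul, zero_sub]

/-- A functional that kills `1` and satisfies the same recursion as `tw` is zero. -/
theorem eq_zero_of_ι_mul (h2 : (2 : F) ≠ 0) {f : Fock F →ₗ[F] F} (h1 : f 1 = 0)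
    (hf : ∀ m w, f (ExteriorAlgebra.ι F m * w) = -f (contract (twForm F m) w)) : f = 0 := by
  have key : f ∘ₗ (twEquiv h2).symm.toLinearMap = 0 := by
    refine hom_ext ?_ fun i w _ => ?_
    · have : (twEquiv h2).symm 1 = 1 := by
        rw [LinearEquiv.symm_apply_eq, twEquiv_one]
      simp [this, h1]
    · have e : (twEquiv h2).symm (cr i w) = ExteriorAlgebra.ι F (Finsupp.single i 1) *
          (twEquiv h2).symm w + contract (twForm F (Finsupp.single i 1)) ((twEquiv h2).symm w) := by
        rw [LinearEquiv.symm_apply_eq, map_add, twEquiv_ι_mul, twEquiv_contract,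
          LinearEquiv.apply_symm_apply, cr_apply, sub_add_cancel]
      rw [LinearMap.comp_apply, LinearEquiv.coe_coe, e, map_add, hf, neg_add_cancel,
        LinearMap.zero_apply]
  refine LinearMap.ext fun w => ?_
  have := LinearMap.congr_fun key (twEquiv h2 w)
  simpa using this

theorem twCoeff_eq_zero (N : ℕ) {m : ℤ} (hm : m < -((N + 1 : ℕ) : ℤ)) : twCoeff F N m = 0 := by
  rw [twCoeff, gam_neg (by omega), bet_neg (by omega)]
  simp

theorem comb_twCoeff (N : ℕ) (w : Fock F) : comb (twCoeff F N) w =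
    ExteriorAlgebra.ι F (twVec F N) * w + contract (twDual F N) w := by
  rw [comb_eq (K := N + 1) (fun m hm => twCoeff_eq_zero N hm), twDual, twVec, map_sum, Finset.sum_mul,
    ← Finset.sum_range_reflect]
  congr 1
  refine Finset.sum_congr rfl fun k hk => ?_
  rw [Finset.mem_range] at hk
  rw [map_smul, smul_mul_assoc, ← cr_apply, twCoeff, bet_neg (by omega), zero_div, ite_self, sub_zero,
    show N + 1 - 1 - k = N - k by omega, show -((N - k : ℕ) : ℤ) - 1 + N + 1 = k by omega]

theorem tw_comb (h2 : (2 : F) ≠ 0) (N : ℕ) (w : Fock F) : tw h2 (comb (twCoeff F N) w) = 0 := by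
  rw [comb_twCoeff, map_add, tw_ι_mul, twForm_twVec h2, neg_add_cancel]

/-- A functional that kills `1` and the images of the operators with coefficients `twCoeff` is
zero. -/
theorem eq_zero_of_comb (h2 : (2 : F) ≠ 0) {f : Fock F →ₗ[F] F} (h1 : f 1 = 0)
    (hf : ∀ N w, f (comb (twCoeff F N) w) = 0) : f = 0 := by
  refine eq_zero_of_ι_mul h2 h1 fun m w => ?_
  have key : ∀ N, f (ExteriorAlgebra.ι F (twVec F N) * w) = -f (contract (twForm F (twVec F N)) w) := by
    intro N
    have h := hf N w
    rw [comb_twCoeff, map_add, add_eq_zero_iff_eq_neg, ← twForm_twVec h2] at h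
    exact h
  have hadd : ∀ d d' : Module.Dual F (ℕ →₀ F), contract (d + d') w = contract d w + contract d' w := by
    intro d d'; simp [contract]
  have hsmul : ∀ (a : F) (d : Module.Dual F (ℕ →₀ F)), contract (a • d) w = a • contract d w := by
    intro a d; simp [contract]
  let p : (ℕ →₀ F) →ₗ[F] F :=
    { toFun := fun m => f (ExteriorAlgebra.ι F m * w) + f (contract (twForm F m) w)
      map_add' := fun x y => by
        simp only [map_add, add_mul, hadd]
        ring
      map_smul' := fun a x => by
        simp only [map_smul, smul_mul_assoc, hsmul, RingHom.id_apply, smul_eq_mul]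
        ring }
  have hp : p = 0 := by
    refine Finsupp.lhom_ext' fun a => LinearMap.ext_ring ?_
    change p (Finsupp.single a 1) = 0
    rw [single_eq_sum_twVec h2, map_sum]
    refine Finset.sum_eq_zero fun k _ => ?_
    rw [map_smul]
    have : p (twVec F (a - k)) = 0 := by
      change f _ + f _ = 0
      rw [key, neg_add_cancel]
    rw [this, smul_zero]
  exact eq_neg_of_add_eq_zero_left (LinearMap.congr_fun hp m)

end Fock

end

noncomputable section

namespace Fock

open Fld

variable {F : Type*} [Field F]

/-! ### The Virasoro operators and the functional of the twisted sector -/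

theorem tw_comb_eq_zero (h2 : (2 : F) ≠ 0) {r : ℤ → F} {a b c : F} {N₁ N₂ N₃ : ℕ}
    (h : ∀ m, r m = a * twCoeff F N₁ m + b * twCoeff F N₂ m + c * twCoeff F N₃ m) (w : Fock F) :
    tw h2 (comb r w) = 0 := by
  have hb : ∀ N ∈ ({N₁, N₂, N₃} : Finset ℕ), ∀ m < -((N₁ + N₂ + N₃ + 1 : ℕ) : ℤ),
      twCoeff F N m = 0 := by
    intro N hN m hm
    simp only [Finset.mem_insert, Finset.mem_singleton] at hN
    exact twCoeff_eq_zero N (by omega)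
  have h1 := hb N₁ (by simp)
  have h2' := hb N₂ (by simp)
  have h3 := hb N₃ (by simp)
  rw [comb_linear (a := 1) (b := c) (s := fun m => a * twCoeff F N₁ m + b * twCoeff F N₂ m)
    (t := twCoeff F N₃) (fun m hm => by rw [h1 m hm, h2' m hm]; ring) h3
    (fun m => by rw [h, one_mul]), comb_linear h1 h2' (fun m => rfl), map_add, map_smul, map_smul, map_add,
    map_smul, map_smul, tw_comb, tw_comb, tw_comb]
  simp

theorem adCoeff_eq_zero {r : ℤ → F} {K : ℤ} (hr : ∀ m < K, r m = 0) {n m : ℤ} (hm : m < K + n) :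
    adCoeff n r m = 0 := by
  rw [adCoeff, hr _ (by omega), mul_zero]

/-- The functional w ↦ tw(L₋₁w + L₀w) kills the vacuum. It also kills the images of the operators
with coefficients `twCoeff`, because commuting L₋₁ + L₀ past them gives combinations of operators of
the same kind. So it is zero by `eq_zero_of_comb`. -/
theorem tw_nsL_neg_one (h2 : (2 : F) ≠ 0) (w : Fock F) : tw h2 (nsL (-1) w + nsL 0 w) = 0 := by
  have key : tw h2 ∘ₗ (nsL (-1) + nsL 0) = 0 := by
    refine eq_zero_of_comb h2 ?_ fun N w => ?_
    · simp [nsL_one]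
    have hr : ∀ m < -((N + 1 : ℕ) : ℤ), twCoeff F N m = 0 := fun m hm => twCoeff_eq_zero N hm
    have hc : comb (fun m => adCoeff (-1) (twCoeff F N) m + adCoeff 0 (twCoeff F N) m) w =
        comb (adCoeff (-1) (twCoeff F N)) w + comb (adCoeff 0 (twCoeff F N)) w := by
      rw [comb_linear (a := 1) (b := 1) (s := adCoeff (-1) (twCoeff F N)) (t := adCoeff 0 (twCoeff F N))
        (K := -((N + 1 : ℕ) : ℤ) - 1) (fun m hm => adCoeff_eq_zero hr (by omega))
        (fun m hm => adCoeff_eq_zero hr (by omega)) (fun m => by ring), one_smul, one_smul]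
    have hadd : ∀ v w : Fock F, comb (twCoeff F N) v + comb (twCoeff F N) w =
        comb (twCoeff F N) (v + w) := by
      intro v w
      rw [comb_twCoeff, comb_twCoeff, comb_twCoeff, mul_add, map_add]
      abel
    rw [LinearMap.comp_apply, LinearMap.add_apply, nsL_comb h2 _ hr, nsL_comb h2 _ hr,
      add_add_add_comm, hadd, ← hc, map_add, tw_comb, zero_add]
    refine tw_comb_eq_zero h2 (a := (N : F) + 1) (b := N) (c := 0) (N₁ := N + 1) (N₂ := N) (N₃ := 0)
      (fun m => ?_) w
    have hg := gam_succ h2 (m + N + 1)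
    have hbe := bet_succ h2 m
    simp only [adCoeff, twCoeff, sub_neg_eq_add, sub_zero, Int.cast_neg, Int.cast_one, Int.cast_zero]
    rw [show m + 1 + N + 1 = m + N + 1 + 1 by ring,
      show m + ((N + 1 : ℕ) : ℤ) + 1 = m + N + 1 + 1 by push_cast; ring, if_neg (by omega : N + 1 ≠ 0)]
    push_cast at hg hbe ⊢
    rcases Nat.eq_zero_or_pos N with rfl | hN
    · rw [if_pos rfl, if_pos rfl]
      push_cast at hg ⊢
      simp only [div_eq_mul_inv] at hg hbe ⊢
      have ht := mul_inv_cancel₀ h2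
      grind
    · rw [if_neg (by omega), if_neg (by omega)]
      simp only [div_eq_mul_inv] at hg ⊢
      have ht := mul_inv_cancel₀ h2
      grind
  exact LinearMap.congr_fun key w

/-- The argument of `tw_nsL_neg_one` with L₋₂ - L₀. The weight 1/16 enters here, as the value of tw
on L₋₂·1. -/
theorem tw_nsL_neg_two (h2 : (2 : F) ≠ 0) (w : Fock F) :
    tw h2 (nsL (-2) w - nsL 0 w - (1 / 16 : F) • w) = 0 := by
  have key : tw h2 ∘ₗ (nsL (-2) - nsL 0 - (1 / 16 : F) • LinearMap.id) = 0 := by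
    refine eq_zero_of_comb h2 ?_ fun N w => ?_
    · have h16 : (16 : F) ≠ 0 := by
        have : (16 : F) = 2 ^ 4 := by norm_num
        rw [this]; exact pow_ne_zero _ h2
      -- L₋₂·1 is half of e₁e₀, on which tw equals minus the entry (1,0) of `twForm`.
      have h1 := tw_ι_mul h2 (Finsupp.single 1 1) (cr 0 1)
      rw [cr_apply 0, contract_ι_mul, contract_one, mul_zero, sub_zero, map_smul, tw_one,
        ← cr_apply, ← cr_apply, twForm_single, Finset.sum_range_succ, Finset.sum_range_one,
        LinearMap.add_apply, LinearMap.smul_apply, LinearMap.smul_apply, twDual, twDual,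
        Finsupp.linearCombination_single, Finsupp.linearCombination_single] at h1
      have hg1 := gam_succ h2 0
      have hg2 := gam_succ h2 1
      have hb := bet_zero (F := F)
      have hg0 := gam_zero (F := F)
      simp only [twCoeff] at h1
      norm_num at h1 hg1 hg2
      rw [LinearMap.comp_apply, LinearMap.sub_apply, LinearMap.sub_apply, nsL_neg_two_one h2,
        nsL_one (by omega), LinearMap.smul_apply, LinearMap.id_apply, sub_zero, map_sub, map_smul,
        map_smul, tw_one, h1]
      have h16' : (16 : F)⁻¹ = 2⁻¹ * 2⁻¹ * 2⁻¹ * 2⁻¹ := by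
        rw [← mul_inv, ← mul_inv, ← mul_inv]; norm_num
      have ht := mul_inv_cancel₀ h2
      have hb₁ := bet_succ h2 0
      norm_num at hb₁
      simp only [smul_eq_mul, div_eq_mul_inv, h16'] at *
      grind
    have hr : ∀ m < -((N + 1 : ℕ) : ℤ), twCoeff F N m = 0 := fun m hm => twCoeff_eq_zero N hm
    have hc : comb (fun m => adCoeff (-2) (twCoeff F N) m - adCoeff 0 (twCoeff F N) m) w =
        comb (adCoeff (-2) (twCoeff F N)) w - comb (adCoeff 0 (twCoeff F N)) w := by
      rw [comb_linear (a := 1) (b := -1) (s := adCoeff (-2) (twCoeff F N))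
        (t := adCoeff 0 (twCoeff F N))
        (K := -((N + 1 : ℕ) : ℤ) - 2) (fun m hm => adCoeff_eq_zero hr (by omega))
        (fun m hm => adCoeff_eq_zero hr (by omega)) (fun m => by ring), one_smul, neg_one_smul,
        sub_eq_add_neg]
    have hsub : ∀ v w : Fock F, comb (twCoeff F N) v - comb (twCoeff F N) w =
        comb (twCoeff F N) (v - w) := by
      intro v w
      rw [comb_twCoeff, comb_twCoeff, comb_twCoeff, mul_sub, map_sub]
      abel
    rw [LinearMap.comp_apply, LinearMap.sub_apply, LinearMap.sub_apply, LinearMap.smul_apply,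
      LinearMap.id_apply, nsL_comb h2 _ hr, nsL_comb h2 _ hr, add_sub_add_comm, hsub, ← hc, map_sub,
      map_smul, map_add, tw_comb, tw_comb, zero_add, smul_zero, sub_zero]
    have ht := mul_inv_cancel₀ h2
    have h4 : (4 : F)⁻¹ = 2⁻¹ * 2⁻¹ := by
      rw [← mul_inv]; norm_num
    rcases Nat.eq_zero_or_pos N with rfl | hN
    -- The case N = 0 is separate because of the extra term of `twCoeff F 0`, which changes the
    -- coefficient of the operator for N = 1.
    · refine tw_comb_eq_zero h2 (a := 3 / 2) (b := -(3 / 4)) (c := 0) (N₁ := 2) (N₂ := 1) (N₃ := 0)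
        (fun m => ?_) w
      have hg₁ := gam_succ h2 (m + 1)
      have hg₂ := gam_succ h2 (m + 2)
      have hb₁ := bet_succ h2 m
      have hb₂ := bet_succ h2 (m + 1)
      have e₁ : gam F (m + 2) = bet F (m + 2) + bet F (m + 1) := by rw [gam]; congr 2; ring
      simp only [adCoeff, twCoeff, sub_neg_eq_add, sub_zero, Int.cast_neg, Int.cast_ofNat, Int.cast_zero,
        if_true, OfNat.ofNat_ne_zero, one_ne_zero, if_false, Nat.cast_ofNat, Nat.cast_one,
        Nat.cast_zero, add_zero]
      rw [show m + 1 + 1 = m + 2 by ring] at hg₁ hb₂ ⊢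
      rw [show m + 2 + 1 = m + 3 by ring] at hg₂ ⊢
      push_cast at hg₁ hg₂ hb₂
      simp only [div_eq_mul_inv, h4] at hg₁ hg₂ hb₁ hb₂ ⊢
      grind
    · refine tw_comb_eq_zero h2 (a := N + 3 / 2) (b := -(1 / 2)) (c := -N) (N₁ := N + 2) (N₂ := N + 1)
        (N₃ := N) (fun m => ?_) w
      have hg₁ := gam_succ h2 (m + N + 1)
      have hg₂ := gam_succ h2 (m + N + 2)
      simp only [adCoeff, twCoeff, sub_neg_eq_add, sub_zero, Int.cast_neg, Int.cast_ofNat, Int.cast_zero,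
        if_neg hN.ne', if_neg (Nat.succ_ne_zero _)]
      rw [show m + 2 + N + 1 = m + N + 3 by ring,
        show m + ((N + 2 : ℕ) : ℤ) + 1 = m + N + 3 by push_cast; ring,
        show m + ((N + 1 : ℕ) : ℤ) + 1 = m + N + 2 by push_cast; ring]
      rw [show m + N + 1 + 1 = m + N + 2 by ring] at hg₁
      rw [show m + N + 2 + 1 = m + N + 3 by ring] at hg₂
      push_cast at hg₁ hg₂
      simp only [div_eq_mul_inv] at hg₁ hg₂ ⊢
      grind
  exact LinearMap.congr_fun key w

/-- The bracket of L₋ₘ and L₋ₖ is (k - m)L₋₍ₘ₊ₖ₎, so the formula for m and k implies the one for m +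
k whenever k - m is invertible in F. -/
theorem tw_nsL_neg_add (h2 : (2 : F) ≠ 0) {m k : ℕ} (hmk : ((k : F) - m) ≠ 0) (hpos : 0 < m + k)
    (hm : ∀ w, tw h2 (nsL (-m) w) = (-1) ^ m * (tw h2 (nsL 0 w) + (m - 1) * (1 / 16) * tw h2 w))
    (hk : ∀ w, tw h2 (nsL (-k) w) = (-1) ^ k * (tw h2 (nsL 0 w) + (k - 1) * (1 / 16) * tw h2 w))
    (w : Fock F) : tw h2 (nsL (-((m + k : ℕ) : ℤ)) w) =
      (-1) ^ (m + k) * (tw h2 (nsL 0 w) + (((m + k : ℕ) : F) - 1) * (1 / 16) * tw h2 w) := by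
  have hmk' := congrArg (tw h2) ((isVirRep_nsL h2).comm (-m) (-k) w)
  have hm0 := congrArg (tw h2) ((isVirRep_nsL h2).comm 0 (-m) w)
  have hk0 := congrArg (tw h2) ((isVirRep_nsL h2).comm 0 (-k) w)
  have hz : ∀ j : ℕ, ((if (0 : ℤ) + -j = 0 then (virCoeff F 0 * (1 / 2)) • w else 0) : Fock F) = 0 := by
    intro j
    split_ifs
    · simp [virCoeff]
    · rfl
  rw [if_neg (by omega), add_zero, map_sub, map_smul, hm (nsL (-k) w), hk (nsL (-m) w), hm,
    hk] at hmk'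
  rw [hz, add_zero, zero_add, map_sub, map_smul, hm] at hm0
  rw [hz, add_zero, zero_add, map_sub, map_smul, hk] at hk0
  rw [sub_eq_iff_eq_add.1 hm0, sub_eq_iff_eq_add.1 hk0, hm, hk,
    show (-m + -k : ℤ) = -((m + k : ℕ) : ℤ) by push_cast; ring] at hmk'
  refine mul_left_cancel₀ hmk ?_
  rw [pow_add, Nat.cast_add (R := F)]
  simp only [Int.cast_neg, Int.cast_natCast, Int.cast_zero, smul_eq_mul] at hmk'
  linear_combination -hmk'

/-- The recursion of `Y_singular` for weight 1/16, from the cases 1 and 2. The step to n uses 1 and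
n - 1 unless n = 2 in F; in that case it uses 2 and n - 2, whose difference is -2 in F. -/
theorem tw_nsL_neg (h2 : (2 : F) ≠ 0) (n : ℕ) (hn : 1 ≤ n) (w : Fock F) :
    tw h2 (nsL (-n) w) = (-1) ^ n * (tw h2 (nsL 0 w) + (n - 1) * (1 / 16) * tw h2 w) := by
  induction n using Nat.strong_induction_on generalizing w with
  | _ n ih =>
    have h1 : ∀ w, tw h2 (nsL (-(1 : ℕ)) w) =
        (-1) ^ 1 * (tw h2 (nsL 0 w) + ((1 : ℕ) - 1) * (1 / 16) * tw h2 w) := fun w => by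
      have := tw_nsL_neg_one h2 w
      rw [map_add] at this
      push_cast
      linear_combination this
    have h2' : ∀ w, tw h2 (nsL (-(2 : ℕ)) w) =
        (-1) ^ 2 * (tw h2 (nsL 0 w) + ((2 : ℕ) - 1) * (1 / 16) * tw h2 w) := fun w => by
      have := tw_nsL_neg_two h2 w
      rw [map_sub, map_sub, map_smul, smul_eq_mul] at this
      push_cast
      linear_combination this
    rcases (show n = 1 ∨ n = 2 ∨ 3 ≤ n by omega) with rfl | rfl | h3
    · exact h1 w
    · exact h2' w
    by_cases hn2 : (n : F) - 2 = 0
    · obtain ⟨k, rfl⟩ := Nat.exists_eq_add_of_le (show 2 ≤ n by omega)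
      refine tw_nsL_neg_add h2 ?_ (by omega) h2' (fun w => ih k (by omega) (by omega) w) w
      intro h
      push_cast at hn2 h
      exact h2 (by linear_combination hn2 - h)
    · obtain ⟨k, rfl⟩ := Nat.exists_eq_add_of_le (show 1 ≤ n by omega)
      refine tw_nsL_neg_add h2 ?_ (by omega) h1 (fun w => ih k (by omega) (by omega) w) w
      intro h
      push_cast at hn2 h
      exact hn2 (by linear_combination h)

end Fock

/-! ### The module L(1/2,1/16). -/

namespace VirIrr

open Fock Fld

variable {F : Type*} [Field F]

/-- Both sides satisfy the same recursion along words, by `Y_word_cons` on the module side and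
`tw_nsL_neg` on the Fock side, where L₀ reads off the degree. -/
theorem Y_gen_one_sixteenth (h2 : (2 : F) ≠ 0) {s : ℤ} {x : Verma (1 / 2 : F) 0}
    (hx : x ∈ Verma.deg (1 / 2) 0 s) :
    (Y (1 / 2) (1 / 16 : F) x).1 (s - 1) (gen (1 / 2) (1 / 16)) =
      tw h2 (toFock h2 x) • gen (1 / 2) (1 / 16) := by
  rw [Verma.deg_eq_span] at hx
  induction hx using Submodule.span_induction with
  | mem x hx =>
    obtain ⟨l, hl, rfl, rfl⟩ := hx
    induction l with
    | nil =>
      rw [Verma.word_nil, Y, IsVirField.Y_gen, one_apply, if_pos (by simp), toFock_gen, tw_one,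
        one_smul]
    | cons n l ih =>
      have hl' : ∀ k ∈ l, 1 ≤ k := fun k hk => hl k (List.mem_cons_of_mem _ hk)
      have ht := ih hl'
      have hd : Verma.word (1 / 2 : F) 0 l ∈ Verma.deg (1 / 2) 0 l.sum :=
        Verma.word_mem_deg hl' rfl
      have h0 := toFock_lie h2 0 (Verma.word (1 / 2 : F) 0 l)
      rw [Verma.lie_L_zero hd, map_smul, zero_add] at h0
      rw [Y] at ht ⊢
      rw [List.sum_cons, isVirField_field.Y_word_cons isSingular_gen n (hl n List.mem_cons_self) l
        hl' _ rfl, field_apply, sub_self, lie_L_zero_gen, map_smul, ht, Verma.word_cons, toFock_lie,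
        tw_nsL_neg h2 n (hl n List.mem_cons_self), ← h0, map_smul, smul_eq_mul]
      simp only [← Int.cast_smul_eq_zsmul F]
      simp only [Int.cast_natCast, Int.cast_sub, Int.cast_one, Int.cast_pow, Int.cast_neg]
      module
  | zero => simp
  | add x y _ _ hx hy =>
    rw [map_add, map_add, map_add, add_smul, ← hx, ← hy]; rfl
  | smul a x _ hx =>
    rw [map_smul, map_smul, map_smul, smul_eq_mul, mul_smul, ← hx]; rfl

theorem isGood_field_one_sixteenth (h2 : (2 : F) ≠ 0) (h7 : (7 : F) ≠ 0) :
    (isVirField_field (c := 1 / 2) (h := (1 / 16 : F))).IsGood := by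
  refine isGood_field (gen_zero_ne_zero h2) (gen_one_sixteenth_ne_zero h2) fun s x hx hxW => ?_
  rw [Y_gen_one_sixteenth h2 hx, toFock_eq_zero h2 h7 hxW, map_zero, zero_smul]

end VirIrr

end

theorem theorem4p6 (F : Type*) [Field F] (hF : ringChar F ≠ 2) :
    ∃ V : VertexOperatorAlgebra F (VirIrr (1 / 2 : F) 0),
      V.IsVirasoro ∧
      (∀ V' : VertexOperatorAlgebra F (VirIrr (1 / 2 : F) 0), V'.IsVirasoro → V' = V) ∧
      (∀ (M : Type*) [AddCommGroup M] [Module F M] [LieRingModule (Vir F) M]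
          [LieModule F (Vir F) M] (h : F) (W : WeakModule V M),
          IsHighestWeightModule M (1 / 2 : F) h → W.ExtendsVir →
          (ringChar F ≠ 7 → h = 0 ∨ h = 1 / 2 ∨ h = 1 / 16) ∧
          (ringChar F = 7 → h = 0 ∨ h = 1 / 2)) ∧
      (ringChar F ≠ 7 →
        ∃ (A₀ : AdmissibleModule V (VirIrr (1 / 2 : F) 0))
          (A₁ : AdmissibleModule V (VirIrr (1 / 2 : F) (1 / 2)))
          (A₂ : AdmissibleModule V (VirIrr (1 / 2 : F) (1 / 16))),
          A₀.IsStandard ∧ A₁.IsStandard ∧ A₂.IsStandard ∧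
          A₀.IsIrreducible ∧ A₁.IsIrreducible ∧ A₂.IsIrreducible ∧
          ¬ A₀.IsIsomorphic A₁.toWeakModule ∧
          ¬ A₀.IsIsomorphic A₂.toWeakModule ∧
          ¬ A₁.IsIsomorphic A₂.toWeakModule ∧
          ∀ (M : Type*) [AddCommGroup M] [Module F M] (W : AdmissibleModule V M),
            W.IsGradedIrreducible →
            W.IsIsomorphic A₀.toWeakModule ∨ W.IsIsomorphic A₁.toWeakModule ∨
              W.IsIsomorphic A₂.toWeakModule) ∧
      (ringChar F = 7 →
        ∀ (M : Type*) [AddCommGroup M] [Module F M] (W : AdmissibleModule V M),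
          W.IsGradedIrreducible →
          (∃ A₀ : AdmissibleModule V (VirIrr (1 / 2 : F) 0),
            A₀.IsStandard ∧ W.IsIsomorphic A₀.toWeakModule) ∨
          (∃ A₁ : AdmissibleModule V (VirIrr (1 / 2 : F) (1 / 2)),
            A₁.IsStandard ∧ W.IsIsomorphic A₁.toWeakModule)) := by
  have h2 : (2 : F) ≠ 0 := Ring.two_ne_zero hF
  have h7 : ringChar F ≠ 7 → (7 : F) ≠ 0 := fun h h0 => by
    have hd : ringChar F ∣ 7 := (ringChar.spec F 7).1 (by exact_mod_cast h0)
    rcases (Nat.dvd_prime (by norm_num)).1 hd with h1 | h1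
    · exact CharP.ringChar_ne_one h1
    · exact h h1
  exact VirIrr.main_of_isGood hF (Fock.gen_zero_ne_zero h2) (Fock.gen_one_half_ne_zero h2)
    (Fock.gen_one_sixteenth_ne_zero h2) (fun h => VirIrr.isGood_field_one_half h2 (h7 h))
    (fun h => VirIrr.isGood_field_one_sixteenth h2 (h7 h))
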